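/- **Setting.** Let $Q$ be a smooth finite-dimensional manifold and let $G$ be a Lie group with Lie algebra $\mathfrak g$, acting smoothly, freely and properly on $Q$. Let $\kappa$ be a $G$-invariant Riemannian metric on $Q$ (the kinetic energy metric), $\kappa^\sharp:TQ\to T^*Q$, $\kappa^\sharp(v)=\kappa(v,\cdot)$, and let $D\subset TQ$ be a $G$-invariant regular distribution (smooth, of constant rank) satisfying the dimension assumption $D+V=TQ$, where $V_q=\{\xi_Q(q):\xi\in\mathfrak g\}$ is the tangent space of the $G$-orbit. Let $W\subset V$ be a $G$-invariant regular vertical complement of $D$, so $TQ=D\oplus W$, with projections $P_D,P_W$. Let $\Theta_Q$ be the Liouville 1-form and $\Omega_Q=-d\Theta_Q$ the canonical 2-form of $T^*Q$; $G$ acts on $T^*Q$ by the cotangent lift. If $F\subset TP$ is a distribution and $\Omega$ a 2-form on $P$ that is nondegenerate on $F$, the pair determines a bivector field $\pi$ by: $\pi^\sharp(\alpha)=-X$ if and only if $X\in F$ and $(\mathbf i_X\Omega)|_F=\alpha|_F$; its bracket is $\{f,g\}=dg(\pi^\sharp(df))$. An almost Poisson bracket is a bilinear skew-symmetric bracket on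 smooth functions satisfying the Leibniz rule; it is Poisson if it also satisfies the Jacobi identity. * *On $\mathcal M$.* $\mathcal M=\kappa^\sharp(D)\subset T^*Q$ is a $G$-invariant embedded submanifold with inclusion $\iota$ and projection $\tau:\mathcal M\to Q$. Put $\Theta_{\mathcal M}=\iota^*\Theta_Q$, $\Omega_{\mathcal M}=\iota^*\Omega_Q$, $\mathcal C=(T\tau)^{-1}(D)$, let $\mathcal V$ be the tangent spaces of the orbits in $\mathcal M$, and $\mathcal W=(T\tau|_{\mathcal V})^{-1}(W)$, so that $T\mathcal M=\mathcal C\oplus\mathcal W$ with projections $P_{\mathcal C},P_{\mathcal W}$. Let $\mathcal J:\mathcal M\to\mathfrak g^*$, $\langle\mathcal J,\eta\rangle=\Theta_{\mathcal M}(\eta_{\mathcal M})$; let $\mathcal A$ be the $\mathfrak g$-valued 1-form with $\mathcal A(v)=\xi$ if and only if $P_{\mathcal W}(v)=\xi_{\mathcal M}(m)$, for $v\in T_m\mathcal M$; and let $\mathcal K(X,Y)=d\mathcal A(P_{\mathcal C}X,P_{\mathcal C}Y)$. Let $\pi_{nh}$ be the bivector field determined by $(\mathcal C,\Omega_{\mathcal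 M})$ and $\pi_{JK}$ the one determined by $(\mathcal C,\Omega_{\mathcal M}+\langle\mathcal J,\mathcal K\rangle)$ (the gauge transformation of $\pi_{nh}$ by $-\langle\mathcal J,\mathcal K\rangle$). * *On $W^\circ$.* The annihilator $W^\circ\subset T^*Q$ of $W$ is a $G$-invariant embedded submanifold with inclusion $\iota_0$ and projection $\tau_0:W^\circ\to Q$. Put $\mathcal C_0=(T\tau_0)^{-1}(D)$, and let $\pi_0$ be the bivector field determined by $(\mathcal C_0,\iota_0^*\Omega_Q)$. Finally let $\kappa_0(X,Y)=\kappa(P_DX,P_DY)+\kappa(P_WX,P_WY)$. The orbit spaces $\mathcal M/G$, $W^\circ/G$, $Q/G$ carry their quotient manifold structures, for which the orbit projections are submersions. **Statement.** 1. $\Omega_{\mathcal M}$ and $\Omega_{\mathcal M}+\langle\mathcal J,\mathcal K\rangle$ are nondegenerate on $\mathcal C$, $\iota_0^*\Omega_Q$ is nondegenerate on $\mathcal C_0$, the brackets of $\pi_{JK}$ and $\pi_0$ are almost Poisson, and there is a diffeomorphism $\Psi:\mathcal M\to W^\circ$, given by $\Psi(\kappa^\sharp(v))=\kappa_0(v,\cdot)$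 for $v\in D$, which is $G$-equivariant and preserves the almost Poisson structures: $$T\Psi\circ\pi_{JK}^\sharp\circ\Psi^*=\pi_0^\sharp .$$ 2. Suppose that $W$ satisfies the vertical-symmetry condition: there is a Lie subalgebra $\mathfrak g_W\subset\mathfrak g$ with $W_q=\{\xi_Q(q):\xi\in\mathfrak g_W\}$ for all $q\in Q$. Then $\pi_{JK}$ and $\pi_0$ descend to Poisson structures $\Lambda$ on $\mathcal M/G$ and $\Lambda_0$ on $W^\circ/G$, and $\Psi$ induces a Poisson diffeomorphism $\Psi_{red}:(\mathcal M/G,\Lambda)\to(W^\circ/G,\Lambda_0)$. 3. Suppose that the system is Chaplygin, i.e. $D\cap V=0$ (so that $W=V$). Composing the map induced by $\Psi$ with the identification $V^\circ/G\cong T^*(Q/G)$ (the class of $\alpha\in V^\circ_q$ corresponds to the covector $\beta$ at $[q]$ with $\beta\circ T_qp=\alpha$, where $p:Q\to Q/G$ is the projection) gives a diffeomorphism $\Phi:\mathcal M/G\to T^*(Q/G)$. The 2-form $\langle\mathcal J,\mathcal K\rangle$ is the pullback of a smooth 2-form $\langle\mathcal J,\mathcal K\rangle_{red}$ on $\mathcal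 M/G$, the reduction of $\pi_{nh}$ to $\mathcal M/G$ is determined by a smooth nondegenerate 2-form $\Omega^{nh}_{red}$ on $\mathcal M/G$, and $$\Omega^{nh}_{red}=\Phi^*\Omega_{Q/G}-\langle\mathcal J,\mathcal K\rangle_{red},$$ where $\Omega_{Q/G}$ is the canonical 2-form of $T^*(Q/G)$. -/

import Mathlib

open scoped Manifold ContDiff Topology

noncomputable section

namespace Nonholonomic

/-! ### Differential forms on manifolds -/

section Forms

variable {E H F : Type*} [NormedAddCommGroup E] [NormedSpace ℝ E] [TopologicalSpace H]
  [NormedAddCommGroup F] [NormedSpace ℝ F]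
  {E' H' : Type*} [NormedAddCommGroup E'] [NormedSpace ℝ E'] [TopologicalSpace H']

/-- (Not necessarily smooth) `n`-forms on the manifold `P` with values in `F`. -/
abbrev DiffForm (I : ModelWithCorners ℝ E H) (P : Type*) [TopologicalSpace P] [ChartedSpace H P]
    (n : ℕ) (F : Type*) [NormedAddCommGroup F] [NormedSpace ℝ F] :=
  ∀ x : P, TangentSpace I x [⋀^Fin n]→L[ℝ] F

variable {I : ModelWithCorners ℝ E H} {P : Type*} [TopologicalSpace P] [ChartedSpace H P]
  {I' : ModelWithCorners ℝ E' H'} {P' : Type*} [TopologicalSpace P'] [ChartedSpace H' P']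

/-- The expression of a form in the preferred chart at `x`: the pullback of the form under the
inverse of the chart. -/
def inChart {n : ℕ} (θ : DiffForm I P n F) (x : P) : E → E [⋀^Fin n]→L[ℝ] F :=
  fun y => (θ ((extChartAt I x).symm y)).compContinuousLinearMap
    (mfderiv 𝓘(ℝ, E) I (extChartAt I x).symm y)

/-- Smoothness of a form on a manifold without boundary. -/
def IsSmoothForm {n : ℕ} (θ : DiffForm I P n F) : Prop :=
  ∀ x : P, ContDiffOn ℝ ∞ (inChart θ x) (extChartAt I x).target

/-- The exterior derivative of a form on a manifold without boundary, computed at `x` in the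
preferred chart at `x` (in which `TangentSpace I x` is identified with `E`).
There is no factorial factor: `dθ(X, Y) = X(θ(Y)) - Y(θ(X)) - θ([X, Y])` for 1-forms. -/
def extd {n : ℕ} (θ : DiffForm I P n F) : DiffForm I P (n + 1) F :=
  fun x => show E [⋀^Fin (n + 1)]→L[ℝ] F from extDeriv (inChart θ x) (extChartAt I x x)

/-- Pullback of a form. -/
def pullback {n : ℕ} (f : P → P') (θ : DiffForm I' P' n F) : DiffForm I P n F :=
  fun x => (θ (f x)).compContinuousLinearMap (mfderiv I I' f x)

/-- The differential of a real function as a covector. -/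
def dfun (I : ModelWithCorners ℝ E H) (f : P → ℝ) (x : P) : TangentSpace I x →L[ℝ] ℝ :=
  mfderiv I 𝓘(ℝ, ℝ) f x

end Forms

/-! ### Almost Poisson brackets and bivector fields -/

section Brackets

variable {E H : Type*} [NormedAddCommGroup E] [NormedSpace ℝ E] [TopologicalSpace H]
  (I : ModelWithCorners ℝ E H) {P : Type*} [TopologicalSpace P] [ChartedSpace H P]

/-- `B` restricts to an almost Poisson bracket on `C^∞(P)`: an `ℝ`-bilinear skew-symmetric
operation satisfying the Leibniz rule. -/
structure IsAlmostPoissonBracket (B : (P → ℝ) → (P → ℝ) → P → ℝ) : Prop where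
  smooth : ∀ f g : P → ℝ, ContMDiff I 𝓘(ℝ, ℝ) ∞ f → ContMDiff I 𝓘(ℝ, ℝ) ∞ g →
    ContMDiff I 𝓘(ℝ, ℝ) ∞ (B f g)
  add_left : ∀ f g h : P → ℝ, ContMDiff I 𝓘(ℝ, ℝ) ∞ f → ContMDiff I 𝓘(ℝ, ℝ) ∞ g →
    ContMDiff I 𝓘(ℝ, ℝ) ∞ h → B (f + g) h = B f h + B g h
  smul_left : ∀ (c : ℝ) (f g : P → ℝ), ContMDiff I 𝓘(ℝ, ℝ) ∞ f → ContMDiff I 𝓘(ℝ, ℝ) ∞ g →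
    B (c • f) g = c • B f g
  skew : ∀ f g : P → ℝ, ContMDiff I 𝓘(ℝ, ℝ) ∞ f → ContMDiff I 𝓘(ℝ, ℝ) ∞ g → B f g = -B g f
  leibniz : ∀ f g h : P → ℝ, ContMDiff I 𝓘(ℝ, ℝ) ∞ f → ContMDiff I 𝓘(ℝ, ℝ) ∞ g →
    ContMDiff I 𝓘(ℝ, ℝ) ∞ h → B (f * g) h = f * B g h + B f h * g

/-- A Poisson bracket: an almost Poisson bracket satisfying the Jacobi identity. -/
structure IsPoissonBracket (B : (P → ℝ) → (P → ℝ) → P → ℝ) : Prop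
    extends IsAlmostPoissonBracket I B where
  jacobi : ∀ f g h : P → ℝ, ContMDiff I 𝓘(ℝ, ℝ) ∞ f → ContMDiff I 𝓘(ℝ, ℝ) ∞ g →
    ContMDiff I 𝓘(ℝ, ℝ) ∞ h → B f (B g h) + B g (B h f) + B h (B f g) = 0

variable {I}

/-- The 2-form `Ω` is nondegenerate on the distribution `F`. -/
def NondegenerateOn (F : ∀ x : P, Submodule ℝ (TangentSpace I x)) (Ω : DiffForm I P 2 ℝ) : Prop :=
  ∀ x, ∀ X ∈ F x, (∀ Y ∈ F x, Ω x ![X, Y] = 0) → X = 0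

open Classical in
/-- The map `π^♯ : T^*P → TP` of the bivector field `π` determined by a distribution `F` and a
2-form `Ω` that is nondegenerate on `F`: `π^♯(α) = -X` iff `X ∈ F` and `(i_X Ω)|_F = α|_F`. -/
def sharp (F : ∀ x : P, Submodule ℝ (TangentSpace I x)) (Ω : DiffForm I P 2 ℝ) (x : P)
    (α : TangentSpace I x →L[ℝ] ℝ) : TangentSpace I x :=
  if h : ∃! X : TangentSpace I x, X ∈ F x ∧ ∀ Y ∈ F x, Ω x ![X, Y] = α Y then -h.choose else 0

/-- The bracket `{f, g} = π(df, dg) = dg(π^♯(df))` of the bivector field determined by `F`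
and `Ω`. -/
def bracket (F : ∀ x : P, Submodule ℝ (TangentSpace I x)) (Ω : DiffForm I P 2 ℝ)
    (f g : P → ℝ) (x : P) : ℝ :=
  dfun I g x (sharp F Ω x (dfun I f x))

/-- The orbit projection `ρ : P → P/G`. -/
def orbitMap (G P : Type*) [Group G] [MulAction G P] : P → MulAction.orbitRel.Quotient G P :=
  Quotient.mk (MulAction.orbitRel G P)

/-- The bracket `Bred` on the orbit space is the reduction of the bracket `B`:
`{f, g}_red ∘ ρ = {f ∘ ρ, g ∘ ρ}`, where `ρ` is the orbit projection. -/
def IsReducedBracket {G : Type*} [Group G] [MulAction G P]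
    {E' H' : Type*} [NormedAddCommGroup E'] [NormedSpace ℝ E'] [TopologicalSpace H']
    (I' : ModelWithCorners ℝ E' H') [ChartedSpace H' (MulAction.orbitRel.Quotient G P)]
    (B : (P → ℝ) → (P → ℝ) → P → ℝ)
    (Bred : (MulAction.orbitRel.Quotient G P → ℝ) → (MulAction.orbitRel.Quotient G P → ℝ) →
      MulAction.orbitRel.Quotient G P → ℝ) : Prop :=
  ∀ f g : MulAction.orbitRel.Quotient G P → ℝ,
    ContMDiff I' 𝓘(ℝ, ℝ) ∞ f → ContMDiff I' 𝓘(ℝ, ℝ) ∞ g →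
    Bred f g ∘ orbitMap G P = B (f ∘ orbitMap G P) (g ∘ orbitMap G P)

end Brackets

/-! ### The cotangent bundle -/

section Cotangent

variable (E Q : Type*) [NormedAddCommGroup E] [NormedSpace ℝ E]
  [TopologicalSpace Q] [ChartedSpace E Q]

/-- The cotangent bundle `T^*Q`. -/
abbrev CotangentBundle : Type _ :=
  Bundle.TotalSpace (E →L[ℝ] ℝ) (fun q : Q => TangentSpace 𝓘(ℝ, E) q →L[ℝ] ℝ)

/-- The model with corners of `T^*Q`. -/
abbrev cotangentModel : ModelWithCorners ℝ (E × (E →L[ℝ] ℝ)) (ModelProd E (E →L[ℝ] ℝ)) :=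
  𝓘(ℝ, E).prod 𝓘(ℝ, E →L[ℝ] ℝ)

variable [IsManifold 𝓘(ℝ, E) ∞ Q]

/-- The Liouville 1-form `Θ_Q`: `Θ_Q(α)(v) = α(Tτ_Q(v))`. -/
def liouvilleForm : DiffForm (cotangentModel E) (CotangentBundle E Q) 1 ℝ :=
  fun α => ContinuousAlternatingMap.ofSubsingleton ℝ _ ℝ (0 : Fin 1)
    (α.snd ∘L mfderiv (cotangentModel E) 𝓘(ℝ, E)
      (Bundle.TotalSpace.proj : CotangentBundle E Q → Q) α)

/-- The canonical 2-form `Ω_Q = -dΘ_Q`. -/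
def canonicalForm : DiffForm (cotangentModel E) (CotangentBundle E Q) 2 ℝ :=
  -extd (liouvilleForm E Q)

end Cotangent

/-! ### Actions -/

section Actions

variable {E Q EG G : Type*} [NormedAddCommGroup E] [NormedSpace ℝ E]
  [TopologicalSpace Q] [ChartedSpace E Q] [Group G] [MulAction G Q]

variable (E) in
/-- The tangent map `T_qQ → T_{g • q}Q` of the action of `g`. -/
def tangentAction (g : G) (q : Q) : TangentSpace 𝓘(ℝ, E) q →L[ℝ] TangentSpace 𝓘(ℝ, E) (g • q) :=
  mfderiv 𝓘(ℝ, E) 𝓘(ℝ, E) (fun q : Q => g • q) q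

/-- The cotangent lift of the action: `g • α = α ∘ (T_qg)⁻¹ ∈ T^*_{g • q}Q` for `α ∈ T^*_qQ`. -/
def cotangentLift (g : G) (α : CotangentBundle E Q) : CotangentBundle E Q :=
  ⟨g • α.proj, α.snd ∘L (tangentAction E g α.proj).inverse⟩

theorem cotangent_ext {a b : CotangentBundle E Q} (h : a.proj = b.proj)
    (h' : ∀ v : E, (show E →L[ℝ] ℝ from a.snd) v = (show E →L[ℝ] ℝ from b.snd) v) : a = b := by
  obtain ⟨p, x⟩ := a
  obtain ⟨p', y⟩ := b
  obtain rfl : p = p' := h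
  congr 1
  exact ContinuousLinearMap.ext h'

theorem tangentAction_mul
    (hG : ∀ g : G, MDifferentiable 𝓘(ℝ, E) 𝓘(ℝ, E) (fun q : Q => g • q))
    (g h : G) (q : Q) (v : E) :
    (show E from tangentAction E (g * h) q v) =
      (show E from tangentAction E g (h • q) (tangentAction E h q v)) := by
  have e : (fun q : Q => (g * h) • q) = (fun q : Q => g • q) ∘ (fun q : Q => h • q) := by
    funext q; simp [mul_smul]
  unfold tangentAction
  rw [e, mfderiv_comp (I' := 𝓘(ℝ, E)) q (hG g (h • q)) (hG h q)]
  rfl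

theorem tangentAction_one (q : Q) (v : E) :
    (show E from tangentAction E (1 : G) q v) = v := by
  have e : (fun q : Q => (1 : G) • q) = id := by
    funext q; simp
  unfold tangentAction
  rw [e, mfderiv_id]
  rfl

theorem tangentAction_isInvertible
    (hG : ∀ g : G, MDifferentiable 𝓘(ℝ, E) 𝓘(ℝ, E) (fun q : Q => g • q))
    (g : G) (q : Q) : (tangentAction E g q).IsInvertible := by
  let f : E →L[ℝ] E := tangentAction E g q
  let f' : E →L[ℝ] E := tangentAction E g⁻¹ (g • q)
  have h1 : ∀ v, f' (f v) = v := by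
    intro v
    have := tangentAction_mul hG g⁻¹ g q v
    rw [inv_mul_cancel] at this
    exact this.symm.trans (tangentAction_one q v)
  have h2 : ∀ v, f (f' v) = v := by
    intro v
    have := tangentAction_mul hG g g⁻¹ (g • q) v
    rw [mul_inv_cancel, inv_smul_smul] at this
    exact this.symm.trans (tangentAction_one (g • q) v)
  exact ⟨ContinuousLinearEquiv.equivOfInverse f f' h1 h2, rfl⟩

theorem cotangentLift_apply
    (hG : ∀ g : G, MDifferentiable 𝓘(ℝ, E) 𝓘(ℝ, E) (fun q : Q => g • q))
    (g : G) (α : CotangentBundle E Q) (v : TangentSpace 𝓘(ℝ, E) α.proj) :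
    (cotangentLift g α).snd (tangentAction E g α.proj v) = α.snd v := by
  change α.snd ((tangentAction E g α.proj).inverse (tangentAction E g α.proj v)) = α.snd v
  congr 1
  exact ((tangentAction_isInvertible hG g α.proj).inverse_apply_eq).2 rfl

theorem cotangentLift_mul
    (hG : ∀ g : G, MDifferentiable 𝓘(ℝ, E) 𝓘(ℝ, E) (fun q : Q => g • q))
    (g h : G) (α : CotangentBundle E Q) :
    cotangentLift (g * h) α = cotangentLift g (cotangentLift h α) := by
  refine cotangent_ext (mul_smul g h α.proj) fun v => ?_
  obtain ⟨w, rfl⟩ : ∃ w : E, (show E from tangentAction E (g * h) α.proj w) = v :=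
    (tangentAction_isInvertible hG (g * h) α.proj).bijective.2 v
  refine (cotangentLift_apply hG (g * h) α w).trans ?_
  rw [tangentAction_mul hG]
  refine Eq.symm ((cotangentLift_apply hG g (cotangentLift h α) _).trans ?_)
  exact cotangentLift_apply hG h α w

theorem cotangentLift_one
    (hG : ∀ g : G, MDifferentiable 𝓘(ℝ, E) 𝓘(ℝ, E) (fun q : Q => g • q))
    (α : CotangentBundle E Q) : cotangentLift (1 : G) α = α := by
  refine cotangent_ext (one_smul G α.proj) fun v => ?_
  refine Eq.trans ?_ (cotangentLift_apply hG (1 : G) α v)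
  exact congrArg (show E →L[ℝ] ℝ from (cotangentLift (1 : G) α).snd)
    (tangentAction_one (G := G) α.proj v).symm

variable [NormedAddCommGroup EG] [NormedSpace ℝ EG] [TopologicalSpace G]
  [ChartedSpace EG G]

variable (E EG G) in
/-- The infinitesimal generators at `x`: the linear map `𝔤 → T_xQ`, `ξ ↦ ξ_Q(x)`, which is the
derivative at `1` of the orbit map `g ↦ g • x`. -/
def infGen (x : Q) : GroupLieAlgebra 𝓘(ℝ, EG) G →L[ℝ] TangentSpace 𝓘(ℝ, E) x :=
  (mfderiv 𝓘(ℝ, EG) 𝓘(ℝ, E) (fun g : G => g • x) 1 :)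

variable (E EG G) in
/-- The tangent space `V_x` to the orbit of `x`. -/
def vertical (x : Q) : Submodule ℝ (TangentSpace 𝓘(ℝ, E) x) :=
  (infGen E EG G x).range

theorem mdifferentiable_action [IsManifold 𝓘(ℝ, E) ∞ Q]
    [h : ContMDiffSMul 𝓘(ℝ, EG) 𝓘(ℝ, E) ∞ G Q] (g : G) :
    MDifferentiable 𝓘(ℝ, E) 𝓘(ℝ, E) (fun q : Q => g • q) := by
  have h : ContMDiff 𝓘(ℝ, E) 𝓘(ℝ, E) ∞ (fun q : Q => g • q) :=
    h.contMDiff_smul.comp (contMDiff_const.prodMk contMDiff_id)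
  exact h.mdifferentiable (by simp)

end Actions

/-! ### Nonholonomic systems with symmetries -/

section Systems

variable (E Q EG G : Type*) [NormedAddCommGroup E] [NormedSpace ℝ E]
  [TopologicalSpace Q] [ChartedSpace E Q] [IsManifold 𝓘(ℝ, E) ∞ Q]
  [NormedAddCommGroup EG] [NormedSpace ℝ EG] [TopologicalSpace G] [ChartedSpace EG G]
  [Group G] [MulAction G Q]

variable {E Q} in
/-- A regular (smooth, constant rank) distribution on `Q`, i.e. a smooth subbundle of `TQ`: near
each point it is spanned by a smooth local frame. -/
def IsRegularDistribution (D : ∀ q : Q, Submodule ℝ (TangentSpace 𝓘(ℝ, E) q)) : Prop :=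
  ∃ k : ℕ, ∀ q₀ : Q, ∃ U ∈ 𝓝 q₀, IsOpen U ∧
    ∃ X : Fin k → ∀ q : Q, TangentSpace 𝓘(ℝ, E) q,
      (∀ i, ContMDiffOn 𝓘(ℝ, E) 𝓘(ℝ, E).tangent ∞
        (fun q => (⟨q, X i q⟩ : TangentBundle 𝓘(ℝ, E) Q)) U) ∧
      ∀ q ∈ U, LinearIndependent ℝ (fun i => X i q) ∧
        Submodule.span ℝ (Set.range fun i => X i q) = D q

/-- A nonholonomic system on `Q` with symmetry group `G` satisfying the dimension assumption: a
`G`-invariant kinetic energy metric `κ` and a `G`-invariant constraint distribution `D` such that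
`TQ = D + V`. (The potential energy plays no role in the geometry, and `D` may be any regular
distribution.) -/
structure SymmetricSystem where
  /-- the kinetic energy metric -/
  metric : Bundle.ContMDiffRiemannianMetric 𝓘(ℝ, E) ∞ E (fun q : Q => TangentSpace 𝓘(ℝ, E) q)
  /-- the constraint distribution -/
  D : ∀ q : Q, Submodule ℝ (TangentSpace 𝓘(ℝ, E) q)
  regular : IsRegularDistribution D
  metric_invariant : ∀ (g : G) (q : Q) (v w : TangentSpace 𝓘(ℝ, E) q),
    metric.inner (g • q) (tangentAction E g q v) (tangentAction E g q w) = metric.inner q v w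
  D_invariant : ∀ (g : G) (q : Q), (D q).map (tangentAction E g q).toLinearMap = D (g • q)
  dimension_assumption : ∀ q : Q, D q ⊔ vertical E EG G q = ⊤

variable {E Q EG G}

/-- A `G`-invariant vertical complement `W` of the constraint distribution `D` in `TQ`. -/
structure VerticalComplement (S : SymmetricSystem E Q EG G) where
  /-- the complement -/
  W : ∀ q : Q, Submodule ℝ (TangentSpace 𝓘(ℝ, E) q)
  regular : IsRegularDistribution W
  W_invariant : ∀ (g : G) (q : Q), (W q).map (tangentAction E g q).toLinearMap = W (g • q)
  isCompl : ∀ q : Q, IsCompl (S.D q) (W q)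
  le_vertical : ∀ q : Q, W q ≤ vertical E EG G q

/-- The vertical-symmetry condition: there is a Lie subalgebra `𝔤_W` of `𝔤` such that
`W_q = {ξ_Q(q) | ξ ∈ 𝔤_W}` for all `q`. -/
def VerticalComplement.VerticalSymmetry {S : SymmetricSystem E Q EG G}
    (W : VerticalComplement S) : Prop :=
  ∃ 𝔤W : Submodule ℝ (GroupLieAlgebra 𝓘(ℝ, EG) G), (∀ ξ ∈ 𝔤W, ∀ η ∈ 𝔤W, ⁅ξ, η⁆ ∈ 𝔤W) ∧
    ∀ q : Q, W.W q = 𝔤W.map (infGen E EG G q).toLinearMap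

namespace SymmetricSystem

variable (S : SymmetricSystem E Q EG G)

/-- The system is Chaplygin: `D ∩ V = 0`. -/
def IsChaplygin : Prop := ∀ q : Q, S.D q ⊓ vertical E EG G q = ⊥

/-- The Legendre transform `κ^♯ : TQ → T^*Q`. -/
def legendre (q : Q) (v : TangentSpace 𝓘(ℝ, E) q) : CotangentBundle E Q :=
  ⟨q, S.metric.inner q v⟩

/-- The constraint manifold `M = κ^♯(D) ⊆ T^*Q`. -/
def constraintManifold : Set (CotangentBundle E Q) :=
  {α | ∃ q, ∃ v ∈ S.D q, α = S.legendre q v}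

variable {S} in
/-- The annihilator `W° ⊆ T^*Q` of `W`. -/
def _root_.Nonholonomic.VerticalComplement.annihilator (W : VerticalComplement S) :
    Set (CotangentBundle E Q) :=
  {α | ∀ w ∈ W.W α.proj, α.snd w = 0}

variable {S} in
/-- The metric `κ₀(X, Y) = κ(P_D X, P_D Y) + κ(P_W X, P_W Y)`, where `P_D`, `P_W` are the
projections of `TQ = D ⊕ W`. -/
def _root_.Nonholonomic.VerticalComplement.modifiedMetric (W : VerticalComplement S) (q : Q)
    (X Y : TangentSpace 𝓘(ℝ, E) q) : ℝ :=
  S.metric.inner q ((S.D q).projection (W.W q) (W.isCompl q) X)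
      ((S.D q).projection (W.W q) (W.isCompl q) Y) +
    S.metric.inner q ((W.W q).projection (S.D q) (W.isCompl q).symm X)
      ((W.W q).projection (S.D q) (W.isCompl q).symm Y)

variable [ContMDiffSMul 𝓘(ℝ, EG) 𝓘(ℝ, E) ∞ G Q]

theorem cotangentLift_mem (g : G) {α : CotangentBundle E Q} (hα : α ∈ S.constraintManifold) :
    cotangentLift g α ∈ S.constraintManifold := by
  obtain ⟨q, v, hv, rfl⟩ := hα
  have hG : ∀ g : G, MDifferentiable 𝓘(ℝ, E) 𝓘(ℝ, E) (fun q : Q => g • q) :=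
    mdifferentiable_action (EG := EG)
  refine ⟨g • q, tangentAction E g q v, ?_, ?_⟩
  · rw [← S.D_invariant]
    exact Submodule.mem_map_of_mem hv
  · refine cotangent_ext rfl fun w => ?_
    obtain ⟨u, rfl⟩ := (tangentAction_isInvertible hG g q).bijective.2 w
    exact (cotangentLift_apply hG g _ u).trans (S.metric_invariant g q v u).symm

/-- The action of `G` on `M`: the restriction of the cotangent lift. -/
instance : MulAction G S.constraintManifold where
  smul g m := ⟨cotangentLift g m.1, S.cotangentLift_mem g m.2⟩
  one_smul m := Subtype.ext (cotangentLift_one (mdifferentiable_action (EG := EG)) m.1)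
  mul_smul g h m := Subtype.ext (cotangentLift_mul (mdifferentiable_action (EG := EG)) g h m.1)

end SymmetricSystem

namespace VerticalComplement

variable {S : SymmetricSystem E Q EG G} (W : VerticalComplement S)
  [ContMDiffSMul 𝓘(ℝ, EG) 𝓘(ℝ, E) ∞ G Q]

theorem cotangentLift_mem (g : G) {α : CotangentBundle E Q} (hα : α ∈ W.annihilator) :
    cotangentLift g α ∈ W.annihilator := by
  have hG : ∀ g : G, MDifferentiable 𝓘(ℝ, E) 𝓘(ℝ, E) (fun q : Q => g • q) :=
    mdifferentiable_action (EG := EG)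
  intro w hw
  change w ∈ W.W (g • α.proj) at hw
  rw [← W.W_invariant] at hw
  obtain ⟨u, hu, rfl⟩ := hw
  exact (cotangentLift_apply hG g α u).trans (hα u hu)

/-- The action of `G` on `W°`: the restriction of the cotangent lift. -/
instance : MulAction G W.annihilator where
  smul g m := ⟨cotangentLift g m.1, W.cotangentLift_mem g m.2⟩
  one_smul m := Subtype.ext (cotangentLift_one (mdifferentiable_action (EG := EG)) m.1)
  mul_smul g h m := Subtype.ext (cotangentLift_mul (mdifferentiable_action (EG := EG)) g h m.1)

end VerticalComplement

end Systems

/-! ### The induced structures on a submanifold of the cotangent bundle -/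

section Submanifold

variable {E Q EN EG G : Type*} [NormedAddCommGroup E] [NormedSpace ℝ E]
  [TopologicalSpace Q] [ChartedSpace E Q] [IsManifold 𝓘(ℝ, E) ∞ Q]
  [NormedAddCommGroup EN] [NormedSpace ℝ EN]
  (N : Set (CotangentBundle E Q)) [ChartedSpace EN N]

/-- The projection `τ : N → Q`. -/
def baseProj (m : N) : Q := m.1.proj

/-- The restriction `Θ_N` of the Liouville form to `N`. -/
def restrictedLiouville : DiffForm 𝓘(ℝ, EN) N 1 ℝ :=
  pullback (Subtype.val : N → CotangentBundle E Q) (liouvilleForm E Q)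

/-- The restriction `Ω_N` of the canonical 2-form to `N`. -/
def restrictedForm : DiffForm 𝓘(ℝ, EN) N 2 ℝ :=
  pullback (Subtype.val : N → CotangentBundle E Q) (canonicalForm E Q)

/-- The distribution `{v ∈ TN | Tτ(v) ∈ D}` on `N` induced by a distribution `D` on `Q`. -/
def liftedDistribution (D : ∀ q : Q, Submodule ℝ (TangentSpace 𝓘(ℝ, E) q)) (m : N) :
    Submodule ℝ (TangentSpace 𝓘(ℝ, EN) m) :=
  (D (baseProj N m)).comap (mfderiv 𝓘(ℝ, EN) 𝓘(ℝ, E) (baseProj N) m).toLinearMap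

variable [NormedAddCommGroup EG] [NormedSpace ℝ EG] [TopologicalSpace G] [ChartedSpace EG G]
  [Group G] [MulAction G N]

variable (EN EG G) in
/-- The momentum map `⟨J(m), η⟩ = Θ_N(η_N(m))`. -/
def momentum (m : N) : EG →L[ℝ] ℝ :=
  (ContinuousAlternatingMap.ofSubsingleton ℝ (TangentSpace 𝓘(ℝ, EN) m) ℝ (0 : Fin 1)).symm
    (restrictedLiouville N m) ∘L infGen EN EG G m

variable (EG G) in
/-- The vertical distribution `(Tτ|_𝒱)⁻¹(W)` on `N`, `𝒱` being the tangent spaces of the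
orbits in `N`. -/
def verticalLift (W : ∀ q : Q, Submodule ℝ (TangentSpace 𝓘(ℝ, E) q)) (m : N) :
    Submodule ℝ (TangentSpace 𝓘(ℝ, EN) m) :=
  vertical EN EG G m ⊓ liftedDistribution N W m

open Classical in
variable (EG G) in
/-- The `𝔤`-valued 1-form `𝒜` on `N` (`𝔤 = T_1G` is identified with the model space `EG`) given by
`𝒜(v) = ξ` iff `P_𝒲(v) = ξ_N(m)`, where `P_𝒲` is the projection of `TN = 𝒞 ⊕ 𝒲` to
`𝒲 = (Tτ|_𝒱)⁻¹(W)` along `𝒞 = (Tτ)⁻¹(D)`. -/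
def connectionForm (D W : ∀ q : Q, Submodule ℝ (TangentSpace 𝓘(ℝ, E) q)) :
    DiffForm 𝓘(ℝ, EN) N 1 EG := fun m =>
  if h : ∃ A : TangentSpace 𝓘(ℝ, EN) m →L[ℝ] EG, ∀ v,
      infGen EN EG G m (A v) ∈ verticalLift EG G N W m ∧
      v - infGen EN EG G m (A v) ∈ liftedDistribution N D m
  then ContinuousAlternatingMap.ofSubsingleton ℝ _ EG (0 : Fin 1) h.choose
  else 0

variable (EG G) in
/-- The projection `P_𝒞 = id - P_𝒲`, where `P_𝒲(v) = 𝒜(v)_N`. -/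
def projC (D W : ∀ q : Q, Submodule ℝ (TangentSpace 𝓘(ℝ, E) q)) (m : N) :
    TangentSpace 𝓘(ℝ, EN) m →L[ℝ] TangentSpace 𝓘(ℝ, EN) m :=
  ContinuousLinearMap.id ℝ _ - infGen EN EG G m ∘L
    (ContinuousAlternatingMap.ofSubsingleton ℝ (TangentSpace 𝓘(ℝ, EN) m) EG (0 : Fin 1)).symm
      (connectionForm EG G N D W m)

variable (EG G) in
/-- The `𝒲`-curvature `𝒦(X, Y) = d𝒜(P_𝒞 X, P_𝒞 Y)`, a `𝔤`-valued 2-form. -/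
def curvature (D W : ∀ q : Q, Submodule ℝ (TangentSpace 𝓘(ℝ, E) q)) :
    DiffForm 𝓘(ℝ, EN) N 2 EG := fun m =>
  (extd (connectionForm EG G N D W) m).compContinuousLinearMap (projC EG G N D W m)

variable (EG G) in
/-- The 2-form `⟨J, 𝒦⟩` on `N`. -/
def pairingJK (D W : ∀ q : Q, Submodule ℝ (TangentSpace 𝓘(ℝ, E) q)) :
    DiffForm 𝓘(ℝ, EN) N 2 ℝ := fun m =>
  (momentum EN EG G N m).compContinuousAlternatingMap (curvature EG G N D W m)

end Submanifold

/-! ### The bivector fields of the theory -/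

section Bivectors

variable {E Q EG G : Type*} [NormedAddCommGroup E] [NormedSpace ℝ E]
  [TopologicalSpace Q] [ChartedSpace E Q] [IsManifold 𝓘(ℝ, E) ∞ Q]
  [NormedAddCommGroup EG] [NormedSpace ℝ EG] [TopologicalSpace G] [ChartedSpace EG G]
  [Group G] [MulAction G Q] [ContMDiffSMul 𝓘(ℝ, EG) 𝓘(ℝ, E) ∞ G Q]
  (EM : Type*) [NormedAddCommGroup EM] [NormedSpace ℝ EM]
  {S : SymmetricSystem E Q EG G} (W : VerticalComplement S)

variable (S) in
/-- The distribution `𝒞 = {v ∈ TM | Tτ(v) ∈ D}` on the constraint manifold `M`. -/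
abbrev SymmetricSystem.distC [ChartedSpace EM S.constraintManifold] :
    ∀ m : S.constraintManifold, Submodule ℝ (TangentSpace 𝓘(ℝ, EM) m) :=
  liftedDistribution S.constraintManifold S.D

variable (S) in
/-- The 2-form `Ω_M = ι^*Ω_Q` on `M`. The nonholonomic bivector field `π_nh` is determined by `𝒞`
and `Ω_M`. -/
abbrev SymmetricSystem.formM [ChartedSpace EM S.constraintManifold] :
    DiffForm 𝓘(ℝ, EM) S.constraintManifold 2 ℝ :=
  restrictedForm S.constraintManifold

namespace VerticalComplement

/-- The 2-form `⟨J, 𝒦_𝒲⟩` on `M`. -/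
abbrev formJK [ChartedSpace EM S.constraintManifold] :
    DiffForm 𝓘(ℝ, EM) S.constraintManifold 2 ℝ :=
  pairingJK EG G S.constraintManifold S.D W.W

/-- The 2-form `Ω_JK = Ω_M + ⟨J, 𝒦_𝒲⟩` on `M`. The bivector field `π_JK` is determined by `𝒞` and
`Ω_JK`; it is the gauge transformation of `π_nh` by `-⟨J, 𝒦_𝒲⟩`. -/
abbrev totalForm [ChartedSpace EM S.constraintManifold] :
    DiffForm 𝓘(ℝ, EM) S.constraintManifold 2 ℝ :=
  S.formM EM + W.formJK EM

/-- The distribution `𝒞₀ = {v ∈ T(W°) | Tτ₀(v) ∈ D}` on `W°`. -/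
abbrev distC₀ [ChartedSpace EM W.annihilator] :
    ∀ m : W.annihilator, Submodule ℝ (TangentSpace 𝓘(ℝ, EM) m) :=
  liftedDistribution W.annihilator S.D

/-- The 2-form `Ω_{W°} = ι₀^*Ω_Q` on `W°`. The bivector field `π₀` is determined by `𝒞₀` and
`Ω_{W°}`. -/
abbrev form₀ [ChartedSpace EM W.annihilator] : DiffForm 𝓘(ℝ, EM) W.annihilator 2 ℝ :=
  restrictedForm W.annihilator

end VerticalComplement

end Bivectors

end Nonholonomic

end

open Nonholonomic

set_option autoImplicit false
set_option linter.unusedSectionVars false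

/-! Both `M` and `W°` are images of fibrewise projections of `T^*Q`. If `R` is the `κ`-orthogonal
projection of `TQ` onto `D` and `P` the projection onto `D` along `W`, then `M = {α | α ∘ R = α}`
and `W° = {α | α ∘ P = α}`. The ranges of `R` and `P` agree, so `α ↦ α ∘ P` and `α ↦ α ∘ R` are
mutually inverse diffeomorphisms between `M` and `W°`. The first is `Ψ`, because `κ(v, P w) = κ₀(v,
w)` for `v ∈ D`. It covers the identity of `Q`, hence carries `𝒞` onto `𝒞₀`.

The central identity is `Θ_M = Ψ^*Θ_{W°} + ⟨J, 𝒜⟩`: at `α` it splits `α(Tτ X)` into `α(P Tτ X)` and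
`α((1 - P) Tτ X)`, and `(1 - P) Tτ X` is the generator of `𝒜(X)`. On `𝒞` the form `𝒜` vanishes, so
only `⟨J, d𝒜⟩` survives differentiation and `Ψ^*Ω_{W°} = Ω_M + ⟨J, 𝒦⟩` on `𝒞`
(`restrictedForm_transfer`, `totalForm_transfer`). Thus `TΨ` is an isomorphism of nondegenerate
pairs and intertwines the bivectors (`map_sharp`).

Under vertical symmetry the momenta of `ξ ∈ 𝔤_W` vanish on `W°`. Since the Liouville form is
invariant, `i_{ξ_N} Ω_{W°} = 0`. For an invariant `f` the equation `i_X Ω = df`, imposed only on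
`𝒞₀`, therefore holds on all of `T W°` (`curl_ham_of_invariant`). As `Ω_{W°}` is exact, the usual
argument gives the Jacobi identity for invariant functions (`jacobi_of_invariant`). The result is
transported to `M/G` by `Ψ`.

In the Chaplygin case `W° = V°`, and a covector killing `V = ker Tp` is pulled back from `Q/G`, so
`V°/G = T^*(Q/G)` (`exists_cotangent_reduction`). The Liouville forms correspond, so `Ψ^*Ω_{W°}` is
the pullback of `Φ^*Ω_{Q/G}` to `M`. The form `⟨J, 𝒦⟩` is the difference of `Ψ^*Ω_{W°}` and `Ω_M` on
`𝒞`-components; these are invariant and determined by projections to `M/G`, so it descends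
(`exists_reduced_pairingJK`), and `Φ^*Ω_{Q/G} - ⟨J, 𝒦⟩_red` pulls back to `Ω_M` on `𝒞`.

Computations on a submanifold `N` (either `M` or `W°`) use the redundant parametrization `(x, p) ↦ p
∘ P_x` by all of `E × E^*` over a chart of `Q` (`spar`). It is a submersion with smooth local
sections, so no adapted chart of `N` is needed. -/

namespace Nonholonomic

/-! ### Calculus of 1-forms on manifolds without boundary -/

section OneForms

variable {E H F Z : Type*} [NormedAddCommGroup E] [NormedSpace ℝ E] [TopologicalSpace H]
  [NormedAddCommGroup F] [NormedSpace ℝ F] [NormedAddCommGroup Z] [NormedSpace ℝ Z]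
  {I : ModelWithCorners ℝ E H} {P : Type*} [TopologicalSpace P] [ChartedSpace H P]

/-- A 1-form regarded as a field of covectors. -/
noncomputable def lin (θ : DiffForm I P 1 F) (x : P) : TangentSpace I x →L[ℝ] F :=
  (ContinuousAlternatingMap.ofSubsingleton ℝ (TangentSpace I x) F (0 : Fin 1)).symm (θ x)

/-- The pullback of a 1-form along a map defined on a vector space. -/
noncomputable def pull (σ : Z → P) (θ : DiffForm I P 1 F) (z : Z) : Z →L[ℝ] F :=
  lin θ (σ z) ∘L mfderiv 𝓘(ℝ, Z) I σ z

theorem pull_apply (σ : Z → P) (θ : DiffForm I P 1 F) (z u : Z) :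
    pull σ θ z u = lin θ (σ z) (mfderiv 𝓘(ℝ, Z) I σ z u) := rfl

/-- A form is smooth at `x` in the preferred chart at `x`. -/
def SmoothFormAt {n : ℕ} (θ : DiffForm I P n F) (x : P) : Prop :=
  ContDiffAt ℝ ∞ (inChart θ x) (extChartAt I x x)

variable [IsManifold I ∞ P]

theorem eventually_mdifferentiableAt {E' H' P' : Type*} [NormedAddCommGroup E'] [NormedSpace ℝ E']
    [TopologicalSpace H'] {I' : ModelWithCorners ℝ E' H'} [TopologicalSpace P'] [ChartedSpace H' P']
    [IsManifold I' ∞ P'] {f : P → P'} {x : P} (hf : ContMDiffAt I I' ∞ f x) :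
    ∀ᶠ y in 𝓝 x, MDifferentiableAt I I' f y := by
  filter_upwards [(contMDiffAt_iff_contMDiffAt_nhds (n := 1) (by simp)).1 (hf.of_le (by simp))]
    with y hy using hy.mdifferentiableAt (by simp)

variable [I.Boundaryless]

theorem contMDiffAt_extChartAt_symm {x : P} {y : E} (hy : y ∈ (extChartAt I x).target) :
    ContMDiffAt 𝓘(ℝ, E) I ∞ (extChartAt I x).symm y :=
  (contMDiffOn_extChartAt_symm x).contMDiffAt ((isOpen_extChartAt_target x).mem_nhds hy)

theorem contMDiffAt_extChartAt_of_mem {x p : P} (hp : p ∈ (extChartAt I x).source) :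
    ContMDiffAt I 𝓘(ℝ, E) ∞ (extChartAt I x) p :=
  contMDiffAt_extChartAt' (by simpa using hp)

/-- Every tangent space is definitionally the model space, so values at equal base points can be
compared after a cast to `E`; the same device recurs below as `show E →L[ℝ] _ from _`. -/
theorem form_transport {n : ℕ} (θ : DiffForm I P n F) {p q : P} (h : p = q) (L : Z →L[ℝ] E) :
    ((show E [⋀^Fin n]→L[ℝ] F from θ p).compContinuousLinearMap L) =
      ((show E [⋀^Fin n]→L[ℝ] F from θ q).compContinuousLinearMap L) := by
  subst h; rfl

/-- The tangent map of a map to a manifold in terms of its expression in a chart. -/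
theorem mfderiv_eq_extChartAt_symm_comp {σ : Z → P} {z : Z} {x : P}
    (hσ : MDifferentiableAt 𝓘(ℝ, Z) I σ z) (hx : σ z ∈ (extChartAt I x).source) :
    (show Z →L[ℝ] E from mfderiv 𝓘(ℝ, Z) I σ z) =
      (show E →L[ℝ] E from mfderiv 𝓘(ℝ, E) I (extChartAt I x).symm (extChartAt I x (σ z))) ∘L
        fderiv ℝ (fun z => extChartAt I x (σ z)) z := by
  have hn : σ ⁻¹' (extChartAt I x).source ∈ 𝓝 z :=
    hσ.continuousAt.preimage_mem_nhds ((isOpen_extChartAt_source x).mem_nhds hx)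
  have he : σ =ᶠ[𝓝 z] (extChartAt I x).symm ∘ (fun z => extChartAt I x (σ z)) := by
    filter_upwards [hn] with w hw
    exact ((extChartAt I x).left_inv hw).symm
  have h1 : MDifferentiableAt 𝓘(ℝ, E) I (extChartAt I x).symm (extChartAt I x (σ z)) :=
    (contMDiffAt_extChartAt_symm ((extChartAt I x).map_source hx)).mdifferentiableAt (by simp)
  have h2 : MDifferentiableAt 𝓘(ℝ, Z) 𝓘(ℝ, E) (fun z => extChartAt I x (σ z)) z :=
    ((contMDiffAt_extChartAt_of_mem hx).mdifferentiableAt (by simp)).comp z hσ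
  rw [he.mfderiv_eq, mfderiv_comp z h1 h2, mfderiv_eq_fderiv]
  rfl

theorem contDiffAt_extChartAt_comp {σ : Z → P} {z : Z} {x : P}
    (hσ : ContMDiffAt 𝓘(ℝ, Z) I ∞ σ z) (hx : σ z ∈ (extChartAt I x).source) :
    ContDiffAt ℝ ∞ (fun z => extChartAt I x (σ z)) z :=
  ((contMDiffAt_extChartAt_of_mem hx).comp z hσ).contDiffAt

/-- Replaces a pullback from a manifold by a pullback between vector spaces, the setting of
`extDeriv_pullback`. -/
theorem pullback_eventuallyEq_inChart {n : ℕ} (θ : DiffForm I P n F) {σ : Z → P} {z : Z}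
    (hσ : ContMDiffAt 𝓘(ℝ, Z) I ∞ σ z) {x : P} (hx : σ z ∈ (extChartAt I x).source) :
    ∀ᶠ w in 𝓝 z, (show Z [⋀^Fin n]→L[ℝ] F from pullback (I := 𝓘(ℝ, Z)) (I' := I) σ θ w) =
      (inChart θ x (extChartAt I x (σ w))).compContinuousLinearMap
        (fderiv ℝ (fun z => extChartAt I x (σ z)) w) := by
  have hn : σ ⁻¹' (extChartAt I x).source ∈ 𝓝 z :=
    hσ.continuousAt.preimage_mem_nhds ((isOpen_extChartAt_source x).mem_nhds hx)
  filter_upwards [hn, eventually_mdifferentiableAt hσ] with w hw hσw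
  have h := mfderiv_eq_extChartAt_symm_comp hσw hw
  calc (show Z [⋀^Fin n]→L[ℝ] F from pullback (I := 𝓘(ℝ, Z)) (I' := I) σ θ w)
      = (show E [⋀^Fin n]→L[ℝ] F from θ (σ w)).compContinuousLinearMap
          (show Z →L[ℝ] E from mfderiv 𝓘(ℝ, Z) I σ w) := rfl
    _ = _ := by
        rw [h, form_transport θ ((extChartAt I x).left_inv hw).symm]
        rfl

/-- The exterior derivative commutes with pullback along maps from a vector space. -/
theorem extDeriv_pullback_eq {n : ℕ} (θ : DiffForm I P n F) {σ : Z → P} {z : Z}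
    (hσ : ContMDiffAt 𝓘(ℝ, Z) I ∞ σ z) (hθ : SmoothFormAt θ (σ z)) :
    extDeriv (fun w => show Z [⋀^Fin n]→L[ℝ] F from pullback (I := 𝓘(ℝ, Z)) (I' := I) σ θ w) z =
      (show E [⋀^Fin (n + 1)]→L[ℝ] F from extd θ (σ z)).compContinuousLinearMap
        (show Z →L[ℝ] E from mfderiv 𝓘(ℝ, Z) I σ z) := by
  -- The chart at `σ z` is the one in which `extd θ (σ z)` is computed, so no change of charts is
  -- needed.
  have hx := mem_extChartAt_source (I := I) (σ z)
  have hd : DifferentiableAt ℝ (inChart θ (σ z)) ((fun w => extChartAt I (σ z) (σ w)) z) :=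
    ContDiffAt.differentiableAt hθ (by simp)
  rw [Filter.EventuallyEq.extDeriv_eq (pullback_eventuallyEq_inChart θ hσ hx),
    extDeriv_pullback (r := ∞) (f := fun w => extChartAt I (σ z) (σ w)) hd
      (contDiffAt_extChartAt_comp hσ hx)
      (by rw [minSmoothness_of_isRCLikeNormedField]; exact ENat.LEInfty.out)]
  have h : (show Z →L[ℝ] E from mfderiv 𝓘(ℝ, Z) I σ z) =
      fderiv ℝ (fun w => extChartAt I (σ z) (σ w)) z := by
    rw [(hσ.mdifferentiableAt (by simp)).mfderiv]
    simp only [writtenInExtChartAt, Function.comp_def, mfld_simps, fderivWithin_univ]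
    rfl
  rw [h]
  rfl

/-- The derivative of a covector field, antisymmetrized. -/
noncomputable def curl (a : Z → Z →L[ℝ] F) (z u v : Z) : F := fderiv ℝ a z u v - fderiv ℝ a z v u

theorem smoothFormAt_pull {θ : DiffForm I P 1 F} {σ : Z → P} {z : Z}
    (hσ : ContMDiffAt 𝓘(ℝ, Z) I ∞ σ z) (hθ : SmoothFormAt θ (σ z)) :
    ContDiffAt ℝ ∞ (pull σ θ) z := by
  have hx := mem_extChartAt_source (I := I) (σ z)
  have h1 := contDiffAt_extChartAt_comp hσ hx
  let L := (ContinuousAlternatingMap.ofSubsingletonLIE (𝕜 := ℝ) (E := E) (F := F) (0 : Fin 1))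
  have h2 : ContDiffAt ℝ ∞ (fun w => (L.symm (inChart θ (σ z) (extChartAt I (σ z) (σ w)))) ∘L
      (fderiv ℝ (fun z' => extChartAt I (σ z) (σ z')) w)) z := by
    refine ContDiffAt.clm_comp ?_ (h1.fderiv_right (m := ∞) (by simp))
    exact L.symm.contDiff.contDiffAt.comp z
      (ContDiffAt.comp (g := inChart θ (σ z)) (f := fun w => extChartAt I (σ z) (σ w)) z hθ h1)
  refine h2.congr_of_eventuallyEq ?_
  filter_upwards [pullback_eventuallyEq_inChart θ hσ hx] with w hw
  ext u
  have := congrArg (fun A : Z [⋀^Fin 1]→L[ℝ] F => A (fun _ => u)) hw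
  exact this

/-- The tool for evaluating exterior derivatives of 1-forms: along any map from a vector space, `d`
becomes an antisymmetrized Fréchet derivative. The map need not be a chart, which allows redundant
parametrizations. -/
theorem curl_pull {θ : DiffForm I P 1 F} {σ : Z → P} {z : Z}
    (hσ : ContMDiffAt 𝓘(ℝ, Z) I ∞ σ z) (hθ : SmoothFormAt θ (σ z)) (u v : Z) :
    curl (pull σ θ) z u v =
      extd θ (σ z) ![mfderiv 𝓘(ℝ, Z) I σ z u, mfderiv 𝓘(ℝ, Z) I σ z v] := by
  let L := (ContinuousAlternatingMap.ofSubsingletonLIE (𝕜 := ℝ) (E := Z) (F := F) (0 : Fin 1))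
  have h := extDeriv_pullback_eq θ hσ hθ
  have hd := (smoothFormAt_pull hσ hθ).differentiableAt (by simp)
  have he : (fun w => show Z [⋀^Fin 1]→L[ℝ] F from pullback (I := 𝓘(ℝ, Z)) (I' := I) σ θ w) =
      fun w => L (pull σ θ w) := by
    funext w
    ext m
    obtain ⟨m0, rfl⟩ : ∃ m0 : Z, m = fun _ => m0 := ⟨m 0, by funext i; rw [Subsingleton.elim i 0]⟩
    rfl
  rw [he] at h
  have h' : extDeriv (fun w => L (pull σ θ w)) z ![u, v] =
      extd θ (σ z) ![mfderiv 𝓘(ℝ, Z) I σ z u, mfderiv 𝓘(ℝ, Z) I σ z v] := by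
    rw [h]
    change (extd θ (σ z)) (fun i => mfderiv 𝓘(ℝ, Z) I σ z (![u, v] i)) = _
    congr 1
    funext i
    fin_cases i <;> rfl
  rw [← h', extDeriv_apply (show DifferentiableAt ℝ (fun w => L (pull σ θ w)) z from
    L.toContinuousLinearEquiv.differentiableAt.comp z hd)]
  have e : ∀ w : Fin 1 → Z, (fun x => (L (pull σ θ x)) w) =
      fun x => pull σ θ x (w 0) := fun w => rfl
  have hder : ∀ w u : Z, fderiv ℝ (fun x => pull σ θ x w) z u = fderiv ℝ (pull σ θ) z u w := by
    intro w u
    rw [fderiv_clm_apply hd (differentiableAt_const w)]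
    simp
  rw [Fin.sum_univ_two, e, e, hder, hder]
  simp [Fin.removeNth, Fin.succAbove, curl, sub_eq_add_neg]

/-- Every point of a manifold is in the image of a smooth local parametrization. -/
theorem exists_param (x : P) : ∃ (σ : E → P) (z : E), ContMDiffAt 𝓘(ℝ, E) I ∞ σ z ∧ σ z = x ∧
    Function.Surjective (mfderiv 𝓘(ℝ, E) I σ z) := by
  have hx := mem_extChartAt_source (I := I) x
  have hs := contMDiffAt_extChartAt_symm (I := I) (mem_extChartAt_target (I := I) x)
  refine ⟨(extChartAt I x).symm, extChartAt I x x, hs, (extChartAt I x).left_inv hx, ?_⟩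
  have h := isInvertible_mfderivWithin_extChartAt_symm (I := I) (mem_extChartAt_target (I := I) x)
  rw [I.range_eq_univ, mfderivWithin_univ] at h
  exact h.bijective.2

/-- 1-forms with the same pullback have exterior derivatives with the same pullback. -/
theorem extd_eq_of_pull_eq {E₁ H₁ P₁ E₂ H₂ P₂ : Type*}
    [NormedAddCommGroup E₁] [NormedSpace ℝ E₁] [TopologicalSpace H₁] {I₁ : ModelWithCorners ℝ E₁ H₁}
    [TopologicalSpace P₁] [ChartedSpace H₁ P₁] [IsManifold I₁ ∞ P₁] [I₁.Boundaryless]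
    [NormedAddCommGroup E₂] [NormedSpace ℝ E₂] [TopologicalSpace H₂] {I₂ : ModelWithCorners ℝ E₂ H₂}
    [TopologicalSpace P₂] [ChartedSpace H₂ P₂] [IsManifold I₂ ∞ P₂] [I₂.Boundaryless]
    {θ₁ : DiffForm I₁ P₁ 1 F} {θ₂ : DiffForm I₂ P₂ 1 F} {f₁ : P → P₁} {f₂ : P → P₂} {x : P}
    (hf₁ : ContMDiffAt I I₁ ∞ f₁ x) (hf₂ : ContMDiffAt I I₂ ∞ f₂ x)
    (hθ₁ : SmoothFormAt θ₁ (f₁ x)) (hθ₂ : SmoothFormAt θ₂ (f₂ x))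
    (h : ∀ᶠ y in 𝓝 x, ∀ v : TangentSpace I y, lin θ₁ (f₁ y) (mfderiv I I₁ f₁ y v) =
      lin θ₂ (f₂ y) (mfderiv I I₂ f₂ y v)) (u v : TangentSpace I x) :
    extd θ₁ (f₁ x) ![mfderiv I I₁ f₁ x u, mfderiv I I₁ f₁ x v] =
      extd θ₂ (f₂ x) ![mfderiv I I₂ f₂ x u, mfderiv I I₂ f₂ x v] := by
  obtain ⟨σ, z, hσ, rfl, hsurj⟩ := exists_param (I := I) x
  obtain ⟨u, rfl⟩ := hsurj u
  obtain ⟨v, rfl⟩ := hsurj v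
  have hσ' := hσ.mdifferentiableAt (by simp)
  have h1 := hf₁.mdifferentiableAt (by simp)
  have h2 := hf₂.mdifferentiableAt (by simp)
  -- By hypothesis both forms have the same pullback to the parameter space near `z`, hence the same
  -- curl at `z`.
  have e : pull (f₁ ∘ σ) θ₁ =ᶠ[𝓝 z] pull (f₂ ∘ σ) θ₂ := by
    filter_upwards [hσ.continuousAt.eventually h, eventually_mdifferentiableAt hσ,
      hσ.continuousAt.eventually (eventually_mdifferentiableAt hf₁),
      hσ.continuousAt.eventually (eventually_mdifferentiableAt hf₂)] with w hw hw1 hw2 hw3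
    ext t
    rw [pull_apply, pull_apply, mfderiv_comp w hw2 hw1, mfderiv_comp w hw3 hw1]
    exact hw _
  have c1 := curl_pull (hf₁.comp z hσ) hθ₁ u v
  have c2 := curl_pull (hf₂.comp z hσ) hθ₂ u v
  rw [mfderiv_comp z h1 hσ'] at c1
  rw [mfderiv_comp z h2 hσ'] at c2
  refine c1.symm.trans (Eq.trans ?_ c2)
  unfold curl
  rw [e.fderiv_eq]

theorem lin_pullback {E' H' P' : Type*} [NormedAddCommGroup E'] [NormedSpace ℝ E']
    [TopologicalSpace H'] {I' : ModelWithCorners ℝ E' H'} [TopologicalSpace P'] [ChartedSpace H' P']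
    (f : P → P') (θ : DiffForm I' P' 1 F) (x : P) (v : TangentSpace I x) :
    lin (pullback (I := I) f θ) x v = lin θ (f x) (mfderiv I I' f x v) := rfl

theorem smoothFormAt_of_pull {θ : DiffForm I P 1 F} {x : P}
    (h : ContDiffAt ℝ ∞ (pull (extChartAt I x).symm θ) (extChartAt I x x)) : SmoothFormAt θ x := by
  let L := (ContinuousAlternatingMap.ofSubsingletonLIE (𝕜 := ℝ) (E := E) (F := F) (0 : Fin 1))
  have h2 : ContDiffAt ℝ ∞ (fun w => L (pull (extChartAt I x).symm θ w)) (extChartAt I x x) :=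
    L.contDiff.contDiffAt.comp _ h
  refine h2.congr_of_eventuallyEq (Filter.Eventually.of_forall fun w => ?_)
  ext m
  obtain ⟨m0, rfl⟩ : ∃ m0 : E, m = fun _ => m0 := ⟨m 0, by funext i; rw [Subsingleton.elim i 0]⟩
  rfl

theorem smoothFormAt_pullback {E' H' P' : Type*} [NormedAddCommGroup E'] [NormedSpace ℝ E']
    [TopologicalSpace H'] {I' : ModelWithCorners ℝ E' H'} [TopologicalSpace P'] [ChartedSpace H' P']
    [IsManifold I' ∞ P'] [I'.Boundaryless]
    {f : P → P'} {θ : DiffForm I' P' 1 F} {x : P} (hf : ContMDiffAt I I' ∞ f x)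
    (hθ : SmoothFormAt θ (f x)) : SmoothFormAt (pullback (I := I) f θ) x := by
  have hx := mem_extChartAt_source (I := I) x
  have hs := contMDiffAt_extChartAt_symm (I := I) (mem_extChartAt_target (I := I) x)
  have e : (extChartAt I x).symm (extChartAt I x x) = x := (extChartAt I x).left_inv hx
  rw [← e] at hf hθ
  refine smoothFormAt_of_pull ((smoothFormAt_pull (hf.comp _ hs) hθ).congr_of_eventuallyEq ?_)
  filter_upwards [eventually_mdifferentiableAt hs,
    hs.continuousAt.eventually (eventually_mdifferentiableAt hf)] with w h1 h2
  ext t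
  rw [pull_apply, pull_apply, lin_pullback, mfderiv_comp w h2 h1]
  rfl

/-- The exterior derivative of 1-forms commutes with pullback. -/
theorem extd_pullback {E' H' P' : Type*} [NormedAddCommGroup E'] [NormedSpace ℝ E']
    [TopologicalSpace H'] {I' : ModelWithCorners ℝ E' H'} [TopologicalSpace P'] [ChartedSpace H' P']
    [IsManifold I' ∞ P'] [I'.Boundaryless]
    {f : P → P'} {θ : DiffForm I' P' 1 F} {x : P} (hf : ContMDiffAt I I' ∞ f x)
    (hθ : SmoothFormAt θ (f x)) (u v : TangentSpace I x) :
    extd (pullback (I := I) f θ) x ![u, v] =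
      extd θ (f x) ![mfderiv I I' f x u, mfderiv I I' f x v] := by
  have h := extd_eq_of_pull_eq (θ₁ := pullback (I := I) f θ) (θ₂ := θ) (f₁ := id) (f₂ := f) (x := x)
    contMDiffAt_id hf (smoothFormAt_pullback hf hθ) hθ
    (Filter.Eventually.of_forall fun y w => by rw [mfderiv_id]; rfl) u v
  rw [mfderiv_id] at h
  exact h

end OneForms

/-! ### Linear algebra of 2-forms -/

section TwoForms

variable {V F : Type*} [AddCommGroup V] [Module ℝ V] [TopologicalSpace V]
  [NormedAddCommGroup F] [NormedSpace ℝ F]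

theorem two_swap (A : V [⋀^Fin 2]→L[ℝ] F) (u v : V) : A ![u, v] = -A ![v, u] := by
  have h := A.toAlternatingMap.map_swap ![v, u] (i := 0) (j := 1) (by simp)
  have e : ![v, u] ∘ ⇑(Equiv.swap (0 : Fin 2) 1) = ![u, v] := by
    funext i; fin_cases i <;> simp
  rw [e] at h
  exact h

/-- A 2-form as a bilinear map. -/
def bil (A : V [⋀^Fin 2]→L[ℝ] F) : V →ₗ[ℝ] V →ₗ[ℝ] F :=
  LinearMap.mk₂ ℝ (fun u v => A ![u, v]) (fun u u' v => A.vecCons_add ![v] u u')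
    (fun c u v => A.vecCons_smul ![v] c u)
    (fun u v v' => by
      rw [two_swap, two_swap A u v, two_swap A u v', A.vecCons_add ![u] v v', neg_add])
    (fun c u v => by rw [two_swap, two_swap A u v, A.vecCons_smul ![u] c v, smul_neg])

theorem bil_apply (A : V [⋀^Fin 2]→L[ℝ] F) (u v : V) : bil A u v = A ![u, v] := rfl

theorem two_ext {A B : V [⋀^Fin 2]→L[ℝ] F} (h : ∀ u v, A ![u, v] = B ![u, v]) : A = B := by
  ext m
  have e : m = ![m 0, m 1] := by funext i; fin_cases i <;> rfl
  rw [e, h]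

theorem two_comp {V' : Type*} [AddCommGroup V'] [Module ℝ V'] [TopologicalSpace V']
    (A : V [⋀^Fin 2]→L[ℝ] F) (T : V' →L[ℝ] V) (u v : V') :
    A.compContinuousLinearMap T ![u, v] = A ![T u, T v] := by
  change A (fun i => T (![u, v] i)) = _
  congr 1
  funext i
  fin_cases i <;> rfl

end TwoForms

theorem pullback_two {E H E' H' P P' F : Type*} [NormedAddCommGroup E] [NormedSpace ℝ E]
    [TopologicalSpace H] [NormedAddCommGroup F] [NormedSpace ℝ F] {I : ModelWithCorners ℝ E H}
    [TopologicalSpace P] [ChartedSpace H P] [NormedAddCommGroup E'] [NormedSpace ℝ E']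
    [TopologicalSpace H'] {I' : ModelWithCorners ℝ E' H'} [TopologicalSpace P'] [ChartedSpace H' P']
    (f : P → P') (θ : DiffForm I' P' 2 F) (x : P) (u v : TangentSpace I x) :
    pullback (I := I) f θ x ![u, v] = θ (f x) ![mfderiv I I' f x u, mfderiv I I' f x v] :=
  two_comp _ _ _ _

/-! ### Bivectors of nondegenerate pairs (distribution, 2-form) -/

section Sharp

variable {E H : Type*} [NormedAddCommGroup E] [NormedSpace ℝ E] [TopologicalSpace H]
  {I : ModelWithCorners ℝ E H} {P : Type*} [TopologicalSpace P] [ChartedSpace H P]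
  {D : ∀ x : P, Submodule ℝ (TangentSpace I x)} {Ω : DiffForm I P 2 ℝ}

/-- Nondegeneracy supplies the uniqueness demanded by the definition of `sharp`, so exhibiting one
solution excludes its default value. -/
theorem sharp_eq {x : P} (hnd : ∀ X ∈ D x, (∀ Y ∈ D x, Ω x ![X, Y] = 0) → X = 0)
    {α : TangentSpace I x →L[ℝ] ℝ} {X : TangentSpace I x} (hX : X ∈ D x)
    (h : ∀ Y ∈ D x, Ω x ![X, Y] = α Y) : sharp D Ω x α = -X := by
  have hu : ∃! X : TangentSpace I x, X ∈ D x ∧ ∀ Y ∈ D x, Ω x ![X, Y] = α Y := by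
    refine ⟨X, ⟨hX, h⟩, fun X' hX' => ?_⟩
    rw [← sub_eq_zero]
    refine hnd _ (sub_mem hX'.1 hX) fun Y hY => ?_
    rw [← bil_apply, map_sub, LinearMap.sub_apply, bil_apply, bil_apply, hX'.2 Y hY, h Y hY,
      sub_self]
  rw [sharp, dif_pos hu, hu.unique hu.choose_spec.1 ⟨hX, h⟩]

/-- In finite dimension the injective map `D x → (D x)^*` given by `Ω` is onto, so the default value
`0` of `sharp` plays no role for nondegenerate pairs. -/
theorem exists_sharp_eq [FiniteDimensional ℝ E] {x : P}
    (hnd : ∀ X ∈ D x, (∀ Y ∈ D x, Ω x ![X, Y] = 0) → X = 0) (α : TangentSpace I x →L[ℝ] ℝ) :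
    ∃ X ∈ D x, (∀ Y ∈ D x, Ω x ![X, Y] = α Y) ∧ sharp D Ω x α = -X := by
  have : FiniteDimensional ℝ (TangentSpace I x) := inferInstanceAs (FiniteDimensional ℝ E)
  let B : D x →ₗ[ℝ] Module.Dual ℝ (D x) := (bil (Ω x)).domRestrict₁₂ (D x) (D x)
  have hB : Function.Injective B := by
    rw [← LinearMap.ker_eq_bot, LinearMap.ker_eq_bot']
    intro X hX
    refine Subtype.ext (hnd X X.2 fun Y hY => ?_)
    exact congrArg (fun l : Module.Dual ℝ (D x) => l ⟨Y, hY⟩) hX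
  have hs : Function.Surjective B :=
    (LinearMap.injective_iff_surjective_of_finrank_eq_finrank
      (Subspace.dual_finrank_eq (K := ℝ) (V := D x)).symm).1 hB
  obtain ⟨X, hX⟩ := hs (α.toLinearMap.domRestrict (D x))
  have h : ∀ Y ∈ D x, Ω x ![X.1, Y] = α Y := fun Y hY =>
    congrArg (fun l : Module.Dual ℝ (D x) => l ⟨Y, hY⟩) hX
  exact ⟨X, X.2, h, sharp_eq hnd X.2 h⟩

/-- A linear map that identifies two nondegenerate pairs intertwines their bivectors. -/
theorem map_sharp [FiniteDimensional ℝ E] {E' H' P' : Type*} [NormedAddCommGroup E']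
    [NormedSpace ℝ E'] [TopologicalSpace H'] {I' : ModelWithCorners ℝ E' H'} [TopologicalSpace P']
    [ChartedSpace H' P'] {D' : ∀ x : P', Submodule ℝ (TangentSpace I' x)} {Ω' : DiffForm I' P' 2 ℝ}
    {x : P} {y : P'} (T : TangentSpace I x →L[ℝ] TangentSpace I' y)
    (hnd : ∀ X ∈ D x, (∀ Y ∈ D x, Ω x ![X, Y] = 0) → X = 0)
    (hnd' : ∀ X ∈ D' y, (∀ Y ∈ D' y, Ω' y ![X, Y] = 0) → X = 0)
    (hT : ∀ X ∈ D x, T X ∈ D' y) (hs : ∀ Y ∈ D' y, ∃ X ∈ D x, T X = Y)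
    (hΩ : ∀ X ∈ D x, ∀ Y ∈ D x, Ω' y ![T X, T Y] = Ω x ![X, Y])
    (α : TangentSpace I' y →L[ℝ] ℝ) : T (sharp D Ω x (α ∘L T)) = sharp D' Ω' y α := by
  obtain ⟨X, hX, h, e⟩ := exists_sharp_eq hnd (α ∘L T)
  rw [e, map_neg]
  -- `T X` solves the defining equation in the target, since every test vector there has the form `T
  -- Y`.
  refine (sharp_eq hnd' (hT X hX) fun Y' hY' => ?_).symm
  obtain ⟨Y, hY, rfl⟩ := hs Y' hY'
  rw [hΩ X hX Y hY, h Y hY]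
  rfl

/-- The bivector of a nondegenerate pair is skew-symmetric. -/
theorem sharp_skew [FiniteDimensional ℝ E] {x : P}
    (hnd : ∀ X ∈ D x, (∀ Y ∈ D x, Ω x ![X, Y] = 0) → X = 0) (α β : TangentSpace I x →L[ℝ] ℝ) :
    β (sharp D Ω x α) = -α (sharp D Ω x β) := by
  obtain ⟨X, hX, h, e⟩ := exists_sharp_eq hnd α
  obtain ⟨Y, hY, h', e'⟩ := exists_sharp_eq hnd β
  rw [e, e', map_neg, map_neg, ← h Y hY, ← h' X hX, two_swap]

theorem sharp_add [FiniteDimensional ℝ E] {x : P}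
    (hnd : ∀ X ∈ D x, (∀ Y ∈ D x, Ω x ![X, Y] = 0) → X = 0) (α β : TangentSpace I x →L[ℝ] ℝ) :
    sharp D Ω x (α + β) = sharp D Ω x α + sharp D Ω x β := by
  obtain ⟨X, hX, h, e⟩ := exists_sharp_eq hnd α
  obtain ⟨Y, hY, h', e'⟩ := exists_sharp_eq hnd β
  rw [e, e', ← neg_add]
  refine sharp_eq hnd (add_mem hX hY) fun Z hZ => ?_
  rw [← bil_apply, map_add, LinearMap.add_apply, bil_apply, bil_apply, h Z hZ, h' Z hZ]
  rfl

theorem sharp_smul [FiniteDimensional ℝ E] {x : P}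
    (hnd : ∀ X ∈ D x, (∀ Y ∈ D x, Ω x ![X, Y] = 0) → X = 0) (c : ℝ)
    (α : TangentSpace I x →L[ℝ] ℝ) : sharp D Ω x (c • α) = c • sharp D Ω x α := by
  obtain ⟨X, hX, h, e⟩ := exists_sharp_eq hnd α
  rw [e, smul_neg]
  refine sharp_eq hnd (Submodule.smul_mem _ c hX) fun Z hZ => ?_
  rw [← bil_apply, map_smul, LinearMap.smul_apply, bil_apply, h Z hZ]
  rfl

/-- The bracket of a nondegenerate pair is almost Poisson as soon as it is smooth. -/
theorem isAlmostPoissonBracket_of_smooth [FiniteDimensional ℝ E] (hnd : NondegenerateOn D Ω)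
    (hs : ∀ f g : P → ℝ, ContMDiff I 𝓘(ℝ, ℝ) ∞ f → ContMDiff I 𝓘(ℝ, ℝ) ∞ g →
      ContMDiff I 𝓘(ℝ, ℝ) ∞ (bracket D Ω f g)) : IsAlmostPoissonBracket I (bracket D Ω) where
  smooth := hs
  add_left f g h hf hg _ := by
    funext x
    have e : dfun I (f + g) x = dfun I f x + dfun I g x :=
      mfderiv_add (hf.mdifferentiableAt (by simp)) (hg.mdifferentiableAt (by simp))
    simp only [bracket, e, sharp_add (hnd x), Pi.add_apply, map_add]
  smul_left c f g hf _ := by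
    funext x
    have e : dfun I (c • f) x = c • dfun I f x :=
      const_smul_mfderiv (hf.mdifferentiableAt (by simp)) c
    simp only [bracket, e, sharp_smul (hnd x), Pi.smul_apply, map_smul]
  skew f g _ _ := by
    funext x
    exact sharp_skew (hnd x) _ _
  leibniz f g h hf hg _ := by
    funext x
    have e : dfun I (f * g) x = f x • dfun I g x + g x • dfun I f x := by
      have h1 := (hf.mdifferentiableAt (x := x) (by simp)).hasMFDerivAt
      have h2 := (hg.mdifferentiableAt (x := x) (by simp)).hasMFDerivAt
      exact (h1.mul h2).mfderiv
    simp only [bracket, e, sharp_add (hnd x), sharp_smul (hnd x), Pi.add_apply, Pi.mul_apply,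
      map_add, map_smul, smul_eq_mul]
    ring

end Sharp

/-! ### Smoothness in vector spaces -/

section Smoothness

variable {Z E V K F : Type*} [NormedAddCommGroup Z] [NormedSpace ℝ Z] [NormedAddCommGroup E]
  [NormedSpace ℝ E] [NormedAddCommGroup V] [NormedSpace ℝ V] [NormedAddCommGroup K]
  [NormedSpace ℝ K] [NormedAddCommGroup F] [NormedSpace ℝ F]

/-- Evaluation on all tuples of basis vectors is an injective linear map into a finite-dimensional
space. A linear left inverse of it recovers the form smoothly from finitely many smooth functions.
-/
theorem contDiffAt_alternating_of_apply [FiniteDimensional ℝ E] {n : ℕ}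
    {f : Z → E [⋀^Fin n]→L[ℝ] ℝ} {z : Z}
    (h : ∀ m : Fin n → E, ContDiffAt ℝ ∞ (fun z => f z m) z) : ContDiffAt ℝ ∞ f z := by
  let b := Module.finBasis ℝ E
  let T : (E [⋀^Fin n]→L[ℝ] ℝ) →ₗ[ℝ] ((Fin n → Fin (Module.finrank ℝ E)) → ℝ) :=
    { toFun := fun A s => A (fun i => b (s i))
      map_add' := fun _ _ => rfl
      map_smul' := fun _ _ => rfl }
  have hT : LinearMap.ker T = ⊥ := by
    rw [LinearMap.ker_eq_bot']
    intro A hA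
    ext m
    refine congrFun (congrArg DFunLike.coe (Module.Basis.ext_multilinear (f := A.toMultilinearMap)
      (g := 0) (fun _ => b) fun s => ?_)) m
    exact congrFun hA s
  obtain ⟨R, hR⟩ := T.exists_leftInverse_of_injective hT
  have e : f = fun z => LinearMap.toContinuousLinearMap R (T (f z)) := by
    funext w
    exact (congrArg (fun l : _ →ₗ[ℝ] _ => l (f w)) hR).symm
  rw [e]
  exact (LinearMap.toContinuousLinearMap R).contDiff.contDiffAt.comp z
    (contDiffAt_pi.2 fun s => h _)

theorem contDiffAt_clm_of_apply [FiniteDimensional ℝ E] {f : Z → E →L[ℝ] F} {z : Z}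
    (h : ∀ v : E, ContDiffAt ℝ ∞ (fun z => f z v) z) : ContDiffAt ℝ ∞ f z := by
  let b := Module.finBasis ℝ E
  have e : f = fun z => ∑ i, (LinearMap.toContinuousLinearMap (b.coord i)).smulRight
      (f z (b i)) := by
    funext w
    ext v
    conv_lhs => rw [← b.sum_repr v]
    rw [map_sum]
    simp
  rw [e]
  exact ContDiffAt.sum fun i _ => contDiffAt_const.smulRight (h _)

theorem contDiffAt_inverse [CompleteSpace E] {f : Z → E →L[ℝ] F} {z : Z} (hf : ContDiffAt ℝ ∞ f z)
    (h : (f z).IsInvertible) : ContDiffAt ℝ ∞ (fun z => (f z).inverse) z :=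
  ContDiffAt.comp z h.contDiffAt_map_inverse hf

theorem eventually_isInvertible [CompleteSpace E] {f : Z → E →L[ℝ] F} {z : Z}
    (hf : ContinuousAt f z) (h : (f z).IsInvertible) : ∀ᶠ w in 𝓝 z, (f w).IsInvertible := by
  obtain ⟨e, he⟩ := h
  have := hf.preimage_mem_nhds (by rw [← he]; exact e.nhds)
  filter_upwards [this] with w hw
  obtain ⟨e', he'⟩ := hw
  exact ⟨e', he'⟩

/-- If two smooth families of linear maps satisfy `L ∘ A = B` with `L` injective, then the
solution `A` is smooth. -/
theorem contDiffAt_of_comp_eq [FiniteDimensional ℝ V] [FiniteDimensional ℝ E]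
    {L : Z → V →L[ℝ] E} {B : Z → K →L[ℝ] E} {A : Z → K →L[ℝ] V} {z : Z}
    (hL : ContDiffAt ℝ ∞ L z) (hB : ContDiffAt ℝ ∞ B z) (hinj : Function.Injective (L z))
    (h : ∀ᶠ w in 𝓝 z, L w ∘L A w = B w) : ContDiffAt ℝ ∞ A z := by
  -- With `R` a left inverse of `L z`, the map `R ∘ L w` stays invertible near `z`, and `A w = (R ∘
  -- L w)⁻¹ ∘ R ∘ B w`.
  obtain ⟨R, hR⟩ := (L z).toLinearMap.exists_leftInverse_of_injective (LinearMap.ker_eq_bot.2 hinj)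
  let R' : E →L[ℝ] V := LinearMap.toContinuousLinearMap R
  have hRL : ContDiffAt ℝ ∞ (fun w => R' ∘L L w) z := contDiffAt_const.clm_comp hL
  have hinv : (R' ∘L L z).IsInvertible := by
    refine ⟨ContinuousLinearEquiv.refl ℝ V, ?_⟩
    ext v
    exact (congrArg (fun l : V →ₗ[ℝ] V => l v) hR).symm
  refine ((contDiffAt_inverse hRL hinv).clm_comp (contDiffAt_const.clm_comp hB
    (g := fun _ => R'))).congr_of_eventuallyEq ?_
  filter_upwards [h, eventually_isInvertible hRL.continuousAt hinv] with w hw hi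
  ext v
  refine ((ContinuousLinearMap.IsInvertible.inverse_apply_eq hi).2 ?_).symm
  rw [← hw]
  rfl

/-- The curl of a product. -/
theorem curl_add_clm_comp {θ₁ θ₂ : Z → Z →L[ℝ] K} {c : Z → F →L[ℝ] K} {A : Z → Z →L[ℝ] F} {z : Z}
    (hθ₂ : DifferentiableAt ℝ θ₂ z) (hc : DifferentiableAt ℝ c z) (hA : DifferentiableAt ℝ A z)
    (h : θ₁ =ᶠ[𝓝 z] fun w => θ₂ w + c w ∘L A w) {u v : Z} (hu : A z u = 0) (hv : A z v = 0) :
    curl θ₁ z u v = curl θ₂ z u v + c z (curl A z u v) := by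
  have e := fderiv_fun_add hθ₂ (hc.clm_comp hA)
  -- In the product rule the derivative of `c` is only paired with `A z u` and `A z v`, which
  -- vanish.
  unfold curl
  rw [h.fderiv_eq, e, fderiv_clm_comp hc hA]
  simp [hu, hv]
  abel

/-- The curl of the pullback of the Liouville form under `(x, p) ↦ (x, p ∘ P x)`. -/
theorem curl_comp_fst {T : E → E →L[ℝ] E} {x : E} (p : E →L[ℝ] ℝ) (hT : DifferentiableAt ℝ T x)
    (u v : E × (E →L[ℝ] ℝ)) :
    curl (fun z : E × (E →L[ℝ] ℝ) => (z.2 ∘L T z.1) ∘L ContinuousLinearMap.fst ℝ E (E →L[ℝ] ℝ))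
      (x, p) u v = u.2 (T x v.1) + p (fderiv ℝ T x u.1 v.1) -
        (v.2 (T x u.1) + p (fderiv ℝ T x v.1 u.1)) := by
  have h1 : DifferentiableAt ℝ (fun z : E × (E →L[ℝ] ℝ) => T z.1) (x, p) :=
    DifferentiableAt.comp (x, p) (g := T) (f := Prod.fst) hT differentiableAt_fst
  have h2 : DifferentiableAt ℝ (fun z : E × (E →L[ℝ] ℝ) => z.2) (x, p) := differentiableAt_snd
  have h3 : fderiv ℝ (fun z : E × (E →L[ℝ] ℝ) => T z.1) (x, p) =
      fderiv ℝ T x ∘L ContinuousLinearMap.fst ℝ E (E →L[ℝ] ℝ) := by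
    have := fderiv_comp (x, p) (g := T) (f := (Prod.fst : E × (E →L[ℝ] ℝ) → E)) hT
      differentiableAt_fst
    rw [fderiv_fst] at this
    exact this
  have h4 : fderiv ℝ (fun z : E × (E →L[ℝ] ℝ) => z.2) (x, p) =
      ContinuousLinearMap.snd ℝ E (E →L[ℝ] ℝ) := fderiv_snd
  unfold curl
  rw [fderiv_clm_comp (h2.clm_comp h1) (differentiableAt_const _), fderiv_clm_comp h2 h1, h3, h4]
  simp
  ring

/-- The Jacobi identity for functions with Hamiltonian vector fields relative to a closed 2-form. -/
theorem jacobi_of_curl {θ : Z → Z →L[ℝ] ℝ} {z : Z} (hθ : ContDiffAt ℝ ∞ θ z)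
    {f₁ f₂ f₃ : Z → ℝ} {X₁ X₂ X₃ : Z → Z}
    (hf₁ : ContDiffAt ℝ ∞ f₁ z) (hf₂ : ContDiffAt ℝ ∞ f₂ z) (hf₃ : ContDiffAt ℝ ∞ f₃ z)
    (hX₁ : DifferentiableAt ℝ X₁ z) (hX₂ : DifferentiableAt ℝ X₂ z)
    (hX₃ : DifferentiableAt ℝ X₃ z)
    (h₁ : ∀ᶠ w in 𝓝 z, ∀ v, -curl θ w (X₁ w) v = fderiv ℝ f₁ w v)
    (h₂ : ∀ᶠ w in 𝓝 z, ∀ v, -curl θ w (X₂ w) v = fderiv ℝ f₂ w v)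
    (h₃ : ∀ᶠ w in 𝓝 z, ∀ v, -curl θ w (X₃ w) v = fderiv ℝ f₃ w v) :
    fderiv ℝ (fun w => fderiv ℝ f₃ w (X₂ w)) z (X₁ z) +
      fderiv ℝ (fun w => fderiv ℝ f₁ w (X₃ w)) z (X₂ z) +
      fderiv ℝ (fun w => fderiv ℝ f₂ w (X₁ w)) z (X₃ z) = 0 := by
  have hdθ : DifferentiableAt ℝ (fderiv ℝ θ) z :=
    (hθ.fderiv_right (m := ∞) (by simp)).differentiableAt (by simp)
  have h2 : minSmoothness ℝ 2 ≤ (∞ : ℕ∞ω) := by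
    rw [minSmoothness_of_isRCLikeNormedField]; exact ENat.LEInfty.out
  have hsymm : ∀ {f : Z → ℝ},
      ContDiffAt ℝ ∞ f z → ∀ u v, fderiv ℝ (fderiv ℝ f) z u v = fderiv ℝ (fderiv ℝ f) z v u :=
    fun hf u v => (hf.isSymmSndFDerivAt h2) u v
  have hsymmθ : ∀ u v, fderiv ℝ (fderiv ℝ θ) z u v = fderiv ℝ (fderiv ℝ θ) z v u :=
    fun u v => (hθ.isSymmSndFDerivAt h2) u v
  have hd : ∀ {f : Z → ℝ}, ContDiffAt ℝ ∞ f z → DifferentiableAt ℝ (fderiv ℝ f) z := fun hf =>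
    (hf.fderiv_right (m := ∞) (by simp)).differentiableAt (by simp)
  -- Differentiating Hamilton's equation in the direction `u` expresses the Hessian of `f` through
  -- `D²θ` and `DX`.
  have key : ∀ {f : Z → ℝ} {X : Z → Z}, ContDiffAt ℝ ∞ f z → DifferentiableAt ℝ X z →
      (∀ᶠ w in 𝓝 z, ∀ v, -curl θ w (X w) v = fderiv ℝ f w v) → ∀ u v,
      fderiv ℝ (fderiv ℝ f) z u v =
        -(fderiv ℝ (fderiv ℝ θ) z u (X z) v + fderiv ℝ θ z (fderiv ℝ X z u) v -
          (fderiv ℝ (fderiv ℝ θ) z u v (X z) + fderiv ℝ θ z v (fderiv ℝ X z u))) := by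
    intro f X hf hX h u v
    have e1 : fderiv ℝ (fun w => fderiv ℝ f w v) z u = fderiv ℝ (fderiv ℝ f) z u v := by
      rw [fderiv_clm_apply (hd hf) (differentiableAt_const v)]
      simp
    have e2 : (fun w => fderiv ℝ f w v) =ᶠ[𝓝 z]
        fun w => -(fderiv ℝ θ w (X w) v - fderiv ℝ θ w v (X w)) := by
      filter_upwards [h] with w hw
      exact (hw v).symm
    have d1 := hdθ.clm_apply hX
    have d2 := hdθ.clm_apply (differentiableAt_const v)
    rw [← e1, e2.fderiv_eq, fderiv_fun_neg,
      fderiv_fun_sub (d1.clm_apply (differentiableAt_const v)) (d2.clm_apply hX),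
      fderiv_clm_apply d1 (differentiableAt_const v), fderiv_clm_apply d2 hX,
      fderiv_clm_apply hdθ hX, fderiv_clm_apply hdθ (differentiableAt_const v)]
    simp
    ring
  have main : ∀ {f : Z → ℝ} {X : Z → Z}, ContDiffAt ℝ ∞ f z → DifferentiableAt ℝ X z → ∀ u,
      fderiv ℝ (fun w => fderiv ℝ f w (X w)) z u =
        fderiv ℝ (fderiv ℝ f) z u (X z) + fderiv ℝ f z (fderiv ℝ X z u) := by
    intro f X hf hX u
    rw [fderiv_clm_apply (hd hf) hX]
    simp [add_comm]
  rw [main hf₃ hX₂, main hf₁ hX₃, main hf₂ hX₁, ← h₃.self_of_nhds, ← h₁.self_of_nhds,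
    ← h₂.self_of_nhds]
  -- The Hessian of `f₂` is taken at `(X₁, X₃)` so that its term in `DX₂(X₁)` cancels
  -- `df₃(DX₂(X₁))`; the other two cases are cyclic. What remains is `d(dθ)` on the three fields,
  -- which vanishes by symmetry of `D²θ`.
  have k2 := key hf₂ hX₂ h₂ (X₁ z) (X₃ z)
  have k3 := key hf₃ hX₃ h₃ (X₂ z) (X₁ z)
  have k1 := key hf₁ hX₁ h₁ (X₃ z) (X₂ z)
  rw [hsymm hf₂] at k2
  rw [hsymm hf₃] at k3
  rw [hsymm hf₁] at k1
  rw [k1, k2, k3]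
  have s1 := congrArg (fun l : Z →L[ℝ] ℝ => l (X₃ z)) (hsymmθ (X₁ z) (X₂ z))
  have s2 := congrArg (fun l : Z →L[ℝ] ℝ => l (X₂ z)) (hsymmθ (X₁ z) (X₃ z))
  have s3 := congrArg (fun l : Z →L[ℝ] ℝ => l (X₁ z)) (hsymmθ (X₂ z) (X₃ z))
  simp only [curl]
  linarith

end Smoothness

/-! ### Coordinates on the tangent and cotangent bundles -/

section Coordinates

variable {E Q : Type*} [NormedAddCommGroup E] [NormedSpace ℝ E]
  [TopologicalSpace Q] [ChartedSpace E Q]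

variable (E) in
/-- The tangent map of the chart at `q₀`. -/
noncomputable def dch (q₀ q : Q) : TangentSpace 𝓘(ℝ, E) q →L[ℝ] E :=
  mfderiv 𝓘(ℝ, E) 𝓘(ℝ, E) (extChartAt 𝓘(ℝ, E) q₀) q

/-- The tangent map of the inverse of the chart at `q₀`. -/
noncomputable def dpar (q₀ : Q) (x : E) :
    E →L[ℝ] TangentSpace 𝓘(ℝ, E) ((extChartAt 𝓘(ℝ, E) q₀).symm x) :=
  mfderiv 𝓘(ℝ, E) 𝓘(ℝ, E) (extChartAt 𝓘(ℝ, E) q₀).symm x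

/-- The local parametrization of the cotangent bundle over the chart at `q₀`. -/
noncomputable def cotPar (q₀ : Q) (z : E × (E →L[ℝ] ℝ)) : CotangentBundle E Q :=
  ⟨(extChartAt 𝓘(ℝ, E) q₀).symm z.1, z.2 ∘L dch E q₀ ((extChartAt 𝓘(ℝ, E) q₀).symm z.1)⟩

/-- The fibre coordinate of a covector over the chart at `q₀`. -/
noncomputable def cotCoord (q₀ : Q) (α : CotangentBundle E Q) : E →L[ℝ] ℝ :=
  α.snd ∘L (dch E q₀ α.proj).inverse

variable [IsManifold 𝓘(ℝ, E) ∞ Q]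

theorem dch_dpar {q₀ : Q} {x : E} (hx : x ∈ (extChartAt 𝓘(ℝ, E) q₀).target) (v : E) :
    dch E q₀ ((extChartAt 𝓘(ℝ, E) q₀).symm x) (dpar q₀ x v) = v := by
  have h := mfderiv_extChartAt_comp_mfderivWithin_extChartAt_symm (I := 𝓘(ℝ, E)) hx
  rw [ModelWithCorners.range_eq_univ, mfderivWithin_univ] at h
  exact congrArg (fun l : E →L[ℝ] E => l v) h

theorem dpar_dch {q₀ : Q} {x : E} (hx : x ∈ (extChartAt 𝓘(ℝ, E) q₀).target)
    (v : TangentSpace 𝓘(ℝ, E) ((extChartAt 𝓘(ℝ, E) q₀).symm x)) :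
    dpar q₀ x (dch E q₀ ((extChartAt 𝓘(ℝ, E) q₀).symm x) v) = v := by
  have h := mfderivWithin_extChartAt_symm_comp_mfderiv_extChartAt (I := 𝓘(ℝ, E)) hx
  rw [ModelWithCorners.range_eq_univ, mfderivWithin_univ] at h
  exact congrArg (fun l : E →L[ℝ] E => l v) h

theorem dch_isInvertible {q₀ q : Q} (hq : q ∈ (extChartAt 𝓘(ℝ, E) q₀).source) :
    (dch E q₀ q).IsInvertible := isInvertible_mfderiv_extChartAt hq

theorem dch_inverse_apply {q₀ q : Q} (hq : q ∈ (extChartAt 𝓘(ℝ, E) q₀).source)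
    (v : TangentSpace 𝓘(ℝ, E) q) : (dch E q₀ q).inverse (dch E q₀ q v) = v :=
  (dch_isInvertible hq).inverse_apply_eq.2 rfl

theorem dch_apply_inverse {q₀ q : Q} (hq : q ∈ (extChartAt 𝓘(ℝ, E) q₀).source) (v : E) :
    dch E q₀ q ((dch E q₀ q).inverse v) = v :=
  ((dch_isInvertible hq).inverse_apply_eq.1 rfl).symm

theorem cotCoord_cotPar {q₀ : Q} {z : E × (E →L[ℝ] ℝ)}
    (hz : z.1 ∈ (extChartAt 𝓘(ℝ, E) q₀).target) : cotCoord q₀ (cotPar q₀ z) = z.2 := by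
  ext v
  change z.2 (dch E q₀ _ ((dch E q₀ _).inverse v)) = z.2 v
  rw [dch_apply_inverse ((extChartAt 𝓘(ℝ, E) q₀).map_target hz)]

theorem cotPar_cotCoord {q₀ : Q} {α : CotangentBundle E Q}
    (hα : α.proj ∈ (extChartAt 𝓘(ℝ, E) q₀).source) :
    cotPar q₀ (extChartAt 𝓘(ℝ, E) q₀ α.proj, cotCoord q₀ α) = α := by
  refine cotangent_ext ((extChartAt 𝓘(ℝ, E) q₀).left_inv hα) fun v => ?_
  -- Generalizing the base point to a variable and substituting avoids rewriting inside dependent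
  -- types. The auxiliary statements `key` below serve the same purpose.
  have key : ∀ q : Q, q = α.proj → (show E →L[ℝ] ℝ from α.snd)
      ((show E →L[ℝ] E from (dch E q₀ α.proj).inverse) ((show E →L[ℝ] E from dch E q₀ q) v)) =
      (show E →L[ℝ] ℝ from α.snd) v := by
    rintro q rfl
    exact congrArg _ (dch_inverse_apply hα v)
  exact key _ ((extChartAt 𝓘(ℝ, E) q₀).left_inv hα)

variable {EX HX X : Type*} [NormedAddCommGroup EX] [NormedSpace ℝ EX] [TopologicalSpace HX]
  {IX : ModelWithCorners ℝ EX HX} [TopologicalSpace X] [ChartedSpace HX X]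

/-- Smoothness of maps to the tangent bundle in coordinates. -/
theorem contMDiffAt_tangent_iff {f : X → TangentBundle 𝓘(ℝ, E) Q} {x : X} {q₀ : Q}
    (hq : (f x).proj ∈ (extChartAt 𝓘(ℝ, E) q₀).source) :
    ContMDiffAt IX 𝓘(ℝ, E).tangent ∞ f x ↔
      ContMDiffAt IX 𝓘(ℝ, E) ∞ (fun y => (f y).proj) x ∧
        ContMDiffAt IX 𝓘(ℝ, E) ∞ (fun y => dch E q₀ (f y).proj (f y).snd) x := by
  have hs : f x ∈ (trivializationAt E (TangentSpace 𝓘(ℝ, E)) q₀).source := by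
    rw [Bundle.Trivialization.mem_source, TangentBundle.trivializationAt_baseSet]
    simpa using hq
  refine (Bundle.Trivialization.contMDiffAt_iff (IB := 𝓘(ℝ, E)) hs).trans
    (and_congr_right fun h => ?_)
  refine Filter.EventuallyEq.contMDiffAt_iff ?_
  filter_upwards [h.continuousAt.preimage_mem_nhds ((isOpen_extChartAt_source q₀).mem_nhds hq)]
    with y hy
  have hy' : (f y).proj ∈ (chartAt E q₀).source := by simpa using hy
  have h1 := TangentBundle.continuousLinearMapAt_trivializationAt (I := 𝓘(ℝ, E)) hy'
  have hb : (f y).proj ∈ (trivializationAt E (TangentSpace 𝓘(ℝ, E)) q₀).baseSet := by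
    rw [TangentBundle.trivializationAt_baseSet]; exact hy'
  rw [dch, ← h1]
  exact (congrFun (Bundle.Trivialization.coe_linearMapAt_of_mem (R := ℝ) _ hb) _).symm

/-- Smoothness of maps to the cotangent bundle in coordinates. -/
theorem contMDiffAt_cotangent_iff {f : X → CotangentBundle E Q} {x : X} {q₀ : Q}
    (hq : (f x).proj ∈ (extChartAt 𝓘(ℝ, E) q₀).source) :
    ContMDiffAt IX (cotangentModel E) ∞ f x ↔
      ContMDiffAt IX 𝓘(ℝ, E) ∞ (fun y => (f y).proj) x ∧
        ContMDiffAt IX 𝓘(ℝ, E →L[ℝ] ℝ) ∞ (fun y => cotCoord q₀ (f y)) x := by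
  have hb' : ∀ {q : Q}, q ∈ (extChartAt 𝓘(ℝ, E) q₀).source →
      q ∈ (trivializationAt E (TangentSpace 𝓘(ℝ, E)) q₀).baseSet := by
    intro q hq
    rw [TangentBundle.trivializationAt_baseSet]
    simpa using hq
  have hs : f x ∈ (trivializationAt (E →L[ℝ] ℝ)
      (fun q : Q => TangentSpace 𝓘(ℝ, E) q →L[ℝ] ℝ) q₀).source := by
    rw [Bundle.Trivialization.mem_source]
    exact ⟨hb' hq, Set.mem_univ _⟩
  refine (Bundle.Trivialization.contMDiffAt_iff (IB := 𝓘(ℝ, E)) hs).trans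
    (and_congr_right fun h => ?_)
  refine Filter.EventuallyEq.contMDiffAt_iff ?_
  filter_upwards [h.continuousAt.preimage_mem_nhds ((isOpen_extChartAt_source q₀).mem_nhds hq)]
    with y hy
  have hy' : (f y).proj ∈ (chartAt E q₀).source := by simpa using hy
  have h1 := TangentBundle.continuousLinearMapAt_trivializationAt (I := 𝓘(ℝ, E)) hy'
  have hb := hb' hy
  have e : (dch E q₀ (f y).proj).inverse = (ContinuousLinearEquiv.symm
      ((trivializationAt E (TangentSpace 𝓘(ℝ, E)) q₀).continuousLinearEquivAt ℝ (f y).proj hb) :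
        E →L[ℝ] TangentSpace 𝓘(ℝ, E) (f y).proj) := by
    rw [dch, ← h1, ← ContinuousLinearMap.inverse_equiv]
    congr 1
    ext v
    exact congrFun (Bundle.Trivialization.coe_linearMapAt_of_mem (R := ℝ) _ hb) v
  rw [cotCoord, e, hom_trivializationAt_apply, ContinuousLinearMap.inCoordinates_eq hb
    (by exact Set.mem_univ _)]
  rfl

theorem contMDiffAt_cotPar {q₀ : Q} {z : E × (E →L[ℝ] ℝ)}
    (hz : z.1 ∈ (extChartAt 𝓘(ℝ, E) q₀).target) :
    ContMDiffAt 𝓘(ℝ, E × (E →L[ℝ] ℝ)) (cotangentModel E) ∞ (cotPar q₀) z := by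
  refine (contMDiffAt_cotangent_iff ((extChartAt 𝓘(ℝ, E) q₀).map_target hz)).2 ⟨?_, ?_⟩
  · exact (contMDiffAt_extChartAt_symm hz).comp z (contDiffAt_fst.contMDiffAt)
  · refine (contDiffAt_snd.contMDiffAt).congr_of_eventuallyEq ?_
    filter_upwards [continuous_fst.continuousAt.preimage_mem_nhds
      ((isOpen_extChartAt_target (I := 𝓘(ℝ, E)) q₀).mem_nhds hz)] with w hw
    exact cotCoord_cotPar hw

theorem dch_mfderiv {Z : Type*} [NormedAddCommGroup Z] [NormedSpace ℝ Z] {f : Z → Q} {w : Z}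
    {q₀ : Q} (hf : MDifferentiableAt 𝓘(ℝ, Z) 𝓘(ℝ, E) f w)
    (hw : f w ∈ (extChartAt 𝓘(ℝ, E) q₀).source) (u : Z) :
    dch E q₀ (f w) (mfderiv 𝓘(ℝ, Z) 𝓘(ℝ, E) f w u) =
      fderiv ℝ (fun w => extChartAt 𝓘(ℝ, E) q₀ (f w)) w u := by
  have h := mfderiv_comp w ((contMDiffAt_extChartAt_of_mem hw).mdifferentiableAt (by simp)) hf
  rw [mfderiv_eq_fderiv] at h
  exact (congrArg (fun l : Z →L[ℝ] E => l u) h).symm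

theorem lin_liouville (α : CotangentBundle E Q) (v : TangentSpace (cotangentModel E) α) :
    lin (liouvilleForm E Q) α v = α.snd (mfderiv (cotangentModel E) 𝓘(ℝ, E)
      (Bundle.TotalSpace.proj : CotangentBundle E Q → Q) α v) := rfl

theorem contMDiff_cotangent_proj :
    ContMDiff (cotangentModel E) 𝓘(ℝ, E) ∞ (Bundle.TotalSpace.proj : CotangentBundle E Q → Q) :=
  Bundle.contMDiff_proj _

theorem lin_liouville_comp {f : X → CotangentBundle E Q} {x : X}
    (hf : MDifferentiableAt IX (cotangentModel E) f x) (v : TangentSpace IX x) :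
    lin (liouvilleForm E Q) (f x) (mfderiv IX (cotangentModel E) f x v) =
      (f x).snd (mfderiv IX 𝓘(ℝ, E) (fun y => (f y).proj) x v) := by
  rw [lin_liouville]
  have h := mfderiv_comp x
    ((contMDiff_cotangent_proj (E := E) (Q := Q)).mdifferentiableAt (x := f x) (by simp)) hf
  exact congrArg (f x).snd (congrArg (fun l : TangentSpace IX x →L[ℝ] E => l v) h).symm

/-- The pullback of the Liouville form in coordinates. -/
theorem pull_liouville {Z : Type*} [NormedAddCommGroup Z] [NormedSpace ℝ Z]
    {σ : Z → CotangentBundle E Q} {w : Z} {q₀ : Q}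
    (hσ : MDifferentiableAt 𝓘(ℝ, Z) (cotangentModel E) σ w)
    (hw : (σ w).proj ∈ (extChartAt 𝓘(ℝ, E) q₀).source) :
    pull σ (liouvilleForm E Q) w = cotCoord q₀ (σ w) ∘L
      fderiv ℝ (fun w => extChartAt 𝓘(ℝ, E) q₀ (σ w).proj) w := by
  ext u
  refine (pull_apply _ _ _ _).trans ((lin_liouville_comp hσ u).trans ?_)
  have h := dch_mfderiv (f := fun w => (σ w).proj)
    ((contMDiff_cotangent_proj.mdifferentiableAt (by simp)).comp w hσ) hw u
  change _ = (σ w).snd ((dch E q₀ (σ w).proj).inverse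
    (fderiv ℝ (fun w => extChartAt 𝓘(ℝ, E) q₀ (σ w).proj) w u))
  rw [← h]
  exact congrArg (σ w).snd (dch_inverse_apply hw _).symm

/-- Over a chart of the base the form is `p dx`, a composition of smooth families. -/
theorem smoothFormAt_liouville (α : CotangentBundle E Q) :
    SmoothFormAt (liouvilleForm E Q) α := by
  refine smoothFormAt_of_pull ?_
  have hα := mem_extChartAt_source (I := cotangentModel E) α
  have hs := contMDiffAt_extChartAt_symm (I := cotangentModel E)
    (mem_extChartAt_target (I := cotangentModel E) α)
  have e : (extChartAt (cotangentModel E) α).symm (extChartAt (cotangentModel E) α α) = α :=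
    (extChartAt (cotangentModel E) α).left_inv hα
  have hq : ((extChartAt (cotangentModel E) α).symm (extChartAt (cotangentModel E) α α)).proj ∈
      (extChartAt 𝓘(ℝ, E) α.proj).source := by
    rw [e]; exact mem_extChartAt_source _
  obtain ⟨h1, h2⟩ := (contMDiffAt_cotangent_iff hq).1 hs
  have h3 := contDiffAt_extChartAt_comp h1 hq
  refine (h2.contDiffAt.clm_comp (h3.fderiv_right (m := ∞) (by simp))).congr_of_eventuallyEq ?_
  filter_upwards [eventually_mdifferentiableAt hs, h1.continuousAt.preimage_mem_nhds
    ((isOpen_extChartAt_source α.proj).mem_nhds hq)] with w hw hw'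
  exact pull_liouville hw hw'

end Coordinates

/-! ### Smooth fields of projections -/

section Projections

variable {E Q : Type*} [NormedAddCommGroup E] [NormedSpace ℝ E]
  [TopologicalSpace Q] [ChartedSpace E Q]

/-- The expression of a field of endomorphisms of `TQ` in the chart at `q₀`. -/
noncomputable def loc
    (P : ∀ q : Q, TangentSpace 𝓘(ℝ, E) q →L[ℝ] TangentSpace 𝓘(ℝ, E) q) (q₀ : Q) (x : E) :
    E →L[ℝ] E :=
  dch E q₀ ((extChartAt 𝓘(ℝ, E) q₀).symm x) ∘L P ((extChartAt 𝓘(ℝ, E) q₀).symm x) ∘L dpar q₀ x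

variable (E Q) in
/-- A smooth field of projections of the tangent spaces of `Q`. -/
structure ProjField where
  /-- the projections -/
  P : ∀ q : Q, TangentSpace 𝓘(ℝ, E) q →L[ℝ] TangentSpace 𝓘(ℝ, E) q
  idem : ∀ (q : Q) (v : TangentSpace 𝓘(ℝ, E) q), P q (P q v) = P q v
  smooth : ∀ (q₀ : Q), ∀ x ∈ (extChartAt 𝓘(ℝ, E) q₀).target, ContDiffAt ℝ ∞ (loc P q₀) x

variable [FiniteDimensional ℝ E] [IsManifold 𝓘(ℝ, E) ∞ Q]

/-- A regular distribution has smooth local frames in charts. -/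
theorem IsRegularDistribution.exists_frame {D : ∀ q : Q, Submodule ℝ (TangentSpace 𝓘(ℝ, E) q)}
    (hD : IsRegularDistribution D) (q₀ : Q) {x : E} (hx : x ∈ (extChartAt 𝓘(ℝ, E) q₀).target) :
    ∃ (k : ℕ) (L : E → (Fin k → ℝ) →L[ℝ] E), ContDiffAt ℝ ∞ L x ∧
      ∀ᶠ y in 𝓝 x, Function.Injective (L y) ∧
        ∀ v : E, v ∈ Set.range (L y) ↔ dpar q₀ y v ∈ D ((extChartAt 𝓘(ℝ, E) q₀).symm y) := by
  obtain ⟨k, hk⟩ := hD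
  obtain ⟨U, hU, hUo, X, hX, hspan⟩ := hk ((extChartAt 𝓘(ℝ, E) q₀).symm x)
  have hs := contMDiffAt_extChartAt_symm (I := 𝓘(ℝ, E)) hx
  let Y : Fin k → E → E := fun i y => dch E q₀ ((extChartAt 𝓘(ℝ, E) q₀).symm y)
    (X i ((extChartAt 𝓘(ℝ, E) q₀).symm y))
  have hY : ∀ i, ContDiffAt ℝ ∞ (Y i) x := by
    intro i
    have h1 := ((hX i).contMDiffAt hU).comp x hs
    exact ((contMDiffAt_tangent_iff (q₀ := q₀) ((extChartAt 𝓘(ℝ, E) q₀).map_target hx)).1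
      h1).2.contDiffAt
  have hL : ∀ y (t : Fin k → ℝ), (∑ i, (ContinuousLinearMap.proj (R := ℝ) (φ := fun _ => ℝ)
      i).smulRight (Y i y)) t = ∑ i, t i • Y i y := by
    intro y t
    simp
  refine ⟨k, fun y => ∑ i, (ContinuousLinearMap.proj (R := ℝ) (φ := fun _ => ℝ) i).smulRight
    (Y i y), ContDiffAt.sum fun i _ => contDiffAt_const.smulRight (hY i), ?_⟩
  filter_upwards [hs.continuousAt.preimage_mem_nhds hU,
    (isOpen_extChartAt_target (I := 𝓘(ℝ, E)) q₀).mem_nhds hx] with y hyU hy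
  obtain ⟨hli, hsp⟩ := hspan _ hyU
  have hsum : ∀ t : Fin k → ℝ, ∑ i, t i • Y i y = dch E q₀ ((extChartAt 𝓘(ℝ, E) q₀).symm y)
      (∑ i, t i • X i ((extChartAt 𝓘(ℝ, E) q₀).symm y)) := by
    intro t
    rw [map_sum]
    simp only [map_smul]
    rfl
  refine ⟨?_, fun v => ?_⟩
  · rw [← ContinuousLinearMap.coe_coe, ← LinearMap.ker_eq_bot, LinearMap.ker_eq_bot']
    intro t ht
    have h0 : dch E q₀ ((extChartAt 𝓘(ℝ, E) q₀).symm y)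
      (∑ i, t i • X i ((extChartAt 𝓘(ℝ, E) q₀).symm y)) = 0 := by
      rw [← hsum, ← hL]; exact ht
    have h1 := congrArg (dpar q₀ y) h0
    rw [dpar_dch hy, map_zero] at h1
    funext i
    exact Fintype.linearIndependent_iff.1 hli t h1 i
  · rw [← hsp, Submodule.mem_span_range_iff_exists_fun]
    constructor
    · rintro ⟨t, rfl⟩
      refine ⟨t, ?_⟩
      rw [hL, hsum, dpar_dch hy]
    · rintro ⟨t, ht⟩
      refine ⟨t, ?_⟩
      rw [hL, hsum, ht, dch_dpar hy]

end Projections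

theorem isInvertible_of_bijective {V F : Type*} [NormedAddCommGroup V] [NormedSpace ℝ V]
    [FiniteDimensional ℝ V] [NormedAddCommGroup F] [NormedSpace ℝ F] {A : V →L[ℝ] F}
    (hA : Function.Bijective A) : A.IsInvertible := by
  have : FiniteDimensional ℝ F := FiniteDimensional.of_surjective A.toLinearMap hA.2
  exact ⟨(LinearEquiv.ofBijective A.toLinearMap hA).toContinuousLinearEquiv, by ext v; rfl⟩

/-! ### Smoothness of oblique and orthogonal projections -/

section Projections

variable {E Q : Type*} [NormedAddCommGroup E] [NormedSpace ℝ E] [FiniteDimensional ℝ E]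
  [TopologicalSpace Q] [ChartedSpace E Q] [IsManifold 𝓘(ℝ, E) ∞ Q]

/-- The projection onto a regular distribution along a regular complement is smooth. -/
theorem contDiffAt_loc_of_isCompl {D C : ∀ q : Q, Submodule ℝ (TangentSpace 𝓘(ℝ, E) q)}
    (hD : IsRegularDistribution D) (hC : IsRegularDistribution C) (h : ∀ q, IsCompl (D q) (C q))
    {P : ∀ q : Q, TangentSpace 𝓘(ℝ, E) q →L[ℝ] TangentSpace 𝓘(ℝ, E) q}
    (hPD : ∀ q, ∀ v ∈ D q, P q v = v) (hPC : ∀ q, ∀ v ∈ C q, P q v = 0)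
    (q₀ : Q) {x : E} (hx : x ∈ (extChartAt 𝓘(ℝ, E) q₀).target) : ContDiffAt ℝ ∞ (loc P q₀) x := by
  obtain ⟨k, L, hL, hL'⟩ := hD.exists_frame q₀ hx
  obtain ⟨l, M, hM, hM'⟩ := hC.exists_frame q₀ hx
  -- `B y` joins the frames of the two summands. It is invertible by complementarity, and the
  -- projection is `L y ∘ fst ∘ (B y)⁻¹`.
  let B : E → (Fin k → ℝ) × (Fin l → ℝ) →L[ℝ] E := fun y => (L y).coprod (M y)
  have hB : ContDiffAt ℝ ∞ B x := by
    have e : B = fun y => L y ∘L ContinuousLinearMap.fst ℝ _ _ +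
        M y ∘L ContinuousLinearMap.snd ℝ _ _ := by
      funext y; ext v <;> simp [B]
    rw [e]
    exact (hL.clm_comp contDiffAt_const).add (hM.clm_comp contDiffAt_const)
  have hinv : ∀ᶠ y in 𝓝 x, (B y).IsInvertible ∧
      loc P q₀ y ∘L B y = L y ∘L ContinuousLinearMap.fst ℝ _ _ := by
    filter_upwards [hL', hM', (isOpen_extChartAt_target (I := 𝓘(ℝ, E)) q₀).mem_nhds hx]
      with y h1 h2 hy
    refine ⟨isInvertible_of_bijective ⟨?_, ?_⟩, ?_⟩
    · rw [← ContinuousLinearMap.coe_coe, ← LinearMap.ker_eq_bot, LinearMap.ker_eq_bot']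
      rintro ⟨s, t⟩ hst
      have hst' : L y s = -M y t := eq_neg_of_add_eq_zero_left hst
      have m1 := (h1.2 (L y s)).1 ⟨s, rfl⟩
      have m2 : dpar q₀ y (L y s) ∈ C ((extChartAt 𝓘(ℝ, E) q₀).symm y) := by
        rw [hst', map_neg]; exact neg_mem ((h2.2 (M y t)).1 ⟨t, rfl⟩)
      have h0 := (Submodule.disjoint_def.1 (h _).disjoint) _ m1 m2
      have h3 : L y s = 0 := by rw [← dch_dpar hy (L y s), h0, map_zero]
      rw [h3, eq_comm, neg_eq_zero] at hst'
      rw [Prod.mk_eq_zero]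
      exact ⟨h1.1 (by rw [h3, map_zero]), h2.1 (by rw [hst', map_zero])⟩
    · intro v
      have hv : dpar q₀ y v ∈ D ((extChartAt 𝓘(ℝ, E) q₀).symm y) ⊔
          C ((extChartAt 𝓘(ℝ, E) q₀).symm y) := by
        rw [(h _).sup_eq_top]; trivial
      obtain ⟨d, hd, c, hc, hdc⟩ := Submodule.mem_sup.1 hv
      obtain ⟨s, hs⟩ := (h1.2 (dch E q₀ _ d)).2 (by rw [dpar_dch hy]; exact hd)
      obtain ⟨t, ht⟩ := (h2.2 (dch E q₀ _ c)).2 (by rw [dpar_dch hy]; exact hc)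
      refine ⟨(s, t), ?_⟩
      change L y s + M y t = v
      rw [hs, ht, ← map_add, hdc, dch_dpar hy]
    · ext st
      · change dch E q₀ _ (P _ (dpar q₀ y (L y _ + M y 0))) = L y _
        rw [map_zero, add_zero, hPD _ _ ((h1.2 _).1 ⟨_, rfl⟩), dch_dpar hy]
        rfl
      · change dch E q₀ _ (P _ (dpar q₀ y (L y 0 + M y _))) = L y 0
        rw [map_zero, zero_add, hPC _ _ ((h2.2 _).1 ⟨_, rfl⟩), map_zero]
  refine ((hL.clm_comp (contDiffAt_const
    (c := ContinuousLinearMap.fst ℝ (Fin k → ℝ) (Fin l → ℝ)))).clm_comp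
    (contDiffAt_inverse hB hinv.self_of_nhds.1)).congr_of_eventuallyEq ?_
  filter_upwards [hinv] with y hy
  refine Eq.trans ?_ (congrArg (fun A : (Fin k → ℝ) × (Fin l → ℝ) →L[ℝ] E =>
    A ∘L (B y).inverse) hy.2)
  ext v
  exact congrArg (loc P q₀ y) (hy.1.inverse_apply_eq.1 rfl)

/-- The expression of a metric in the chart at `q₀`. -/
noncomputable def locMetric
    (κ : Bundle.ContMDiffRiemannianMetric 𝓘(ℝ, E) ∞ E (fun q : Q => TangentSpace 𝓘(ℝ, E) q))
    (q₀ : Q) (x : E) : E →L[ℝ] E →L[ℝ] ℝ :=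
  (ContinuousLinearMap.compL ℝ E E ℝ).flip (dpar q₀ x) ∘L
    (show E →L[ℝ] E →L[ℝ] ℝ from κ.inner ((extChartAt 𝓘(ℝ, E) q₀).symm x)) ∘L dpar q₀ x

theorem contMDiffAt_dpar (q₀ : Q) {x : E} (hx : x ∈ (extChartAt 𝓘(ℝ, E) q₀).target) (v : E) :
    ContMDiffAt 𝓘(ℝ, E) 𝓘(ℝ, E).tangent ∞
      (fun y => (⟨_, dpar q₀ y v⟩ : TangentBundle 𝓘(ℝ, E) Q)) x := by
  refine (contMDiffAt_tangent_iff (q₀ := q₀) ((extChartAt 𝓘(ℝ, E) q₀).map_target hx)).2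
    ⟨contMDiffAt_extChartAt_symm hx, ?_⟩
  refine (contMDiffAt_const (c := v)).congr_of_eventuallyEq ?_
  filter_upwards [(isOpen_extChartAt_target (I := 𝓘(ℝ, E)) q₀).mem_nhds hx] with y hy
  exact dch_dpar hy v

theorem contDiffAt_locMetric
    (κ : Bundle.ContMDiffRiemannianMetric 𝓘(ℝ, E) ∞ E (fun q : Q => TangentSpace 𝓘(ℝ, E) q))
    (q₀ : Q) {x : E} (hx : x ∈ (extChartAt 𝓘(ℝ, E) q₀).target) :
    ContDiffAt ℝ ∞ (locMetric κ q₀) x := by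
  refine contDiffAt_clm_of_apply fun u => contDiffAt_clm_of_apply fun v => ?_
  have h1 := (κ.contMDiff.contMDiffAt).comp x (contMDiffAt_extChartAt_symm (I := 𝓘(ℝ, E)) hx)
  have h2 := ContMDiffAt.clm_bundle_apply₂ (F₃ := ℝ) (E₃ := Bundle.Trivial Q ℝ) h1
    (contMDiffAt_dpar q₀ hx u) (contMDiffAt_dpar q₀ hx v)
  exact ((Bundle.contMDiffAt_totalSpace).1 h2).2.contDiffAt

/-- The orthogonal projection onto a regular distribution is smooth. -/
theorem contDiffAt_loc_of_orthogonal {D : ∀ q : Q, Submodule ℝ (TangentSpace 𝓘(ℝ, E) q)}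
    (hD : IsRegularDistribution D)
    (κ : Bundle.ContMDiffRiemannianMetric 𝓘(ℝ, E) ∞ E (fun q : Q => TangentSpace 𝓘(ℝ, E) q))
    {P : ∀ q : Q, TangentSpace 𝓘(ℝ, E) q →L[ℝ] TangentSpace 𝓘(ℝ, E) q}
    (hPD : ∀ q v, P q v ∈ D q) (hP : ∀ q v, ∀ w ∈ D q, κ.inner q (P q v) w = κ.inner q v w)
    (q₀ : Q) {x : E} (hx : x ∈ (extChartAt 𝓘(ℝ, E) q₀).target) : ContDiffAt ℝ ∞ (loc P q₀) x := by
  obtain ⟨k, L, hL, hL'⟩ := hD.exists_frame q₀ hx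
  -- `N y` pairs a vector with the frame, so `N y ∘ L y` is the Gram matrix, invertible by
  -- positivity, and the orthogonal projection is `L (N L)⁻¹ N`.
  let N : E → E →L[ℝ] (Fin k → ℝ) →L[ℝ] ℝ := fun y =>
    (ContinuousLinearMap.compL ℝ (Fin k → ℝ) E ℝ).flip (L y) ∘L locMetric κ q₀ y
  have hN : ContDiffAt ℝ ∞ N x :=
    (contDiffAt_const.clm_apply hL).clm_comp (contDiffAt_locMetric κ q₀ hx)
  have hinv : ∀ᶠ y in 𝓝 x, (N y ∘L L y).IsInvertible ∧
      loc P q₀ y = L y ∘L (N y ∘L L y).inverse ∘L N y := by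
    filter_upwards [hL', (isOpen_extChartAt_target (I := 𝓘(ℝ, E)) q₀).mem_nhds hx]
      with y h1 hy
    have hG : (N y ∘L L y).IsInvertible := by
      have hi : Function.Injective (N y ∘L L y) := by
        rw [← ContinuousLinearMap.coe_coe, ← LinearMap.ker_eq_bot, LinearMap.ker_eq_bot']
        intro t ht
        have h0 : κ.inner _ (dpar q₀ y (L y t)) (dpar q₀ y (L y t)) = 0 :=
          congrArg (fun l : (Fin k → ℝ) →L[ℝ] ℝ => l t) ht
        by_contra hne
        refine (κ.pos _ (dpar q₀ y (L y t)) fun h => hne (h1.1 ?_)).ne' h0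
        rw [← dch_dpar hy (L y t), h, map_zero, map_zero]
      refine isInvertible_of_bijective ⟨hi, ?_⟩
      refine (LinearMap.injective_iff_surjective_of_finrank_eq_finrank
        (f := (N y ∘L L y).toLinearMap) ?_).1 hi
      rw [← (LinearMap.toContinuousLinearMap (𝕜 := ℝ) (E := Fin k → ℝ) (F' := ℝ)).finrank_eq]
      exact (Subspace.dual_finrank_eq (K := ℝ) (V := Fin k → ℝ)).symm
    refine ⟨hG, ?_⟩
    ext v
    obtain ⟨t, ht⟩ := (h1.2 (loc P q₀ y v)).2 (by
      change dpar q₀ y (dch E q₀ _ _) ∈ _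
      rw [dpar_dch hy]; exact hPD _ _)
    have e : (N y ∘L L y) t = N y v := by
      ext s
      change κ.inner _ (dpar q₀ y (L y t)) (dpar q₀ y (L y s)) =
        κ.inner _ (dpar q₀ y v) (dpar q₀ y (L y s))
      rw [ht]
      change κ.inner _ (dpar q₀ y (dch E q₀ _ _)) _ = _
      rw [dpar_dch hy]
      exact hP _ _ _ ((h1.2 _).1 ⟨s, rfl⟩)
    rw [← ht]
    change L y t = L y ((N y ∘L L y).inverse (N y v))
    rw [hG.inverse_apply_eq.2 e.symm]
  refine (hL.clm_comp ((contDiffAt_inverse (hN.clm_comp hL) hinv.self_of_nhds.1).clm_comp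
    hN)).congr_of_eventuallyEq ?_
  filter_upwards [hinv] with y hy
  exact hy.2

end Projections

/-! ### Submanifolds of the cotangent bundle that are images of transposed projections -/

section DualImage

variable {E Q : Type*} [NormedAddCommGroup E] [NormedSpace ℝ E] [FiniteDimensional ℝ E]
  [TopologicalSpace Q] [ChartedSpace E Q] [IsManifold 𝓘(ℝ, E) ∞ Q]

namespace ProjField

variable (R : ProjField E Q)

/-- The transpose of a field of projections, a fibrewise projection of the cotangent bundle. -/
noncomputable def dual (α : CotangentBundle E Q) : CotangentBundle E Q :=
  ⟨α.proj, α.snd ∘L R.P α.proj⟩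

theorem dual_dual (α : CotangentBundle E Q) : R.dual (R.dual α) = R.dual α :=
  cotangent_ext rfl fun v => congrArg α.snd (R.idem α.proj v)

theorem dual_cotPar {q₀ : Q} {z : E × (E →L[ℝ] ℝ)}
    (hz : z.1 ∈ (extChartAt 𝓘(ℝ, E) q₀).target) :
    R.dual (cotPar q₀ z) = cotPar q₀ (z.1, z.2 ∘L loc R.P q₀ z.1) := by
  refine cotangent_ext rfl fun v => ?_
  exact congrArg (fun w => z.2 (dch E q₀ _ (R.P _ w))) (dpar_dch hz v).symm

theorem cotCoord_dual {q₀ : Q} {α : CotangentBundle E Q}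
    (hα : α.proj ∈ (extChartAt 𝓘(ℝ, E) q₀).source) :
    cotCoord q₀ (R.dual α) =
      cotCoord q₀ α ∘L loc R.P q₀ (extChartAt 𝓘(ℝ, E) q₀ α.proj) := by
  have ht := (extChartAt 𝓘(ℝ, E) q₀).map_source hα
  have h := R.dual_cotPar (z := (extChartAt 𝓘(ℝ, E) q₀ α.proj, cotCoord q₀ α)) ht
  rw [cotPar_cotCoord hα] at h
  rw [h, cotCoord_cotPar ht]

theorem contMDiff_dual : ContMDiff (cotangentModel E) (cotangentModel E) ∞ R.dual := by
  intro α
  have hα : α.proj ∈ (extChartAt 𝓘(ℝ, E) α.proj).source := mem_extChartAt_source _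
  obtain ⟨h1, h2⟩ := (contMDiffAt_cotangent_iff (f := id) hα).1
    (contMDiffAt_id (I := cotangentModel E) (n := ∞))
  refine (contMDiffAt_cotangent_iff (q₀ := α.proj) hα).2 ⟨h1, ?_⟩
  have h3 : ContMDiffAt (cotangentModel E) 𝓘(ℝ, E →L[ℝ] E) ∞
      (fun β : CotangentBundle E Q =>
        loc R.P α.proj (extChartAt 𝓘(ℝ, E) α.proj β.proj)) α :=
    (R.smooth α.proj _ ((extChartAt 𝓘(ℝ, E) α.proj).map_source hα)).contMDiffAt.comp α
      ((contMDiffAt_extChartAt_of_mem hα).comp α h1)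
  refine (h2.clm_comp h3).congr_of_eventuallyEq ?_
  filter_upwards [h1.continuousAt.preimage_mem_nhds
    ((isOpen_extChartAt_source α.proj).mem_nhds hα)] with β hβ
  exact R.cotCoord_dual hβ

variable {EN : Type*} [NormedAddCommGroup EN] [NormedSpace ℝ EN]

variable (EN) in
/-- The embedded submanifold `N` is the image of the transposed field of projections. -/
structure IsDualImage (N : Set (CotangentBundle E Q)) [ChartedSpace EN N] : Prop where
  mem_iff : ∀ α, α ∈ N ↔ R.dual α = α
  emb : Manifold.IsSmoothEmbedding 𝓘(ℝ, EN) (cotangentModel E) ∞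
    (Subtype.val : N → CotangentBundle E Q)

namespace IsDualImage

variable {R} {N : Set (CotangentBundle E Q)} [ChartedSpace EN N] [IsManifold 𝓘(ℝ, EN) ∞ N]
  (hN : R.IsDualImage EN N)

include hN

theorem contMDiff_val : ContMDiff 𝓘(ℝ, EN) (cotangentModel E) ∞
    (Subtype.val : N → CotangentBundle E Q) := hN.emb.contMDiff

theorem contMDiff_baseProj : ContMDiff 𝓘(ℝ, EN) 𝓘(ℝ, E) ∞ (baseProj N) :=
  contMDiff_cotangent_proj.comp hN.contMDiff_val

/-- Smoothness of maps to `N`. -/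
theorem contMDiffAt_iff {EX HX X : Type*} [NormedAddCommGroup EX] [NormedSpace ℝ EX]
    [TopologicalSpace HX] {IX : ModelWithCorners ℝ EX HX} [TopologicalSpace X] [ChartedSpace HX X]
    {f : X → N} {x : X} : ContMDiffAt IX 𝓘(ℝ, EN) ∞ f x ↔
      ContMDiffAt IX (cotangentModel E) ∞ (fun y => (f y).1) x := by
  refine ⟨fun h => (hN.contMDiff_val.contMDiffAt).comp x h, fun h => ?_⟩
  refine (ContMDiffAt.iff_comp_isImmersionAt (hN.emb.isImmersion.isImmersionAt _)).2
    ⟨?_, h⟩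
  exact hN.emb.isEmbedding.continuousAt_iff.2 h.continuousAt

/-- The retraction of the cotangent bundle onto `N`. -/
noncomputable def retr (α : CotangentBundle E Q) : N :=
  ⟨R.dual α, (hN.mem_iff _).2 (R.dual_dual α)⟩

theorem retr_coe (m : N) : hN.retr m.1 = m := Subtype.ext ((hN.mem_iff _).1 m.2)

theorem contMDiff_retr : ContMDiff (cotangentModel E) 𝓘(ℝ, EN) ∞ hN.retr := fun α =>
  hN.contMDiffAt_iff.2 (R.contMDiff_dual α)

/-- The (redundant) local parametrization of `N` over the chart at `q₀`. -/
noncomputable def spar (q₀ : Q) (z : E × (E →L[ℝ] ℝ)) : N := hN.retr (cotPar q₀ z)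

omit hN in
/-- The coordinates on `N` over the chart at `q₀`. -/
noncomputable def _root_.Nonholonomic.scoord (q₀ : Q) (m : N) : E × (E →L[ℝ] ℝ) :=
  (extChartAt 𝓘(ℝ, E) q₀ (baseProj N m), cotCoord q₀ m.1)

end IsDualImage
end ProjField
end DualImage

/-! ### Surjectivity of tangent maps from local sections -/

section LocalSections

variable {E P E' P' : Type*} [NormedAddCommGroup E] [NormedSpace ℝ E]
  [TopologicalSpace P] [ChartedSpace E P]
  [NormedAddCommGroup E'] [NormedSpace ℝ E'] [TopologicalSpace P'] [ChartedSpace E' P']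

theorem surjective_mfderiv_of_section {f : P → P'} {s : P' → P} {x : P}
    (hf : MDifferentiableAt 𝓘(ℝ, E) 𝓘(ℝ, E') f x)
    (hs : MDifferentiableAt 𝓘(ℝ, E') 𝓘(ℝ, E) s (f x)) (hx : s (f x) = x)
    (h : ∀ᶠ y in 𝓝 (f x), f (s y) = y) :
    Function.Surjective (mfderiv 𝓘(ℝ, E) 𝓘(ℝ, E') f x) := by
  intro w
  have hf' : HasMFDerivAt 𝓘(ℝ, E) 𝓘(ℝ, E') f (s (f x))
      (show E →L[ℝ] E' from mfderiv 𝓘(ℝ, E) 𝓘(ℝ, E') f x) := by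
    have key : ∀ p, p = x → HasMFDerivAt 𝓘(ℝ, E) 𝓘(ℝ, E') f p
        (show E →L[ℝ] E' from mfderiv 𝓘(ℝ, E) 𝓘(ℝ, E') f x) := by
      rintro p rfl; exact hf.hasMFDerivAt
    exact key _ hx
  have h1 := (hf'.comp (f x) hs.hasMFDerivAt).mfderiv
  have h2 : f ∘ s =ᶠ[𝓝 (f x)] id := h
  rw [h2.mfderiv_eq, mfderiv_id] at h1
  exact ⟨(show E' →L[ℝ] E from mfderiv 𝓘(ℝ, E') 𝓘(ℝ, E) s (f x)) w,
    (congrArg (fun l : E' →L[ℝ] E' => l w) h1).symm⟩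

end LocalSections

/-! ### Redundant parametrization and the restricted canonical form -/

section DualImageForms

variable {E Q : Type*} [NormedAddCommGroup E] [NormedSpace ℝ E] [FiniteDimensional ℝ E]
  [TopologicalSpace Q] [ChartedSpace E Q] [IsManifold 𝓘(ℝ, E) ∞ Q]
  {EN : Type*} [NormedAddCommGroup EN] [NormedSpace ℝ EN]
  {R : ProjField E Q} {N : Set (CotangentBundle E Q)} [ChartedSpace EN N]
  [IsManifold 𝓘(ℝ, EN) ∞ N]

theorem contMDiffAt_scoord (hN : R.IsDualImage EN N) {q₀ : Q} {m : N}
    (hm : baseProj N m ∈ (extChartAt 𝓘(ℝ, E) q₀).source) :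
    ContMDiffAt 𝓘(ℝ, EN) 𝓘(ℝ, E × (E →L[ℝ] ℝ)) ∞ (scoord q₀ : N → _) m := by
  have h := (contMDiffAt_cotangent_iff (q₀ := q₀) (f := (Subtype.val : N → _)) hm).1
    hN.contMDiff_val.contMDiffAt
  exact ((contMDiffAt_extChartAt_of_mem hm).comp m h.1).prodMk_space h.2

namespace ProjField.IsDualImage

variable (hN : R.IsDualImage EN N)

include hN

theorem spar_scoord {q₀ : Q} {m : N} (hm : baseProj N m ∈ (extChartAt 𝓘(ℝ, E) q₀).source) :
    hN.spar q₀ (scoord q₀ m) = m := by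
  unfold spar scoord
  exact (congrArg hN.retr (cotPar_cotCoord hm)).trans (hN.retr_coe m)

theorem contMDiffAt_spar {q₀ : Q} {z : E × (E →L[ℝ] ℝ)}
    (hz : z.1 ∈ (extChartAt 𝓘(ℝ, E) q₀).target) :
    ContMDiffAt 𝓘(ℝ, E × (E →L[ℝ] ℝ)) 𝓘(ℝ, EN) ∞ (hN.spar q₀) z :=
  hN.contMDiff_retr.contMDiffAt.comp z (contMDiffAt_cotPar hz)

omit hN in
theorem loc_idem {q₀ : Q} {x : E} (hx : x ∈ (extChartAt 𝓘(ℝ, E) q₀).target) (v : E) :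
    loc R.P q₀ x (loc R.P q₀ x v) = loc R.P q₀ x v := by
  change dch E q₀ _ (R.P _ (dpar q₀ x (dch E q₀ _ (R.P _ (dpar q₀ x v))))) = _
  rw [dpar_dch hx, R.idem]
  rfl

/-- The momentum enters the parametrization only through its composition with the projection; this
is the whole redundancy. -/
theorem spar_eventuallyEq {q₀ : Q} {z : E × (E →L[ℝ] ℝ)}
    (hz : z.1 ∈ (extChartAt 𝓘(ℝ, E) q₀).target) :
    hN.spar q₀ z = hN.spar q₀ (z.1, z.2 ∘L loc R.P q₀ z.1) := by
  refine Subtype.ext ?_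
  change R.dual (cotPar q₀ z) = R.dual (cotPar q₀ _)
  rw [R.dual_cotPar hz, R.dual_cotPar (z := (z.1, z.2 ∘L loc R.P q₀ z.1)) hz]
  congr 2
  ext v
  exact (congrArg z.2 (loc_idem hz v)).symm

/-- The local parametrizations have local sections through all points. -/
theorem exists_spar_section {q₀ : Q} {z : E × (E →L[ℝ] ℝ)}
    (hz : z.1 ∈ (extChartAt 𝓘(ℝ, E) q₀).target) :
    ∃ s : N → E × (E →L[ℝ] ℝ),
      ContMDiffAt 𝓘(ℝ, EN) 𝓘(ℝ, E × (E →L[ℝ] ℝ)) ∞ s (hN.spar q₀ z) ∧ s (hN.spar q₀ z) = z ∧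
        ∀ᶠ m in 𝓝 (hN.spar q₀ z), hN.spar q₀ (s m) = m := by
  have hs : baseProj N (hN.spar q₀ z) ∈ (extChartAt 𝓘(ℝ, E) q₀).source :=
    (extChartAt 𝓘(ℝ, E) q₀).map_target hz
  have hsc : scoord q₀ (hN.spar q₀ z) = (z.1, z.2 ∘L loc R.P q₀ z.1) := by
    refine Prod.ext ((extChartAt 𝓘(ℝ, E) q₀).right_inv hz) ?_
    change cotCoord q₀ (R.dual (cotPar q₀ z)) = _
    rw [R.dual_cotPar hz]
    exact cotCoord_cotPar (z := (z.1, z.2 ∘L loc R.P q₀ z.1)) hz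
  -- The section `scoord` meets only the reduced momenta `p ∘ P`. Adding the missing part of `z.2`,
  -- cut off by `1 - P` at the moving base point, makes the section pass through `z` itself and is
  -- invisible to the parametrization.
  let c : E × (E →L[ℝ] ℝ) → E × (E →L[ℝ] ℝ) := fun w =>
    (w.1, w.2 + (z.2 - z.2 ∘L loc R.P q₀ z.1) ∘L (ContinuousLinearMap.id ℝ E - loc R.P q₀ w.1))
  have hc : ContDiffAt ℝ ∞ c (scoord q₀ (hN.spar q₀ z)) := by
    have h1 : ContDiffAt ℝ ∞ (fun w : E × (E →L[ℝ] ℝ) => loc R.P q₀ w.1)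
        (scoord q₀ (hN.spar q₀ z)) :=
      ContDiffAt.comp _ (g := loc R.P q₀) (f := Prod.fst)
        (R.smooth q₀ _ (by rw [hsc]; exact hz)) contDiffAt_fst
    exact contDiffAt_fst.prodMk (contDiffAt_snd.add
      ((contDiffAt_const (c := z.2 - z.2 ∘L loc R.P q₀ z.1)).clm_comp
        ((contDiffAt_const (c := ContinuousLinearMap.id ℝ E)).sub h1)))
  refine ⟨c ∘ scoord q₀, hc.contMDiffAt.comp _ (contMDiffAt_scoord hN hs), ?_, ?_⟩
  · simp only [Function.comp, hsc, c]
    refine Prod.ext rfl (ContinuousLinearMap.ext fun v => ?_)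
    have h2 := loc_idem (R := R) hz v
    simp only [add_apply, sub_apply, ContinuousLinearMap.comp_apply,
      ContinuousLinearMap.id_apply, map_sub, h2]
    ring
  · filter_upwards [hN.contMDiff_baseProj.continuous.continuousAt.preimage_mem_nhds
      ((isOpen_extChartAt_source q₀).mem_nhds hs)] with m hm
    have hm' : (scoord q₀ m).1 ∈ (extChartAt 𝓘(ℝ, E) q₀).target :=
      (extChartAt 𝓘(ℝ, E) q₀).map_source hm
    refine Eq.trans ?_ (hN.spar_scoord hm)
    rw [hN.spar_eventuallyEq (z := (c ∘ scoord q₀) m) hm', hN.spar_eventuallyEq hm']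
    congr 1
    refine Prod.ext rfl (ContinuousLinearMap.ext fun v => ?_)
    have h2 := loc_idem (R := R) hm' v
    simp only [Function.comp, c, add_apply, sub_apply, ContinuousLinearMap.comp_apply,
      ContinuousLinearMap.id_apply, map_sub, h2]
    ring

theorem surjective_mfderiv_spar {q₀ : Q} {z : E × (E →L[ℝ] ℝ)}
    (hz : z.1 ∈ (extChartAt 𝓘(ℝ, E) q₀).target) :
    Function.Surjective (mfderiv 𝓘(ℝ, E × (E →L[ℝ] ℝ)) 𝓘(ℝ, EN) (hN.spar q₀) z) := by
  obtain ⟨s, hs, hsz, h⟩ := hN.exists_spar_section hz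
  exact surjective_mfderiv_of_section ((hN.contMDiffAt_spar hz).mdifferentiableAt (by simp))
    (hs.mdifferentiableAt (by simp)) hsz h

/-- Every point of `N` lies in the image of a local parametrization. -/
theorem exists_spar_eq (q₀ : Q) {m : N} (hm : baseProj N m ∈ (extChartAt 𝓘(ℝ, E) q₀).source) :
    ∃ z : E × (E →L[ℝ] ℝ), z.1 ∈ (extChartAt 𝓘(ℝ, E) q₀).target ∧ scoord q₀ m = z ∧
      hN.spar q₀ z = m :=
  ⟨_, (extChartAt 𝓘(ℝ, E) q₀).map_source hm, rfl, hN.spar_scoord hm⟩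

theorem mfderiv_baseProj_spar {q₀ : Q} {z : E × (E →L[ℝ] ℝ)}
    (hz : z.1 ∈ (extChartAt 𝓘(ℝ, E) q₀).target) (u : E × (E →L[ℝ] ℝ)) :
    mfderiv 𝓘(ℝ, EN) 𝓘(ℝ, E) (baseProj N) (hN.spar q₀ z)
      (mfderiv 𝓘(ℝ, E × (E →L[ℝ] ℝ)) 𝓘(ℝ, EN) (hN.spar q₀) z u) = dpar q₀ z.1 u.1 := by
  have h1 := mfderiv_comp z (hN.contMDiff_baseProj.mdifferentiableAt (x := hN.spar q₀ z) (by simp))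
    ((hN.contMDiffAt_spar hz).mdifferentiableAt (by simp))
  have h2 : baseProj N ∘ hN.spar q₀ = (extChartAt 𝓘(ℝ, E) q₀).symm ∘ Prod.fst := rfl
  have h3 : mfderiv 𝓘(ℝ, E × (E →L[ℝ] ℝ)) 𝓘(ℝ, E)
      ((extChartAt 𝓘(ℝ, E) q₀).symm ∘ Prod.fst) z =
      dpar q₀ z.1 ∘L ContinuousLinearMap.fst ℝ E (E →L[ℝ] ℝ) := by
    rw [mfderiv_comp (I' := 𝓘(ℝ, E)) z
      ((contMDiffAt_extChartAt_symm hz).mdifferentiableAt (by simp))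
      (differentiableAt_fst.mdifferentiableAt), mfderiv_eq_fderiv, fderiv_fst]
    rfl
  exact (congrArg (fun l : E × (E →L[ℝ] ℝ) →L[ℝ] E => l u) h1).symm.trans
    (congrArg (fun l : E × (E →L[ℝ] ℝ) →L[ℝ] E => l u) h3)

theorem lin_restrictedLiouville (m : N) (X : TangentSpace 𝓘(ℝ, EN) m) :
    lin (restrictedLiouville N) m X = m.1.snd (mfderiv 𝓘(ℝ, EN) 𝓘(ℝ, E) (baseProj N) m X) :=
  (lin_pullback _ _ _ _).trans
    (lin_liouville_comp (hN.contMDiff_val.mdifferentiableAt (by simp)) X)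

theorem smoothFormAt_restrictedLiouville (m : N) :
    SmoothFormAt (restrictedLiouville (EN := EN) N) m :=
  smoothFormAt_pullback hN.contMDiff_val.contMDiffAt (smoothFormAt_liouville _)

theorem restrictedForm_eq (m : N) (X Y : TangentSpace 𝓘(ℝ, EN) m) :
    restrictedForm N m ![X, Y] = -extd (restrictedLiouville N) m ![X, Y] := by
  rw [restrictedLiouville, extd_pullback hN.contMDiff_val.contMDiffAt (smoothFormAt_liouville _)]
  exact pullback_two _ _ _ _ _

theorem pull_spar {q₀ : Q} {z : E × (E →L[ℝ] ℝ)} (hz : z.1 ∈ (extChartAt 𝓘(ℝ, E) q₀).target) :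
    pull (hN.spar q₀) (restrictedLiouville (EN := EN) N) z =
      (z.2 ∘L loc R.P q₀ z.1) ∘L ContinuousLinearMap.fst ℝ E (E →L[ℝ] ℝ) := by
  refine ContinuousLinearMap.ext fun u => ?_
  refine (pull_apply _ _ _ _).trans ((hN.lin_restrictedLiouville _ _).trans ?_)
  exact congrArg (hN.spar q₀ z).1.snd (hN.mfderiv_baseProj_spar hz u)

/-- The canonical form in a local parametrization. -/
theorem restrictedForm_spar {q₀ : Q} {z : E × (E →L[ℝ] ℝ)}
    (hz : z.1 ∈ (extChartAt 𝓘(ℝ, E) q₀).target) (u v : E × (E →L[ℝ] ℝ)) :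
    restrictedForm N (hN.spar q₀ z)
      ![mfderiv 𝓘(ℝ, E × (E →L[ℝ] ℝ)) 𝓘(ℝ, EN) (hN.spar q₀) z u,
        mfderiv 𝓘(ℝ, E × (E →L[ℝ] ℝ)) 𝓘(ℝ, EN) (hN.spar q₀) z v] =
      v.2 (loc R.P q₀ z.1 u.1) + z.2 (fderiv ℝ (loc R.P q₀) z.1 v.1 u.1) -
        (u.2 (loc R.P q₀ z.1 v.1) + z.2 (fderiv ℝ (loc R.P q₀) z.1 u.1 v.1)) := by
  rw [hN.restrictedForm_eq, ← curl_pull (hN.contMDiffAt_spar hz)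
    (hN.smoothFormAt_restrictedLiouville _)]
  have he : pull (hN.spar q₀) (restrictedLiouville (EN := EN) N) =ᶠ[𝓝 z] fun z =>
      (z.2 ∘L loc R.P q₀ z.1) ∘L ContinuousLinearMap.fst ℝ E (E →L[ℝ] ℝ) := by
    filter_upwards [continuous_fst.continuousAt.preimage_mem_nhds
      ((isOpen_extChartAt_target (I := 𝓘(ℝ, E)) q₀).mem_nhds hz)] with w hw
    exact hN.pull_spar hw
  have h := curl_comp_fst (x := z.1) z.2
    ((R.smooth q₀ z.1 hz).differentiableAt (by simp)) u v
  have he' : curl (pull (hN.spar q₀) (restrictedLiouville (EN := EN) N)) z u v = curl (fun z =>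
      (z.2 ∘L loc R.P q₀ z.1) ∘L ContinuousLinearMap.fst ℝ E (E →L[ℝ] ℝ)) z u v := by
    unfold curl
    rw [he.fderiv_eq]
  rw [he', h]
  ring

variable {D : ∀ q : Q, Submodule ℝ (TangentSpace 𝓘(ℝ, E) q)}
  (hD : ∀ q v, v ∈ D q ↔ R.P q v = v)

include hD

theorem mfderiv_spar_mem {q₀ : Q} {z : E × (E →L[ℝ] ℝ)}
    (hz : z.1 ∈ (extChartAt 𝓘(ℝ, E) q₀).target) (u : E × (E →L[ℝ] ℝ)) :
    mfderiv 𝓘(ℝ, E × (E →L[ℝ] ℝ)) 𝓘(ℝ, EN) (hN.spar q₀) z u ∈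
      liftedDistribution N D (hN.spar q₀ z) ↔ loc R.P q₀ z.1 u.1 = u.1 := by
  have h1 : mfderiv 𝓘(ℝ, E × (E →L[ℝ] ℝ)) 𝓘(ℝ, EN) (hN.spar q₀) z u ∈
      liftedDistribution N D (hN.spar q₀ z) ↔
      mfderiv 𝓘(ℝ, EN) 𝓘(ℝ, E) (baseProj N) (hN.spar q₀ z)
      (mfderiv 𝓘(ℝ, E × (E →L[ℝ] ℝ)) 𝓘(ℝ, EN) (hN.spar q₀) z u) ∈
        D ((extChartAt 𝓘(ℝ, E) q₀).symm z.1) := Iff.rfl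
  rw [h1, hN.mfderiv_baseProj_spar hz u]
  refine (hD ((extChartAt 𝓘(ℝ, E) q₀).symm z.1) (dpar q₀ z.1 u.1)).trans ?_
  constructor
  · intro h
    exact (congrArg (dch E q₀ _) h).trans (dch_dpar hz _)
  · intro h
    have h2 := congrArg (dpar q₀ z.1) h
    change dpar q₀ z.1 (dch E q₀ _ (R.P _ (dpar q₀ z.1 u.1))) = _ at h2
    rwa [dpar_dch hz] at h2

-- The parametrization is constant along the line `z + t (0, μ)`, because `μ` is killed by the
-- projection.
omit hD in
theorem mfderiv_spar_vertical {q₀ : Q} {z : E × (E →L[ℝ] ℝ)}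
    (hz : z.1 ∈ (extChartAt 𝓘(ℝ, E) q₀).target) (μ : E →L[ℝ] ℝ) (hμ : μ ∘L loc R.P q₀ z.1 = 0) :
    mfderiv 𝓘(ℝ, E × (E →L[ℝ] ℝ)) 𝓘(ℝ, EN) (hN.spar q₀) z (0, μ) = 0 := by
  have hc : (fun t : ℝ => hN.spar q₀ (z + t • (0, μ))) = fun _ => hN.spar q₀ z := by
    funext t
    have h1 : (z + t • ((0 : E), μ)).1 = z.1 := by simp
    rw [hN.spar_eventuallyEq (z := z + t • (0, μ)) (by rw [h1]; exact hz),
      hN.spar_eventuallyEq hz, h1]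
    congr 2
    change (z.2 + t • μ) ∘L _ = _
    rw [ContinuousLinearMap.add_comp, ContinuousLinearMap.smul_comp, hμ, smul_zero, add_zero]
  have hl : HasFDerivAt (fun t : ℝ => z + t • ((0 : E), μ))
      ((ContinuousLinearMap.id ℝ ℝ).smulRight ((0 : E), μ)) 0 :=
    ((hasFDerivAt_id (0 : ℝ)).smul_const ((0 : E), μ)).const_add z
  have hz0 : z = z + (0 : ℝ) • ((0 : E), μ) := by simp
  have hd : MDifferentiableAt 𝓘(ℝ, E × (E →L[ℝ] ℝ)) 𝓘(ℝ, EN) (hN.spar q₀)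
      (z + (0 : ℝ) • ((0 : E), μ)) := by
    rw [← hz0]; exact (hN.contMDiffAt_spar hz).mdifferentiableAt (by simp)
  have h2 := mfderiv_comp (I := 𝓘(ℝ, ℝ)) (0 : ℝ) hd (hl.differentiableAt.mdifferentiableAt)
  have h3 : hN.spar q₀ ∘ (fun t : ℝ => z + t • ((0 : E), μ)) = fun _ => hN.spar q₀ z := hc
  rw [h3, mfderiv_const, mfderiv_eq_fderiv, hl.fderiv] at h2
  have h4 := congrArg (fun l : ℝ →L[ℝ] EN => l 1) h2
  have h5 : (0 : EN) = (show E × (E →L[ℝ] ℝ) →L[ℝ] EN from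
    mfderiv 𝓘(ℝ, E × (E →L[ℝ] ℝ)) 𝓘(ℝ, EN) (hN.spar q₀) (z + (0 : ℝ) • ((0 : E), μ)))
      ((1 : ℝ) • (0, μ)) := h4
  rw [one_smul, ← hz0] at h5
  exact h5.symm

/-- The canonical form is nondegenerate on the distribution induced by the image of the
projections. -/
theorem nondegenerateOn : NondegenerateOn (liftedDistribution (EN := EN) N D)
    (restrictedForm N) := by
  intro m X hX h
  obtain ⟨q₀, hm⟩ : ∃ q₀, baseProj N m ∈ (extChartAt 𝓘(ℝ, E) q₀).source :=
    ⟨_, mem_extChartAt_source _⟩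
  obtain ⟨z, hz, -, rfl⟩ := hN.exists_spar_eq q₀ hm
  obtain ⟨⟨a, μ⟩, rfl⟩ := hN.surjective_mfderiv_spar hz X
  rw [hN.mfderiv_spar_mem hD hz] at hX
  -- A vector `(0, ν)` is tangent to the fibre, hence lies in the distribution, and pairs with `(a,
  -- μ)` to `ν(P a) = ν(a)`. Hahn-Banach provides a `ν` that detects `a`.
  have h1 : a = 0 := by
    by_contra ha
    obtain ⟨ν, -, hν⟩ := exists_dual_vector ℝ a (norm_ne_zero_iff.2 ha)
    have h2 := h _ ((hN.mfderiv_spar_mem hD hz (0, ν)).2 (by simp))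
    rw [hN.restrictedForm_spar hz] at h2
    simp only [map_zero, zero_apply, hX, add_zero, sub_zero] at h2
    rw [hν] at h2
    exact ha (norm_eq_zero.1 h2)
  subst h1
  refine hN.mfderiv_spar_vertical hz μ ?_
  ext b
  -- With `a = 0`, pairing against `(P b, 0)` leaves `-μ(P b)`. So `μ ∘ P = 0` and the vector is one
  -- of the redundant directions.
  have h2 := h _ ((hN.mfderiv_spar_mem hD hz (loc R.P q₀ z.1 b, 0)).2 (loc_idem hz b))
  rw [hN.restrictedForm_spar hz] at h2
  simpa [loc_idem hz] using h2

end ProjField.IsDualImage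
end DualImageForms

/-! ### Hamiltonian vector fields of the distribution in coordinates -/

section HamiltonianFields

variable {E Q : Type*} [NormedAddCommGroup E] [NormedSpace ℝ E] [FiniteDimensional ℝ E]
  [TopologicalSpace Q] [ChartedSpace E Q] [IsManifold 𝓘(ℝ, E) ∞ Q]

/-- Reflexivity of `E`: the partial derivative of a function in the momentum lies in the double dual
and has to be read as a velocity in `E`. -/
theorem isInvertible_inclusionInDoubleDual :
    (NormedSpace.inclusionInDoubleDual ℝ E).IsInvertible := by
  have hi : Function.Injective (NormedSpace.inclusionInDoubleDual ℝ E) :=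
    (NormedSpace.inclusionInDoubleDualLi ℝ (E := E)).injective
  have e : ∀ (V : Type _) [NormedAddCommGroup V] [NormedSpace ℝ V] [FiniteDimensional ℝ V],
      Module.finrank ℝ (V →L[ℝ] ℝ) = Module.finrank ℝ V := by
    intro V _ _ _
    rw [← (LinearMap.toContinuousLinearMap (𝕜 := ℝ) (E := V) (F' := ℝ)).finrank_eq]
    exact Subspace.dual_finrank_eq
  have hs : Function.Surjective (NormedSpace.inclusionInDoubleDual ℝ E) :=
    (LinearMap.injective_iff_surjective_of_finrank_eq_finrank
      (f := (NormedSpace.inclusionInDoubleDual ℝ E).toLinearMap)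
      ((e (E →L[ℝ] ℝ)).trans (e E)).symm).1 hi
  exact @isInvertible_of_bijective E ((E →L[ℝ] ℝ) →L[ℝ] ℝ) _ _ _ _ _
    (NormedSpace.inclusionInDoubleDual ℝ E) ⟨hi, hs⟩

namespace ProjField

variable (R : ProjField E Q)

/-- The configuration component of the Hamiltonian vector field of `F`. -/
noncomputable def hamBase (F : E × (E →L[ℝ] ℝ) → ℝ) (z : E × (E →L[ℝ] ℝ)) : E :=
  (NormedSpace.inclusionInDoubleDual ℝ E).inverse
    (fderiv ℝ F z ∘L ContinuousLinearMap.inr ℝ E (E →L[ℝ] ℝ))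

theorem apply_hamBase (F : E × (E →L[ℝ] ℝ) → ℝ) (z : E × (E →L[ℝ] ℝ)) (ν : E →L[ℝ] ℝ) :
    ν (hamBase F z) = fderiv ℝ F z (0, ν) := by
  have h := (isInvertible_inclusionInDoubleDual (E := E)).inverse_apply_eq.1
    (show _ = hamBase F z from rfl)
  exact (congrArg (fun l : (E →L[ℝ] ℝ) →L[ℝ] ℝ => l ν) h).symm

/-- The momentum component of the Hamiltonian vector field of `F`. -/
noncomputable def hamFibre (q₀ : Q) (F : E × (E →L[ℝ] ℝ) → ℝ) (z : E × (E →L[ℝ] ℝ)) :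
    E →L[ℝ] ℝ :=
  -- Obtained by solving the coordinate formula `restrictedForm_spar` for the momentum component
  -- against `(b, 0)` with `b` in the range of the projection. The final composition with the
  -- projection extends the answer to all `b`.
  (z.2 ∘L (fderiv ℝ (loc R.P q₀) z.1).flip (hamBase F z) -
    z.2 ∘L fderiv ℝ (loc R.P q₀) z.1 (hamBase F z) -
    fderiv ℝ F z ∘L ContinuousLinearMap.inl ℝ E (E →L[ℝ] ℝ)) ∘L loc R.P q₀ z.1

/-- The Hamiltonian vector field of `F` in a local parametrization. -/
noncomputable def ham (q₀ : Q) (F : E × (E →L[ℝ] ℝ) → ℝ) (z : E × (E →L[ℝ] ℝ)) :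
    E × (E →L[ℝ] ℝ) := (hamBase F z, R.hamFibre q₀ F z)

theorem contDiffAt_ham {q₀ : Q} {F : E × (E →L[ℝ] ℝ) → ℝ} {z : E × (E →L[ℝ] ℝ)}
    (hF : ContDiffAt ℝ ∞ F z) (hz : z.1 ∈ (extChartAt 𝓘(ℝ, E) q₀).target) :
    ContDiffAt ℝ ∞ (R.ham q₀ F) z := by
  have hF' : ContDiffAt ℝ ∞ (fderiv ℝ F) z := hF.fderiv_right (m := ∞) (by simp)
  have ha : ContDiffAt ℝ ∞ (hamBase F) z :=
    (ContinuousLinearMap.contDiff _).contDiffAt.comp z (hF'.clm_comp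
      (contDiffAt_const (c := ContinuousLinearMap.inr ℝ E (E →L[ℝ] ℝ))))
  have hT := R.smooth q₀ z.1 hz
  have hT0 : ContDiffAt ℝ ∞ (fun z : E × (E →L[ℝ] ℝ) => loc R.P q₀ z.1) z :=
    ContDiffAt.comp z (g := loc R.P q₀) (f := Prod.fst) hT contDiffAt_fst
  have hT1 : ContDiffAt ℝ ∞ (fun z : E × (E →L[ℝ] ℝ) => fderiv ℝ (loc R.P q₀) z.1) z :=
    ContDiffAt.comp z (g := fderiv ℝ (loc R.P q₀)) (f := Prod.fst)
      (hT.fderiv_right (m := ∞) (by simp)) contDiffAt_fst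
  have hp : ContDiffAt ℝ ∞ (fun z : E × (E →L[ℝ] ℝ) => z.2) z := contDiffAt_snd
  refine ha.prodMk ?_
  refine ContDiffAt.clm_comp ?_ hT0
  refine ((hp.clm_comp ?_).sub (hp.clm_comp (hT1.clm_apply ha))).sub
    (hF'.clm_comp (contDiffAt_const (c := ContinuousLinearMap.inl ℝ E (E →L[ℝ] ℝ))))
  refine contDiffAt_clm_of_apply fun b => ?_
  exact (hT1.clm_apply (contDiffAt_const (c := b))).clm_apply ha

namespace IsDualImage

variable {EN : Type*} [NormedAddCommGroup EN] [NormedSpace ℝ EN]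
  {R : ProjField E Q} {N : Set (CotangentBundle E Q)} [ChartedSpace EN N]
  [IsManifold 𝓘(ℝ, EN) ∞ N] (hN : R.IsDualImage EN N)

include hN

theorem fderiv_comp_spar {q₀ : Q} {z : E × (E →L[ℝ] ℝ)}
    (hz : z.1 ∈ (extChartAt 𝓘(ℝ, E) q₀).target) {f : N → ℝ}
    (hf : MDifferentiableAt 𝓘(ℝ, EN) 𝓘(ℝ, ℝ) f (hN.spar q₀ z)) (u : E × (E →L[ℝ] ℝ)) :
    fderiv ℝ (f ∘ hN.spar q₀) z u = dfun 𝓘(ℝ, EN) f (hN.spar q₀ z)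
      (mfderiv 𝓘(ℝ, E × (E →L[ℝ] ℝ)) 𝓘(ℝ, EN) (hN.spar q₀) z u) := by
  have h := mfderiv_comp z hf ((hN.contMDiffAt_spar hz).mdifferentiableAt (by simp))
  rw [mfderiv_eq_fderiv] at h
  exact congrArg (fun l : E × (E →L[ℝ] ℝ) →L[ℝ] ℝ => l u) h

/-- `f ∘ spar` does not change along momenta `ν ∘ P - ν`, which the projection kills. So every `ν`
takes the same value on `P a` and `a`, where `a` is the momentum derivative. -/
theorem loc_hamBase {q₀ : Q} {z : E × (E →L[ℝ] ℝ)}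
    (hz : z.1 ∈ (extChartAt 𝓘(ℝ, E) q₀).target) {f : N → ℝ}
    (hf : MDifferentiableAt 𝓘(ℝ, EN) 𝓘(ℝ, ℝ) f (hN.spar q₀ z)) :
    loc R.P q₀ z.1 (hamBase (f ∘ hN.spar q₀) z) = hamBase (f ∘ hN.spar q₀) z := by
  rw [← sub_eq_zero]
  by_contra ha
  obtain ⟨ν, -, hν⟩ := exists_dual_vector ℝ _ (norm_ne_zero_iff.2 ha)
  have h1 : ν (loc R.P q₀ z.1 (hamBase (f ∘ hN.spar q₀) z)) =
      fderiv ℝ (f ∘ hN.spar q₀) z (0, ν ∘L loc R.P q₀ z.1) :=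
    apply_hamBase (f ∘ hN.spar q₀) z (ν ∘L loc R.P q₀ z.1)
  have h2 := apply_hamBase (f ∘ hN.spar q₀) z ν
  have h3 : fderiv ℝ (f ∘ hN.spar q₀) z (0, ν ∘L loc R.P q₀ z.1 - ν) = 0 := by
    rw [hN.fderiv_comp_spar hz hf, hN.mfderiv_spar_vertical hz, map_zero]
    ext v
    exact sub_eq_zero.2 (congrArg ν (loc_idem hz v))
  have h4 : ((0 : E), ν ∘L loc R.P q₀ z.1 - ν) = (0, ν ∘L loc R.P q₀ z.1) - (0, ν) := by simp
  rw [h4, map_sub, ← h1, ← h2, ← map_sub, hν] at h3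
  exact ha (norm_eq_zero.1 h3)

/-- Hamilton's equation is only claimed against test vectors of the distribution: `hv` removes the
projections from `restrictedForm_spar`, after which `hamFibre` was chosen to fit. -/
theorem curl_ham {q₀ : Q} {z : E × (E →L[ℝ] ℝ)}
    (hz : z.1 ∈ (extChartAt 𝓘(ℝ, E) q₀).target) {f : N → ℝ}
    (hf : MDifferentiableAt 𝓘(ℝ, EN) 𝓘(ℝ, ℝ) f (hN.spar q₀ z)) {v : E × (E →L[ℝ] ℝ)}
    (hv : loc R.P q₀ z.1 v.1 = v.1) :
    restrictedForm N (hN.spar q₀ z)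
      ![mfderiv 𝓘(ℝ, E × (E →L[ℝ] ℝ)) 𝓘(ℝ, EN) (hN.spar q₀) z (R.ham q₀ (f ∘ hN.spar q₀) z),
        mfderiv 𝓘(ℝ, E × (E →L[ℝ] ℝ)) 𝓘(ℝ, EN) (hN.spar q₀) z v] =
      fderiv ℝ (f ∘ hN.spar q₀) z v := by
  rw [hN.restrictedForm_spar hz]
  have h1 : (R.ham q₀ (f ∘ hN.spar q₀) z).1 = hamBase (f ∘ hN.spar q₀) z := rfl
  have h2 : ∀ b, (R.ham q₀ (f ∘ hN.spar q₀) z).2 b =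
      z.2 (fderiv ℝ (loc R.P q₀) z.1 (loc R.P q₀ z.1 b) (hamBase (f ∘ hN.spar q₀) z)) -
      z.2 (fderiv ℝ (loc R.P q₀) z.1 (hamBase (f ∘ hN.spar q₀) z) (loc R.P q₀ z.1 b)) -
      fderiv ℝ (f ∘ hN.spar q₀) z (loc R.P q₀ z.1 b, 0) := fun b => rfl
  have h3 : v = (v.1, 0) + (0, v.2) := by simp
  rw [h1, h2, hN.loc_hamBase hz hf, hv, hv, apply_hamBase]
  conv_rhs => rw [h3, map_add]
  ring

variable {D : ∀ q : Q, Submodule ℝ (TangentSpace 𝓘(ℝ, E) q)}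
  (hD : ∀ q v, v ∈ D q ↔ R.P q v = v)

include hD

theorem ham_mem {q₀ : Q} {z : E × (E →L[ℝ] ℝ)}
    (hz : z.1 ∈ (extChartAt 𝓘(ℝ, E) q₀).target) {f : N → ℝ}
    (hf : MDifferentiableAt 𝓘(ℝ, EN) 𝓘(ℝ, ℝ) f (hN.spar q₀ z)) :
    mfderiv 𝓘(ℝ, E × (E →L[ℝ] ℝ)) 𝓘(ℝ, EN) (hN.spar q₀) z (R.ham q₀ (f ∘ hN.spar q₀) z) ∈
      liftedDistribution N D (hN.spar q₀ z) :=
  (hN.mfderiv_spar_mem hD hz _).2 (hN.loc_hamBase hz hf)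

/-- The bivector field determined by the canonical form is given by Hamiltonian vector fields. -/
theorem sharp_spar {q₀ : Q} {z : E × (E →L[ℝ] ℝ)}
    (hz : z.1 ∈ (extChartAt 𝓘(ℝ, E) q₀).target) {f : N → ℝ}
    (hf : MDifferentiableAt 𝓘(ℝ, EN) 𝓘(ℝ, ℝ) f (hN.spar q₀ z)) :
    sharp (liftedDistribution N D) (restrictedForm N) (hN.spar q₀ z)
      (dfun 𝓘(ℝ, EN) f (hN.spar q₀ z)) =
      -mfderiv 𝓘(ℝ, E × (E →L[ℝ] ℝ)) 𝓘(ℝ, EN) (hN.spar q₀) z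
        (R.ham q₀ (f ∘ hN.spar q₀) z) := by
  refine sharp_eq (hN.nondegenerateOn hD _) (hN.ham_mem hD hz hf) fun Y hY => ?_
  obtain ⟨v, rfl⟩ := hN.surjective_mfderiv_spar hz Y
  exact (hN.curl_ham hz hf ((hN.mfderiv_spar_mem hD hz v).1 hY)).trans
    (hN.fderiv_comp_spar hz hf v)

theorem bracket_spar {q₀ : Q} {z : E × (E →L[ℝ] ℝ)}
    (hz : z.1 ∈ (extChartAt 𝓘(ℝ, E) q₀).target) {f g : N → ℝ}
    (hf : MDifferentiableAt 𝓘(ℝ, EN) 𝓘(ℝ, ℝ) f (hN.spar q₀ z))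
    (hg : MDifferentiableAt 𝓘(ℝ, EN) 𝓘(ℝ, ℝ) g (hN.spar q₀ z)) :
    bracket (liftedDistribution (EN := EN) N D) (restrictedForm N) f g (hN.spar q₀ z) =
      -fderiv ℝ (g ∘ hN.spar q₀) z (R.ham q₀ (f ∘ hN.spar q₀) z) := by
  rw [bracket, hN.sharp_spar hD hz hf, map_neg, ← hN.fderiv_comp_spar hz hg]

theorem contMDiff_bracket {f g : N → ℝ} (hf : ContMDiff 𝓘(ℝ, EN) 𝓘(ℝ, ℝ) ∞ f)
    (hg : ContMDiff 𝓘(ℝ, EN) 𝓘(ℝ, ℝ) ∞ g) : ContMDiff 𝓘(ℝ, EN) 𝓘(ℝ, ℝ) ∞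
      (bracket (liftedDistribution (EN := EN) N D) (restrictedForm N) f g) := by
  intro m
  obtain ⟨q₀, hm⟩ : ∃ q₀, baseProj N m ∈ (extChartAt 𝓘(ℝ, E) q₀).source :=
    ⟨_, mem_extChartAt_source _⟩
  have hz : (scoord q₀ m).1 ∈ (extChartAt 𝓘(ℝ, E) q₀).target :=
    (extChartAt 𝓘(ℝ, E) q₀).map_source hm
  have hF : ContDiffAt ℝ ∞ (f ∘ hN.spar q₀) (scoord q₀ m) :=
    ((hf _).comp _ (hN.contMDiffAt_spar hz)).contDiffAt
  have hG : ContDiffAt ℝ ∞ (g ∘ hN.spar q₀) (scoord q₀ m) :=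
    ((hg _).comp _ (hN.contMDiffAt_spar hz)).contDiffAt
  have h1 : ContDiffAt ℝ ∞ (fun z => -fderiv ℝ (g ∘ hN.spar q₀) z
      (R.ham q₀ (f ∘ hN.spar q₀) z)) (scoord q₀ m) :=
    ((hG.fderiv_right (m := ∞) (by simp)).clm_apply (R.contDiffAt_ham hF hz)).neg
  -- `scoord` is a smooth section of the parametrization, so smoothness in the parameters passes to
  -- `N`.
  refine (h1.contMDiffAt.comp m (contMDiffAt_scoord hN hm)).congr_of_eventuallyEq ?_
  filter_upwards [hN.contMDiff_baseProj.continuous.continuousAt.preimage_mem_nhds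
    ((isOpen_extChartAt_source q₀).mem_nhds hm)] with m' hm'
  obtain ⟨z, hz', hzm, rfl⟩ := hN.exists_spar_eq q₀ hm'
  rw [hN.bracket_spar hD hz' (hf.mdifferentiableAt (by simp)) (hg.mdifferentiableAt (by simp))]
  simp only [Function.comp_apply, hzm]

end IsDualImage
end ProjField
end HamiltonianFields

/-! ### The diffeomorphism between dual images, and its equivariance -/

section Diffeo

variable {E Q : Type*} [NormedAddCommGroup E] [NormedSpace ℝ E] [FiniteDimensional ℝ E]
  [TopologicalSpace Q] [ChartedSpace E Q] [IsManifold 𝓘(ℝ, E) ∞ Q]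

/-- Transposition reverses composition. Applied in both orders to projections with equal ranges, it
shows that the two transposes invert each other on the two images. -/
theorem ProjField.dual_comp {R₁ R₂ : ProjField E Q}
    (h : ∀ q v, R₂.P q (R₁.P q v) = R₁.P q v) (α : CotangentBundle E Q) :
    R₁.dual (R₂.dual α) = R₁.dual α :=
  cotangent_ext rfl fun v => congrArg α.snd (h α.proj v)

/-- The identification of the dual images of two fields of projections with the same ranges. -/
noncomputable def ProjField.IsDualImage.diffeo {R₁ R₂ : ProjField E Q} {E₁ E₂ : Type*}
    [NormedAddCommGroup E₁] [NormedSpace ℝ E₁] [NormedAddCommGroup E₂] [NormedSpace ℝ E₂]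
    {N₁ N₂ : Set (CotangentBundle E Q)} [ChartedSpace E₁ N₁] [IsManifold 𝓘(ℝ, E₁) ∞ N₁]
    [ChartedSpace E₂ N₂] [IsManifold 𝓘(ℝ, E₂) ∞ N₂]
    (h₁ : R₁.IsDualImage E₁ N₁) (h₂ : R₂.IsDualImage E₂ N₂)
    (h : ∀ q v, R₂.P q (R₁.P q v) = R₁.P q v) (h' : ∀ q v, R₁.P q (R₂.P q v) = R₂.P q v) :
    N₁ ≃ₘ^∞⟮𝓘(ℝ, E₁), 𝓘(ℝ, E₂)⟯ N₂ where
  toFun m := h₂.retr m.1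
  invFun m := h₁.retr m.1
  left_inv m := Subtype.ext
    ((ProjField.dual_comp h m.1).trans ((h₁.mem_iff m.1).1 m.2))
  right_inv m := Subtype.ext
    ((ProjField.dual_comp h' m.1).trans ((h₂.mem_iff m.1).1 m.2))
  contMDiff_toFun := h₂.contMDiff_retr.comp h₁.contMDiff_val
  contMDiff_invFun := h₁.contMDiff_retr.comp h₂.contMDiff_val

variable {G : Type*} [Group G] [MulAction G Q]

variable (G) in
/-- Invariance of a field of projections under a group action. -/
def ProjField.IsInvariant (R : ProjField E Q) : Prop :=
  ∀ (g : G) (q : Q) (v : TangentSpace 𝓘(ℝ, E) q),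
    R.P (g • q) (tangentAction E g q v) = tangentAction E g q (R.P q v)

theorem ProjField.IsInvariant.dual_cotangentLift {R : ProjField E Q} (hR : R.IsInvariant G)
    (hG : ∀ g : G, MDifferentiable 𝓘(ℝ, E) 𝓘(ℝ, E) (fun q : Q => g • q))
    (g : G) (α : CotangentBundle E Q) :
    R.dual (cotangentLift g α) = cotangentLift g (R.dual α) := by
  refine cotangent_ext rfl fun w => ?_
  obtain ⟨u, rfl⟩ := (tangentAction_isInvertible hG g α.proj).bijective.2 w
  refine Eq.trans ?_ (cotangentLift_apply hG g (R.dual α) u).symm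
  exact (congrArg (cotangentLift g α).snd (hR g α.proj u)).trans (cotangentLift_apply hG g α _)

theorem projection_tangentAction {D C : ∀ q : Q, Submodule ℝ (TangentSpace 𝓘(ℝ, E) q)}
    (h : ∀ q, IsCompl (D q) (C q)) {g : G} {q : Q}
    (hD : ∀ v ∈ D q, tangentAction E g q v ∈ D (g • q))
    (hC : ∀ v ∈ C q, tangentAction E g q v ∈ C (g • q)) (v : TangentSpace 𝓘(ℝ, E) q) :
    (D (g • q)).projection (C (g • q)) (h (g • q)) (tangentAction E g q v) =
      tangentAction E g q ((D q).projection (C q) (h q) v) := by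
  have h1 : v = (D q).projection (C q) (h q) v + (C q).projection (D q) (h q).symm v :=
    (Submodule.projection_add_projection_eq_self (h q) v).symm
  conv_lhs => rw [h1]
  rw [map_add, map_add, Submodule.projection_apply_of_mem_left _
    (hD _ (Submodule.projection_apply_mem _ _)), (Submodule.projection_apply_eq_zero_iff _).2
    (hC _ (Submodule.projection_apply_mem _ _)), add_zero]

end Diffeo

/-! ### The orthogonal projection onto `D` and the projection along `W` -/

section SystemProjections

variable {E Q EG G : Type*} [NormedAddCommGroup E] [NormedSpace ℝ E] [FiniteDimensional ℝ E]
  [TopologicalSpace Q] [ChartedSpace E Q] [IsManifold 𝓘(ℝ, E) ∞ Q]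
  [NormedAddCommGroup EG] [NormedSpace ℝ EG] [TopologicalSpace G] [ChartedSpace EG G]
  [Group G] [MulAction G Q]

instance (q : Q) : FiniteDimensional ℝ (TangentSpace 𝓘(ℝ, E) q) :=
  inferInstanceAs (FiniteDimensional ℝ E)

instance (q : Q) : T2Space (TangentSpace 𝓘(ℝ, E) q) := inferInstanceAs (T2Space E)

namespace SymmetricSystem

variable (S : SymmetricSystem E Q EG G)

/-- The orthogonal complement of the constraint distribution. -/
def orth (q : Q) : Submodule ℝ (TangentSpace 𝓘(ℝ, E) q) where
  carrier := {v | ∀ w ∈ S.D q, S.metric.inner q w v = 0}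
  add_mem' ha hb w hw := by rw [map_add, ha w hw, hb w hw, add_zero]
  zero_mem' w _ := map_zero _
  smul_mem' c v hv w hw := by rw [map_smul, hv w hw, smul_zero]

theorem isCompl_orth (q : Q) : IsCompl (S.D q) (S.orth q) := by
  let B : LinearMap.BilinForm ℝ (TangentSpace 𝓘(ℝ, E) q) :=
    LinearMap.mk₂ ℝ (fun v w => S.metric.inner q v w) (by simp) (by simp) (by simp) (by simp)
  have h := LinearMap.BilinForm.isCompl_orthogonal_iff_disjoint (B := B) (W := S.D q)
    (fun x y hxy => (S.metric.symm q y x).trans hxy)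
  refine h.2 ?_
  rw [Submodule.disjoint_def]
  intro v hv hv'
  by_contra hne
  exact (S.metric.pos q v hne).ne' (hv' v hv)

/-- The orthogonal projection to the constraint distribution. -/
noncomputable def projD : ProjField E Q where
  P q := ((S.D q).projection (S.orth q) (S.isCompl_orth q)).toContinuousLinearMap
  idem q v := Submodule.projection_apply_of_mem_left _ (Submodule.projection_apply_mem _ _)
  smooth q₀ x hx := by
    refine contDiffAt_loc_of_orthogonal S.regular S.metric
      (fun q v => Submodule.projection_apply_mem _ _) (fun q v w hw => ?_) q₀ hx
    have h1 := Submodule.projection_add_projection_eq_self (S.isCompl_orth q) v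
    have h2 := (Submodule.projection_apply_mem (S.isCompl_orth q).symm v) w hw
    rw [S.metric.symm q v w]
    conv_rhs => rw [← h1]
    rw [map_add, h2, add_zero, S.metric.symm q w]
    rfl

theorem projD_mem (q : Q) (v : TangentSpace 𝓘(ℝ, E) q) : S.projD.P q v ∈ S.D q :=
  Submodule.projection_apply_mem _ _

theorem mem_D_iff (q : Q) (v : TangentSpace 𝓘(ℝ, E) q) : v ∈ S.D q ↔ S.projD.P q v = v :=
  (Submodule.projection_eq_self_iff _ _).symm

theorem inner_projD (q : Q) {v : TangentSpace 𝓘(ℝ, E) q} (hv : v ∈ S.D q)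
    (w : TangentSpace 𝓘(ℝ, E) q) : S.metric.inner q v (S.projD.P q w) = S.metric.inner q v w := by
  have h1 := Submodule.projection_add_projection_eq_self (S.isCompl_orth q) w
  have h2 := (Submodule.projection_apply_mem (S.isCompl_orth q).symm w) v hv
  conv_rhs => rw [← h1]
  rw [map_add, h2, add_zero]
  rfl

theorem inner_projD_right (q : Q) (v w : TangentSpace 𝓘(ℝ, E) q) :
    S.metric.inner q v (S.projD.P q w) = S.metric.inner q (S.projD.P q v) w := by
  rw [← S.inner_projD _ (S.projD_mem _ v), S.metric.symm,
    S.metric.symm _ (S.projD.P q v), S.inner_projD _ (S.projD_mem _ w)]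

theorem exists_inner_eq (q : Q) (α : TangentSpace 𝓘(ℝ, E) q →L[ℝ] ℝ) :
    ∃ v, S.metric.inner q v = α := by
  let B : TangentSpace 𝓘(ℝ, E) q →ₗ[ℝ] Module.Dual ℝ (TangentSpace 𝓘(ℝ, E) q) :=
    LinearMap.mk₂ ℝ (fun v w => S.metric.inner q v w) (by simp) (by simp) (by simp) (by simp)
  have hB : Function.Injective B := by
    rw [← LinearMap.ker_eq_bot, LinearMap.ker_eq_bot']
    intro v hv
    by_contra hne
    exact (S.metric.pos q v hne).ne'
      (congrArg (fun l : Module.Dual ℝ (TangentSpace 𝓘(ℝ, E) q) => l v) hv)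
  obtain ⟨v, hv⟩ := (LinearMap.injective_iff_surjective_of_finrank_eq_finrank
    (Subspace.dual_finrank_eq (K := ℝ) (V := TangentSpace 𝓘(ℝ, E) q)).symm).1 hB α.toLinearMap
  refine ⟨v, ContinuousLinearMap.ext fun w => ?_⟩
  exact congrArg (fun l : Module.Dual ℝ (TangentSpace 𝓘(ℝ, E) q) => l w) hv

/-- The orthogonal projection is self-adjoint, so precomposing `κ(v, ·)` with it gives `κ(R v, ·)`;
nondegeneracy of `κ` puts every covector in the form `κ(v, ·)`. -/
theorem isDualImage {EM : Type*} [NormedAddCommGroup EM] [NormedSpace ℝ EM]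
    [ChartedSpace EM S.constraintManifold]
    (hM : Manifold.IsSmoothEmbedding 𝓘(ℝ, EM) (cotangentModel E) ∞
      (Subtype.val : S.constraintManifold → CotangentBundle E Q)) :
    S.projD.IsDualImage EM S.constraintManifold where
  mem_iff α := by
    constructor
    · rintro ⟨q, v, hv, rfl⟩
      exact cotangent_ext rfl fun w => S.inner_projD q hv w
    · intro h
      obtain ⟨v, hv⟩ := S.exists_inner_eq α.proj α.snd
      refine ⟨α.proj, S.projD.P α.proj v, S.projD_mem _ _, ?_⟩
      refine Eq.trans h.symm (cotangent_ext rfl fun w => ?_)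
      exact (congrArg (fun l : TangentSpace 𝓘(ℝ, E) α.proj →L[ℝ] ℝ => l (S.projD.P α.proj w))
        hv.symm).trans (S.inner_projD_right α.proj v w)
  emb := hM

variable [ContMDiffSMul 𝓘(ℝ, EG) 𝓘(ℝ, E) ∞ G Q]

omit [FiniteDimensional ℝ E] [ContMDiffSMul 𝓘(ℝ, EG) 𝓘(ℝ, E) ∞ G Q] in
theorem tangentAction_mem_D {g : G} {q : Q} {v : TangentSpace 𝓘(ℝ, E) q} (hv : v ∈ S.D q) :
    tangentAction E g q v ∈ S.D (g • q) := by
  rw [← S.D_invariant]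
  exact Submodule.mem_map_of_mem hv

end SymmetricSystem

namespace VerticalComplement

variable {S : SymmetricSystem E Q EG G} (W : VerticalComplement S)

/-- The projection to the constraint distribution along the vertical complement. -/
noncomputable def proj : ProjField E Q where
  P q := ((S.D q).projection (W.W q) (W.isCompl q)).toContinuousLinearMap
  idem _ _ := Submodule.projection_apply_of_mem_left _ (Submodule.projection_apply_mem _ _)
  smooth q₀ _ hx := contDiffAt_loc_of_isCompl S.regular W.regular W.isCompl
    (fun _ _ h => Submodule.projection_apply_of_mem_left _ h)
    (fun q _ h => (Submodule.projection_apply_eq_zero_iff (W.isCompl q)).2 h) q₀ hx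

theorem proj_mem (q : Q) (v : TangentSpace 𝓘(ℝ, E) q) : W.proj.P q v ∈ S.D q :=
  Submodule.projection_apply_mem _ _

theorem mem_D_iff (q : Q) (v : TangentSpace 𝓘(ℝ, E) q) : v ∈ S.D q ↔ W.proj.P q v = v :=
  (Submodule.projection_eq_self_iff _ _).symm

theorem mem_W_iff (q : Q) (v : TangentSpace 𝓘(ℝ, E) q) : v ∈ W.W q ↔ W.proj.P q v = 0 :=
  (Submodule.projection_apply_eq_zero_iff _).symm

theorem sub_proj_mem (q : Q) (v : TangentSpace 𝓘(ℝ, E) q) : v - W.proj.P q v ∈ W.W q := by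
  rw [W.mem_W_iff, map_sub, W.proj.idem, sub_self]

/-- The vectors `v - P v` lie in `W`, and `P` kills `W`; so vanishing on `W` is the same as
invariance under precomposition with `P`. -/
theorem isDualImage {E₀ : Type*} [NormedAddCommGroup E₀] [NormedSpace ℝ E₀]
    [ChartedSpace E₀ W.annihilator]
    (hW : Manifold.IsSmoothEmbedding 𝓘(ℝ, E₀) (cotangentModel E) ∞
      (Subtype.val : W.annihilator → CotangentBundle E Q)) :
    W.proj.IsDualImage E₀ W.annihilator where
  mem_iff α := by
    constructor
    · intro h
      refine cotangent_ext rfl fun w => ?_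
      have h1 : α.snd w - α.snd (W.proj.P α.proj w) = 0 :=
        (map_sub α.snd _ _).symm.trans (h _ (W.sub_proj_mem α.proj w))
      exact (sub_eq_zero.1 h1).symm
    · intro h w hw
      rw [← h]
      change α.snd (W.proj.P α.proj w) = 0
      rw [(W.mem_W_iff _ _).1 hw, map_zero]
  emb := hW

theorem tangentAction_mem_W {g : G} {q : Q} {v : TangentSpace 𝓘(ℝ, E) q} (hv : v ∈ W.W q) :
    tangentAction E g q v ∈ W.W (g • q) := by
  rw [← W.W_invariant]
  exact Submodule.mem_map_of_mem hv

theorem proj_isInvariant : W.proj.IsInvariant G := fun _ _ v =>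
  projection_tangentAction W.isCompl (fun _ hv => S.tangentAction_mem_D hv)
    (fun _ hv => W.tangentAction_mem_W hv) v

theorem proj_projD (q : Q) (v : TangentSpace 𝓘(ℝ, E) q) :
    W.proj.P q (S.projD.P q v) = S.projD.P q v := (W.mem_D_iff q _).1 (S.projD_mem q v)

theorem projD_proj (q : Q) (v : TangentSpace 𝓘(ℝ, E) q) :
    S.projD.P q (W.proj.P q v) = W.proj.P q v := (S.mem_D_iff q _).1 (W.proj_mem q v)

/-- Identifies the transposed projection of `κ^♯(v)` with `κ₀(v, ·)`: for `v ∈ D` the `W`-part of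
`κ₀` drops out. -/
theorem inner_proj_eq_modifiedMetric (q : Q) {v : TangentSpace 𝓘(ℝ, E) q} (hv : v ∈ S.D q)
    (w : TangentSpace 𝓘(ℝ, E) q) :
    S.metric.inner q v (W.proj.P q w) = W.modifiedMetric q v w := by
  unfold modifiedMetric
  rw [Submodule.projection_apply_of_mem_left _ hv,
    (Submodule.projection_apply_eq_zero_iff (W.isCompl q).symm).2 hv, map_zero]
  simp only [zero_apply, add_zero]
  rfl

end VerticalComplement
end SystemProjections

/-! ### Curves with zero velocity -/

section Calculus

variable {E Q : Type*} [NormedAddCommGroup E] [NormedSpace ℝ E]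
  [TopologicalSpace Q] [ChartedSpace E Q]

theorem mfderiv_eq_of_eq {E' Q' : Type*} [NormedAddCommGroup E'] [NormedSpace ℝ E']
    [TopologicalSpace Q'] [ChartedSpace E' Q'] (f : Q → Q') {x y : Q} (h : x = y) :
    (show E →L[ℝ] E' from mfderiv 𝓘(ℝ, E) 𝓘(ℝ, E') f x) =
      (show E →L[ℝ] E' from mfderiv 𝓘(ℝ, E) 𝓘(ℝ, E') f y) := by
  subst h; rfl

theorem eventually_eq_of_hasMFDerivAt_zero [IsManifold 𝓘(ℝ, E) ∞ Q] {γ : ℝ → Q}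
    (h : ∀ᶠ t in 𝓝 (0 : ℝ), HasMFDerivAt 𝓘(ℝ, ℝ) 𝓘(ℝ, E) γ t 0) :
    ∀ᶠ t in 𝓝 (0 : ℝ), γ t = γ 0 := by
  have hs := mem_extChartAt_source (I := 𝓘(ℝ, E)) (γ 0)
  have h1 : ∀ᶠ t in 𝓝 (0 : ℝ), γ t ∈ (extChartAt 𝓘(ℝ, E) (γ 0)).source :=
    h.self_of_nhds.continuousAt.preimage_mem_nhds ((isOpen_extChartAt_source (γ 0)).mem_nhds hs)
  obtain ⟨ε, hε, hb⟩ := Metric.eventually_nhds_iff_ball.1 (h.and h1)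
  filter_upwards [Metric.ball_mem_nhds (0 : ℝ) hε] with t ht
  have hd : ∀ t ∈ Metric.ball (0 : ℝ) ε,
      HasFDerivAt (fun t => extChartAt 𝓘(ℝ, E) (γ 0) (γ t)) (0 : ℝ →L[ℝ] E) t := by
    intro t ht
    have h2 := ((contMDiffAt_extChartAt_of_mem (I := 𝓘(ℝ, E))
      (hb t ht).2).mdifferentiableAt (by simp)).hasMFDerivAt.comp t (hb t ht).1
    refine (hasMFDerivAt_iff_hasFDerivAt.1 h2).congr_fderiv ?_
    exact ContinuousLinearMap.comp_zero _
  have h3 := (convex_ball (0 : ℝ) ε).is_const_of_fderivWithin_eq_zero (𝕜 := ℝ)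
    (f := fun t => extChartAt 𝓘(ℝ, E) (γ 0) (γ t))
    (fun t ht => (hd t ht).differentiableAt.differentiableWithinAt)
    (fun t ht => by
      rw [fderivWithin_of_isOpen Metric.isOpen_ball ht, (hd t ht).fderiv]) ht
    (Metric.mem_ball_self hε)
  exact (extChartAt 𝓘(ℝ, E) (γ 0)).injOn (hb t ht).2 hs h3

end Calculus

/-! ### Infinitesimal generators of a free action -/

section GroupActions

variable {E Q EG G : Type*} [NormedAddCommGroup E] [NormedSpace ℝ E]
  [TopologicalSpace Q] [ChartedSpace E Q] [IsManifold 𝓘(ℝ, E) ∞ Q]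
  [NormedAddCommGroup EG] [NormedSpace ℝ EG]
  [TopologicalSpace G] [ChartedSpace EG G] [Group G] [LieGroup 𝓘(ℝ, EG) ∞ G]
  [MulAction G Q] [ContMDiffSMul 𝓘(ℝ, EG) 𝓘(ℝ, E) ∞ G Q]

omit [LieGroup 𝓘(ℝ, EG) ∞ G] [IsManifold 𝓘(ℝ, E) ∞ Q] in
theorem contMDiff_smul_const (q : Q) : ContMDiff 𝓘(ℝ, EG) 𝓘(ℝ, E) ∞ (fun g : G => g • q) :=
  (ContMDiffSMul.contMDiff_smul (I := 𝓘(ℝ, EG)) (I' := 𝓘(ℝ, E))).comp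
    (contMDiff_id.prodMk contMDiff_const)

omit [IsManifold 𝓘(ℝ, E) ∞ Q] [LieGroup 𝓘(ℝ, EG) ∞ G]
  [ContMDiffSMul 𝓘(ℝ, EG) 𝓘(ℝ, E) ∞ G Q] in
theorem contMDiff_const_action [h : ContMDiffSMul 𝓘(ℝ, EG) 𝓘(ℝ, E) ∞ G Q] (g : G) :
    ContMDiff 𝓘(ℝ, E) 𝓘(ℝ, E) ∞ (fun q : Q => g • q) :=
  h.contMDiff_smul.comp (contMDiff_const.prodMk contMDiff_id)

/-- Differentiate `(g * h) • q = g • (h • q)` in `h` at the identity. -/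
theorem mfderiv_orbit_mulInvariantVectorField (q : Q) (g : G) (ξ : GroupLieAlgebra 𝓘(ℝ, EG) G) :
    (show E from mfderiv 𝓘(ℝ, EG) 𝓘(ℝ, E) (fun g : G => g • q) g (mulInvariantVectorField ξ g)) =
      (show E →L[ℝ] E from tangentAction E g q) (infGen E EG G q ξ) := by
  have hL : MDifferentiableAt 𝓘(ℝ, EG) 𝓘(ℝ, EG) (fun h : G => g * h) 1 :=
    (contMDiff_mul_left (I := 𝓘(ℝ, EG)) (n := ∞)).mdifferentiableAt (by simp)
  have h1 := mfderiv_comp (I'' := 𝓘(ℝ, E)) (1 : G) (f := fun h : G => g * h)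
    (g := fun g : G => g • q) ((contMDiff_smul_const (EG := EG) q).mdifferentiableAt (by simp)) hL
  have h2 := mfderiv_comp (I := 𝓘(ℝ, EG)) (I' := 𝓘(ℝ, E)) (I'' := 𝓘(ℝ, E)) (1 : G)
    (f := fun h : G => h • q) (g := fun q : Q => g • q)
    ((contMDiff_const_action (EG := EG) g).mdifferentiableAt (by simp))
    ((contMDiff_smul_const (EG := EG) q).mdifferentiableAt (by simp))
  have e : (fun g : G => g • q) ∘ (fun h : G => g * h) =
      (fun q : Q => g • q) ∘ fun h : G => h • q := by
    funext h; exact mul_smul g h q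
  rw [e] at h1
  have h3 := congrArg (fun l : EG →L[ℝ] E => l ξ) (h1.symm.trans h2)
  have e1 := mfderiv_eq_of_eq (E := EG) (E' := E) (fun g : G => g • q) (mul_one g)
  have e2 := mfderiv_eq_of_eq (E := E) (E' := E) (fun q : Q => g • q) (one_smul G q)
  refine (congrArg (fun l : EG →L[ℝ] E => l (mulInvariantVectorField ξ g)) e1.symm).trans
    (h3.trans ?_)
  exact congrArg (fun l : E →L[ℝ] E => l (infGen E EG G q ξ)) e2

/-- The infinitesimal generators of a free action are injective. -/
theorem infGen_injective [FiniteDimensional ℝ EG] [IsCancelSMul G Q] (q : Q) :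
    Function.Injective (infGen E EG G q) := by
  have : CompleteSpace EG := FiniteDimensional.complete ℝ EG
  rw [← ContinuousLinearMap.coe_coe, ← LinearMap.ker_eq_bot, LinearMap.ker_eq_bot']
  intro ξ hξ
  have : LieGroup 𝓘(ℝ, EG) (minSmoothness ℝ 3) G := LieGroup.of_le (n := ∞) (by
    rw [minSmoothness_of_isRCLikeNormedField]; exact ENat.LEInfty.out)
  have hX := (contMDiff_mulInvariantVectorField (I := 𝓘(ℝ, EG)) ξ).of_le (m := 1) (by
    rw [minSmoothness_of_isRCLikeNormedField]; norm_num)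
  have : IsManifold 𝓘(ℝ, EG) 1 G := IsManifold.of_le (n := ∞) (by simp)
  -- `γ` is the integral curve through `1` of the left-invariant field of `ξ`. If `ξ_Q(q) = 0`, then
  -- `γ t • q` has zero velocity and is constant, so `γ` is constant by freeness and its velocity
  -- `ξ` at `1` vanishes.
  obtain ⟨γ, h0, hγ⟩ := exists_isMIntegralCurveAt_of_contMDiffAt_boundaryless 0
    (hX.contMDiffAt (x := (1 : G)))
  have h1 : ∀ᶠ t in 𝓝 (0 : ℝ), HasMFDerivAt 𝓘(ℝ, ℝ) 𝓘(ℝ, E) (fun t => γ t • q) t 0 := by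
    filter_upwards [hγ] with t ht
    have h2 := (((contMDiff_smul_const (E := E) (EG := EG) (G := G) q).mdifferentiableAt
      (x := γ t) (by simp)).hasMFDerivAt).comp t ht
    have h3 : (mfderiv 𝓘(ℝ, EG) 𝓘(ℝ, E) (fun g : G => g • q) (γ t)) ∘L
        ((1 : ℝ →L[ℝ] ℝ).smulRight (mulInvariantVectorField ξ (γ t))) = 0 := by
      ext
      have h4 := (mfderiv_orbit_mulInvariantVectorField (E := E) q (γ t) ξ).trans
        ((congrArg (show E →L[ℝ] E from tangentAction E (γ t) q) hξ).trans (map_zero _))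
      change mfderiv 𝓘(ℝ, EG) 𝓘(ℝ, E) (fun g : G => g • q) (γ t)
        ((1 : ℝ) • mulInvariantVectorField ξ (γ t)) = 0
      rw [one_smul]
      exact h4
    exact h2.congr_mfderiv h3
  have h2 : γ =ᶠ[𝓝 0] fun _ => γ 0 := by
    filter_upwards [eventually_eq_of_hasMFDerivAt_zero h1] with t ht
    exact IsCancelSMul.right_cancel _ _ _ ht
  have h3 := hγ.self_of_nhds.mfderiv
  rw [h2.mfderiv_eq, mfderiv_const] at h3
  have h4 := congrArg (fun l : ℝ →L[ℝ] EG => l 1) h3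
  have h5 : (0 : EG) = (1 : ℝ) • (show EG from mulInvariantVectorField ξ (γ 0)) := h4
  rw [one_smul, h0] at h5
  refine Eq.trans ?_ h5.symm
  have h6 : (fun h : G => 1 * h) = id := by funext h; exact one_mul h
  unfold mulInvariantVectorField
  rw [h6, mfderiv_id]
  rfl

end GroupActions

/-- Smooth dependence of derivatives on parameters. -/
theorem contMDiffAt_fderiv_param {EX HX X E E' : Type*} [NormedAddCommGroup EX] [NormedSpace ℝ EX]
    [TopologicalSpace HX] {IX : ModelWithCorners ℝ EX HX} [TopologicalSpace X] [ChartedSpace HX X]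
    [IsManifold IX ∞ X]
    [NormedAddCommGroup E] [NormedSpace ℝ E] [NormedAddCommGroup E'] [NormedSpace ℝ E']
    {f : X → E → E'} {g : X → E} {x₀ : X}
    (hf : ContMDiffAt (IX.prod 𝓘(ℝ, E)) 𝓘(ℝ, E') ∞ (Function.uncurry f) (x₀, g x₀))
    (hg : ContMDiffAt IX 𝓘(ℝ, E) ∞ g x₀) :
    ContMDiffAt IX 𝓘(ℝ, E →L[ℝ] E') ∞ (fun x => fderiv ℝ (f x) (g x)) x₀ := by
  have h3 := ContMDiffAt.mfderiv (I := 𝓘(ℝ, E)) (I' := 𝓘(ℝ, E')) (n := ∞) (m := ∞) f g hf hg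
    (by simp)
  have h4 := inTangentCoordinates_model_space (I := 𝓘(ℝ, E)) (I' := 𝓘(ℝ, E'))
    g (fun x => f x (g x)) (fun x => mfderiv 𝓘(ℝ, E) 𝓘(ℝ, E') (f x) (g x)) x₀
  refine h3.congr_of_eventuallyEq (Filter.EventuallyEq.of_eq (Eq.trans ?_ h4.symm))
  funext x
  exact mfderiv_eq_fderiv.symm

/-! ### Smoothness of the cotangent lift -/

section CotangentAction

variable {E Q EG G : Type*} [NormedAddCommGroup E] [NormedSpace ℝ E] [FiniteDimensional ℝ E]
  [TopologicalSpace Q] [ChartedSpace E Q] [IsManifold 𝓘(ℝ, E) ∞ Q]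
  [NormedAddCommGroup EG] [NormedSpace ℝ EG]
  [TopologicalSpace G] [ChartedSpace EG G] [Group G]
  [MulAction G Q]

/-- The tangent map of the action in charts. -/
noncomputable def actionCoord (q₀ q₁ : Q) (g : G) (q : Q) : E →L[ℝ] E :=
  fderiv ℝ (fun y => extChartAt 𝓘(ℝ, E) q₁ (g • (extChartAt 𝓘(ℝ, E) q₀).symm y))
    (extChartAt 𝓘(ℝ, E) q₀ q)

theorem actionCoord_dch [h : ContMDiffSMul 𝓘(ℝ, EG) 𝓘(ℝ, E) ∞ G Q] {q₀ q₁ q : Q} {g : G}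
    (hq : q ∈ (extChartAt 𝓘(ℝ, E) q₀).source)
    (hg : g • q ∈ (extChartAt 𝓘(ℝ, E) q₁).source) (v : TangentSpace 𝓘(ℝ, E) q) :
    actionCoord q₀ q₁ g q (dch E q₀ q v) = dch E q₁ (g • q) (tangentAction E g q v) := by
  obtain ⟨x, hx, rfl⟩ : ∃ x ∈ (extChartAt 𝓘(ℝ, E) q₀).target,
      (extChartAt 𝓘(ℝ, E) q₀).symm x = q :=
    ⟨_, (extChartAt 𝓘(ℝ, E) q₀).map_source hq, (extChartAt 𝓘(ℝ, E) q₀).left_inv hq⟩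
  obtain ⟨u, rfl⟩ : ∃ u, dpar q₀ x u = v := ⟨_, dpar_dch hx v⟩
  have h1 := mfderiv_comp (I' := 𝓘(ℝ, E)) (I'' := 𝓘(ℝ, E)) x (f := (extChartAt 𝓘(ℝ, E) q₀).symm)
    (g := fun q : Q => g • q)
    ((contMDiff_const_action (EG := EG) g).mdifferentiableAt (by simp))
    ((contMDiffAt_extChartAt_symm hx).mdifferentiableAt (by simp))
  have h2 := dch_mfderiv (q₀ := q₁)
    (f := (fun q : Q => g • q) ∘ (extChartAt 𝓘(ℝ, E) q₀).symm) (w := x)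
    (((contMDiff_const_action (EG := EG) g).mdifferentiableAt (by simp)).comp x
      ((contMDiffAt_extChartAt_symm hx).mdifferentiableAt (by simp))) hg u
  rw [dch_dpar hx, actionCoord, (extChartAt 𝓘(ℝ, E) q₀).right_inv hx]
  refine h2.symm.trans ?_
  exact congrArg (dch E q₁ (g • (extChartAt 𝓘(ℝ, E) q₀).symm x))
    (congrArg (fun l : E →L[ℝ] E => l u) h1)

theorem actionCoord_isInvertible [h : ContMDiffSMul 𝓘(ℝ, EG) 𝓘(ℝ, E) ∞ G Q] {q₀ q₁ q : Q} {g : G}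
    (hq : q ∈ (extChartAt 𝓘(ℝ, E) q₀).source)
    (hg : g • q ∈ (extChartAt 𝓘(ℝ, E) q₁).source) : (actionCoord (E := E) q₀ q₁ g q).IsInvertible := by
  have e : actionCoord q₀ q₁ g q =
      (dch E q₁ (g • q) ∘L tangentAction E g q) ∘L (dch E q₀ q).inverse := by
    ext v
    conv_lhs => rw [← dch_apply_inverse hq v]
    exact actionCoord_dch (EG := EG) hq hg _
  rw [e]
  exact ((dch_isInvertible hg).comp (tangentAction_isInvertible
    (mdifferentiable_action (EG := EG)) g q)).comp (dch_isInvertible hq).inverse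

theorem cotCoord_cotangentLift [h : ContMDiffSMul 𝓘(ℝ, EG) 𝓘(ℝ, E) ∞ G Q] {q₀ q₁ : Q} {g : G}
    {α : CotangentBundle E Q} (hq : α.proj ∈ (extChartAt 𝓘(ℝ, E) q₀).source)
    (hg : g • α.proj ∈ (extChartAt 𝓘(ℝ, E) q₁).source) :
    cotCoord q₁ (cotangentLift g α) = cotCoord q₀ α ∘L (actionCoord q₀ q₁ g α.proj).inverse := by
  have hi := actionCoord_isInvertible (EG := EG) hq hg
  ext w
  obtain ⟨v, rfl⟩ := hi.bijective.2 w
  have h1 : v = dch E q₀ α.proj ((dch E q₀ α.proj).inverse v) := (dch_apply_inverse hq v).symm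
  have h2 : (actionCoord q₀ q₁ g α.proj).inverse (actionCoord q₀ q₁ g α.proj v) = v :=
    hi.inverse_apply_eq.2 rfl
  change _ = cotCoord q₀ α ((actionCoord q₀ q₁ g α.proj).inverse _)
  rw [h2]
  conv_lhs => rw [h1]
  rw [actionCoord_dch (EG := EG) hq hg]
  change (cotangentLift g α).snd ((dch E q₁ (g • α.proj)).inverse
    (dch E q₁ (g • α.proj) (tangentAction E g α.proj ((dch E q₀ α.proj).inverse v)))) =
    α.snd ((dch E q₀ α.proj).inverse v)
  refine (congrArg (cotangentLift g α).snd (dch_inverse_apply hg _)).trans ?_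
  exact cotangentLift_apply (mdifferentiable_action (EG := EG)) g α _

/-- In charts the lift composes the momentum with the inverse of the tangent map of the action,
which depends smoothly on group element and point together by `contMDiffAt_fderiv_param`. -/
theorem contMDiff_cotangentLift [h : ContMDiffSMul 𝓘(ℝ, EG) 𝓘(ℝ, E) ∞ G Q]
    [IsManifold 𝓘(ℝ, EG) ∞ G] :
    ContMDiff (𝓘(ℝ, EG).prod (cotangentModel E)) (cotangentModel E) ∞
      (fun p : G × CotangentBundle E Q => cotangentLift p.1 p.2) := by
  rintro ⟨g, α⟩
  have : CompleteSpace E := FiniteDimensional.complete ℝ E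
  have hq : α.proj ∈ (extChartAt 𝓘(ℝ, E) α.proj).source := mem_extChartAt_source _
  have hg : g • α.proj ∈ (extChartAt 𝓘(ℝ, E) (g • α.proj)).source := mem_extChartAt_source _
  have hα : ContMDiffAt (𝓘(ℝ, EG).prod (cotangentModel E)) (cotangentModel E) ∞
      (fun p : G × CotangentBundle E Q => p.2) (g, α) := contMDiffAt_snd
  obtain ⟨h1, h2⟩ := (contMDiffAt_cotangent_iff (q₀ := α.proj) hq).1 hα
  have hsm : ContMDiffAt (𝓘(ℝ, EG).prod (cotangentModel E)) 𝓘(ℝ, E) ∞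
      (fun p : G × CotangentBundle E Q => p.1 • p.2.proj) (g, α) :=
    h.contMDiff_smul.contMDiffAt.comp (g, α) (contMDiffAt_fst.prodMk h1)
  refine (contMDiffAt_cotangent_iff (q₀ := g • α.proj) hg).2 ⟨hsm, ?_⟩
  have hx : ContMDiffAt (𝓘(ℝ, EG).prod (cotangentModel E)) 𝓘(ℝ, E) ∞
      (fun p : G × CotangentBundle E Q => extChartAt 𝓘(ℝ, E) α.proj p.2.proj) (g, α) :=
    (contMDiffAt_extChartAt_of_mem hq).comp (g, α) h1
  have hM : ContMDiffAt (𝓘(ℝ, EG).prod (cotangentModel E)) 𝓘(ℝ, E →L[ℝ] E) ∞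
      (fun p : G × CotangentBundle E Q =>
        actionCoord (E := E) α.proj (g • α.proj) p.1 p.2.proj) (g, α) := by
    refine contMDiffAt_fderiv_param (f := fun (p : G × CotangentBundle E Q) (y : E) =>
        extChartAt 𝓘(ℝ, E) (g • α.proj) (p.1 • (extChartAt 𝓘(ℝ, E) α.proj).symm y)) ?_ hx
    have h4 : ContMDiffAt ((𝓘(ℝ, EG).prod (cotangentModel E)).prod 𝓘(ℝ, E)) 𝓘(ℝ, E) ∞
          (fun r : (G × CotangentBundle E Q) × E =>
            r.1.1 • (extChartAt 𝓘(ℝ, E) α.proj).symm r.2)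
          ((g, α), extChartAt 𝓘(ℝ, E) α.proj α.proj) := by
      refine h.contMDiff_smul.contMDiffAt.comp _ ((contMDiffAt_fst.comp _
        contMDiffAt_fst).prodMk ?_)
      exact ContMDiffAt.comp ((g, α), extChartAt 𝓘(ℝ, E) α.proj α.proj)
        (contMDiffAt_extChartAt_symm (mem_extChartAt_target α.proj)) contMDiffAt_snd
    refine ContMDiffAt.comp _ (contMDiffAt_extChartAt_of_mem (I := 𝓘(ℝ, E)) ?_) h4
    change g • (extChartAt 𝓘(ℝ, E) α.proj).symm (extChartAt 𝓘(ℝ, E) α.proj α.proj) ∈ _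
    rw [(extChartAt 𝓘(ℝ, E) α.proj).left_inv hq]
    exact hg
  have hinv := (contDiffAt_inverse contDiffAt_id
    (actionCoord_isInvertible (EG := EG) hq hg)).contMDiffAt.comp (g, α) hM
  refine (h2.clm_comp hinv).congr_of_eventuallyEq ?_
  filter_upwards [h1.continuousAt.preimage_mem_nhds ((isOpen_extChartAt_source α.proj).mem_nhds hq),
    hsm.continuousAt.preimage_mem_nhds ((isOpen_extChartAt_source (g • α.proj)).mem_nhds hg)]
    with p hp hp'
  exact cotCoord_cotangentLift (EG := EG) hp hp'

end CotangentAction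

theorem eq_sub_apply_of_apply_eq_zero {V : Type*} [TopologicalSpace V] [AddCommGroup V]
    [Module ℝ V] (P : V →L[ℝ] V) {w v : V} (h : P v = 0) (h' : P (w - v) = w - v) :
    v = w - P w := by
  rw [map_sub, h, sub_zero] at h'
  rw [h', sub_sub_cancel]

/-! ### Smoothness of generators and the connection on `Q` -/

section LocalGenerators

variable {E Q EG G : Type*} [NormedAddCommGroup E] [NormedSpace ℝ E] [FiniteDimensional ℝ E]
  [TopologicalSpace Q] [ChartedSpace E Q] [IsManifold 𝓘(ℝ, E) ∞ Q]
  [NormedAddCommGroup EG] [NormedSpace ℝ EG] [FiniteDimensional ℝ EG]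
  [TopologicalSpace G] [ChartedSpace EG G] [Group G] [LieGroup 𝓘(ℝ, EG) ∞ G]
  [MulAction G Q] [ContMDiffSMul 𝓘(ℝ, EG) 𝓘(ℝ, E) ∞ G Q]

omit [FiniteDimensional ℝ E] [IsManifold 𝓘(ℝ, E) ∞ Q] in
theorem dch_eq_of_eq {q₀ p p' : Q} (h : p = p') :
    (show E →L[ℝ] E from dch E q₀ p) = (show E →L[ℝ] E from dch E q₀ p') := by
  subst h; rfl

variable (EG G) in
/-- The infinitesimal generators in the chart at `q₀`. -/
noncomputable def locGen (q₀ : Q) (x : E) : EG →L[ℝ] E :=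
  dch E q₀ ((extChartAt 𝓘(ℝ, E) q₀).symm x) ∘L infGen E EG G ((extChartAt 𝓘(ℝ, E) q₀).symm x)

-- The generators are the partial derivative of the smooth action in the group variable at the
-- identity, with the point of `Q` as a parameter.
variable (EG G) in
theorem contDiffAt_locGen (q₀ : Q) {x : E} (hx : x ∈ (extChartAt 𝓘(ℝ, E) q₀).target) :
    ContDiffAt ℝ ∞ (locGen EG G q₀) x := by
  let c : EG → G := (extChartAt 𝓘(ℝ, EG) (1 : G)).symm
  let e : EG := extChartAt 𝓘(ℝ, EG) (1 : G) 1
  have he : e ∈ (extChartAt 𝓘(ℝ, EG) (1 : G)).target := mem_extChartAt_target _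
  have hce : c e = 1 := (extChartAt 𝓘(ℝ, EG) (1 : G)).left_inv (mem_extChartAt_source _)
  have hc : ContMDiffAt 𝓘(ℝ, EG) 𝓘(ℝ, EG) ∞ c e := contMDiffAt_extChartAt_symm he
  have hσ := contMDiffAt_extChartAt_symm (I := 𝓘(ℝ, E)) hx
  have h1 : ContMDiffAt (𝓘(ℝ, E).prod 𝓘(ℝ, EG)) 𝓘(ℝ, E) ∞
      (fun r : E × EG => c r.2 • (extChartAt 𝓘(ℝ, E) q₀).symm r.1) (x, e) :=
    (ContMDiffSMul.contMDiff_smul (I := 𝓘(ℝ, EG)) (I' := 𝓘(ℝ, E))).contMDiffAt.comp (x, e)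
      ((ContMDiffAt.comp (x, e) hc contMDiffAt_snd).prodMk
        (ContMDiffAt.comp (x, e) hσ contMDiffAt_fst))
  have hsrc : ∀ y ∈ (extChartAt 𝓘(ℝ, E) q₀).target,
      c e • (extChartAt 𝓘(ℝ, E) q₀).symm y ∈ (extChartAt 𝓘(ℝ, E) q₀).source := by
    intro y hy
    rw [hce, one_smul]
    exact (extChartAt 𝓘(ℝ, E) q₀).map_target hy
  have h2 : ContMDiffAt 𝓘(ℝ, E) 𝓘(ℝ, EG →L[ℝ] E) ∞ (fun y => fderiv ℝ
      (fun e => extChartAt 𝓘(ℝ, E) q₀ (c e • (extChartAt 𝓘(ℝ, E) q₀).symm y)) e) x := by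
    refine contMDiffAt_fderiv_param (f := fun (y : E) (e : EG) =>
      extChartAt 𝓘(ℝ, E) q₀ (c e • (extChartAt 𝓘(ℝ, E) q₀).symm y)) (g := fun _ => e) ?_
      contMDiffAt_const
    exact ContMDiffAt.comp (x, e) (contMDiffAt_extChartAt_of_mem (hsrc x hx)) h1
  -- The partial derivative is taken in the chart of `G` at `1`; the constant factor `dch EG 1`
  -- turns Lie algebra elements into chart vectors.
  refine (h2.contDiffAt.clm_comp (contDiffAt_const
    (c := show EG →L[ℝ] EG from dch EG (1 : G) (c e)))).congr_of_eventuallyEq ?_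
  filter_upwards [(isOpen_extChartAt_target (I := 𝓘(ℝ, E)) q₀).mem_nhds hx] with y hy
  refine ContinuousLinearMap.ext fun ξ => ?_
  have hs := (contMDiff_smul_const (EG := EG) (G := G) (E := E)
    ((extChartAt 𝓘(ℝ, E) q₀).symm y)).mdifferentiableAt (x := c e) (by simp)
  have hd := hc.mdifferentiableAt (by simp)
  have h3 := dch_mfderiv (E := E) (q₀ := q₀) (hs.comp e hd) (hsrc y hy) (dch EG (1 : G) (c e) ξ)
  have h4 := mfderiv_comp e hs hd
  refine Eq.trans ?_ h3
  have h5 : mfderiv 𝓘(ℝ, EG) 𝓘(ℝ, EG) c e (dch EG (1 : G) (c e) ξ) = ξ := dpar_dch he ξ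
  have h6 := (congrArg (fun l : EG →L[ℝ] E => l (dch EG (1 : G) (c e) ξ)) h4).trans
    (congrArg (fun η : EG => (show EG →L[ℝ] E from mfderiv 𝓘(ℝ, EG) 𝓘(ℝ, E)
      (fun g : G => g • (extChartAt 𝓘(ℝ, E) q₀).symm y) (c e)) η) h5)
  have h7 := mfderiv_eq_of_eq (E := EG) (E' := E)
    (fun g : G => g • (extChartAt 𝓘(ℝ, E) q₀).symm y) hce
  have h8 := h6.trans (congrArg (fun l : EG →L[ℝ] E => l ξ) h7)
  have h9 : c e • (extChartAt 𝓘(ℝ, E) q₀).symm y = (extChartAt 𝓘(ℝ, E) q₀).symm y := by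
    rw [hce, one_smul]
  refine Eq.symm ((congrArg (fun l : E →L[ℝ] E => l _)
    (dch_eq_of_eq (E := E) (q₀ := q₀) h9)).trans ?_)
  exact congrArg (show E →L[ℝ] E from dch E q₀ ((extChartAt 𝓘(ℝ, E) q₀).symm y)) h8

/-- Vertical components of tangent vectors are infinitesimal generators of unique elements of the
Lie algebra. -/
theorem exists_vertical_connection [IsCancelSMul G Q] (R : ProjField E Q)
    (hv : ∀ q v, v - R.P q v ∈ vertical E EG G q) :
    ∃ A : ∀ q : Q, TangentSpace 𝓘(ℝ, E) q →L[ℝ] EG,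
      ∀ q v, infGen E EG G q (A q v) = v - R.P q v := by
  have : ∀ q : Q, ∃ A : TangentSpace 𝓘(ℝ, E) q →L[ℝ] EG,
      ∀ v, infGen E EG G q (A v) = v - R.P q v := by
    intro q
    have hi : Function.Injective (infGen E EG G q) := infGen_injective q
    obtain ⟨L, hL⟩ := (infGen E EG G q).toLinearMap.exists_leftInverse_of_injective
      (LinearMap.ker_eq_bot.2 hi)
    refine ⟨(show E →L[ℝ] EG from LinearMap.toContinuousLinearMap (show E →ₗ[ℝ] EG from L)) ∘L
      (ContinuousLinearMap.id ℝ _ - R.P q), fun v => ?_⟩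
    obtain ⟨ξ, hξ⟩ := hv q v
    have h1 : L (v - R.P q v) = ξ :=
      (congrArg L hξ.symm).trans (congrArg (fun l : GroupLieAlgebra 𝓘(ℝ, EG) G →ₗ[ℝ]
        GroupLieAlgebra 𝓘(ℝ, EG) G => l ξ) hL)
    exact (congrArg (infGen E EG G q) h1).trans hξ
  choose A hA using this
  exact ⟨A, hA⟩

/-- A field of covectors with values in a vector space as a 1-form. -/
noncomputable def oneForm {F : Type*} [NormedAddCommGroup F] [NormedSpace ℝ F]
    (A : ∀ q : Q, TangentSpace 𝓘(ℝ, E) q →L[ℝ] F) : DiffForm 𝓘(ℝ, E) Q 1 F := fun q =>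
  ContinuousAlternatingMap.ofSubsingleton ℝ (TangentSpace 𝓘(ℝ, E) q) F (0 : Fin 1) (A q)

variable {R : ProjField E Q} {A : ∀ q : Q, TangentSpace 𝓘(ℝ, E) q →L[ℝ] EG}
  (hA : ∀ q v, infGen E EG G q (A q v) = v - R.P q v)

include hA

/-- In a chart `A` solves `locGen ∘ A = 1 - P`, whose left factor is smooth and injective, so
`contDiffAt_of_comp_eq` applies. -/
theorem contDiffAt_connection [IsCancelSMul G Q] (q₀ : Q) {x : E}
    (hx : x ∈ (extChartAt 𝓘(ℝ, E) q₀).target) :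
    ContDiffAt ℝ ∞ (fun y => (show E →L[ℝ] EG from
      A ((extChartAt 𝓘(ℝ, E) q₀).symm y) ∘L dpar q₀ y)) x := by
  refine contDiffAt_of_comp_eq (contDiffAt_locGen EG G q₀ hx)
    (B := fun y => ContinuousLinearMap.id ℝ E - loc R.P q₀ y)
    (contDiffAt_const.sub (R.smooth q₀ x hx)) ?_ ?_
  · intro ξ η h
    refine infGen_injective (E := E) (EG := EG) (G := G) ((extChartAt 𝓘(ℝ, E) q₀).symm x) ?_
    have h1 := congrArg (dpar q₀ x) h
    exact (dpar_dch hx _).symm.trans (h1.trans (dpar_dch hx _))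
  · filter_upwards [(isOpen_extChartAt_target (I := 𝓘(ℝ, E)) q₀).mem_nhds hx] with y hy
    refine ContinuousLinearMap.ext fun v => ?_
    refine (congrArg (dch E q₀ _) (hA _ (dpar q₀ y v))).trans ?_
    rw [map_sub, dch_dpar hy]
    rfl

theorem smoothFormAt_connection [IsCancelSMul G Q] (q : Q) : SmoothFormAt (oneForm A) q :=
  smoothFormAt_of_pull (contDiffAt_connection hA q (mem_extChartAt_target q))

end LocalGenerators

/-! ### Group action, momentum map and connection form on a dual image -/

section ActionOnDualImage

variable {E Q EG G : Type*} [NormedAddCommGroup E] [NormedSpace ℝ E] [FiniteDimensional ℝ E]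
  [TopologicalSpace Q] [ChartedSpace E Q] [IsManifold 𝓘(ℝ, E) ∞ Q]
  [NormedAddCommGroup EG] [NormedSpace ℝ EG] [FiniteDimensional ℝ EG]
  [TopologicalSpace G] [ChartedSpace EG G] [Group G] [LieGroup 𝓘(ℝ, EG) ∞ G]
  [MulAction G Q] [ContMDiffSMul 𝓘(ℝ, EG) 𝓘(ℝ, E) ∞ G Q]
  {EN : Type*} [NormedAddCommGroup EN] [NormedSpace ℝ EN]
  {R : ProjField E Q} {N : Set (CotangentBundle E Q)} [ChartedSpace EN N]
  [IsManifold 𝓘(ℝ, EN) ∞ N] [MulAction G N] (hN : R.IsDualImage EN N)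
  (hact : ∀ (g : G) (m : N), (g • m).1 = cotangentLift g m.1)

include hact

theorem baseProj_smul (g : G) (m : N) : baseProj N (g • m) = g • baseProj N m :=
  congrArg Bundle.TotalSpace.proj (hact g m)

include hN

namespace ProjField.IsDualImage

omit [FiniteDimensional ℝ EG] in
theorem contMDiffSMul : ContMDiffSMul 𝓘(ℝ, EG) 𝓘(ℝ, EN) ∞ G N := by
  refine ⟨fun p => hN.contMDiffAt_iff.2 ?_⟩
  simp only [hact]
  exact (contMDiff_cotangentLift (E := E) (EG := EG) (G := G)).contMDiffAt.comp p
    (contMDiffAt_fst.prodMk (hN.contMDiff_val.contMDiffAt.comp p contMDiffAt_snd))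

omit [FiniteDimensional ℝ EG] in
theorem mfderiv_baseProj_infGen (m : N) (ξ : GroupLieAlgebra 𝓘(ℝ, EG) G) :
    mfderiv 𝓘(ℝ, EN) 𝓘(ℝ, E) (baseProj N) m (infGen EN EG G m ξ) =
      infGen E EG G (baseProj N m) ξ := by
  have := hN.contMDiffSMul (EG := EG) hact
  have h1 := mfderiv_comp (I := 𝓘(ℝ, EG)) (I' := 𝓘(ℝ, EN)) (I'' := 𝓘(ℝ, E)) (1 : G)
    (g := baseProj N) (f := fun g : G => g • m)
    (hN.contMDiff_baseProj.mdifferentiableAt (by simp))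
    ((contMDiff_smul_const (EG := EG) m).mdifferentiableAt (by simp))
  have h2 : baseProj N ∘ (fun g : G => g • m) = fun g : G => g • baseProj N m :=
    funext fun g => baseProj_smul hact g m
  rw [h2] at h1
  have h3 := mfderiv_eq_of_eq (E := EN) (E' := E) (baseProj N) (one_smul G m)
  exact (congrArg (fun l : EN →L[ℝ] E => l (infGen EN EG G m ξ)) h3.symm).trans
    (congrArg (fun l : EG →L[ℝ] E => l ξ) h1).symm

omit [FiniteDimensional ℝ EG] in
theorem momentum_apply (m : N) (ξ : EG) :
    momentum EN EG G N m ξ = m.1.snd (infGen E EG G (baseProj N m) ξ) :=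
  (hN.lin_restrictedLiouville m (infGen EN EG G m ξ)).trans
    (congrArg m.1.snd (hN.mfderiv_baseProj_infGen hact m ξ))

theorem contMDiff_momentum :
    ContMDiff 𝓘(ℝ, EN) 𝓘(ℝ, EG →L[ℝ] ℝ) ∞ (momentum EN EG G N) := by
  intro m
  have hm : baseProj N m ∈ (extChartAt 𝓘(ℝ, E) (baseProj N m)).source := mem_extChartAt_source _
  obtain ⟨h1, h2⟩ := (contMDiffAt_cotangent_iff (q₀ := baseProj N m)
    (f := (Subtype.val : N → _)) hm).1 hN.contMDiff_val.contMDiffAt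
  have h3 : ContMDiffAt 𝓘(ℝ, EN) 𝓘(ℝ, EG →L[ℝ] E) ∞ (fun m' : N =>
      locGen EG G (baseProj N m) (extChartAt 𝓘(ℝ, E) (baseProj N m) m'.1.proj)) m :=
    (contDiffAt_locGen EG G (baseProj N m) (mem_extChartAt_target _)).contMDiffAt.comp m
      ((contMDiffAt_extChartAt_of_mem hm).comp m h1)
  refine (h2.clm_comp h3).congr_of_eventuallyEq ?_
  filter_upwards [h1.continuousAt.preimage_mem_nhds
    ((isOpen_extChartAt_source (baseProj N m)).mem_nhds hm)] with m' hm'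
  refine ContinuousLinearMap.ext fun ξ => (hN.momentum_apply hact m' ξ).trans ?_
  have key : ∀ q : Q, q = m'.1.proj → (show E →L[ℝ] ℝ from m'.1.snd)
      (infGen E EG G (baseProj N m') ξ) = (show E →L[ℝ] ℝ from m'.1.snd)
      ((show E →L[ℝ] E from (dch E (baseProj N m) m'.1.proj).inverse)
        ((show E →L[ℝ] E from dch E (baseProj N m) q) (infGen E EG G q ξ))) := by
    rintro q rfl
    exact congrArg m'.1.snd (dch_inverse_apply hm' _).symm
  exact key _ ((extChartAt 𝓘(ℝ, E) (baseProj N m)).left_inv hm')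

variable {A : ∀ q : Q, TangentSpace 𝓘(ℝ, E) q →L[ℝ] EG} {P : ProjField E Q}
  (hA : ∀ q v, infGen E EG G q (A q v) = v - P.P q v)
  {D W : ∀ q : Q, Submodule ℝ (TangentSpace 𝓘(ℝ, E) q)}
  (hD : ∀ q v, v ∈ D q ↔ P.P q v = v) (hW : ∀ q v, v ∈ W q ↔ P.P q v = 0)

include hA hD hW

omit hA hD hW in
omit [FiniteDimensional ℝ EG] in
theorem infGen_mem_liftedDistribution (m : N) (ξ : GroupLieAlgebra 𝓘(ℝ, EG) G) :
    infGen EN EG G m ξ ∈ liftedDistribution N W m ↔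
      infGen E EG G (baseProj N m) ξ ∈ W (baseProj N m) := by
  rw [← hN.mfderiv_baseProj_infGen hact]
  rfl

omit hA hD hW in
omit [FiniteDimensional ℝ EG] in
theorem sub_infGen_mem_liftedDistribution (m : N) (v : TangentSpace 𝓘(ℝ, EN) m)
    (ξ : GroupLieAlgebra 𝓘(ℝ, EG) G) :
    v - infGen EN EG G m ξ ∈ liftedDistribution N D m ↔
      mfderiv 𝓘(ℝ, EN) 𝓘(ℝ, E) (baseProj N) m v - infGen E EG G (baseProj N m) ξ ∈
        D (baseProj N m) := by
  rw [← hN.mfderiv_baseProj_infGen hact, ← map_sub]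
  rfl

/-- Membership of a generator in `𝒲`, and of the remainder in `𝒞`, can be tested after projection to
`Q`. There the two conditions force the generator to be `w - P w`, and injectivity of generators
fixes `𝒜`. So `𝒜` is pulled back from the base and is smooth. -/
theorem connectionForm_eq [IsCancelSMul G Q] :
    connectionForm (EN := EN) EG G N D W =
      pullback (I := 𝓘(ℝ, EN)) (I' := 𝓘(ℝ, E)) (baseProj N) (oneForm A) := by
  funext m
  have hex : ∃ A : TangentSpace 𝓘(ℝ, EN) m →L[ℝ] EG, ∀ v,
      infGen EN EG G m (A v) ∈ verticalLift EG G N W m ∧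
      v - infGen EN EG G m (A v) ∈ liftedDistribution N D m := by
    refine ⟨A (baseProj N m) ∘L mfderiv 𝓘(ℝ, EN) 𝓘(ℝ, E) (baseProj N) m,
      fun v => ⟨⟨⟨_, rfl⟩, (hN.infGen_mem_liftedDistribution hact m _).2 ?_⟩,
        (hN.sub_infGen_mem_liftedDistribution hact m v _).2 ?_⟩⟩
    · refine (hW _ _).2 ((congrArg (P.P (baseProj N m)) (hA _ _)).trans ?_)
      rw [map_sub, P.idem, sub_self]
    · have e := (congrArg (fun w => mfderiv 𝓘(ℝ, EN) 𝓘(ℝ, E) (baseProj N) m v - w)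
        (hA (baseProj N m) (mfderiv 𝓘(ℝ, EN) 𝓘(ℝ, E) (baseProj N) m v))).trans
        (sub_sub_cancel _ _)
      exact (congrArg (fun w => w ∈ D (baseProj N m)) e).mpr ((hD _ _).2 (P.idem _ _))
  rw [connectionForm, dif_pos hex]
  have h2 : hex.choose = A (baseProj N m) ∘L mfderiv 𝓘(ℝ, EN) 𝓘(ℝ, E) (baseProj N) m := by
    refine ContinuousLinearMap.ext fun v => ?_
    obtain ⟨⟨-, h3⟩, h4⟩ := hex.choose_spec v
    have h3' := (hW _ _).1 ((hN.infGen_mem_liftedDistribution hact m _).1 h3)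
    have h4' := (hD _ _).1 ((hN.sub_infGen_mem_liftedDistribution hact m v _).1 h4)
    refine infGen_injective (E := E) (EG := EG) (G := G) (baseProj N m) ?_
    refine Eq.trans ?_ (hA (baseProj N m) (mfderiv 𝓘(ℝ, EN) 𝓘(ℝ, E) (baseProj N) m v)).symm
    exact eq_sub_apply_of_apply_eq_zero _ h3' h4'
  rw [h2]
  rfl

end ProjField.IsDualImage
end ActionOnDualImage

/-! ### Comparison of Liouville and canonical forms on `M` and `W°` -/

section Gauge

variable {E Q EG G : Type*} [NormedAddCommGroup E] [NormedSpace ℝ E] [FiniteDimensional ℝ E]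
  [TopologicalSpace Q] [ChartedSpace E Q] [IsManifold 𝓘(ℝ, E) ∞ Q]
  [NormedAddCommGroup EG] [NormedSpace ℝ EG] [FiniteDimensional ℝ EG]
  [TopologicalSpace G] [ChartedSpace EG G] [Group G] [LieGroup 𝓘(ℝ, EG) ∞ G]
  [MulAction G Q] [ContMDiffSMul 𝓘(ℝ, EG) 𝓘(ℝ, E) ∞ G Q] [IsCancelSMul G Q]
  {EM E₀ : Type*} [NormedAddCommGroup EM] [NormedSpace ℝ EM]
  [NormedAddCommGroup E₀] [NormedSpace ℝ E₀]
  {R P : ProjField E Q} {M N₀ : Set (CotangentBundle E Q)} [ChartedSpace EM M]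
  [IsManifold 𝓘(ℝ, EM) ∞ M] [ChartedSpace E₀ N₀] [IsManifold 𝓘(ℝ, E₀) ∞ N₀]
  [MulAction G M] (hM : R.IsDualImage EM M) (hN : P.IsDualImage E₀ N₀)
  (hact : ∀ (g : G) (m : M), (g • m).1 = cotangentLift g m.1)
  {A : ∀ q : Q, TangentSpace 𝓘(ℝ, E) q →L[ℝ] EG}
  (hA : ∀ q v, infGen E EG G q (A q v) = v - P.P q v)
  {D W : ∀ q : Q, Submodule ℝ (TangentSpace 𝓘(ℝ, E) q)}
  (hD : ∀ q v, v ∈ D q ↔ P.P q v = v) (hW : ∀ q v, v ∈ W q ↔ P.P q v = 0)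

namespace ProjField.IsDualImage

/-- The retraction onto `N₀` restricted to `M`. -/
noncomputable def transfer (hN : P.IsDualImage E₀ N₀) (m : M) : N₀ := hN.retr m.1

include hM in
theorem contMDiff_transfer :
    ContMDiff 𝓘(ℝ, EM) 𝓘(ℝ, E₀) ∞ (hN.transfer : M → N₀) :=
  hN.contMDiff_retr.comp hM.contMDiff_val

include hM in
theorem mfderiv_baseProj_transfer (m : M) (X : TangentSpace 𝓘(ℝ, EM) m) :
    mfderiv 𝓘(ℝ, E₀) 𝓘(ℝ, E) (baseProj N₀) (hN.transfer m)
      (mfderiv 𝓘(ℝ, EM) 𝓘(ℝ, E₀) hN.transfer m X) =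
      mfderiv 𝓘(ℝ, EM) 𝓘(ℝ, E) (baseProj M) m X := by
  have h1 := mfderiv_comp m
    (hN.contMDiff_baseProj.mdifferentiableAt (x := hN.transfer m) (by simp))
    ((contMDiff_transfer hM hN).mdifferentiableAt (by simp))
  exact (congrArg (fun l : EM →L[ℝ] E => l X) h1).symm

-- The transfer covers the identity of `Q`, so tangent vectors keep their projection to `TQ`.
include hM in
theorem mfderiv_transfer_mem (m : M) (X : TangentSpace 𝓘(ℝ, EM) m) :
    mfderiv 𝓘(ℝ, EM) 𝓘(ℝ, E₀) hN.transfer m X ∈ liftedDistribution N₀ D (hN.transfer m) ↔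
      X ∈ liftedDistribution M D m := by
  have h := mfderiv_baseProj_transfer hM hN m X
  exact iff_of_eq (congrArg (fun w => w ∈ D (baseProj M m)) h)

section connection

omit [IsCancelSMul G Q] [LieGroup 𝓘(ℝ, EG) ∞ G] in
theorem connection_eq_zero_iff [LieGroup 𝓘(ℝ, EG) ∞ G] [IsCancelSMul G Q]
    (hA : ∀ q v, infGen E EG G q (A q v) = v - P.P q v) (q : Q) (v : TangentSpace 𝓘(ℝ, E) q) :
    A q v = 0 ↔ P.P q v = v := by
  have h := hA q v
  constructor
  · intro h0
    have h1 : infGen E EG G q (A q v) = 0 := (congrArg (infGen E EG G q) h0).trans (map_zero _)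
    exact (sub_eq_zero.1 (h.symm.trans h1)).symm
  · intro h0
    refine infGen_injective (E := E) (EG := EG) (G := G) q (h.trans ?_)
    rw [h0, sub_self]
    exact (map_zero _).symm

include hM hact hA hD hW

theorem lin_connectionForm (m : M) (X : TangentSpace 𝓘(ℝ, EM) m) :
    lin (connectionForm (EN := EM) EG G M D W) m X =
      A (baseProj M m) (mfderiv 𝓘(ℝ, EM) 𝓘(ℝ, E) (baseProj M) m X) := by
  rw [hM.connectionForm_eq hact hA hD hW]
  rfl

theorem smoothFormAt_connectionForm (m : M) :
    SmoothFormAt (connectionForm (EN := EM) EG G M D W) m := by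
  rw [hM.connectionForm_eq hact hA hD hW]
  exact smoothFormAt_pullback hM.contMDiff_baseProj.contMDiffAt (smoothFormAt_connection hA _)

theorem mfderiv_projC (m : M) (X : TangentSpace 𝓘(ℝ, EM) m) :
    mfderiv 𝓘(ℝ, EM) 𝓘(ℝ, E) (baseProj M) m (projC EG G M D W m X) =
      P.P (baseProj M m) (mfderiv 𝓘(ℝ, EM) 𝓘(ℝ, E) (baseProj M) m X) := by
  have h1 : projC EG G M D W m X =
    X - infGen EM EG G m (lin (connectionForm (EN := EM) EG G M D W) m X) := rfl
  rw [h1, map_sub]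
  refine (congrArg (fun w => _ - w) ((hM.mfderiv_baseProj_infGen hact m _).trans ?_)).trans
    (sub_sub_cancel _ _)
  exact (congrArg (infGen E EG G (baseProj M m))
    (hM.lin_connectionForm hact hA hD hW m X)).trans (hA _ _)

theorem projC_mem (m : M) (X : TangentSpace 𝓘(ℝ, EM) m) :
    projC EG G M D W m X ∈ liftedDistribution M D m := by
  have h := hM.mfderiv_projC hact hA hD hW m X
  exact (congrArg (fun w => w ∈ D (baseProj M m)) h).mpr ((hD _ _).2 (P.idem _ _))

theorem lin_connectionForm_eq_zero_iff (m : M) (X : TangentSpace 𝓘(ℝ, EM) m) :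
    lin (connectionForm (EN := EM) EG G M D W) m X = 0 ↔ X ∈ liftedDistribution M D m := by
  rw [hM.lin_connectionForm hact hA hD hW, connection_eq_zero_iff hA, ← hD]
  rfl

theorem projC_of_mem {m : M} {X : TangentSpace 𝓘(ℝ, EM) m} (hX : X ∈ liftedDistribution M D m) :
    projC EG G M D W m X = X := by
  have h1 : projC EG G M D W m X =
    X - infGen EM EG G m (lin (connectionForm (EN := EM) EG G M D W) m X) := rfl
  have h2 := congrArg (infGen EM EG G m)
    ((hM.lin_connectionForm_eq_zero_iff hact hA hD hW m X).2 hX)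
  rw [h1]
  exact (congrArg (fun w => X - w) (h2.trans (map_zero _))).trans (sub_zero X)

include hN

/-- The Liouville forms of `M` and `N₀` differ by the momentum-connection pairing. -/
theorem lin_liouville_transfer (m : M) (X : TangentSpace 𝓘(ℝ, EM) m) :
    lin (restrictedLiouville M) m X =
      lin (restrictedLiouville N₀) (hN.transfer m)
        (mfderiv 𝓘(ℝ, EM) 𝓘(ℝ, E₀) hN.transfer m X) +
      momentum EM EG G M m (lin (connectionForm (EN := EM) EG G M D W) m X) := by
  rw [hM.momentum_apply hact, hN.lin_restrictedLiouville, hM.lin_restrictedLiouville,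
    hM.lin_connectionForm hact hA hD hW]
  have h1 := hA (baseProj M m) (mfderiv 𝓘(ℝ, EM) 𝓘(ℝ, E) (baseProj M) m X)
  have h2 := mfderiv_baseProj_transfer hM hN m X
  have h3 := congrArg (hN.transfer m).1.snd h2
  have h4 := congrArg m.1.snd h1
  -- With `w = Tτ X` and `α = m`, this is `α(P w) + α(w - P w) = α(w)`.
  refine Eq.symm ((congrArg₂ (· + ·) h3 h4).trans ?_)
  refine (map_add m.1.snd _ _).symm.trans (congrArg m.1.snd ?_)
  exact add_sub_cancel _ _

/-- Exterior derivative of `Θ_M = Ψ^*Θ_{N₀} + ⟨J, 𝒜⟩`. The term `dJ ∧ 𝒜` vanishes on `𝒞 = ker 𝒜`,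
leaving `⟨J, d𝒜⟩`; the sign comes from `Ω = -dΘ`. -/
theorem restrictedForm_transfer {m : M} {X Y : TangentSpace 𝓘(ℝ, EM) m}
    (hX : X ∈ liftedDistribution M D m) (hY : Y ∈ liftedDistribution M D m) :
    restrictedForm N₀ (hN.transfer m) ![mfderiv 𝓘(ℝ, EM) 𝓘(ℝ, E₀) hN.transfer m X,
      mfderiv 𝓘(ℝ, EM) 𝓘(ℝ, E₀) hN.transfer m Y] =
      restrictedForm M m ![X, Y] +
        momentum EM EG G M m (extd (connectionForm (EN := EM) EG G M D W) m ![X, Y]) := by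
  have hT := contMDiff_transfer hM hN
  rw [← hM.lin_connectionForm_eq_zero_iff hact hA hD hW] at hX hY
  rw [hN.restrictedForm_eq, hM.restrictedForm_eq]
  obtain ⟨σ, z, hσ, rfl, hsurj⟩ := exists_param (I := 𝓘(ℝ, EM)) m
  obtain ⟨u, rfl⟩ := hsurj X
  obtain ⟨v, rfl⟩ := hsurj Y
  have hσ' := hσ.mdifferentiableAt (by simp)
  have hTσ := hT.contMDiffAt.comp z hσ
  have hs₁ := hM.smoothFormAt_restrictedLiouville (σ z)
  have hs₂ := hN.smoothFormAt_restrictedLiouville (hN.transfer (σ z))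
  have hs₃ := hM.smoothFormAt_connectionForm hact hA hD hW (σ z)
  have c1 := curl_pull hσ hs₁ u v
  have c2 := curl_pull hTσ hs₂ u v
  have c3 := curl_pull hσ hs₃ u v
  have d2 := (smoothFormAt_pull hTσ hs₂).differentiableAt (by simp)
  have d3 := (smoothFormAt_pull hσ hs₃).differentiableAt (by simp)
  have dJ : DifferentiableAt ℝ (fun w => momentum EM EG G M (σ w)) z :=
    (((hM.contMDiff_momentum hact).contMDiffAt.comp z hσ).contDiffAt).differentiableAt (by simp)
  have e : pull σ (restrictedLiouville (EN := EM) M) =ᶠ[𝓝 z] fun w =>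
      pull (hN.transfer ∘ σ) (restrictedLiouville (EN := E₀) N₀) w +
        momentum EM EG G M (σ w) ∘L pull σ (connectionForm (EN := EM) EG G M D W) w := by
    filter_upwards [eventually_mdifferentiableAt hσ] with w hw
    refine ContinuousLinearMap.ext fun t => ?_
    have h1 := mfderiv_comp w (hT.mdifferentiableAt (x := σ w) (by simp)) hw
    refine (hM.lin_liouville_transfer hN hact hA hD hW (σ w)
      (mfderiv 𝓘(ℝ, EM) 𝓘(ℝ, EM) σ w t)).trans ?_
    refine congrArg₂ (· + ·) ?_ rfl
    exact congrArg (lin (restrictedLiouville N₀) (hN.transfer (σ w)))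
      (congrArg (fun l : EM →L[ℝ] E₀ => l t) h1).symm
  -- `hX` and `hY` have become the vanishing of `𝒜` on both arguments.
  have key := curl_add_clm_comp d2 dJ d3 e (u := u) (v := v) hX hY
  have h1 := mfderiv_comp z (hT.mdifferentiableAt (x := σ z) (by simp)) hσ'
  have hu := congrArg (fun l : EM →L[ℝ] E₀ => l u) h1
  have hv := congrArg (fun l : EM →L[ℝ] E₀ => l v) h1
  have c2' : curl (pull (hN.transfer ∘ σ) (restrictedLiouville (EN := E₀) N₀)) z u v =
      extd (restrictedLiouville N₀) (hN.transfer (σ z))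
        ![mfderiv 𝓘(ℝ, EM) 𝓘(ℝ, E₀) hN.transfer (σ z) (mfderiv 𝓘(ℝ, EM) 𝓘(ℝ, EM) σ z u),
          mfderiv 𝓘(ℝ, EM) 𝓘(ℝ, E₀) hN.transfer (σ z) (mfderiv 𝓘(ℝ, EM) 𝓘(ℝ, EM) σ z v)] :=
    c2.trans (congrArg (extd (restrictedLiouville N₀) (hN.transfer (σ z)))
      (congrArg₂ (fun a b : E₀ => ![a, b]) hu hv))
  rw [c1, c2', c3] at key
  rw [key]
  ring

/-- The pairing of momentum and curvature measures the difference of the canonical forms. -/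
theorem pairingJK_apply (m : M) (X Y : TangentSpace 𝓘(ℝ, EM) m) :
    pairingJK EG G M D W m ![X, Y] =
      restrictedForm N₀ (hN.transfer m)
        ![mfderiv 𝓘(ℝ, EM) 𝓘(ℝ, E₀) hN.transfer m (projC EG G M D W m X),
          mfderiv 𝓘(ℝ, EM) 𝓘(ℝ, E₀) hN.transfer m (projC EG G M D W m Y)] -
      restrictedForm M m ![projC EG G M D W m X, projC EG G M D W m Y] := by
  rw [hM.restrictedForm_transfer hN hact hA hD hW (hM.projC_mem hact hA hD hW m X)
    (hM.projC_mem hact hA hD hW m Y), add_sub_cancel_left]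
  exact congrArg (momentum EM EG G M m) (two_comp _ _ _ _)

/-- On `𝒞` the projection `P_𝒞` is the identity, so the curvature term there is exactly the defect
between the two canonical forms. -/
theorem totalForm_transfer {m : M} {X Y : TangentSpace 𝓘(ℝ, EM) m}
    (hX : X ∈ liftedDistribution M D m) (hY : Y ∈ liftedDistribution M D m) :
    restrictedForm N₀ (hN.transfer m) ![mfderiv 𝓘(ℝ, EM) 𝓘(ℝ, E₀) hN.transfer m X,
      mfderiv 𝓘(ℝ, EM) 𝓘(ℝ, E₀) hN.transfer m Y] =
      (restrictedForm M + pairingJK EG G M D W : DiffForm 𝓘(ℝ, EM) M 2 ℝ) m ![X, Y] := by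
  change _ = restrictedForm M m ![X, Y] + pairingJK EG G M D W m ![X, Y]
  rw [hM.pairingJK_apply hN hact hA hD hW, hM.projC_of_mem hact hA hD hW hX,
    hM.projC_of_mem hact hA hD hW hY, add_sub_cancel]

end connection

end ProjField.IsDualImage
end Gauge

/-! ### Transfer of nondegeneracy, bivectors and brackets -/

section GaugeBrackets

variable {E Q EG G : Type*} [NormedAddCommGroup E] [NormedSpace ℝ E] [FiniteDimensional ℝ E]
  [TopologicalSpace Q] [ChartedSpace E Q] [IsManifold 𝓘(ℝ, E) ∞ Q]
  [NormedAddCommGroup EG] [NormedSpace ℝ EG] [FiniteDimensional ℝ EG]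
  [TopologicalSpace G] [ChartedSpace EG G] [Group G] [LieGroup 𝓘(ℝ, EG) ∞ G]
  [MulAction G Q] [ContMDiffSMul 𝓘(ℝ, EG) 𝓘(ℝ, E) ∞ G Q] [IsCancelSMul G Q]
  {EM E₀ : Type*} [NormedAddCommGroup EM] [NormedSpace ℝ EM] [FiniteDimensional ℝ EM]
  [NormedAddCommGroup E₀] [NormedSpace ℝ E₀] [FiniteDimensional ℝ E₀]
  {R P : ProjField E Q} {M N₀ : Set (CotangentBundle E Q)} [ChartedSpace EM M]
  [IsManifold 𝓘(ℝ, EM) ∞ M] [ChartedSpace E₀ N₀] [IsManifold 𝓘(ℝ, E₀) ∞ N₀]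
  [MulAction G M] (hM : R.IsDualImage EM M) (hN : P.IsDualImage E₀ N₀)
  (h : ∀ q v, P.P q (R.P q v) = R.P q v) (h' : ∀ q v, R.P q (P.P q v) = P.P q v)
  {D W : ∀ q : Q, Submodule ℝ (TangentSpace 𝓘(ℝ, E) q)}

namespace ProjField.IsDualImage

include h h' hM

omit [FiniteDimensional ℝ EM] [FiniteDimensional ℝ E₀] [MulAction G M] in
theorem bijective_mfderiv_transfer (m : M) :
    Function.Bijective (mfderiv 𝓘(ℝ, EM) 𝓘(ℝ, E₀) hN.transfer m) := by
  have e := ((hM.diffeo hN h h').mfderivToContinuousLinearEquiv (by simp) m).bijective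
  rw [← ContinuousLinearEquiv.coe_coe, Diffeomorph.mfderivToContinuousLinearEquiv_coe] at e
  exact e

omit [FiniteDimensional ℝ EM] [FiniteDimensional ℝ E₀] [MulAction G M] in
theorem exists_mfderiv_transfer_eq {m : M} {Y : TangentSpace 𝓘(ℝ, E₀) (hN.transfer m)}
    (hY : Y ∈ liftedDistribution N₀ D (hN.transfer m)) :
    ∃ X ∈ liftedDistribution M D m, mfderiv 𝓘(ℝ, EM) 𝓘(ℝ, E₀) hN.transfer m X = Y := by
  obtain ⟨X, rfl⟩ := (bijective_mfderiv_transfer hM hN h h' m).2 Y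
  exact ⟨X, (mfderiv_transfer_mem hM hN m X).1 hY, rfl⟩

variable (hact : ∀ (g : G) (m : M), (g • m).1 = cotangentLift g m.1)
  {A : ∀ q : Q, TangentSpace 𝓘(ℝ, E) q →L[ℝ] EG}
  (hA : ∀ q v, infGen E EG G q (A q v) = v - P.P q v)
  (hD : ∀ q v, v ∈ D q ↔ P.P q v = v) (hW : ∀ q v, v ∈ W q ↔ P.P q v = 0)

include hact hA hD hW hN

-- Inherited from the canonical form on `N₀`, because the tangent map of the transfer is bijective,
-- matches the distributions, and pulls the form back to the total form.
omit [FiniteDimensional ℝ EM] [FiniteDimensional ℝ E₀] in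
theorem nondegenerateOn_totalForm : NondegenerateOn (liftedDistribution (EN := EM) M D)
    (restrictedForm M + pairingJK EG G M D W) := by
  intro m X hX h0
  refine (bijective_mfderiv_transfer hM hN h h' m).1 (Eq.trans ?_ (map_zero _).symm)
  refine hN.nondegenerateOn hD (hN.transfer m) _ ((mfderiv_transfer_mem hM hN m X).2 hX)
    fun Y hY => ?_
  obtain ⟨Y', hY', rfl⟩ := exists_mfderiv_transfer_eq hM hN h h' hY
  exact (hM.totalForm_transfer hN hact hA hD hW hX hY').trans (h0 Y' hY')

omit [FiniteDimensional ℝ E₀] in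
theorem map_sharp_totalForm (m : M) (α : TangentSpace 𝓘(ℝ, E₀) (hN.transfer m) →L[ℝ] ℝ) :
    mfderiv 𝓘(ℝ, EM) 𝓘(ℝ, E₀) hN.transfer m
      (sharp (liftedDistribution M D) (restrictedForm M + pairingJK EG G M D W) m
        (α ∘L mfderiv 𝓘(ℝ, EM) 𝓘(ℝ, E₀) hN.transfer m)) =
      sharp (liftedDistribution N₀ D) (restrictedForm N₀) (hN.transfer m) α :=
  map_sharp _ (nondegenerateOn_totalForm hM hN h h' hact hA hD hW m)
    (hN.nondegenerateOn hD _) (fun X hX => (mfderiv_transfer_mem hM hN m X).2 hX)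
    (fun _ hY => exists_mfderiv_transfer_eq hM hN h h' hY)
    (fun _ hX _ hY => hM.totalForm_transfer hN hact hA hD hW hX hY) α

omit [FiniteDimensional ℝ E₀] in
theorem bracket_totalForm {f g : N₀ → ℝ} (hf : ContMDiff 𝓘(ℝ, E₀) 𝓘(ℝ, ℝ) ∞ f)
    (hg : ContMDiff 𝓘(ℝ, E₀) 𝓘(ℝ, ℝ) ∞ g) :
    bracket (liftedDistribution (EN := EM) M D) (restrictedForm M + pairingJK EG G M D W)
      (f ∘ hN.transfer) (g ∘ hN.transfer) =
      bracket (liftedDistribution (EN := E₀) N₀ D) (restrictedForm N₀) f g ∘ hN.transfer := by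
  funext m
  have hT := (contMDiff_transfer hM hN).mdifferentiableAt (x := m) (by simp)
  have e : ∀ {f : N₀ → ℝ}, ContMDiff 𝓘(ℝ, E₀) 𝓘(ℝ, ℝ) ∞ f →
      dfun 𝓘(ℝ, EM) (f ∘ hN.transfer) m =
      dfun 𝓘(ℝ, E₀) f (hN.transfer m) ∘L mfderiv 𝓘(ℝ, EM) 𝓘(ℝ, E₀) hN.transfer m :=
    fun hf => mfderiv_comp m (hf.mdifferentiableAt (by simp)) hT
  change dfun 𝓘(ℝ, EM) (g ∘ hN.transfer) m (sharp _ _ m (dfun 𝓘(ℝ, EM) (f ∘ hN.transfer) m)) = _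
  rw [e hf, e hg]
  exact congrArg (dfun 𝓘(ℝ, E₀) g (hN.transfer m))
    (map_sharp_totalForm hM hN h h' hact hA hD hW m _)

-- Smoothness of the bracket is not computed on `M`: every function on `M` is a function on `N₀`
-- composed with the diffeomorphism, and the brackets correspond.
omit [FiniteDimensional ℝ E₀] in
theorem isAlmostPoissonBracket_totalForm : IsAlmostPoissonBracket 𝓘(ℝ, EM)
    (bracket (liftedDistribution (EN := EM) M D)
      (restrictedForm M + pairingJK EG G M D W)) := by
  refine isAlmostPoissonBracket_of_smooth
    (nondegenerateOn_totalForm hM hN h h' hact hA hD hW) fun f g hf hg => ?_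
  have hs := (hM.diffeo hN h h').symm.contMDiff
  have e : ∀ f : M → ℝ, f = (f ∘ (hM.diffeo hN h h').symm) ∘ hN.transfer := fun f =>
    funext fun m => congrArg f ((hM.diffeo hN h h').symm_apply_apply m).symm
  rw [e f, e g, bracket_totalForm hM hN h h' hact hA hD hW (hf.comp hs) (hg.comp hs)]
  exact (hN.contMDiff_bracket hD (hf.comp hs) (hg.comp hs)).comp (contMDiff_transfer hM hN)

end ProjField.IsDualImage

theorem ProjField.IsDualImage.isAlmostPoissonBracket (hN : P.IsDualImage E₀ N₀)
    (hD : ∀ q v, v ∈ D q ↔ P.P q v = v) : IsAlmostPoissonBracket 𝓘(ℝ, E₀)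
    (bracket (liftedDistribution (EN := E₀) N₀ D) (restrictedForm N₀)) :=
  isAlmostPoissonBracket_of_smooth (hN.nondegenerateOn hD)
    fun _ _ hf hg => hN.contMDiff_bracket hD hf hg

end GaugeBrackets

/-! ### Local sections of submersions and curves in their fibres -/

section Submersions

variable {E P E' P' : Type*} [NormedAddCommGroup E] [NormedSpace ℝ E]
  [TopologicalSpace P] [ChartedSpace E P] [IsManifold 𝓘(ℝ, E) ∞ P]
  [NormedAddCommGroup E'] [NormedSpace ℝ E']
  [TopologicalSpace P'] [ChartedSpace E' P'] [IsManifold 𝓘(ℝ, E') ∞ P']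

/-- Tangent vectors are represented by curves. -/
theorem exists_curve (x : P) (v : TangentSpace 𝓘(ℝ, E) x) :
    ∃ γ : ℝ → P, ContMDiffAt 𝓘(ℝ, ℝ) 𝓘(ℝ, E) ∞ γ 0 ∧ γ 0 = x ∧
      (show E from mfderiv 𝓘(ℝ, ℝ) 𝓘(ℝ, E) γ 0 (1 : ℝ)) = v := by
  obtain ⟨σ, z, hσ, rfl, hs⟩ := exists_param (I := 𝓘(ℝ, E)) x
  obtain ⟨u, rfl⟩ : ∃ u : E, mfderiv 𝓘(ℝ, E) 𝓘(ℝ, E) σ z u = v := hs v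
  have hl : HasFDerivAt (fun t : ℝ => z + t • u)
      ((ContinuousLinearMap.id ℝ ℝ).smulRight u) 0 :=
    ((hasFDerivAt_id (0 : ℝ)).smul_const u).const_add z
  have hz : z + (0 : ℝ) • u = z := by simp
  have hc : ContMDiffAt 𝓘(ℝ, ℝ) 𝓘(ℝ, E) ∞ (fun t : ℝ => z + t • u) 0 := by
    apply ContDiffAt.contMDiffAt; fun_prop
  have hσ' : ContMDiffAt 𝓘(ℝ, E) 𝓘(ℝ, E) ∞ σ (z + (0 : ℝ) • u) := by rw [hz]; exact hσ
  refine ⟨σ ∘ fun t : ℝ => z + t • u, hσ'.comp 0 hc, congrArg σ hz, ?_⟩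
  have h2 := mfderiv_comp (I := 𝓘(ℝ, ℝ)) (0 : ℝ) (hσ'.mdifferentiableAt (by simp))
    hl.differentiableAt.mdifferentiableAt
  rw [mfderiv_eq_fderiv, hl.fderiv] at h2
  refine (congrArg (fun l : ℝ →L[ℝ] E => l 1) h2).trans ?_
  change (show E →L[ℝ] E from mfderiv 𝓘(ℝ, E) 𝓘(ℝ, E) σ (z + (0 : ℝ) • u)) ((1 : ℝ) • u) = _
  rw [one_smul]
  exact congrArg (fun l : E →L[ℝ] E => l u) (mfderiv_eq_of_eq σ hz)

theorem mfderiv_comp_curve {f : P → P'} {γ : ℝ → P} {x : P} {v : TangentSpace 𝓘(ℝ, E) x}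
    (hγ : ContMDiffAt 𝓘(ℝ, ℝ) 𝓘(ℝ, E) ∞ γ 0) (h0 : γ 0 = x)
    (hv : (show E from mfderiv 𝓘(ℝ, ℝ) 𝓘(ℝ, E) γ 0 (1 : ℝ)) = v)
    (hf : MDifferentiableAt 𝓘(ℝ, E) 𝓘(ℝ, E') f x) :
    (show E' from mfderiv 𝓘(ℝ, ℝ) 𝓘(ℝ, E') (f ∘ γ) 0 (1 : ℝ)) =
      mfderiv 𝓘(ℝ, E) 𝓘(ℝ, E') f x v := by
  subst h0 hv
  exact congrArg (fun l : ℝ →L[ℝ] E' => l 1)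
    (mfderiv_comp (I := 𝓘(ℝ, ℝ)) (0 : ℝ) hf (hγ.mdifferentiableAt (by simp)))

/-- A submersion has local sections, and its fibres are filled by curves. -/
theorem exists_section_of_isSubmersion {f : P → P'}
    (hf : Manifold.IsSubmersion 𝓘(ℝ, E) 𝓘(ℝ, E') ∞ f) (x : P) :
    (∃ s : P' → P, ContMDiffAt 𝓘(ℝ, E') 𝓘(ℝ, E) ∞ s (f x) ∧ s (f x) = x ∧
      ∀ᶠ y in 𝓝 (f x), f (s y) = y) ∧
    ∀ v : TangentSpace 𝓘(ℝ, E) x, mfderiv 𝓘(ℝ, E) 𝓘(ℝ, E') f x v = 0 →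
      ∃ γ : ℝ → P, ContMDiffAt 𝓘(ℝ, ℝ) 𝓘(ℝ, E) ∞ γ 0 ∧ γ 0 = x ∧
        (∀ᶠ t in 𝓝 0, f (γ t) = f x) ∧
        (show E from mfderiv 𝓘(ℝ, ℝ) 𝓘(ℝ, E) γ 0 (1 : ℝ)) = v := by
  have h := hf.isSubmersionAt x
  let e := h.equiv
  have hd := h.domChart_mem_maximalAtlas
  have hc := h.codChart_mem_maximalAtlas
  have hw : ∀ z ∈ h.domChart.target, h.codChart (f (h.domChart.symm z)) = (e z).1 := by
    intro z hz
    have hz' : z ∈ (h.domChart.extend 𝓘(ℝ, E)).target := by simpa using hz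
    exact h.writtenInCharts hz'
  have hsrc : ∀ z ∈ h.domChart.target, f (h.domChart.symm z) ∈ h.codChart.source :=
    fun z hz => h.source_subset_preimage_source (h.domChart.map_target hz)
  have hsymm : ∀ z ∈ h.domChart.target, f (h.domChart.symm z) = h.codChart.symm (e z).1 :=
    fun z hz => by rw [← hw z hz, h.codChart.left_inv (hsrc z hz)]
  have hx := h.mem_domChart_source
  have hfx := h.mem_codChart_source
  have hz0 := h.domChart.map_source hx
  have hex : (e (h.domChart x)).1 = h.codChart (f x) := by
    rw [← hw _ hz0, h.domChart.left_inv hx]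
  constructor
  -- In the adapted charts `f` is the first projection; the section freezes the complementary
  -- coordinate at its value at `x`.
  · let a : P' → E := fun y => e.symm (h.codChart y, (e (h.domChart x)).2)
    have ha0 : a (f x) = h.domChart x := by
      simp only [a]
      rw [← hex]
      exact e.symm_apply_apply _
    have ha : ContMDiffAt 𝓘(ℝ, E') 𝓘(ℝ, E) ∞ a (f x) := by
      have h1 : ContMDiffAt 𝓘(ℝ, E') 𝓘(ℝ, E') ∞ h.codChart (f x) :=
        contMDiffAt_of_mem_maximalAtlas hc hfx
      have h2 : ContDiff ℝ ∞ (fun b : E' => e.symm (b, (e (h.domChart x)).2)) :=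
        e.symm.contDiff.comp (contDiff_id.prodMk contDiff_const)
      exact h2.contMDiff.contMDiffAt.comp (f x) h1
    refine ⟨h.domChart.symm ∘ a, ?_, ?_, ?_⟩
    · refine ContMDiffAt.comp (I' := 𝓘(ℝ, E)) (f x) ?_ ha
      rw [ha0]
      exact contMDiffAt_symm_of_mem_maximalAtlas hd hz0
    · simp only [Function.comp, ha0, h.domChart.left_inv hx]
    · have hn : a ⁻¹' h.domChart.target ∈ 𝓝 (f x) :=
        ha.continuousAt.preimage_mem_nhds (h.domChart.open_target.mem_nhds (by rw [ha0]; exact hz0))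
      filter_upwards [hn, h.codChart.open_source.mem_nhds hfx] with y hy hy'
      rw [Function.comp, hsymm _ hy]
      simp only [a, ContinuousLinearEquiv.apply_symm_apply]
      exact h.codChart.left_inv hy'
  · intro v hv
    let L : E →L[ℝ] E := mfderiv 𝓘(ℝ, E) 𝓘(ℝ, E) h.domChart x
    have hdx : ContMDiffAt 𝓘(ℝ, E) 𝓘(ℝ, E) ∞ h.domChart x :=
      contMDiffAt_of_mem_maximalAtlas hd hx
    have hds : ContMDiffAt 𝓘(ℝ, E) 𝓘(ℝ, E) ∞ h.domChart.symm (h.domChart x) :=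
      contMDiffAt_symm_of_mem_maximalAtlas hd hz0
    have hcx : ContMDiffAt 𝓘(ℝ, E') 𝓘(ℝ, E') ∞ h.codChart (f x) :=
      contMDiffAt_of_mem_maximalAtlas hc hfx
    have hev : h.codChart ∘ f =ᶠ[𝓝 x] (ContinuousLinearMap.fst ℝ E' h.complement ∘L
        (e : E →L[ℝ] E' × h.complement)) ∘ h.domChart := by
      filter_upwards [h.domChart.open_source.mem_nhds hx] with y hy
      have := hw _ (h.domChart.map_source hy)
      rw [h.domChart.left_inv hy] at this
      exact this
    have h1 := mfderiv_comp (I'' := 𝓘(ℝ, E')) x (hcx.mdifferentiableAt (by simp))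
      ((hf.contMDiff x).mdifferentiableAt (by simp))
    have h2 := mfderiv_comp (I := 𝓘(ℝ, E)) (I' := 𝓘(ℝ, E)) (I'' := 𝓘(ℝ, E')) x
      (g := ContinuousLinearMap.fst ℝ E' h.complement ∘L (e : E →L[ℝ] E' × h.complement))
      (f := h.domChart)
      (ContinuousLinearMap.differentiableAt _).mdifferentiableAt
      (hdx.mdifferentiableAt (by simp))
    rw [← hev.mfderiv_eq, h1, mfderiv_eq_fderiv, ContinuousLinearMap.fderiv] at h2
    have h3 : (e (L v)).1 = 0 := by
      refine (congrArg (fun l : E →L[ℝ] E' => l v) h2).symm.trans ?_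
      exact (congrArg (mfderiv 𝓘(ℝ, E') 𝓘(ℝ, E') h.codChart (f x)) hv).trans (map_zero _)
    -- The curve is a straight line in the adapted chart; by `h3` its direction has no first
    -- component, so `f` is constant along it.
    have hl : HasFDerivAt (fun t : ℝ => h.domChart x + t • L v)
        ((ContinuousLinearMap.id ℝ ℝ).smulRight (L v)) 0 :=
      ((hasFDerivAt_id (0 : ℝ)).smul_const (L v)).const_add _
    have hz : h.domChart x + (0 : ℝ) • L v = h.domChart x := by simp
    have hcd : ContMDiffAt 𝓘(ℝ, ℝ) 𝓘(ℝ, E) ∞ (fun t : ℝ => h.domChart x + t • L v) 0 := by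
      apply ContDiffAt.contMDiffAt; fun_prop
    have hds' : ContMDiffAt 𝓘(ℝ, E) 𝓘(ℝ, E) ∞ h.domChart.symm (h.domChart x + (0 : ℝ) • L v) := by
      rw [hz]; exact hds
    refine ⟨h.domChart.symm ∘ fun t : ℝ => h.domChart x + t • L v, hds'.comp 0 hcd, ?_, ?_, ?_⟩
    · simp only [Function.comp, hz, h.domChart.left_inv hx]
    · have hn : (fun t : ℝ => h.domChart x + t • L v) ⁻¹' h.domChart.target ∈ 𝓝 0 :=
        hcd.continuousAt.preimage_mem_nhds (h.domChart.open_target.mem_nhds (by rw [hz]; exact hz0))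
      filter_upwards [hn] with t ht
      rw [Function.comp, hsymm _ ht, map_add, map_smul, Prod.fst_add, Prod.smul_fst, h3, smul_zero,
        add_zero, hex, h.codChart.left_inv hfx]
    · have h4 := mfderiv_comp (I := 𝓘(ℝ, ℝ)) (0 : ℝ) (hds'.mdifferentiableAt (by simp))
        hl.differentiableAt.mdifferentiableAt
      rw [mfderiv_eq_fderiv, hl.fderiv] at h4
      refine (congrArg (fun l : ℝ →L[ℝ] E => l 1) h4).trans ?_
      change (show E →L[ℝ] E from mfderiv 𝓘(ℝ, E) 𝓘(ℝ, E) h.domChart.symm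
        (h.domChart x + (0 : ℝ) • L v)) ((1 : ℝ) • L v) = _
      rw [one_smul]
      refine (congrArg (fun l : E →L[ℝ] E => l (L v))
        (mfderiv_eq_of_eq (E := E) (E' := E) h.domChart.symm hz)).trans ?_
      have h5 := mfderiv_comp (I'' := 𝓘(ℝ, E)) x (hds.mdifferentiableAt (by simp))
        (hdx.mdifferentiableAt (by simp))
      have h6 : h.domChart.symm ∘ h.domChart =ᶠ[𝓝 x] id := by
        filter_upwards [h.domChart.open_source.mem_nhds hx] with y hy
        exact h.domChart.left_inv hy
      rw [h6.mfderiv_eq, mfderiv_id] at h5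
      exact (congrArg (fun l : E →L[ℝ] E => l v) h5).symm

variable {f : P → P'} (hf : Manifold.IsSubmersion 𝓘(ℝ, E) 𝓘(ℝ, E') ∞ f)

include hf

theorem surjective_mfderiv_of_isSubmersion (x : P) :
    Function.Surjective (mfderiv 𝓘(ℝ, E) 𝓘(ℝ, E') f x) := by
  obtain ⟨⟨s, hs, hsx, hfs⟩, -⟩ := exists_section_of_isSubmersion hf x
  exact surjective_mfderiv_of_section ((hf.contMDiff x).mdifferentiableAt (by simp))
    (hs.mdifferentiableAt (by simp)) hsx hfs

/-- Smoothness descends along submersions. -/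
theorem contMDiffAt_of_comp_isSubmersion {EZ HZ Z : Type*} [NormedAddCommGroup EZ]
    [NormedSpace ℝ EZ] [TopologicalSpace HZ] {IZ : ModelWithCorners ℝ EZ HZ} [TopologicalSpace Z]
    [ChartedSpace HZ Z] {u : P' → Z} {x : P}
    (hu : ContMDiffAt 𝓘(ℝ, E) IZ ∞ (u ∘ f) x) : ContMDiffAt 𝓘(ℝ, E') IZ ∞ u (f x) := by
  obtain ⟨⟨s, hs, hsx, hfs⟩, -⟩ := exists_section_of_isSubmersion hf x
  rw [← hsx] at hu
  refine (hu.comp (f x) hs).congr_of_eventuallyEq ?_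
  filter_upwards [hfs] with y hy
  exact congrArg u hy.symm

end Submersions

/-! ### Reduction of brackets to orbit spaces -/

section Reduction

variable {G P : Type*} [Group G] [MulAction G P]

theorem orbitMap_smul (g : G) (x : P) : orbitMap G P (g • x) = orbitMap G P x :=
  Quotient.sound (MulAction.orbitRel_apply.2 ⟨g, rfl⟩)

theorem orbitMap_eq_iff {x y : P} : orbitMap G P x = orbitMap G P y ↔ ∃ g : G, g • y = x :=
  Quotient.eq.trans MulAction.orbitRel_apply

theorem orbitMap_surjective : Function.Surjective (orbitMap G P) := Quotient.mk_surjective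

/-- The bracket on the orbit space induced by a bracket. -/
noncomputable def reducedBracket (B : (P → ℝ) → (P → ℝ) → P → ℝ)
    (f g : MulAction.orbitRel.Quotient G P → ℝ) (y : MulAction.orbitRel.Quotient G P) : ℝ :=
  B (f ∘ orbitMap G P) (g ∘ orbitMap G P) y.out

variable {E E' : Type*} [NormedAddCommGroup E] [NormedSpace ℝ E]
  [TopologicalSpace P] [ChartedSpace E P] [IsManifold 𝓘(ℝ, E) ∞ P]
  [NormedAddCommGroup E'] [NormedSpace ℝ E'] [ChartedSpace E' (MulAction.orbitRel.Quotient G P)]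
  [IsManifold 𝓘(ℝ, E') ∞ (MulAction.orbitRel.Quotient G P)]
  {B : (P → ℝ) → (P → ℝ) → P → ℝ}

theorem isReducedBracket_reducedBracket
    (hB : ∀ f g : MulAction.orbitRel.Quotient G P → ℝ,
      ContMDiff 𝓘(ℝ, E') 𝓘(ℝ, ℝ) ∞ f → ContMDiff 𝓘(ℝ, E') 𝓘(ℝ, ℝ) ∞ g → ∀ (c : G) (x : P),
      B (f ∘ orbitMap G P) (g ∘ orbitMap G P) (c • x) =
        B (f ∘ orbitMap G P) (g ∘ orbitMap G P) x) :
    IsReducedBracket 𝓘(ℝ, E') B (reducedBracket (G := G) B) := by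
  intro f g hf hg
  funext x
  obtain ⟨c, hc⟩ := orbitMap_eq_iff.1
    (show orbitMap G P (orbitMap G P x).out = orbitMap G P x from Quotient.out_eq _)
  change B _ _ (orbitMap G P x).out = _
  rw [← hc, hB f g hf hg]

variable (hρ : Manifold.IsSubmersion 𝓘(ℝ, E) 𝓘(ℝ, E') ∞ (orbitMap G P))
  {Bred : (MulAction.orbitRel.Quotient G P → ℝ) → (MulAction.orbitRel.Quotient G P → ℝ) →
    MulAction.orbitRel.Quotient G P → ℝ}

include hρ

theorem contMDiff_of_comp_orbitMap {EZ HZ Z : Type*} [NormedAddCommGroup EZ]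
    [NormedSpace ℝ EZ] [TopologicalSpace HZ] {IZ : ModelWithCorners ℝ EZ HZ} [TopologicalSpace Z]
    [ChartedSpace HZ Z] {u : MulAction.orbitRel.Quotient G P → Z}
    (hu : ContMDiff 𝓘(ℝ, E) IZ ∞ (u ∘ orbitMap G P)) : ContMDiff 𝓘(ℝ, E') IZ ∞ u := by
  intro y
  obtain ⟨x, rfl⟩ := orbitMap_surjective y
  exact contMDiffAt_of_comp_isSubmersion hρ (hu x)

/-- The reduction of an almost Poisson bracket is a Poisson bracket if invariant functions satisfy
the Jacobi identity. -/
theorem IsReducedBracket.isPoissonBracket (hred : IsReducedBracket 𝓘(ℝ, E') B Bred)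
    (hB : IsAlmostPoissonBracket 𝓘(ℝ, E) B)
    (hJ : ∀ f g h : MulAction.orbitRel.Quotient G P → ℝ, ContMDiff 𝓘(ℝ, E') 𝓘(ℝ, ℝ) ∞ f →
      ContMDiff 𝓘(ℝ, E') 𝓘(ℝ, ℝ) ∞ g → ContMDiff 𝓘(ℝ, E') 𝓘(ℝ, ℝ) ∞ h →
      B (f ∘ orbitMap G P) (B (g ∘ orbitMap G P) (h ∘ orbitMap G P)) +
        B (g ∘ orbitMap G P) (B (h ∘ orbitMap G P) (f ∘ orbitMap G P)) +
        B (h ∘ orbitMap G P) (B (f ∘ orbitMap G P) (g ∘ orbitMap G P)) = 0) :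
    IsPoissonBracket 𝓘(ℝ, E') Bred := by
  have hc : ∀ {f : MulAction.orbitRel.Quotient G P → ℝ}, ContMDiff 𝓘(ℝ, E') 𝓘(ℝ, ℝ) ∞ f →
      ContMDiff 𝓘(ℝ, E) 𝓘(ℝ, ℝ) ∞ (f ∘ orbitMap G P) := fun hf => hf.comp hρ.contMDiff
  -- Each bracket identity is checked after composition with the surjective orbit map, where it
  -- becomes an identity for `B`.
  have hinj : ∀ {u v : MulAction.orbitRel.Quotient G P → ℝ},
      u ∘ orbitMap G P = v ∘ orbitMap G P → u = v := fun h =>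
    orbitMap_surjective.injective_comp_right h
  have hs : ∀ f g : MulAction.orbitRel.Quotient G P → ℝ, ContMDiff 𝓘(ℝ, E') 𝓘(ℝ, ℝ) ∞ f →
      ContMDiff 𝓘(ℝ, E') 𝓘(ℝ, ℝ) ∞ g → ContMDiff 𝓘(ℝ, E') 𝓘(ℝ, ℝ) ∞ (Bred f g) := by
    intro f g hf hg
    refine contMDiff_of_comp_orbitMap hρ ?_
    rw [hred f g hf hg]
    exact hB.smooth _ _ (hc hf) (hc hg)
  have hadd : ∀ u v : MulAction.orbitRel.Quotient G P → ℝ,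
      (u + v) ∘ orbitMap G P = u ∘ orbitMap G P + v ∘ orbitMap G P := fun _ _ => rfl
  have hmul : ∀ u v : MulAction.orbitRel.Quotient G P → ℝ,
      (u * v) ∘ orbitMap G P = u ∘ orbitMap G P * v ∘ orbitMap G P := fun _ _ => rfl
  have hsmul : ∀ (c : ℝ) (u : MulAction.orbitRel.Quotient G P → ℝ),
      (c • u) ∘ orbitMap G P = c • (u ∘ orbitMap G P) := fun _ _ => rfl
  have hneg : ∀ u : MulAction.orbitRel.Quotient G P → ℝ,
      (-u) ∘ orbitMap G P = -(u ∘ orbitMap G P) := fun _ => rfl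
  refine { smooth := hs, add_left := ?_, smul_left := ?_, skew := ?_, leibniz := ?_, jacobi := ?_ }
  · intro f g h hf hg hh
    refine hinj ?_
    rw [hred _ _ (hf.add hg) hh, hadd, hadd, hred _ _ hf hh, hred _ _ hg hh,
      hB.add_left _ _ _ (hc hf) (hc hg) (hc hh)]
  · intro c f g hf hg
    refine hinj ?_
    have hcf : ContMDiff 𝓘(ℝ, E') 𝓘(ℝ, ℝ) ∞ (c • f) :=
      (contDiff_const_smul c).contMDiff.comp hf
    rw [hred _ _ hcf hg, hsmul, hsmul, hred _ _ hf hg,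
      hB.smul_left _ _ _ (hc hf) (hc hg)]
  · intro f g hf hg
    refine hinj ?_
    rw [hneg, hred _ _ hf hg, hred _ _ hg hf, hB.skew _ _ (hc hf) (hc hg)]
  · intro f g h hf hg hh
    refine hinj ?_
    rw [hred _ _ (hf.mul hg) hh, hadd, hmul, hmul, hmul, hred _ _ hf hh, hred _ _ hg hh,
      hB.leibniz _ _ _ (hc hf) (hc hg) (hc hh)]
  · intro f g h hf hg hh
    refine hinj ?_
    rw [hadd, hadd, hred _ _ hf (hs _ _ hg hh), hred _ _ hg (hs _ _ hh hf),
      hred _ _ hh (hs _ _ hf hg), hred _ _ hg hh, hred _ _ hh hf, hred _ _ hf hg]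
    exact hJ f g h hf hg hh

end Reduction

/-! ### Transport along diffeomorphisms and passage to orbit spaces -/

section Transport

variable {E E' : Type*} [NormedAddCommGroup E] [NormedSpace ℝ E]
  [NormedAddCommGroup E'] [NormedSpace ℝ E']
  {P P' : Type*} [TopologicalSpace P] [ChartedSpace E P] [IsManifold 𝓘(ℝ, E) ∞ P]
  [TopologicalSpace P'] [ChartedSpace E' P'] [IsManifold 𝓘(ℝ, E') ∞ P']

theorem IsPoissonBracket.transport {B : (P' → ℝ) → (P' → ℝ) → P' → ℝ}
    (hB : IsPoissonBracket 𝓘(ℝ, E') B) (Ψ : P ≃ₘ^∞⟮𝓘(ℝ, E), 𝓘(ℝ, E')⟯ P') :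
    IsPoissonBracket 𝓘(ℝ, E) (fun f g => B (f ∘ Ψ.symm) (g ∘ Ψ.symm) ∘ Ψ) := by
  have hc : ∀ {f : P → ℝ}, ContMDiff 𝓘(ℝ, E) 𝓘(ℝ, ℝ) ∞ f →
      ContMDiff 𝓘(ℝ, E') 𝓘(ℝ, ℝ) ∞ (f ∘ Ψ.symm) := fun hf => hf.comp Ψ.symm.contMDiff
  have hΨ : ∀ u : P' → ℝ, (u ∘ Ψ) ∘ Ψ.symm = u := fun u =>
    funext fun x => congrArg u (Ψ.apply_symm_apply x)
  refine { smooth := fun f g hf hg => (hB.smooth _ _ (hc hf) (hc hg)).comp Ψ.contMDiff,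
           add_left := fun f g h hf hg hh => ?_, smul_left := fun c f g hf hg => ?_,
           skew := fun f g hf hg => ?_, leibniz := fun f g h hf hg hh => ?_,
           jacobi := fun f g h hf hg hh => ?_ }
  · exact congrArg (· ∘ Ψ) (hB.add_left _ _ _ (hc hf) (hc hg) (hc hh))
  · exact congrArg (· ∘ Ψ) (hB.smul_left c _ _ (hc hf) (hc hg))
  · exact congrArg (· ∘ Ψ) (hB.skew _ _ (hc hf) (hc hg))
  · refine (congrArg (· ∘ Ψ) (hB.leibniz _ _ _ (hc hf) (hc hg) (hc hh))).trans ?_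
    funext x
    simp [Function.comp]
  · simp only [hΨ]
    exact congrArg (· ∘ Ψ) (hB.jacobi _ _ _ (hc hf) (hc hg) (hc hh))

variable {G : Type*} [Group G] [MulAction G P] [MulAction G P']
  {Er Er' : Type*} [NormedAddCommGroup Er] [NormedSpace ℝ Er]
  [ChartedSpace Er (MulAction.orbitRel.Quotient G P)]
  [IsManifold 𝓘(ℝ, Er) ∞ (MulAction.orbitRel.Quotient G P)]
  [NormedAddCommGroup Er'] [NormedSpace ℝ Er']
  [ChartedSpace Er' (MulAction.orbitRel.Quotient G P')]
  [IsManifold 𝓘(ℝ, Er') ∞ (MulAction.orbitRel.Quotient G P')]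

/-- The diffeomorphism of orbit spaces induced by an equivariant diffeomorphism. -/
theorem exists_reduced_diffeomorph
    (hρ : Manifold.IsSubmersion 𝓘(ℝ, E) 𝓘(ℝ, Er) ∞ (orbitMap G P))
    (hρ' : Manifold.IsSubmersion 𝓘(ℝ, E') 𝓘(ℝ, Er') ∞ (orbitMap G P'))
    (Ψ : P ≃ₘ^∞⟮𝓘(ℝ, E), 𝓘(ℝ, E')⟯ P') (hΨ : ∀ (g : G) (x : P), Ψ (g • x) = g • Ψ x) :
    ∃ Ψred : MulAction.orbitRel.Quotient G P ≃ₘ^∞⟮𝓘(ℝ, Er), 𝓘(ℝ, Er')⟯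
      MulAction.orbitRel.Quotient G P', ∀ x, Ψred (orbitMap G P x) = orbitMap G P' (Ψ x) := by
  have hΨ' : ∀ (g : G) (x : P'), Ψ.symm (g • x) = g • Ψ.symm x := fun g x => by
    refine Ψ.injective ((Ψ.apply_symm_apply _).trans ?_)
    exact ((hΨ g _).trans (congrArg (g • ·) (Ψ.apply_symm_apply x))).symm
  let F : MulAction.orbitRel.Quotient G P → MulAction.orbitRel.Quotient G P' :=
    Quotient.lift (fun x => orbitMap G P' (Ψ x)) (fun a b hab => by
      obtain ⟨g, rfl⟩ := MulAction.orbitRel_apply.1 hab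
      rw [hΨ, orbitMap_smul])
  let F' : MulAction.orbitRel.Quotient G P' → MulAction.orbitRel.Quotient G P :=
    Quotient.lift (fun x => orbitMap G P (Ψ.symm x)) (fun a b hab => by
      obtain ⟨g, rfl⟩ := MulAction.orbitRel_apply.1 hab
      rw [hΨ', orbitMap_smul])
  refine ⟨{ toFun := F, invFun := F', left_inv := fun y => ?_, right_inv := fun y => ?_,
            contMDiff_toFun := contMDiff_of_comp_orbitMap hρ (hρ'.contMDiff.comp Ψ.contMDiff),
            contMDiff_invFun :=
              contMDiff_of_comp_orbitMap hρ' (hρ.contMDiff.comp Ψ.symm.contMDiff) },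
    fun x => rfl⟩
  · obtain ⟨x, rfl⟩ := orbitMap_surjective y
    exact congrArg (orbitMap G P) (Ψ.symm_apply_apply x)
  · obtain ⟨x, rfl⟩ := orbitMap_surjective y
    exact congrArg (orbitMap G P') (Ψ.apply_symm_apply x)

end Transport

/-! ### Invariance of the forms and brackets under the group -/

section Invariance

variable {E Q EG G : Type*} [NormedAddCommGroup E] [NormedSpace ℝ E] [FiniteDimensional ℝ E]
  [TopologicalSpace Q] [ChartedSpace E Q] [IsManifold 𝓘(ℝ, E) ∞ Q]
  [NormedAddCommGroup EG] [NormedSpace ℝ EG]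
  [TopologicalSpace G] [ChartedSpace EG G] [Group G]
  [MulAction G Q]
  {EN : Type*} [NormedAddCommGroup EN] [NormedSpace ℝ EN]
  {R : ProjField E Q} {N : Set (CotangentBundle E Q)} [ChartedSpace EN N]
  [IsManifold 𝓘(ℝ, EN) ∞ N] [MulAction G N] (hN : R.IsDualImage EN N)
  (hact : ∀ (g : G) (m : N), (g • m).1 = cotangentLift g m.1)

namespace ProjField.IsDualImage

include hN hact

theorem mfderiv_baseProj_smul [h : ContMDiffSMul 𝓘(ℝ, EG) 𝓘(ℝ, E) ∞ G Q]
    [LieGroup 𝓘(ℝ, EG) ∞ G] (g : G) (m : N) (X : TangentSpace 𝓘(ℝ, EN) m) :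
    (show E from mfderiv 𝓘(ℝ, EN) 𝓘(ℝ, E) (baseProj N) (g • m) (tangentAction EN g m X)) =
      tangentAction E g (baseProj N m) (mfderiv 𝓘(ℝ, EN) 𝓘(ℝ, E) (baseProj N) m X) := by
  have := hN.contMDiffSMul (EG := EG) hact
  have h1 := mfderiv_comp (I' := 𝓘(ℝ, EN)) (I'' := 𝓘(ℝ, E)) m
    (g := baseProj N) (f := fun m : N => g • m)
    (hN.contMDiff_baseProj.mdifferentiableAt (by simp))
    ((contMDiff_const_action (EG := EG) g).mdifferentiableAt (by simp))
  have h2 := mfderiv_comp (I' := 𝓘(ℝ, E)) (I'' := 𝓘(ℝ, E)) m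
    (g := fun q : Q => g • q) (f := baseProj N)
    ((contMDiff_const_action (EG := EG) g).mdifferentiableAt (by simp))
    (hN.contMDiff_baseProj.mdifferentiableAt (by simp))
  have e : baseProj N ∘ (fun m : N => g • m) = (fun q : Q => g • q) ∘ baseProj N :=
    funext fun m => baseProj_smul hact g m
  rw [e] at h1
  exact congrArg (fun l : EN →L[ℝ] E => l X) (h1.symm.trans h2)

theorem lin_restrictedLiouville_smul [h : ContMDiffSMul 𝓘(ℝ, EG) 𝓘(ℝ, E) ∞ G Q]
    [LieGroup 𝓘(ℝ, EG) ∞ G] (g : G) (m : N) (X : TangentSpace 𝓘(ℝ, EN) m) :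
    lin (restrictedLiouville N) (g • m) (tangentAction EN g m X) =
      lin (restrictedLiouville N) m X := by
  refine (hN.lin_restrictedLiouville _ _).trans (Eq.trans ?_ (hN.lin_restrictedLiouville m X).symm)
  have key : ∀ (β : CotangentBundle E Q) (w : E), β = cotangentLift g m.1 →
      w = tangentAction E g (baseProj N m) (mfderiv 𝓘(ℝ, EN) 𝓘(ℝ, E) (baseProj N) m X) →
      (show E →L[ℝ] ℝ from β.snd) w =
        m.1.snd (mfderiv 𝓘(ℝ, EN) 𝓘(ℝ, E) (baseProj N) m X) := by
    rintro β w rfl rfl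
    exact cotangentLift_apply (mdifferentiable_action (EG := EG)) g m.1 _
  exact key _ _ (hact g m) (hN.mfderiv_baseProj_smul (EG := EG) hact g m X)

theorem restrictedForm_smul [h : ContMDiffSMul 𝓘(ℝ, EG) 𝓘(ℝ, E) ∞ G Q]
    [LieGroup 𝓘(ℝ, EG) ∞ G] (g : G) (m : N) (X Y : TangentSpace 𝓘(ℝ, EN) m) :
    restrictedForm N (g • m) ![tangentAction EN g m X, tangentAction EN g m Y] =
      restrictedForm N m ![X, Y] := by
  have := hN.contMDiffSMul (EG := EG) hact
  refine (hN.restrictedForm_eq (g • m) _ _).trans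
    (Eq.trans ?_ (hN.restrictedForm_eq m X Y).symm)
  have h1 := extd_eq_of_pull_eq (θ₁ := restrictedLiouville (EN := EN) N)
    (θ₂ := restrictedLiouville (EN := EN) N) (f₁ := fun m : N => g • m) (f₂ := id) (x := m)
    (contMDiff_const_action (EG := EG) g).contMDiffAt contMDiffAt_id
    (hN.smoothFormAt_restrictedLiouville _) (hN.smoothFormAt_restrictedLiouville _)
    (Filter.Eventually.of_forall fun y v => by
      rw [mfderiv_id]
      exact hN.lin_restrictedLiouville_smul (EG := EG) hact g y v) X Y
  rw [mfderiv_id] at h1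
  exact congrArg Neg.neg h1

variable {D : ∀ q : Q, Submodule ℝ (TangentSpace 𝓘(ℝ, E) q)}
  (hD : ∀ q v, v ∈ D q ↔ R.P q v = v)
  (hDG : ∀ (g : G) (q : Q) (v : TangentSpace 𝓘(ℝ, E) q), v ∈ D q → tangentAction E g q v ∈ D (g • q))

include hDG in
theorem tangentAction_mem_liftedDistribution [h : ContMDiffSMul 𝓘(ℝ, EG) 𝓘(ℝ, E) ∞ G Q]
    [LieGroup 𝓘(ℝ, EG) ∞ G] (g : G) {m : N} {X : TangentSpace 𝓘(ℝ, EN) m}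
    (hX : X ∈ liftedDistribution N D m) :
    tangentAction EN g m X ∈ liftedDistribution N D (g • m) := by
  have key : ∀ (q : Q) (w : E), q = g • baseProj N m →
      w = tangentAction E g (baseProj N m) (mfderiv 𝓘(ℝ, EN) 𝓘(ℝ, E) (baseProj N) m X) →
      (show TangentSpace 𝓘(ℝ, E) q from w) ∈ D q := by
    rintro q w rfl rfl
    exact hDG g _ _ hX
  exact key _ _ (baseProj_smul hact g m) (hN.mfderiv_baseProj_smul (EG := EG) hact g m X)

include hD hDG in
/-- The bracket of invariant functions is invariant. -/
theorem bracket_smul [FiniteDimensional ℝ EN] [h : ContMDiffSMul 𝓘(ℝ, EG) 𝓘(ℝ, E) ∞ G Q]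
    [LieGroup 𝓘(ℝ, EG) ∞ G] {f k : N → ℝ} (hf : MDifferentiable 𝓘(ℝ, EN) 𝓘(ℝ, ℝ) f)
    (hk : MDifferentiable 𝓘(ℝ, EN) 𝓘(ℝ, ℝ) k) (hfG : ∀ (g : G) (m : N), f (g • m) = f m)
    (hkG : ∀ (g : G) (m : N), k (g • m) = k m) (g : G) (m : N) :
    bracket (liftedDistribution (EN := EN) N D) (restrictedForm N) f k (g • m) =
      bracket (liftedDistribution (EN := EN) N D) (restrictedForm N) f k m := by
  have hsm := hN.contMDiffSMul (EG := EG) hact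
  have hdf : ∀ {f : N → ℝ}, MDifferentiable 𝓘(ℝ, EN) 𝓘(ℝ, ℝ) f →
      (∀ (g : G) (m : N), f (g • m) = f m) →
      dfun 𝓘(ℝ, EN) f m = dfun 𝓘(ℝ, EN) f (g • m) ∘L tangentAction EN g m := by
    intro f hf hfG
    have h1 := mfderiv_comp (I' := 𝓘(ℝ, EN)) (I'' := 𝓘(ℝ, ℝ)) m
      (g := f) (f := fun m : N => g • m) (hf _)
      ((contMDiff_const_action (EG := EG) g).mdifferentiableAt (by simp))
    have e : f ∘ (fun m : N => g • m) = f := funext fun m => hfG g m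
    rw [e] at h1
    exact h1
  have hG : ∀ g : G, MDifferentiable 𝓘(ℝ, EN) 𝓘(ℝ, EN) (fun m : N => g • m) :=
    mdifferentiable_action (EG := EG)
  have hsurj : ∀ Y ∈ liftedDistribution (EN := EN) N D (g • m),
      ∃ X ∈ liftedDistribution (EN := EN) N D m, tangentAction EN g m X = Y := by
    intro Y hY
    obtain ⟨X, rfl⟩ := (tangentAction_isInvertible hG g m).bijective.2 Y
    refine ⟨X, ?_, rfl⟩
    have h1 := hN.tangentAction_mem_liftedDistribution (EG := EG) hact hDG g⁻¹ hY
    have h2 := (tangentAction_mul hG g⁻¹ g m X).symm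
    rw [inv_mul_cancel] at h2
    have h3 := h2.trans (tangentAction_one (E := EN) m (show EN from X))
    have key : ∀ (p : N) (w : EN), p = m → w = X →
        (show TangentSpace 𝓘(ℝ, EN) p from w) ∈ liftedDistribution (EN := EN) N D p →
        X ∈ liftedDistribution (EN := EN) N D m := by
      rintro p w rfl rfl h; exact h
    exact key _ _ (inv_smul_smul g m) h3 h1
  -- The tangent map of `g` is an isomorphism between the nondegenerate pairs at `m` and `g • m`.
  have h1 := map_sharp (tangentAction EN g m) (hN.nondegenerateOn hD m)
    (hN.nondegenerateOn hD (g • m))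
    (fun X hX => hN.tangentAction_mem_liftedDistribution (EG := EG) hact hDG g hX) hsurj
    (fun X _ Y _ => hN.restrictedForm_smul (EG := EG) hact g m X Y)
    (dfun 𝓘(ℝ, EN) f (g • m))
  rw [← hdf hf hfG] at h1
  change dfun 𝓘(ℝ, EN) k (g • m) (sharp _ _ (g • m) (dfun 𝓘(ℝ, EN) f (g • m))) =
    dfun 𝓘(ℝ, EN) k m (sharp _ _ m (dfun 𝓘(ℝ, EN) f m))
  rw [← h1, hdf hk hkG]
  rfl

end ProjField.IsDualImage
end Invariance

theorem two_eq_of_eq {E H F P : Type*} [NormedAddCommGroup E] [NormedSpace ℝ E]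
    [TopologicalSpace H] [NormedAddCommGroup F] [NormedSpace ℝ F] {I : ModelWithCorners ℝ E H}
    [TopologicalSpace P] [ChartedSpace H P] (θ : DiffForm I P 2 F) {x y : P} (h : x = y)
    {u v u' v' : E} (hu : u = u') (hv : v = v') :
    (show E [⋀^Fin 2]→L[ℝ] F from θ x) ![u, v] = (show E [⋀^Fin 2]→L[ℝ] F from θ y) ![u', v'] := by
  subst h hu hv; rfl

theorem fderiv_apply_eq_zero_of_line {V : Type*} [NormedAddCommGroup V] [NormedSpace ℝ V]
    {a : V → V →L[ℝ] ℝ} {p : V} (ha : DifferentiableAt ℝ a p) (u v : V) {C : ℝ}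
    (h : ∀ᶠ t in 𝓝 (0 : ℝ), a (p + t • u) v = C) : fderiv ℝ a p u v = 0 := by
  have hl : HasFDerivAt (fun t : ℝ => p + t • u)
      ((ContinuousLinearMap.id ℝ ℝ).smulRight u) 0 :=
    ((hasFDerivAt_id (0 : ℝ)).smul_const u).const_add p
  have ha' : HasFDerivAt a (fderiv ℝ a p) (p + (0 : ℝ) • u) := by
    rw [zero_smul, add_zero]; exact ha.hasFDerivAt
  have h1 := (ha'.comp (0 : ℝ) hl).clm_apply (hasFDerivAt_const v (0 : ℝ))
  have h2 : (fun t : ℝ => (a ∘ fun t : ℝ => p + t • u) t v) =ᶠ[𝓝 0] fun _ => C := h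
  have h3 := (h1.congr_of_eventuallyEq h2.symm).unique (hasFDerivAt_const C (0 : ℝ))
  simpa using congrArg (fun l : ℝ →L[ℝ] ℝ => l 1) h3

/-! ### Vanishing momenta and the Jacobi identity for invariant functions -/

section MomentumLevel

variable {E Q EG G : Type*} [NormedAddCommGroup E] [NormedSpace ℝ E] [FiniteDimensional ℝ E]
  [TopologicalSpace Q] [ChartedSpace E Q] [IsManifold 𝓘(ℝ, E) ∞ Q]
  [NormedAddCommGroup EG] [NormedSpace ℝ EG]
  [TopologicalSpace G] [ChartedSpace EG G] [Group G] [LieGroup 𝓘(ℝ, EG) ∞ G]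
  [MulAction G Q] [ContMDiffSMul 𝓘(ℝ, EG) 𝓘(ℝ, E) ∞ G Q]
  {EN : Type*} [NormedAddCommGroup EN] [NormedSpace ℝ EN]
  {R : ProjField E Q} {N : Set (CotangentBundle E Q)} [ChartedSpace EN N]
  [IsManifold 𝓘(ℝ, EN) ∞ N] [MulAction G N] (hN : R.IsDualImage EN N)
  (hact : ∀ (g : G) (m : N), (g • m).1 = cotangentLift g m.1)

theorem dfun_infGen_of_invariant {P : Type*} [TopologicalSpace P] [ChartedSpace EN P]
    [MulAction G P] [ContMDiffSMul 𝓘(ℝ, EG) 𝓘(ℝ, EN) ∞ G P] {f : P → ℝ} {m : P}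
    (hf : MDifferentiableAt 𝓘(ℝ, EN) 𝓘(ℝ, ℝ) f m) (hfG : ∀ (g : G), f (g • m) = f m)
    (ξ : GroupLieAlgebra 𝓘(ℝ, EG) G) : dfun 𝓘(ℝ, EN) f m (infGen EN EG G m ξ) = 0 := by
  have hf' : HasMFDerivAt 𝓘(ℝ, EN) 𝓘(ℝ, ℝ) f ((1 : G) • m)
      (show EN →L[ℝ] ℝ from mfderiv 𝓘(ℝ, EN) 𝓘(ℝ, ℝ) f m) := by
    have key : ∀ p, p = m → HasMFDerivAt 𝓘(ℝ, EN) 𝓘(ℝ, ℝ) f p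
        (show EN →L[ℝ] ℝ from mfderiv 𝓘(ℝ, EN) 𝓘(ℝ, ℝ) f m) := by
      rintro p rfl; exact hf.hasMFDerivAt
    exact key _ (one_smul G m)
  have h1 := (HasMFDerivAt.comp (I := 𝓘(ℝ, EG)) (f := fun g : G => g • m) (1 : G) hf'
    ((contMDiff_smul_const (EG := EG) m).mdifferentiableAt (by simp)).hasMFDerivAt).mfderiv
  have h2 : f ∘ (fun g : G => g • m) = fun _ => f m := funext hfG
  rw [h2, mfderiv_const] at h1
  exact (congrArg (fun l : EG →L[ℝ] ℝ => l ξ) h1).symm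

namespace ProjField.IsDualImage

include hN hact

/-- The canonical form vanishes on infinitesimal generators with vanishing momentum. -/
theorem restrictedForm_infGen {q₀ : Q} {z : E × (E →L[ℝ] ℝ)}
    (hz : z.1 ∈ (extChartAt 𝓘(ℝ, E) q₀).target) {ξ : GroupLieAlgebra 𝓘(ℝ, EG) G}
    (hξ : ∀ m : N, m.1.snd (infGen E EG G (baseProj N m) ξ) = 0) (v : E × (E →L[ℝ] ℝ)) :
    restrictedForm N (hN.spar q₀ z) ![infGen EN EG G (hN.spar q₀ z) ξ,
      mfderiv 𝓘(ℝ, E × (E →L[ℝ] ℝ)) 𝓘(ℝ, EN) (hN.spar q₀) z v] = 0 := by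
  have hsm := hN.contMDiffSMul (EG := EG) hact
  obtain ⟨c, hc, hc0, hcξ⟩ := exists_curve (1 : G) ξ
  -- The map extends both arguments of the form: its `t`-derivative at `t = 0` is the generator of
  -- `ξ`, and its derivative in the parameters gives the other vector. Only the velocity of `c` at
  -- `0` matters, so `c` need not be a one-parameter subgroup.
  let σ : ℝ × E × (E →L[ℝ] ℝ) → N := fun p => c p.1 • hN.spar q₀ p.2
  have hσ : ∀ w : E × (E →L[ℝ] ℝ), w.1 ∈ (extChartAt 𝓘(ℝ, E) q₀).target →
      ContMDiffAt 𝓘(ℝ, ℝ × E × (E →L[ℝ] ℝ)) 𝓘(ℝ, EN) ∞ σ (0, w) := by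
    intro w hw
    have h1 : ContMDiffAt 𝓘(ℝ, ℝ × E × (E →L[ℝ] ℝ)) 𝓘(ℝ, EG) ∞ (fun p => c p.1) ((0 : ℝ), w) :=
      ContMDiffAt.comp ((0 : ℝ), w) (f := Prod.fst) hc contDiff_fst.contMDiff.contMDiffAt
    have h2 : ContMDiffAt 𝓘(ℝ, ℝ × E × (E →L[ℝ] ℝ)) 𝓘(ℝ, EN) ∞
        (fun p => hN.spar q₀ p.2) ((0 : ℝ), w) :=
      ContMDiffAt.comp ((0 : ℝ), w) (f := Prod.snd) (hN.contMDiffAt_spar hw)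
        contDiff_snd.contMDiff.contMDiffAt
    exact ContMDiffAt.comp ((0 : ℝ), w) hsm.contMDiff_smul.contMDiffAt (h1.prodMk h2)
  have hσ0 : ∀ w, σ (0, w) = hN.spar q₀ w := fun w => by
    simp only [σ, hc0, one_smul]
  -- the tangent map of `σ` in the two directions
  have ht : ∀ w : E × (E →L[ℝ] ℝ), w.1 ∈ (extChartAt 𝓘(ℝ, E) q₀).target →
      (show EN from mfderiv 𝓘(ℝ, ℝ × E × (E →L[ℝ] ℝ)) 𝓘(ℝ, EN) σ (0, w) ((1 : ℝ), 0)) =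
        infGen EN EG G (hN.spar q₀ w) ξ := by
    intro w hw
    have h1 := mfderiv_comp (I := 𝓘(ℝ, ℝ)) (I' := 𝓘(ℝ, ℝ × E × (E →L[ℝ] ℝ))) (0 : ℝ)
      (f := fun t : ℝ => (t, w)) (g := σ) ((hσ w hw).mdifferentiableAt (by simp))
      (((differentiableAt_id).prodMk (differentiableAt_const w)).mdifferentiableAt)
    have h2 : HasFDerivAt (fun t : ℝ => (t, w))
        ((ContinuousLinearMap.id ℝ ℝ).prod (0 : ℝ →L[ℝ] E × (E →L[ℝ] ℝ))) 0 :=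
      (hasFDerivAt_id (0 : ℝ)).prodMk (hasFDerivAt_const w 0)
    rw [mfderiv_eq_fderiv, h2.fderiv] at h1
    have h3 := mfderiv_comp_curve (f := fun g : G => g • hN.spar q₀ w) hc hc0 hcξ
      ((contMDiff_smul_const (E := EN) (EG := EG) (hN.spar q₀ w)).mdifferentiableAt (by simp))
    exact (congrArg (fun l : ℝ →L[ℝ] EN => l 1) h1).symm.trans h3
  have hw : ∀ (t : ℝ), MDifferentiableAt 𝓘(ℝ, ℝ × E × (E →L[ℝ] ℝ)) 𝓘(ℝ, EN) σ (t, z) →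
      (show EN from mfderiv 𝓘(ℝ, ℝ × E × (E →L[ℝ] ℝ)) 𝓘(ℝ, EN) σ (t, z) ((0 : ℝ), v)) =
        tangentAction EN (c t) (hN.spar q₀ z)
          (mfderiv 𝓘(ℝ, E × (E →L[ℝ] ℝ)) 𝓘(ℝ, EN) (hN.spar q₀) z v) := by
    intro t ht
    have h1 := mfderiv_comp (I := 𝓘(ℝ, E × (E →L[ℝ] ℝ))) (I' := 𝓘(ℝ, ℝ × E × (E →L[ℝ] ℝ))) z
      (f := fun w : E × (E →L[ℝ] ℝ) => (t, w)) (g := σ) ht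
      (((differentiableAt_const t).prodMk differentiableAt_id).mdifferentiableAt)
    have h2 : HasFDerivAt (fun w : E × (E →L[ℝ] ℝ) => (t, w))
        ((0 : E × (E →L[ℝ] ℝ) →L[ℝ] ℝ).prod (ContinuousLinearMap.id ℝ _)) z :=
      (hasFDerivAt_const t z).prodMk (hasFDerivAt_id z)
    rw [mfderiv_eq_fderiv, h2.fderiv] at h1
    have h3 := mfderiv_comp (I := 𝓘(ℝ, E × (E →L[ℝ] ℝ))) (I' := 𝓘(ℝ, EN)) (I'' := 𝓘(ℝ, EN)) z
      (f := hN.spar q₀) (g := fun m : N => c t • m)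
      ((contMDiff_const_action (EG := EG) (c t)).mdifferentiableAt (by simp))
      ((hN.contMDiffAt_spar hz).mdifferentiableAt (by simp))
    exact (congrArg (fun l : E × (E →L[ℝ] ℝ) →L[ℝ] EN => l v) (h1.symm.trans h3))
  have hθ := fun m => hN.smoothFormAt_restrictedLiouville m
  have hd := (smoothFormAt_pull (hσ z hz) (hθ _)).differentiableAt (by simp)
  have hcurl := curl_pull (hσ z hz) (hθ _) ((1 : ℝ), 0) ((0 : ℝ), v)
  -- Along `t` the second vector is moved by the group, and the Liouville form is invariant.
  have e1 : fderiv ℝ (pull σ (restrictedLiouville (EN := EN) N)) (0, z) ((1 : ℝ), 0)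
      ((0 : ℝ), v) = 0 := by
    refine fderiv_apply_eq_zero_of_line hd _ _ (C := lin (restrictedLiouville N) (hN.spar q₀ z)
      (mfderiv 𝓘(ℝ, E × (E →L[ℝ] ℝ)) 𝓘(ℝ, EN) (hN.spar q₀) z v)) ?_
    have hcont : Filter.Tendsto (fun t : ℝ => ((t, z) : ℝ × E × (E →L[ℝ] ℝ))) (𝓝 0)
        (𝓝 (0, z)) := (Continuous.prodMk_left z).tendsto 0
    filter_upwards [hcont.eventually (eventually_mdifferentiableAt (hσ z hz))] with t ht
    have e : ((0 : ℝ), z) + t • ((1 : ℝ), (0 : E × (E →L[ℝ] ℝ))) = (t, z) := by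
      simp
    rw [e]
    refine (congrArg (lin (restrictedLiouville N) (σ (t, z))) (hw t ht)).trans ?_
    exact hN.lin_restrictedLiouville_smul (EG := EG) hact (c t) (hN.spar q₀ z) _
  -- At `t = 0` the Liouville form on the generator is the momentum of `ξ`, identically zero by
  -- `hξ`.
  have e2 : fderiv ℝ (pull σ (restrictedLiouville (EN := EN) N)) (0, z) ((0 : ℝ), v)
      ((1 : ℝ), 0) = 0 := by
    refine fderiv_apply_eq_zero_of_line hd _ _ (C := 0) ?_
    have hcont : Filter.Tendsto (fun t : ℝ => (z + t • v).1) (𝓝 0) (𝓝 z.1) := by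
      have : Continuous fun t : ℝ => (z + t • v).1 := by fun_prop
      simpa using this.tendsto 0
    filter_upwards [hcont.eventually ((isOpen_extChartAt_target q₀).mem_nhds hz)] with t htz
    have e : ((0 : ℝ), z) + t • ((0 : ℝ), v) = (0, z + t • v) := by simp
    rw [e]
    refine (congrArg (lin (restrictedLiouville N) (σ (0, z + t • v))) (ht _ htz)).trans ?_
    have key : ∀ m : N, m = hN.spar q₀ (z + t • v) → lin (restrictedLiouville N) m
        (show TangentSpace 𝓘(ℝ, EN) m from infGen EN EG G (hN.spar q₀ (z + t • v)) ξ) = 0 := by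
      rintro m rfl
      refine (hN.lin_restrictedLiouville _ _).trans ?_
      exact (congrArg _ (hN.mfderiv_baseProj_infGen hact _ ξ)).trans (hξ _)
    exact key _ (hσ0 _)
  have e3 : curl (pull σ (restrictedLiouville (EN := EN) N)) (0, z) ((1 : ℝ), 0)
      ((0 : ℝ), v) = 0 := by
    unfold curl
    rw [e1, e2, sub_zero]
  rw [e3] at hcurl
  refine (hN.restrictedForm_eq _ _ _).trans ?_
  refine neg_eq_zero.2 (Eq.trans ?_ hcurl.symm)
  refine (two_eq_of_eq (extd (restrictedLiouville (EN := EN) N)) (hσ0 z) (ht z hz) ?_).symm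
  have hd0 := (hσ z hz).mdifferentiableAt (by simp)
  refine (hw 0 hd0).trans ?_
  have key : ∀ g : G, g = 1 → (show EN from tangentAction EN g (hN.spar q₀ z)
      (mfderiv 𝓘(ℝ, E × (E →L[ℝ] ℝ)) 𝓘(ℝ, EN) (hN.spar q₀) z v)) =
      mfderiv 𝓘(ℝ, E × (E →L[ℝ] ℝ)) 𝓘(ℝ, EN) (hN.spar q₀) z v := by
    rintro g rfl
    exact tangentAction_one (E := EN) (hN.spar q₀ z) _
  exact key _ hc0

variable {D W : ∀ q : Q, Submodule ℝ (TangentSpace 𝓘(ℝ, E) q)}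
  (hD : ∀ q v, v ∈ D q ↔ R.P q v = v) (hW : ∀ q v, v ∈ W q ↔ R.P q v = 0)
  {𝔤W : Submodule ℝ (GroupLieAlgebra 𝓘(ℝ, EG) G)}
  (hS : ∀ q : Q, W q = 𝔤W.map (infGen E EG G q).toLinearMap)

-- A covector in `N` factors through `R`, which kills `W`; hence `N` lies in the zero level of the
-- momenta of `𝔤W`.
include hW hS in
theorem snd_infGen_eq_zero {ξ : GroupLieAlgebra 𝓘(ℝ, EG) G} (hξ : ξ ∈ 𝔤W) (m : N) :
    m.1.snd (infGen E EG G (baseProj N m) ξ) = 0 := by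
  have h1 : infGen E EG G (baseProj N m) ξ ∈ W (baseProj N m) := by
    rw [hS]; exact Submodule.mem_map_of_mem hξ
  have h2 : (R.dual m.1).snd (infGen E EG G (baseProj N m) ξ) = 0 :=
    (congrArg m.1.snd ((hW _ _).1 h1)).trans (map_zero _)
  have key : ∀ β : CotangentBundle E Q, β = m.1 → (show E →L[ℝ] ℝ from β.snd)
      (infGen E EG G (baseProj N m) ξ) = 0 → m.1.snd (infGen E EG G (baseProj N m) ξ) = 0 := by
    rintro β rfl h; exact h
  exact key _ ((hN.mem_iff m.1).1 m.2) h2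

include hD hW hS in
/-- The Hamiltonian vector field of an invariant function for the distribution is Hamiltonian for
the canonical form. -/
theorem curl_ham_of_invariant {q₀ : Q} {z : E × (E →L[ℝ] ℝ)}
    (hz : z.1 ∈ (extChartAt 𝓘(ℝ, E) q₀).target) {f : N → ℝ}
    (hf : MDifferentiableAt 𝓘(ℝ, EN) 𝓘(ℝ, ℝ) f (hN.spar q₀ z))
    (hfG : ∀ (g : G), f (g • hN.spar q₀ z) = f (hN.spar q₀ z)) (v : E × (E →L[ℝ] ℝ)) :
    -curl (pull (hN.spar q₀) (restrictedLiouville (EN := EN) N)) z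
      (R.ham q₀ (f ∘ hN.spar q₀) z) v = fderiv ℝ (f ∘ hN.spar q₀) z v := by
  have hsm := hN.contMDiffSMul (EG := EG) hact
  rw [curl_pull (hN.contMDiffAt_spar hz) (hN.smoothFormAt_restrictedLiouville _),
    ← hN.restrictedForm_eq]
  -- The `W`-component of the projected vector is the generator of some `ξ ∈ 𝔤W`. Subtracting the
  -- generator of `ξ` on `N` leaves a vector of the distribution.
  obtain ⟨ξ, hξ, hξv⟩ : ∃ ξ ∈ 𝔤W, infGen E EG G (baseProj N (hN.spar q₀ z)) ξ =
      mfderiv 𝓘(ℝ, EN) 𝓘(ℝ, E) (baseProj N) (hN.spar q₀ z)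
        (mfderiv 𝓘(ℝ, E × (E →L[ℝ] ℝ)) 𝓘(ℝ, EN) (hN.spar q₀) z v) - R.P _
      (mfderiv 𝓘(ℝ, EN) 𝓘(ℝ, E) (baseProj N) (hN.spar q₀ z)
        (mfderiv 𝓘(ℝ, E × (E →L[ℝ] ℝ)) 𝓘(ℝ, EN) (hN.spar q₀) z v)) := by
    have h1 : mfderiv 𝓘(ℝ, EN) 𝓘(ℝ, E) (baseProj N) (hN.spar q₀ z)
        (mfderiv 𝓘(ℝ, E × (E →L[ℝ] ℝ)) 𝓘(ℝ, EN) (hN.spar q₀) z v) - R.P _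
        (mfderiv 𝓘(ℝ, EN) 𝓘(ℝ, E) (baseProj N) (hN.spar q₀ z)
        (mfderiv 𝓘(ℝ, E × (E →L[ℝ] ℝ)) 𝓘(ℝ, EN) (hN.spar q₀) z v)) ∈
        W (baseProj N (hN.spar q₀ z)) := by
      rw [hW, map_sub, R.idem, sub_self]
    rw [hS] at h1
    exact h1
  obtain ⟨v', hv'⟩ : ∃ v' : E × (E →L[ℝ] ℝ),
      mfderiv 𝓘(ℝ, E × (E →L[ℝ] ℝ)) 𝓘(ℝ, EN) (hN.spar q₀) z v' =
        mfderiv 𝓘(ℝ, E × (E →L[ℝ] ℝ)) 𝓘(ℝ, EN) (hN.spar q₀) z v -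
          infGen EN EG G (hN.spar q₀ z) ξ := hN.surjective_mfderiv_spar hz _
  have hmem : mfderiv 𝓘(ℝ, E × (E →L[ℝ] ℝ)) 𝓘(ℝ, EN) (hN.spar q₀) z v' ∈
      liftedDistribution N D (hN.spar q₀ z) := by
    rw [hv', hN.sub_infGen_mem_liftedDistribution hact, hξv, sub_sub_cancel, hD]
    exact R.idem _ _
  have hsplit : mfderiv 𝓘(ℝ, E × (E →L[ℝ] ℝ)) 𝓘(ℝ, EN) (hN.spar q₀) z v =
      mfderiv 𝓘(ℝ, E × (E →L[ℝ] ℝ)) 𝓘(ℝ, EN) (hN.spar q₀) z v' +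
        infGen EN EG G (hN.spar q₀ z) ξ := by
    rw [hv', sub_add_cancel]
  have h0 := hN.restrictedForm_infGen hact hz (hN.snd_infGen_eq_zero hact hW hS hξ)
    (R.ham q₀ (f ∘ hN.spar q₀) z)
  have h1 := hN.curl_ham hz hf ((hN.mfderiv_spar_mem hD hz v').1 hmem)
  -- On the distribution the equation is `curl_ham`; on the generator `df` vanishes by invariance
  -- and the form vanishes by `h0`.
  rw [hN.fderiv_comp_spar hz hf] at h1 ⊢
  rw [hsplit, map_add, dfun_infGen_of_invariant hf hfG, add_zero, ← h1]
  rw [← bil_apply, ← bil_apply, map_add]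
  rw [two_swap] at h0
  rw [← bil_apply, neg_eq_zero] at h0
  rw [h0, add_zero]

-- For invariant functions the fields `ham` are Hamiltonian in every direction, not only along the
-- distribution, and the restricted form is exact. The computation `jacobi_of_curl` then applies in
-- the parameter space; it needs Hamilton's equations but not nondegeneracy, so the redundancy of
-- the parameters is harmless.
include hD hW hS in
theorem jacobi_of_invariant {f g h : N → ℝ} (hf : ContMDiff 𝓘(ℝ, EN) 𝓘(ℝ, ℝ) ∞ f)
    (hg : ContMDiff 𝓘(ℝ, EN) 𝓘(ℝ, ℝ) ∞ g) (hh : ContMDiff 𝓘(ℝ, EN) 𝓘(ℝ, ℝ) ∞ h)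
    (hfG : ∀ (c : G) (m : N), f (c • m) = f m) (hgG : ∀ (c : G) (m : N), g (c • m) = g m)
    (hhG : ∀ (c : G) (m : N), h (c • m) = h m) :
    bracket (liftedDistribution (EN := EN) N D) (restrictedForm N) f
        (bracket (liftedDistribution (EN := EN) N D) (restrictedForm N) g h) +
      bracket (liftedDistribution (EN := EN) N D) (restrictedForm N) g
        (bracket (liftedDistribution (EN := EN) N D) (restrictedForm N) h f) +
      bracket (liftedDistribution (EN := EN) N D) (restrictedForm N) h
        (bracket (liftedDistribution (EN := EN) N D) (restrictedForm N) f g) = 0 := by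
  funext m
  obtain ⟨q₀, hm⟩ : ∃ q₀, baseProj N m ∈ (extChartAt 𝓘(ℝ, E) q₀).source :=
    ⟨_, mem_extChartAt_source _⟩
  obtain ⟨z, hz, -, rfl⟩ := hN.exists_spar_eq q₀ hm
  have hev : ∀ᶠ w : E × (E →L[ℝ] ℝ) in 𝓝 z, w.1 ∈ (extChartAt 𝓘(ℝ, E) q₀).target :=
    continuous_fst.continuousAt.preimage_mem_nhds ((isOpen_extChartAt_target q₀).mem_nhds hz)
  have hd : ∀ {f : N → ℝ}, ContMDiff 𝓘(ℝ, EN) 𝓘(ℝ, ℝ) ∞ f → ∀ m,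
      MDifferentiableAt 𝓘(ℝ, EN) 𝓘(ℝ, ℝ) f m := fun hf m => hf.mdifferentiableAt (by simp)
  have hF : ∀ {f : N → ℝ}, ContMDiff 𝓘(ℝ, EN) 𝓘(ℝ, ℝ) ∞ f →
      ContDiffAt ℝ ∞ (f ∘ hN.spar q₀) z := fun hf =>
    ((hf _).comp _ (hN.contMDiffAt_spar hz)).contDiffAt
  have hX : ∀ {f : N → ℝ}, ContMDiff 𝓘(ℝ, EN) 𝓘(ℝ, ℝ) ∞ f →
      DifferentiableAt ℝ (R.ham q₀ (f ∘ hN.spar q₀)) z := fun hf =>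
    (R.contDiffAt_ham (hF hf) hz).differentiableAt (by simp)
  have hc : ∀ {f : N → ℝ}, ContMDiff 𝓘(ℝ, EN) 𝓘(ℝ, ℝ) ∞ f →
      (∀ (c : G) (m : N), f (c • m) = f m) → ∀ᶠ w in 𝓝 z, ∀ v,
      -curl (pull (hN.spar q₀) (restrictedLiouville (EN := EN) N)) w
        (R.ham q₀ (f ∘ hN.spar q₀) w) v = fderiv ℝ (f ∘ hN.spar q₀) w v := by
    intro f hf hfG
    filter_upwards [hev] with w hw v
    exact hN.curl_ham_of_invariant hact hD hW hS hw (hd hf _) (fun g => hfG g _) v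
  have hb : ∀ {f g h : N → ℝ}, ContMDiff 𝓘(ℝ, EN) 𝓘(ℝ, ℝ) ∞ f →
      ContMDiff 𝓘(ℝ, EN) 𝓘(ℝ, ℝ) ∞ g → ContMDiff 𝓘(ℝ, EN) 𝓘(ℝ, ℝ) ∞ h →
      bracket (liftedDistribution (EN := EN) N D) (restrictedForm N) f
        (bracket (liftedDistribution (EN := EN) N D) (restrictedForm N) g h) (hN.spar q₀ z) =
      fderiv ℝ (fun w => fderiv ℝ (h ∘ hN.spar q₀) w (R.ham q₀ (g ∘ hN.spar q₀) w)) z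
        (R.ham q₀ (f ∘ hN.spar q₀) z) := by
    intro f g h hf hg hh
    rw [hN.bracket_spar hD hz (hd hf _) (hd (hN.contMDiff_bracket hD hg hh) _)]
    have e : bracket (liftedDistribution (EN := EN) N D) (restrictedForm N) g h ∘ hN.spar q₀
        =ᶠ[𝓝 z] fun w => -fderiv ℝ (h ∘ hN.spar q₀) w (R.ham q₀ (g ∘ hN.spar q₀) w) := by
      filter_upwards [hev] with w hw
      exact hN.bracket_spar hD hw (hd hg _) (hd hh _)
    rw [e.fderiv_eq, fderiv_fun_neg]
    exact neg_neg _
  have hJ := jacobi_of_curl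
    (smoothFormAt_pull (hN.contMDiffAt_spar hz) (hN.smoothFormAt_restrictedLiouville _))
    (hF hf) (hF hg) (hF hh) (hX hf) (hX hg) (hX hh) (hc hf hfG) (hc hg hgG) (hc hh hhG)
  change _ + _ + _ = (0 : ℝ)
  rw [hb hf hg hh, hb hg hh hf, hb hh hf hg]
  exact hJ

end ProjField.IsDualImage
end MomentumLevel

/-! ### The kernel of the orbit projection is vertical -/

section OrbitTangent

variable {E Q EG G : Type*} [NormedAddCommGroup E] [NormedSpace ℝ E]
  [TopologicalSpace Q] [ChartedSpace E Q] [IsManifold 𝓘(ℝ, E) ∞ Q]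
  [NormedAddCommGroup EG] [NormedSpace ℝ EG]
  [TopologicalSpace G] [ChartedSpace EG G] [Group G] [LieGroup 𝓘(ℝ, EG) ∞ G]
  [MulAction G Q] [ContMDiffSMul 𝓘(ℝ, EG) 𝓘(ℝ, E) ∞ G Q]

omit [ChartedSpace E Q] [IsManifold 𝓘(ℝ, E) ∞ Q] [NormedSpace ℝ E]
  [ContMDiffSMul 𝓘(ℝ, EG) 𝓘(ℝ, E) ∞ G Q] [ChartedSpace EG G] [NormedSpace ℝ EG]
  [LieGroup 𝓘(ℝ, EG) ∞ G] [NormedAddCommGroup E] [NormedAddCommGroup EG] in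
/-- The orbit maps of a free proper action are topological embeddings. -/
theorem tendsto_of_tendsto_smul [T2Space Q] [ProperSMul G Q] [IsCancelSMul G Q] {ι : Type*}
    {l : Filter ι} {g : ι → G} {c : G} {q : Q}
    (h : Filter.Tendsto (fun i => g i • q) l (𝓝 (c • q))) : Filter.Tendsto g l (𝓝 c) := by
  -- Properness makes this map closed and freeness makes it injective.
  have h1 : Topology.IsClosedEmbedding (fun p : G × Q => (p.1 • p.2, p.2)) := by
    have hp := ProperSMul.isProperMap_smul_pair (G := G) (X := Q)
    refine Topology.IsClosedEmbedding.of_continuous_injective_isClosedMap hp.continuous ?_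
      hp.isClosedMap
    rintro ⟨a, x⟩ ⟨b, y⟩ hab
    obtain ⟨h1, rfl⟩ := Prod.ext_iff.1 hab
    exact Prod.ext (IsCancelSMul.right_cancel _ _ _ h1) rfl
  have h2 : Filter.Tendsto (fun i => (g i, q)) l (𝓝 (c, q)) :=
    h1.isInducing.tendsto_nhds_iff.2 (h.prodMk_nhds tendsto_const_nhds)
  exact (continuous_fst.tendsto (c, q)).comp h2

variable [FiniteDimensional ℝ EG] [FiniteDimensional ℝ E] [T2Space Q] [ProperSMul G Q]
  [IsCancelSMul G Q]

/-- The velocity of a curve in an orbit is vertical. -/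
theorem mem_vertical_of_curve {γ : ℝ → Q} (hγ : ContMDiffAt 𝓘(ℝ, ℝ) 𝓘(ℝ, E) ∞ γ 0)
    (h : ∀ᶠ t in 𝓝 0, ∃ g : G, g • γ 0 = γ t) :
    (show TangentSpace 𝓘(ℝ, E) (γ 0) from mfderiv 𝓘(ℝ, ℝ) 𝓘(ℝ, E) γ 0 (1 : ℝ)) ∈
      vertical E EG G (γ 0) := by
  have : CompleteSpace EG := FiniteDimensional.complete ℝ EG
  obtain ⟨q, hq⟩ : ∃ q, q = γ 0 := ⟨_, rfl⟩
  classical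
  -- The group elements are chosen pointwise, without any regularity; continuity at `0` comes from
  -- properness and differentiability from the inverse function theorem.
  let g : ℝ → G := fun t => if h : ∃ g : G, g • γ 0 = γ t then h.choose else 1
  have hg : ∀ᶠ t in 𝓝 0, g t • γ 0 = γ t := by
    filter_upwards [h] with t ht
    simp only [g, dif_pos ht]
    exact ht.choose_spec
  have hlim : Filter.Tendsto g (𝓝 0) (𝓝 1) := by
    refine tendsto_of_tendsto_smul (q := γ 0) ?_
    rw [one_smul]
    exact hγ.continuousAt.tendsto.congr' (hg.mono fun t ht => ht.symm)
  have h1s := mem_extChartAt_source (I := 𝓘(ℝ, EG)) (1 : G)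
  have hy0 := mem_extChartAt_target (I := 𝓘(ℝ, EG)) (1 : G)
  have hc1 := (extChartAt 𝓘(ℝ, EG) (1 : G)).left_inv h1s
  set y0 := extChartAt 𝓘(ℝ, EG) (1 : G) 1 with hy0_def
  let m : EG → Q := fun y => (extChartAt 𝓘(ℝ, EG) (1 : G)).symm y • γ 0
  have hm : ContMDiffAt 𝓘(ℝ, EG) 𝓘(ℝ, E) ∞ m y0 :=
    (contMDiff_smul_const (EG := EG) (γ 0)).contMDiffAt.comp y0 (contMDiffAt_extChartAt_symm hy0)
  have hm0 : m y0 = γ 0 := by simp only [m, hc1, one_smul]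
  have hdm : HasMFDerivAt 𝓘(ℝ, EG) 𝓘(ℝ, E) m y0
      ((show EG →L[ℝ] E from infGen E EG G (γ 0)) ∘L
        (show EG →L[ℝ] EG from dpar (1 : G) y0)) := by
    have key : ∀ p : G, p = 1 → HasMFDerivAt 𝓘(ℝ, EG) 𝓘(ℝ, E) (fun g : G => g • γ 0) p
        (show EG →L[ℝ] E from infGen E EG G (γ 0)) := by
      rintro p rfl
      exact ((contMDiff_smul_const (EG := EG) (γ 0)).mdifferentiableAt (by simp)).hasMFDerivAt
    exact (key _ hc1).comp y0
      ((contMDiffAt_extChartAt_symm hy0).mdifferentiableAt (by simp)).hasMFDerivAt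
  have hsrc : m y0 ∈ (extChartAt 𝓘(ℝ, E) (γ 0)).source := by
    rw [hm0]; exact mem_extChartAt_source _
  let o : EG → E := fun y => extChartAt 𝓘(ℝ, E) (γ 0) (m y)
  have ho : ContDiffAt ℝ ∞ o y0 :=
    ((contMDiffAt_extChartAt_of_mem hsrc).comp y0 hm).contDiffAt
  have hinj : Function.Injective (fderiv ℝ o y0) := by
    intro u v huv
    rw [← dch_mfderiv (hm.mdifferentiableAt (by simp)) hsrc,
      ← dch_mfderiv (hm.mdifferentiableAt (by simp)) hsrc] at huv
    have h1 := (dch_isInvertible hsrc).bijective.1 huv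
    rw [hdm.mfderiv] at h1
    have h2 := infGen_injective (E := E) (EG := EG) (G := G) (γ 0) h1
    have h3 := congrArg (dch EG (1 : G) ((extChartAt 𝓘(ℝ, EG) (1 : G)).symm y0)) h2
    exact (dch_dpar hy0 u).symm.trans (h3.trans (dch_dpar hy0 v))
  obtain ⟨L, hL⟩ := (fderiv ℝ o y0).toLinearMap.exists_leftInverse_of_injective
    (LinearMap.ker_eq_bot.2 hinj)
  let L' : E →L[ℝ] EG := LinearMap.toContinuousLinearMap L
  -- The orbit map `o` in charts is an immersion at `y0`. Composed with a left inverse `L'` of its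
  -- derivative it becomes locally invertible on `EG`.
  have hstrict : HasStrictFDerivAt (L' ∘ o) (ContinuousLinearEquiv.refl ℝ EG : EG →L[ℝ] EG) y0 := by
    have h1 := (L'.hasStrictFDerivAt).comp y0 (ho.hasStrictFDerivAt (by simp))
    convert! h1 using 1
    ext v
    exact (congrArg (fun l : EG →ₗ[ℝ] EG => l v) hL).symm
  -- the coordinates of the group elements
  let y : ℝ → EG := fun t => extChartAt 𝓘(ℝ, EG) (1 : G) (g t)
  have hy : Filter.Tendsto y (𝓝 0) (𝓝 y0) :=
    ((continuousAt_extChartAt (I := 𝓘(ℝ, EG)) (1 : G)).tendsto).comp hlim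
  have hmy : ∀ᶠ t in 𝓝 0, m (y t) = γ t := by
    filter_upwards [hg, hlim.eventually ((isOpen_extChartAt_source (I := 𝓘(ℝ, EG)) (1 : G)).mem_nhds
      h1s)] with t ht hts
    simp only [m, y]
    rw [(extChartAt 𝓘(ℝ, EG) (1 : G)).left_inv hts, ht]
  have hk : DifferentiableAt ℝ (fun t => L' (extChartAt 𝓘(ℝ, E) (γ 0) (γ t))) 0 :=
    (L'.contDiff.contDiffAt.comp 0 (contDiffAt_extChartAt_comp hγ
      (mem_extChartAt_source _))).differentiableAt (by simp)
  -- The group coordinate is recovered from the curve by the local inverse, so it is differentiable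
  -- at `0`; the chain rule then shows that the velocity is a generator.
  have hyeq : y =ᶠ[𝓝 0] hstrict.localInverse ∘
      fun t => L' (extChartAt 𝓘(ℝ, E) (γ 0) (γ t)) := by
    filter_upwards [hy.eventually hstrict.eventually_left_inverse, hmy] with t ht ht'
    rw [Function.comp, ← ht']
    exact ht.symm
  have hk0 : L' (extChartAt 𝓘(ℝ, E) (γ 0) (γ 0)) = (L' ∘ o) y0 := by
    simp only [o, Function.comp, hm0]
  have hdinv : DifferentiableAt ℝ (hstrict.localInverse)
      ((fun t => L' (extChartAt 𝓘(ℝ, E) (γ 0) (γ t))) 0) := by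
    change DifferentiableAt ℝ _ (L' (extChartAt 𝓘(ℝ, E) (γ 0) (γ 0)))
    rw [hk0]
    exact hstrict.to_localInverse.differentiableAt
  have hdy : DifferentiableAt ℝ y 0 := (hdinv.comp 0 hk).congr_of_eventuallyEq hyeq
  have hy0' : y 0 = y0 := by
    have h1 := hyeq.self_of_nhds
    rw [h1, Function.comp, hk0]
    exact hstrict.localInverse_apply_image
  rw [← hy0'] at hdm
  have hfin := ((hdm.comp 0 hdy.hasFDerivAt.hasMFDerivAt).congr_of_eventuallyEq
    (show γ =ᶠ[𝓝 0] m ∘ y from hmy.mono fun t ht => ht.symm)).mfderiv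
  exact ⟨(show EG →L[ℝ] EG from dpar (1 : G) (y 0)) (fderiv ℝ y 0 1),
    (congrArg (fun l : ℝ →L[ℝ] E => l 1) hfin).symm⟩

variable {EB : Type*} [NormedAddCommGroup EB] [NormedSpace ℝ EB]
  [ChartedSpace EB (MulAction.orbitRel.Quotient G Q)]
  [IsManifold 𝓘(ℝ, EB) ∞ (MulAction.orbitRel.Quotient G Q)]
  (hp : Manifold.IsSubmersion 𝓘(ℝ, E) 𝓘(ℝ, EB) ∞ (orbitMap G Q))

include hp in
/-- The kernel of the tangent map of the orbit projection is tangent to the orbits. -/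
theorem mem_vertical_of_mfderiv_orbitMap {q : Q} {v : TangentSpace 𝓘(ℝ, E) q}
    (hv : mfderiv 𝓘(ℝ, E) 𝓘(ℝ, EB) (orbitMap G Q) q v = 0) : v ∈ vertical E EG G q := by
  obtain ⟨γ, hγ, rfl, hγq, rfl⟩ := (exists_section_of_isSubmersion hp q).2 v hv
  refine mem_vertical_of_curve hγ ?_
  filter_upwards [hγq] with t ht
  exact orbitMap_eq_iff.1 ht

end OrbitTangent

theorem mfderiv_orbitMap_infGen {E Q EG G : Type*} [NormedAddCommGroup E] [NormedSpace ℝ E]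
    [TopologicalSpace Q] [ChartedSpace E Q] [IsManifold 𝓘(ℝ, E) ∞ Q]
    [NormedAddCommGroup EG] [NormedSpace ℝ EG]
    [TopologicalSpace G] [ChartedSpace EG G] [Group G] [LieGroup 𝓘(ℝ, EG) ∞ G]
    [MulAction G Q] [ContMDiffSMul 𝓘(ℝ, EG) 𝓘(ℝ, E) ∞ G Q]
    {EB : Type*} [NormedAddCommGroup EB] [NormedSpace ℝ EB]
    [ChartedSpace EB (MulAction.orbitRel.Quotient G Q)]
    [IsManifold 𝓘(ℝ, EB) ∞ (MulAction.orbitRel.Quotient G Q)]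
    (hp : ContMDiff 𝓘(ℝ, E) 𝓘(ℝ, EB) ∞ (orbitMap G Q)) (q : Q)
    (ξ : GroupLieAlgebra 𝓘(ℝ, EG) G) :
    mfderiv 𝓘(ℝ, E) 𝓘(ℝ, EB) (orbitMap G Q) q (infGen E EG G q ξ) = 0 := by
  obtain ⟨c, hc, hc0, hcξ⟩ := exists_curve (1 : G) ξ
  have h1 := mfderiv_comp_curve (f := fun g : G => g • q) hc hc0 hcξ
    ((contMDiff_smul_const (E := E) (EG := EG) q).mdifferentiableAt (by simp))
  have h2 : ContMDiffAt 𝓘(ℝ, ℝ) 𝓘(ℝ, E) ∞ ((fun g : G => g • q) ∘ c) 0 :=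
    (contMDiff_smul_const (E := E) (EG := EG) q).contMDiffAt.comp 0 hc
  have h3 := mfderiv_comp_curve (f := orbitMap G Q) h2
    (by simp only [Function.comp, hc0, one_smul]) h1 (hp.mdifferentiableAt (by simp))
  refine (congrArg (fun l : E →L[ℝ] EB => l (infGen E EG G q ξ))
    (mfderiv_eq_of_eq (orbitMap G Q) (one_smul G q)).symm).trans (h3.symm.trans ?_)
  have h4 : orbitMap G Q ∘ ((fun g : G => g • q) ∘ c) = fun _ => orbitMap G Q q :=
    funext fun t => orbitMap_smul (c t) q
  rw [h4, mfderiv_const]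
  rfl

/-! ### Covectors pulled back along a map, and smoothness in both directions -/

section CoveredCovectors

variable {E Q EB B : Type*} [NormedAddCommGroup E] [NormedSpace ℝ E]
  [TopologicalSpace Q] [ChartedSpace E Q] [NormedAddCommGroup EB] [NormedSpace ℝ EB]
  [TopologicalSpace B] [ChartedSpace EB B]

/-- The covector `b` on `B` pulls back to the covector `α` on `Q` under the map `f`. -/
def PullsBackTo (f : Q → B) (b : CotangentBundle EB B) (α : CotangentBundle E Q) : Prop :=
  b.proj = f α.proj ∧ ∀ v : E, (show EB →L[ℝ] ℝ from b.snd)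
    ((show E →L[ℝ] EB from mfderiv 𝓘(ℝ, E) 𝓘(ℝ, EB) f α.proj) v) =
      (show E →L[ℝ] ℝ from α.snd) v

/-- The tangent map of `f` in charts. -/
noncomputable def tanCoord (f : Q → B) (q₀ : Q) (b₀ : B) (x : E) : E →L[ℝ] EB :=
  fderiv ℝ (fun y => extChartAt 𝓘(ℝ, EB) b₀ (f ((extChartAt 𝓘(ℝ, E) q₀).symm y))) x

variable {f : Q → B}

theorem PullsBackTo.eq_of_surjective {b b' : CotangentBundle EB B} {α : CotangentBundle E Q}
    (h : PullsBackTo f b α) (h' : PullsBackTo f b' α)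
    (hs : Function.Surjective (mfderiv 𝓘(ℝ, E) 𝓘(ℝ, EB) f α.proj)) : b = b' := by
  refine cotangent_ext (h.1.trans h'.1.symm) fun w => ?_
  obtain ⟨v, rfl⟩ : ∃ v : E,
    (show E →L[ℝ] EB from mfderiv 𝓘(ℝ, E) 𝓘(ℝ, EB) f α.proj) v = w := hs w
  exact (h.2 v).trans (h'.2 v).symm

theorem PullsBackTo.eq_of_proj_eq {b : CotangentBundle EB B} {α α' : CotangentBundle E Q}
    (h : PullsBackTo f b α) (h' : PullsBackTo f b α') (hp : α.proj = α'.proj) : α = α' := by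
  refine cotangent_ext hp fun v => (h.2 v).symm.trans (Eq.trans ?_ (h'.2 v))
  rw [hp]

theorem exists_pullsBackTo (b : CotangentBundle EB B) {q : Q} (hq : b.proj = f q) :
    ∃ α : CotangentBundle E Q, α.proj = q ∧ PullsBackTo f b α := by
  obtain ⟨p, β⟩ := b
  obtain rfl : p = f q := hq
  exact ⟨⟨q, β ∘L mfderiv 𝓘(ℝ, E) 𝓘(ℝ, EB) f q⟩, rfl, rfl, fun v => rfl⟩

/-- Compose `α` with a linear right inverse of the tangent map; the error lies in the kernel, where
`α` vanishes. -/
theorem exists_pullsBackTo_of_ker [FiniteDimensional ℝ EB] (α : CotangentBundle E Q)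
    (hs : Function.Surjective (mfderiv 𝓘(ℝ, E) 𝓘(ℝ, EB) f α.proj))
    (hα : ∀ v, mfderiv 𝓘(ℝ, E) 𝓘(ℝ, EB) f α.proj v = 0 → α.snd v = 0) :
    ∃ b : CotangentBundle EB B, PullsBackTo f b α := by
  let T : E →L[ℝ] EB := mfderiv 𝓘(ℝ, E) 𝓘(ℝ, EB) f α.proj
  obtain ⟨r, hr⟩ := T.toLinearMap.exists_rightInverse_of_surjective
    (LinearMap.range_eq_top.2 hs)
  let r' : EB →L[ℝ] E := LinearMap.toContinuousLinearMap r
  refine ⟨⟨f α.proj, (show E →L[ℝ] ℝ from α.snd) ∘L r'⟩, rfl, fun v => ?_⟩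
  have h1 : T (r (T v) - v) = 0 := by
    rw [map_sub, sub_eq_zero]
    exact congrArg (fun l : EB →ₗ[ℝ] EB => l (T v)) hr
  have h2 := hα (r (T v) - v) h1
  exact sub_eq_zero.1 ((map_sub (show E →L[ℝ] ℝ from α.snd) _ _).symm.trans h2)

variable [IsManifold 𝓘(ℝ, E) ∞ Q] [IsManifold 𝓘(ℝ, EB) ∞ B]
  (hf : ContMDiff 𝓘(ℝ, E) 𝓘(ℝ, EB) ∞ f)

include hf

theorem tanCoord_dch {q₀ q : Q} {b₀ : B} (hq : q ∈ (extChartAt 𝓘(ℝ, E) q₀).source)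
    (hb : f q ∈ (extChartAt 𝓘(ℝ, EB) b₀).source) (v : TangentSpace 𝓘(ℝ, E) q) :
    tanCoord f q₀ b₀ (extChartAt 𝓘(ℝ, E) q₀ q) (dch E q₀ q v) =
      dch EB b₀ (f q) (mfderiv 𝓘(ℝ, E) 𝓘(ℝ, EB) f q v) := by
  obtain ⟨x, hx, rfl⟩ : ∃ x ∈ (extChartAt 𝓘(ℝ, E) q₀).target,
      (extChartAt 𝓘(ℝ, E) q₀).symm x = q :=
    ⟨_, (extChartAt 𝓘(ℝ, E) q₀).map_source hq, (extChartAt 𝓘(ℝ, E) q₀).left_inv hq⟩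
  obtain ⟨u, rfl⟩ : ∃ u, dpar q₀ x u = v := ⟨_, dpar_dch hx v⟩
  have hs : MDifferentiableAt 𝓘(ℝ, E) 𝓘(ℝ, E) (extChartAt 𝓘(ℝ, E) q₀).symm x :=
    (contMDiffAt_extChartAt_symm hx).mdifferentiableAt (by simp)
  have h1 := mfderiv_comp (I' := 𝓘(ℝ, E)) (I'' := 𝓘(ℝ, EB)) x (f := (extChartAt 𝓘(ℝ, E) q₀).symm)
    (g := f) (hf.mdifferentiableAt (by simp)) hs
  have h2 := dch_mfderiv (q₀ := b₀) (f := f ∘ (extChartAt 𝓘(ℝ, E) q₀).symm) (w := x)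
    (MDifferentiableAt.comp (I' := 𝓘(ℝ, E)) x (hf.mdifferentiableAt (by simp)) hs) hb u
  rw [dch_dpar hx, tanCoord, (extChartAt 𝓘(ℝ, E) q₀).right_inv hx]
  refine h2.symm.trans ?_
  exact congrArg (dch EB b₀ (f ((extChartAt 𝓘(ℝ, E) q₀).symm x)))
    (congrArg (fun l : E →L[ℝ] EB => l u) h1)

theorem contDiffAt_tanCoord {q₀ q : Q} {b₀ : B} (hq : q ∈ (extChartAt 𝓘(ℝ, E) q₀).source)
    (hb : f q ∈ (extChartAt 𝓘(ℝ, EB) b₀).source) :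
    ContDiffAt ℝ ∞ (tanCoord (E := E) (EB := EB) f q₀ b₀) (extChartAt 𝓘(ℝ, E) q₀ q) := by
  have hx := (extChartAt 𝓘(ℝ, E) q₀).map_source hq
  have h1 : ContMDiffAt 𝓘(ℝ, E) 𝓘(ℝ, EB) ∞ (f ∘ (extChartAt 𝓘(ℝ, E) q₀).symm)
      (extChartAt 𝓘(ℝ, E) q₀ q) :=
    hf.contMDiffAt.comp _ (contMDiffAt_extChartAt_symm hx)
  refine (contDiffAt_extChartAt_comp h1 ?_).fderiv_right (m := ∞) (by simp)
  simp only [Function.comp, (extChartAt 𝓘(ℝ, E) q₀).left_inv hq, hb]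

theorem PullsBackTo.cotCoord_comp_tanCoord {b : CotangentBundle EB B} {α : CotangentBundle E Q}
    (h : PullsBackTo f b α) {q₀ : Q} {b₀ : B}
    (hq : α.proj ∈ (extChartAt 𝓘(ℝ, E) q₀).source)
    (hb : f α.proj ∈ (extChartAt 𝓘(ℝ, EB) b₀).source) :
    cotCoord b₀ b ∘L tanCoord f q₀ b₀ (extChartAt 𝓘(ℝ, E) q₀ α.proj) = cotCoord q₀ α := by
  obtain ⟨p, β⟩ := b
  obtain ⟨hp, hv⟩ := h
  obtain rfl : p = f α.proj := hp
  refine ContinuousLinearMap.ext fun w => ?_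
  obtain ⟨v, rfl⟩ := (dch_isInvertible hq).bijective.2 w
  refine (congrArg (cotCoord b₀ (⟨f α.proj, β⟩ : CotangentBundle EB B))
    (tanCoord_dch hf hq hb v)).trans ?_
  refine (congrArg β (dch_inverse_apply hb _)).trans ((hv v).trans ?_)
  exact (congrArg α.snd (dch_inverse_apply hq v)).symm

variable {EX HX X : Type*} [NormedAddCommGroup EX] [NormedSpace ℝ EX]
  [TopologicalSpace HX] {IX : ModelWithCorners ℝ EX HX} [TopologicalSpace X] [ChartedSpace HX X]
  {K : X → CotangentBundle EB B} {F : X → CotangentBundle E Q} {x : X}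

theorem contMDiffAt_of_pullsBackTo_right [FiniteDimensional ℝ E]
    (hK : ContMDiffAt IX (cotangentModel EB) ∞ K x)
    (hF : ContMDiffAt IX 𝓘(ℝ, E) ∞ (fun y => (F y).proj) x)
    (h : ∀ᶠ y in 𝓝 x, PullsBackTo f (K y) (F y)) :
    ContMDiffAt IX (cotangentModel E) ∞ F x := by
  have hq : (F x).proj ∈ (extChartAt 𝓘(ℝ, E) (F x).proj).source := mem_extChartAt_source _
  have hb : f (F x).proj ∈ (extChartAt 𝓘(ℝ, EB) (f (F x).proj)).source := mem_extChartAt_source _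
  have hKb : (K x).proj ∈ (extChartAt 𝓘(ℝ, EB) (f (F x).proj)).source := by
    rw [h.self_of_nhds.1]; exact hb
  obtain ⟨h1, h2⟩ := (contMDiffAt_cotangent_iff hKb).1 hK
  refine (contMDiffAt_cotangent_iff hq).2 ⟨hF, ?_⟩
  have h3 : ContMDiffAt IX 𝓘(ℝ, E →L[ℝ] EB) ∞ (fun y => tanCoord f (F x).proj (f (F x).proj)
      (extChartAt 𝓘(ℝ, E) (F x).proj (F y).proj)) x :=
    (contDiffAt_tanCoord hf hq hb).contMDiffAt.comp x
      ((contMDiffAt_extChartAt_of_mem hq).comp x hF)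
  refine (h2.clm_comp h3).congr_of_eventuallyEq ?_
  filter_upwards [h, hF.continuousAt.preimage_mem_nhds
    ((isOpen_extChartAt_source (F x).proj).mem_nhds hq),
    (hf.contMDiffAt.comp x hF).continuousAt.preimage_mem_nhds
    ((isOpen_extChartAt_source (f (F x).proj)).mem_nhds hb)] with y hy hy1 hy2
  exact (hy.cotCoord_comp_tanCoord hf hy1 hy2).symm

theorem contMDiffAt_of_pullsBackTo_left [FiniteDimensional ℝ E] [FiniteDimensional ℝ EB]
    (hF : ContMDiffAt IX (cotangentModel E) ∞ F x)
    (hs : Function.Surjective (mfderiv 𝓘(ℝ, E) 𝓘(ℝ, EB) f (F x).proj))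
    (h : ∀ᶠ y in 𝓝 x, PullsBackTo f (K y) (F y)) :
    ContMDiffAt IX (cotangentModel EB) ∞ K x := by
  have : CompleteSpace EB := FiniteDimensional.complete ℝ EB
  have hq : (F x).proj ∈ (extChartAt 𝓘(ℝ, E) (F x).proj).source := mem_extChartAt_source _
  have hb : f (F x).proj ∈ (extChartAt 𝓘(ℝ, EB) (f (F x).proj)).source := mem_extChartAt_source _
  have hKb : (K x).proj ∈ (extChartAt 𝓘(ℝ, EB) (f (F x).proj)).source := by
    rw [h.self_of_nhds.1]; exact hb
  obtain ⟨h1, h2⟩ := (contMDiffAt_cotangent_iff hq).1 hF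
  have hfF : ContMDiffAt IX 𝓘(ℝ, EB) ∞ (fun y => f (F y).proj) x := hf.contMDiffAt.comp x h1
  refine (contMDiffAt_cotangent_iff hKb).2
    ⟨hfF.congr_of_eventuallyEq (h.mono fun y hy => hy.1), ?_⟩
  let T : X → E →L[ℝ] EB := fun y => tanCoord f (F x).proj (f (F x).proj)
      (extChartAt 𝓘(ℝ, E) (F x).proj (F y).proj)
  have hT : ContMDiffAt IX 𝓘(ℝ, E →L[ℝ] EB) ∞ T x :=
    (contDiffAt_tanCoord hf hq hb).contMDiffAt.comp x
      ((contMDiffAt_extChartAt_of_mem hq).comp x h1)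
  have hTs : Function.Surjective (T x) := by
    intro w
    obtain ⟨u, rfl⟩ := (dch_isInvertible hb).bijective.2 w
    obtain ⟨v, rfl⟩ := hs u
    exact ⟨dch E (F x).proj (F x).proj v, tanCoord_dch hf hq hb v⟩
  -- A right inverse `r'` fixed at `x` still makes `T y ∘ r'` invertible nearby, and the covector
  -- downstairs is `α ∘ r' ∘ (T y ∘ r')⁻¹`.
  obtain ⟨r, hr⟩ := (T x).toLinearMap.exists_rightInverse_of_surjective
    (LinearMap.range_eq_top.2 hTs)
  let r' : EB →L[ℝ] E := LinearMap.toContinuousLinearMap r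
  have hTr : ContMDiffAt IX 𝓘(ℝ, EB →L[ℝ] EB) ∞ (fun y => T y ∘L r') x :=
    hT.clm_comp contMDiffAt_const
  have hinv : (T x ∘L r').IsInvertible := by
    refine ⟨ContinuousLinearEquiv.refl ℝ EB, ?_⟩
    ext v
    exact (congrArg (fun l : EB →ₗ[ℝ] EB => l v) hr).symm
  have hi : ContMDiffAt IX 𝓘(ℝ, EB →L[ℝ] EB) ∞ (fun y => (T y ∘L r').inverse) x :=
    (contDiffAt_inverse contDiffAt_id hinv).contMDiffAt.comp x hTr
  have hei : ∀ᶠ y in 𝓝 x, (T y ∘L r').IsInvertible :=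
    hTr.continuousAt.eventually (eventually_isInvertible continuousAt_id hinv)
  refine ((h2.clm_comp (contMDiffAt_const (c := r'))).clm_comp hi).congr_of_eventuallyEq ?_
  filter_upwards [h, hei, h1.continuousAt.preimage_mem_nhds
    ((isOpen_extChartAt_source (F x).proj).mem_nhds hq), hfF.continuousAt.preimage_mem_nhds
    ((isOpen_extChartAt_source (f (F x).proj)).mem_nhds hb)] with y hy hyi hy1 hy2
  refine ContinuousLinearMap.ext fun w => ?_
  obtain ⟨u, rfl⟩ := hyi.bijective.2 w
  have e1 := hy.cotCoord_comp_tanCoord hf hy1 hy2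
  have e2 : (T y ∘L r').inverse ((T y ∘L r') u) = u := hyi.inverse_apply_eq.2 rfl
  change _ = cotCoord _ (F y) (r' ((T y ∘L r').inverse ((T y ∘L r') u)))
  rw [e2, ← e1]
  rfl

end CoveredCovectors

/-! ### Covectors pulled back from the orbit space and the cotangent lift -/

section OrbitMapInvariance

variable {E Q EG G : Type*} [NormedAddCommGroup E] [NormedSpace ℝ E]
  [TopologicalSpace Q] [ChartedSpace E Q] [IsManifold 𝓘(ℝ, E) ∞ Q]
  [NormedAddCommGroup EG] [NormedSpace ℝ EG]
  [TopologicalSpace G] [ChartedSpace EG G] [Group G] [LieGroup 𝓘(ℝ, EG) ∞ G] [MulAction G Q]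
  {EB : Type*} [NormedAddCommGroup EB] [NormedSpace ℝ EB]
  [ChartedSpace EB (MulAction.orbitRel.Quotient G Q)]

theorem mfderiv_orbitMap_tangentAction [ContMDiffSMul 𝓘(ℝ, EG) 𝓘(ℝ, E) ∞ G Q]
    (hp : ContMDiff 𝓘(ℝ, E) 𝓘(ℝ, EB) ∞ (orbitMap G Q)) (g : G) (q : Q)
    (v : TangentSpace 𝓘(ℝ, E) q) :
    (show EB from mfderiv 𝓘(ℝ, E) 𝓘(ℝ, EB) (orbitMap G Q) (g • q) (tangentAction E g q v)) =
      mfderiv 𝓘(ℝ, E) 𝓘(ℝ, EB) (orbitMap G Q) q v := by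
  have h1 := mfderiv_comp (I' := 𝓘(ℝ, E)) (I'' := 𝓘(ℝ, EB)) q
    (g := orbitMap G Q) (f := fun q : Q => g • q) (hp.mdifferentiableAt (by simp))
    ((contMDiff_const_action (EG := EG) g).mdifferentiableAt (by simp))
  have e : orbitMap G Q ∘ (fun q : Q => g • q) = orbitMap G Q := funext fun q => orbitMap_smul g q
  rw [e] at h1
  exact (congrArg (fun l : E →L[ℝ] EB => l v) h1).symm

theorem PullsBackTo.smul [ContMDiffSMul 𝓘(ℝ, EG) 𝓘(ℝ, E) ∞ G Q]
    (hp : ContMDiff 𝓘(ℝ, E) 𝓘(ℝ, EB) ∞ (orbitMap G Q)) {b : CotangentBundle EB (MulAction.orbitRel.Quotient G Q)}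
    {α : CotangentBundle E Q} (h : PullsBackTo (orbitMap G Q) b α) (g : G) :
    PullsBackTo (orbitMap G Q) b (cotangentLift g α) := by
  have hG : ∀ g : G, MDifferentiable 𝓘(ℝ, E) 𝓘(ℝ, E) (fun q : Q => g • q) :=
    mdifferentiable_action (EG := EG)
  refine ⟨h.1.trans (orbitMap_smul g α.proj).symm, fun w => ?_⟩
  obtain ⟨v, rfl⟩ : ∃ v : E, (show E from tangentAction E g α.proj v) = w :=
    (tangentAction_isInvertible hG g α.proj).bijective.2 w
  refine Eq.trans ?_ (cotangentLift_apply hG g α v).symm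
  exact (congrArg (show EB →L[ℝ] ℝ from b.snd)
    (mfderiv_orbitMap_tangentAction (EG := EG) hp g α.proj v)).trans (h.2 v)

end OrbitMapInvariance

/-! ### The identification of `V°/G` with `T^*(Q/G)` -/

section CotangentReduction

variable {E Q EG G : Type*} [NormedAddCommGroup E] [NormedSpace ℝ E] [FiniteDimensional ℝ E]
  [TopologicalSpace Q] [ChartedSpace E Q] [IsManifold 𝓘(ℝ, E) ∞ Q] [T2Space Q]
  [NormedAddCommGroup EG] [NormedSpace ℝ EG] [FiniteDimensional ℝ EG]
  [TopologicalSpace G] [ChartedSpace EG G] [Group G] [LieGroup 𝓘(ℝ, EG) ∞ G]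
  [MulAction G Q] [ContMDiffSMul 𝓘(ℝ, EG) 𝓘(ℝ, E) ∞ G Q] [ProperSMul G Q] [IsCancelSMul G Q]
  {EB : Type*} [NormedAddCommGroup EB] [NormedSpace ℝ EB] [FiniteDimensional ℝ EB]
  [ChartedSpace EB (MulAction.orbitRel.Quotient G Q)]
  [IsManifold 𝓘(ℝ, EB) ∞ (MulAction.orbitRel.Quotient G Q)]
  (hp : Manifold.IsSubmersion 𝓘(ℝ, E) 𝓘(ℝ, EB) ∞ (orbitMap G Q))

include hp

/-- The zero level of the momentum map of the cotangent lift, reduced by the group, is the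
cotangent bundle of the orbit space. -/
theorem exists_cotangent_reduction {E₀ : Type*} [NormedAddCommGroup E₀] [NormedSpace ℝ E₀]
    {P : ProjField E Q} {N : Set (CotangentBundle E Q)} [ChartedSpace E₀ N]
    [IsManifold 𝓘(ℝ, E₀) ∞ N] [MulAction G N] (hN : P.IsDualImage E₀ N)
    (hact : ∀ (g : G) (m : N), (g • m).1 = cotangentLift g m.1)
    (hann : ∀ α : CotangentBundle E Q, α ∈ N ↔ ∀ w ∈ vertical E EG G α.proj, α.snd w = 0)
    {Er : Type*} [NormedAddCommGroup Er] [NormedSpace ℝ Er]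
    [ChartedSpace Er (MulAction.orbitRel.Quotient G N)]
    [IsManifold 𝓘(ℝ, Er) ∞ (MulAction.orbitRel.Quotient G N)]
    (hρ : Manifold.IsSubmersion 𝓘(ℝ, E₀) 𝓘(ℝ, Er) ∞ (orbitMap G N)) :
    ∃ Φ : MulAction.orbitRel.Quotient G N ≃ₘ^∞⟮𝓘(ℝ, Er), cotangentModel EB⟯
      CotangentBundle EB (MulAction.orbitRel.Quotient G Q),
      ∀ m : N, PullsBackTo (orbitMap G Q) (Φ (orbitMap G N m)) m.1 := by
  have hs := surjective_mfderiv_of_isSubmersion hp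
  -- A covector of `N` kills the vertical space, which contains the kernel of the tangent map of the
  -- orbit projection.
  have hex : ∀ m : N, ∃ b : CotangentBundle EB (MulAction.orbitRel.Quotient G Q),
      PullsBackTo (orbitMap G Q) b m.1 := fun m =>
    exists_pullsBackTo_of_ker m.1 (hs _) fun v hv =>
      (hann m.1).1 m.2 v (mem_vertical_of_mfderiv_orbitMap hp hv)
  choose φ hφ using hex
  have hφs : ContMDiff 𝓘(ℝ, E₀) (cotangentModel EB) ∞ φ := fun m =>
    contMDiffAt_of_pullsBackTo_left hp.contMDiff hN.contMDiff_val.contMDiffAt (hs _)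
      (Filter.Eventually.of_forall hφ)
  have hφG : ∀ (g : G) (m : N), φ (g • m) = φ m := fun g m => by
    have h1 := hφ (g • m)
    have h2 := (hφ m).smul (EG := EG) hp.contMDiff g
    rw [hact] at h1
    exact h1.eq_of_surjective h2 (hs _)
  let F : MulAction.orbitRel.Quotient G N →
      CotangentBundle EB (MulAction.orbitRel.Quotient G Q) :=
    Quotient.lift φ (fun a b hab => by
      obtain ⟨g, rfl⟩ := MulAction.orbitRel_apply.1 hab
      exact hφG g b)
  have hmem : ∀ (b : CotangentBundle EB (MulAction.orbitRel.Quotient G Q)) (q : Q),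
      b.proj = orbitMap G Q q → ∃ m : N, m.1.proj = q ∧ PullsBackTo (orbitMap G Q) b m.1 := by
    intro b q hq
    obtain ⟨α, hα, h⟩ := exists_pullsBackTo (f := orbitMap G Q) (E := E) b hq
    refine ⟨⟨α, (hann α).2 ?_⟩, hα, h⟩
    rintro w ⟨ξ, rfl⟩
    refine (h.2 _).symm.trans ?_
    exact (congrArg (show EB →L[ℝ] ℝ from b.snd)
      (mfderiv_orbitMap_infGen hp.contMDiff α.proj ξ)).trans (map_zero _)
  have hbij : Function.Bijective F := by
    constructor
    · intro y y' h
      obtain ⟨m, rfl⟩ := orbitMap_surjective y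
      obtain ⟨m', rfl⟩ := orbitMap_surjective y'
      have h' : φ m = φ m' := h
      have h1 := hφ m
      have h2 := hφ m'
      rw [h'] at h1
      obtain ⟨g, hg⟩ := orbitMap_eq_iff.1 (h1.1.symm.trans h2.1)
      refine orbitMap_eq_iff.2 ⟨g, Subtype.ext ?_⟩
      rw [hact]
      exact (h2.smul (EG := EG) hp.contMDiff g).eq_of_proj_eq h1 hg
    · intro b
      obtain ⟨q, hq⟩ := orbitMap_surjective (G := G) (P := Q) b.proj
      obtain ⟨m, -, hm⟩ := hmem b q hq.symm
      exact ⟨orbitMap G N m, (hφ m).eq_of_surjective hm (hs _)⟩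
  refine ⟨{ toEquiv := Equiv.ofBijective F hbij
            contMDiff_toFun := contMDiff_of_comp_orbitMap hρ hφs
            contMDiff_invFun := fun b => ?_ }, hφ⟩
  obtain ⟨q, hq⟩ := orbitMap_surjective (G := G) (P := Q) b.proj
  obtain ⟨⟨s, hsm, hsq, hps⟩, -⟩ := exists_section_of_isSubmersion hp q
  obtain ⟨m₀, -, -⟩ := hmem b q hq.symm
  classical
  -- A local lift of the inverse map to `N`: pull `b'` back to the point `s b'.proj` of a local
  -- section `s` of `Q → Q/G`. Near `b` the default `m₀` does not occur.
  let χ : CotangentBundle EB (MulAction.orbitRel.Quotient G Q) → N := fun b' =>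
    if h : ∃ m : N, m.1.proj = s b'.proj ∧ PullsBackTo (orbitMap G Q) b' m.1
    then h.choose else m₀
  have hproj : ContMDiff (cotangentModel EB) 𝓘(ℝ, EB) ∞
      (fun b : CotangentBundle EB (MulAction.orbitRel.Quotient G Q) => b.proj) :=
    contMDiff_cotangent_proj
  have hχ : ∀ᶠ b' in 𝓝 b, (χ b').1.proj = s b'.proj ∧
      PullsBackTo (orbitMap G Q) b' (χ b').1 := by
    rw [hq] at hps
    filter_upwards [hproj.continuous.continuousAt.eventually hps] with b' hb'
    have h := hmem b' (s b'.proj) hb'.symm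
    simp only [χ, dif_pos h]
    exact h.choose_spec
  have hχs : ContMDiffAt (cotangentModel EB) 𝓘(ℝ, E₀) ∞ χ b := by
    refine hN.contMDiffAt_iff.2 (contMDiffAt_of_pullsBackTo_right hp.contMDiff
      (contMDiffAt_id (I := cotangentModel EB)) ?_ (hχ.mono fun b' hb' => hb'.2))
    rw [hq] at hsm
    exact (ContMDiffAt.comp b hsm hproj.contMDiffAt).congr_of_eventuallyEq
      (hχ.mono fun b' hb' => hb'.1)
  refine (hρ.contMDiff.contMDiffAt.comp b hχs).congr_of_eventuallyEq ?_
  filter_upwards [hχ] with b' hb'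
  refine (Equiv.symm_apply_eq _).2 ?_
  exact hb'.2.eq_of_surjective (hφ _) (hs _)

end CotangentReduction

/-! ### Smooth 2-forms and the canonical form of `T^*B` -/

section SmoothTwoForms

variable {E P : Type*} [NormedAddCommGroup E] [NormedSpace ℝ E] [FiniteDimensional ℝ E]
  [TopologicalSpace P] [ChartedSpace E P] [IsManifold 𝓘(ℝ, E) ∞ P]

omit [IsManifold 𝓘(ℝ, E) ∞ P] in
theorem isSmoothForm_two {θ : DiffForm 𝓘(ℝ, E) P 2 ℝ}
    (h : ∀ (x : P), ∀ y ∈ (extChartAt 𝓘(ℝ, E) x).target, ∀ u v : E, ContDiffAt ℝ ∞ (fun w =>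
      θ ((extChartAt 𝓘(ℝ, E) x).symm w)
        ![mfderiv 𝓘(ℝ, E) 𝓘(ℝ, E) (extChartAt 𝓘(ℝ, E) x).symm w u,
          mfderiv 𝓘(ℝ, E) 𝓘(ℝ, E) (extChartAt 𝓘(ℝ, E) x).symm w v]) y) : IsSmoothForm θ := by
  intro x y hy
  refine (contDiffAt_alternating_of_apply fun m => ?_).contDiffWithinAt
  have e : m = ![m 0, m 1] := by funext i; fin_cases i <;> rfl
  rw [e]
  exact (h x y hy (m 0) (m 1)).congr_of_eventuallyEq
    (Filter.Eventually.of_forall fun w => two_comp _ _ _ _)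

omit [FiniteDimensional ℝ E] in
theorem contDiffAt_curl {Z F : Type*} [NormedAddCommGroup Z] [NormedSpace ℝ Z]
    [NormedAddCommGroup F] [NormedSpace ℝ F] {a : Z → Z →L[ℝ] F} {z : Z}
    (h : ContDiffAt ℝ ∞ a z) (u v : Z) : ContDiffAt ℝ ∞ (fun w => curl a w u v) z := by
  have h1 := h.fderiv_right (m := ∞) (by simp)
  exact ((h1.clm_apply contDiffAt_const).clm_apply contDiffAt_const).sub
    ((h1.clm_apply contDiffAt_const).clm_apply contDiffAt_const)

variable {EB B : Type*} [NormedAddCommGroup EB] [NormedSpace ℝ EB] [FiniteDimensional ℝ EB]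
  [TopologicalSpace B] [ChartedSpace EB B] [IsManifold 𝓘(ℝ, EB) ∞ B]

theorem isSmoothForm_pullback_canonicalForm {Φ : P → CotangentBundle EB B}
    (hΦ : ContMDiff 𝓘(ℝ, E) (cotangentModel EB) ∞ Φ) :
    IsSmoothForm (pullback (I := 𝓘(ℝ, E)) Φ (canonicalForm EB B)) := by
  refine isSmoothForm_two fun x y hy u v => ?_
  have hc : ∀ w ∈ (extChartAt 𝓘(ℝ, E) x).target, ContMDiffAt 𝓘(ℝ, E) (cotangentModel EB) ∞
      (Φ ∘ (extChartAt 𝓘(ℝ, E) x).symm) w := fun w hw =>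
    hΦ.contMDiffAt.comp w (contMDiffAt_extChartAt_symm hw)
  have h1 := contDiffAt_curl (smoothFormAt_pull (hc y hy) (smoothFormAt_liouville _)) u v
  refine h1.neg.congr_of_eventuallyEq ?_
  filter_upwards [(isOpen_extChartAt_target (I := 𝓘(ℝ, E)) x).mem_nhds hy] with w hw
  have h2 := mfderiv_comp (I' := 𝓘(ℝ, E)) (I'' := cotangentModel EB) w (g := Φ)
    (f := (extChartAt 𝓘(ℝ, E) x).symm) (hΦ.mdifferentiableAt (by simp))
    ((contMDiffAt_extChartAt_symm hw).mdifferentiableAt (by simp))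
  refine (pullback_two _ _ _ _ _).trans (congrArg Neg.neg ?_)
  refine Eq.trans ?_ (curl_pull (hc w hw) (smoothFormAt_liouville _) u v).symm
  rw [h2]
  rfl

variable {E₀ Q : Type*} [NormedAddCommGroup E₀] [NormedSpace ℝ E₀]
  [TopologicalSpace Q] [ChartedSpace E Q] [IsManifold 𝓘(ℝ, E) ∞ Q]
  {R : ProjField E Q} {N : Set (CotangentBundle E Q)} [ChartedSpace E₀ N]
  [IsManifold 𝓘(ℝ, E₀) ∞ N]

/-- The canonical form of `T^*B` restricts to the canonical form of the covectors on `Q` that are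
pulled back from `B`. -/
theorem ProjField.IsDualImage.canonicalForm_of_pullsBackTo (hN : R.IsDualImage E₀ N) {p : Q → B}
    (hp : ContMDiff 𝓘(ℝ, E) 𝓘(ℝ, EB) ∞ p) {φ : N → CotangentBundle EB B}
    (hφ : ContMDiff 𝓘(ℝ, E₀) (cotangentModel EB) ∞ φ) (h : ∀ m : N, PullsBackTo p (φ m) m.1)
    (m : N) (X Y : TangentSpace 𝓘(ℝ, E₀) m) :
    canonicalForm EB B (φ m) ![mfderiv 𝓘(ℝ, E₀) (cotangentModel EB) φ m X,
      mfderiv 𝓘(ℝ, E₀) (cotangentModel EB) φ m Y] = restrictedForm N m ![X, Y] := by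
  refine Eq.trans ?_ (hN.restrictedForm_eq m X Y).symm
  -- The comparison is made for Liouville forms: both evaluate the covector on the projected vector,
  -- and `φ m` pulls back to `m`.
  have h1 := extd_eq_of_pull_eq (θ₁ := liouvilleForm EB B)
    (θ₂ := restrictedLiouville (EN := E₀) N) (f₁ := φ) (f₂ := id) (x := m)
    hφ.contMDiffAt contMDiffAt_id (smoothFormAt_liouville _)
    (hN.smoothFormAt_restrictedLiouville _) (Filter.Eventually.of_forall fun y v => ?_) X Y
  · rw [mfderiv_id] at h1
    exact congrArg Neg.neg h1
  · rw [mfderiv_id]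
    refine (lin_liouville_comp (hφ.mdifferentiableAt (by simp)) v).trans
      (Eq.trans ?_ (hN.lin_restrictedLiouville y v).symm)
    have e : (fun y => (φ y).proj) = p ∘ baseProj N := funext fun y => (h y).1
    have h2 := mfderiv_comp (I' := 𝓘(ℝ, E)) (I'' := 𝓘(ℝ, EB)) y
      (g := p) (f := baseProj N) (hp.mdifferentiableAt (by simp))
      (hN.contMDiff_baseProj.mdifferentiableAt (by simp))
    rw [← e] at h2
    refine Eq.trans ?_ ((h y).2 (mfderiv 𝓘(ℝ, E₀) 𝓘(ℝ, E) (baseProj N) y v))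
    exact congrArg (show EB →L[ℝ] ℝ from (φ y).snd) (congrArg (fun l : E₀ →L[ℝ] EB => l v) h2)

end SmoothTwoForms

/-! ### Descent of 2-forms along submersions -/

section BasicForms

variable {E P E' P' : Type*} [NormedAddCommGroup E] [NormedSpace ℝ E]
  [TopologicalSpace P] [ChartedSpace E P] [NormedAddCommGroup E'] [NormedSpace ℝ E']
  [FiniteDimensional ℝ E'] [TopologicalSpace P'] [ChartedSpace E' P'] {f : P → P'}

/-- A 2-form whose values depend only on the projections of its arguments descends. -/
theorem exists_pullback_eq (hf : Function.Surjective f)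
    (hs : ∀ x, Function.Surjective (mfderiv 𝓘(ℝ, E) 𝓘(ℝ, E') f x)) {θ : DiffForm 𝓘(ℝ, E) P 2 ℝ}
    (hθ : ∀ x x', f x = f x' → ∀ X Y X' Y' : E,
      (show E →L[ℝ] E' from mfderiv 𝓘(ℝ, E) 𝓘(ℝ, E') f x) X =
        (show E →L[ℝ] E' from mfderiv 𝓘(ℝ, E) 𝓘(ℝ, E') f x') X' →
      (show E →L[ℝ] E' from mfderiv 𝓘(ℝ, E) 𝓘(ℝ, E') f x) Y =
        (show E →L[ℝ] E' from mfderiv 𝓘(ℝ, E) 𝓘(ℝ, E') f x') Y' →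
      (show E [⋀^Fin 2]→L[ℝ] ℝ from θ x) ![X, Y] =
        (show E [⋀^Fin 2]→L[ℝ] ℝ from θ x') ![X', Y']) :
    ∃ θ' : DiffForm 𝓘(ℝ, E') P' 2 ℝ, pullback (I := 𝓘(ℝ, E)) f θ' = θ := by
  have hr : ∀ x, ∃ r : E' →L[ℝ] E, ∀ w, (show E →L[ℝ] E' from mfderiv 𝓘(ℝ, E) 𝓘(ℝ, E') f x) (r w)
      = w := by
    intro x
    obtain ⟨r, hr⟩ := (show E →L[ℝ] E' from
      mfderiv 𝓘(ℝ, E) 𝓘(ℝ, E') f x).toLinearMap.exists_rightInverse_of_surjective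
        (LinearMap.range_eq_top.2 (hs x))
    exact ⟨LinearMap.toContinuousLinearMap r,
      fun w => congrArg (fun l : E' →ₗ[ℝ] E' => l w) hr⟩
  choose r hr using hr
  -- The value at `y` uses an arbitrary preimage and an arbitrary linear right inverse of the
  -- tangent map; `hθ` makes both choices immaterial.
  refine ⟨fun y => (show E [⋀^Fin 2]→L[ℝ] ℝ from
    θ (Function.surjInv hf y)).compContinuousLinearMap (r (Function.surjInv hf y)), ?_⟩
  funext x
  refine two_ext fun X Y => ?_
  refine (pullback_two f _ x X Y).trans ((two_comp _ _ _ _).trans ?_)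
  exact hθ _ _ (Function.surjInv_eq hf (f x)) _ _ _ _ (hr _ _) (hr _ _)

variable [IsManifold 𝓘(ℝ, E) ∞ P] [IsManifold 𝓘(ℝ, E') ∞ P'] [FiniteDimensional ℝ E]

/-- Smoothness of 2-forms can be checked on the pullback along a submersion. -/
theorem isSmoothForm_of_pullback (hf : Manifold.IsSubmersion 𝓘(ℝ, E) 𝓘(ℝ, E') ∞ f)
    (hfs : Function.Surjective f) {θ : DiffForm 𝓘(ℝ, E') P' 2 ℝ}
    (h : ∀ (σ : E' → P) (z : E'), ContMDiffAt 𝓘(ℝ, E') 𝓘(ℝ, E) ∞ σ z → ∀ u v : E',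
      ContDiffAt ℝ ∞ (fun w => pullback (I := 𝓘(ℝ, E)) f θ (σ w)
        ![mfderiv 𝓘(ℝ, E') 𝓘(ℝ, E) σ w u, mfderiv 𝓘(ℝ, E') 𝓘(ℝ, E) σ w v]) z) :
    IsSmoothForm θ := by
  refine isSmoothForm_two fun x y hy u v => ?_
  obtain ⟨q, hq⟩ := hfs ((extChartAt 𝓘(ℝ, E') x).symm y)
  obtain ⟨⟨s, hs, -, hfs⟩, -⟩ := exists_section_of_isSubmersion hf q
  rw [hq] at hs hfs
  have hc := contMDiffAt_extChartAt_symm (I := 𝓘(ℝ, E')) hy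
  -- The inverse chart of `P'` is lifted to `P` by a local section, so coefficients of `θ` become
  -- coefficients of its pullback.
  have hσ : ContMDiffAt 𝓘(ℝ, E') 𝓘(ℝ, E) ∞ (s ∘ (extChartAt 𝓘(ℝ, E') x).symm) y :=
    ContMDiffAt.comp y hs hc
  refine (h _ y hσ u v).congr_of_eventuallyEq ?_
  filter_upwards [(hc.continuousAt.eventually hfs).eventually_nhds,
    eventually_mdifferentiableAt hσ] with w hw hσw
  have hw' : f ∘ (s ∘ (extChartAt 𝓘(ℝ, E') x).symm) =ᶠ[𝓝 w] (extChartAt 𝓘(ℝ, E') x).symm := hw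
  have h1 := mfderiv_comp (I' := 𝓘(ℝ, E)) (I'' := 𝓘(ℝ, E')) w (g := f)
    (f := s ∘ (extChartAt 𝓘(ℝ, E') x).symm) (hf.contMDiff.mdifferentiableAt (by simp)) hσw
  have h2 := hw'.mfderiv_eq (I := 𝓘(ℝ, E')) (I' := 𝓘(ℝ, E'))
  refine Eq.trans ?_ (pullback_two _ _ _ _ _).symm
  have h3 : ∀ t : E', (show E' →L[ℝ] E' from
      mfderiv 𝓘(ℝ, E') 𝓘(ℝ, E') (extChartAt 𝓘(ℝ, E') x).symm w) t =
      (show E →L[ℝ] E' from mfderiv 𝓘(ℝ, E) 𝓘(ℝ, E') f ((s ∘ (extChartAt 𝓘(ℝ, E') x).symm) w))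
        (mfderiv 𝓘(ℝ, E') 𝓘(ℝ, E) (s ∘ (extChartAt 𝓘(ℝ, E') x).symm) w t) := fun t =>
    congrArg (fun l : E' →L[ℝ] E' => l t) (h2.symm.trans h1)
  exact two_eq_of_eq θ hw'.self_of_nhds.symm (h3 u) (h3 v)

end BasicForms

/-! ### Smoothness of the momentum-curvature pairing -/

section PairingSmooth

variable {E Q EG G : Type*} [NormedAddCommGroup E] [NormedSpace ℝ E] [FiniteDimensional ℝ E]
  [TopologicalSpace Q] [ChartedSpace E Q] [IsManifold 𝓘(ℝ, E) ∞ Q]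
  [NormedAddCommGroup EG] [NormedSpace ℝ EG] [FiniteDimensional ℝ EG]
  [TopologicalSpace G] [ChartedSpace EG G] [Group G] [LieGroup 𝓘(ℝ, EG) ∞ G]
  [MulAction G Q] [ContMDiffSMul 𝓘(ℝ, EG) 𝓘(ℝ, E) ∞ G Q] [IsCancelSMul G Q]
  {EM : Type*} [NormedAddCommGroup EM] [NormedSpace ℝ EM]
  {R P : ProjField E Q} {M : Set (CotangentBundle E Q)} [ChartedSpace EM M]
  [IsManifold 𝓘(ℝ, EM) ∞ M]
  [MulAction G M] (hM : R.IsDualImage EM M)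
  (hact : ∀ (g : G) (m : M), (g • m).1 = cotangentLift g m.1)
  {A : ∀ q : Q, TangentSpace 𝓘(ℝ, E) q →L[ℝ] EG}
  (hA : ∀ q v, infGen E EG G q (A q v) = v - P.P q v)
  {D W : ∀ q : Q, Submodule ℝ (TangentSpace 𝓘(ℝ, E) q)}
  (hD : ∀ q v, v ∈ D q ↔ P.P q v = v) (hW : ∀ q v, v ∈ W q ↔ P.P q v = 0)
  {Z : Type*} [NormedAddCommGroup Z] [NormedSpace ℝ Z]

namespace ProjField.IsDualImage

-- `extd` at a point uses the preferred chart there, so smooth dependence on the point is not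
-- visible from its definition. Here the derivative is rewritten in one fixed chart.
include hA in
theorem extd_oneForm_proj {κ : Z → Q} {z : Z} {q₀ : Q}
    (hκ : MDifferentiableAt 𝓘(ℝ, Z) 𝓘(ℝ, E) κ z) (hq : κ z ∈ (extChartAt 𝓘(ℝ, E) q₀).source)
    (u v : Z) :
    extd (oneForm A) (κ z) ![P.P (κ z) (mfderiv 𝓘(ℝ, Z) 𝓘(ℝ, E) κ z u),
      P.P (κ z) (mfderiv 𝓘(ℝ, Z) 𝓘(ℝ, E) κ z v)] =
    curl (pull (extChartAt 𝓘(ℝ, E) q₀).symm (oneForm A)) (extChartAt 𝓘(ℝ, E) q₀ (κ z))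
      (loc P.P q₀ (extChartAt 𝓘(ℝ, E) q₀ (κ z))
        (fderiv ℝ (fun w => extChartAt 𝓘(ℝ, E) q₀ (κ w)) z u))
      (loc P.P q₀ (extChartAt 𝓘(ℝ, E) q₀ (κ z))
        (fderiv ℝ (fun w => extChartAt 𝓘(ℝ, E) q₀ (κ w)) z v)) := by
  have hx := (extChartAt 𝓘(ℝ, E) q₀).map_source hq
  have h1 := curl_pull (contMDiffAt_extChartAt_symm hx)
    (smoothFormAt_connection hA ((extChartAt 𝓘(ℝ, E) q₀).symm (extChartAt 𝓘(ℝ, E) q₀ (κ z))))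
    (loc P.P q₀ (extChartAt 𝓘(ℝ, E) q₀ (κ z))
        (fderiv ℝ (fun w => extChartAt 𝓘(ℝ, E) q₀ (κ w)) z u))
      (loc P.P q₀ (extChartAt 𝓘(ℝ, E) q₀ (κ z))
        (fderiv ℝ (fun w => extChartAt 𝓘(ℝ, E) q₀ (κ w)) z v))
  refine Eq.trans ?_ h1.symm
  have h2 : ∀ t : Z, (show E from P.P (κ z) (mfderiv 𝓘(ℝ, Z) 𝓘(ℝ, E) κ z t)) =
      dpar q₀ (extChartAt 𝓘(ℝ, E) q₀ (κ z)) (loc P.P q₀ (extChartAt 𝓘(ℝ, E) q₀ (κ z))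
        (fderiv ℝ (fun w => extChartAt 𝓘(ℝ, E) q₀ (κ w)) z t)) := by
    intro t
    refine Eq.trans ?_ (dpar_dch hx _).symm
    have key : ∀ (p : Q) (a : E), p = κ z → a = (show E from mfderiv 𝓘(ℝ, Z) 𝓘(ℝ, E) κ z t) →
        (show E from P.P (κ z) (mfderiv 𝓘(ℝ, Z) 𝓘(ℝ, E) κ z t)) =
          (show E →L[ℝ] E from P.P p) a := by
      rintro p a rfl rfl; rfl
    exact key _ _ ((extChartAt 𝓘(ℝ, E) q₀).left_inv hq)
      (congrArg (fun l : Z →L[ℝ] E => l t) (mfderiv_eq_extChartAt_symm_comp hκ hq)).symm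
  exact two_eq_of_eq (extd (oneForm A)) ((extChartAt 𝓘(ℝ, E) q₀).left_inv hq).symm (h2 u) (h2 v)

include hM hact hA hD hW

theorem contDiffAt_pairingJK {σ : Z → M} {z : Z} (hσ : ContMDiffAt 𝓘(ℝ, Z) 𝓘(ℝ, EM) ∞ σ z)
    (u v : Z) : ContDiffAt ℝ ∞ (fun w => pairingJK (EN := EM) EG G M D W (σ w)
      ![mfderiv 𝓘(ℝ, Z) 𝓘(ℝ, EM) σ w u, mfderiv 𝓘(ℝ, Z) 𝓘(ℝ, EM) σ w v]) z := by
  obtain ⟨q₀, hq₀⟩ : ∃ q₀, q₀ = baseProj M (σ z) := ⟨_, rfl⟩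
  have hκ : ContMDiffAt 𝓘(ℝ, Z) 𝓘(ℝ, E) ∞ (baseProj M ∘ σ) z :=
    hM.contMDiff_baseProj.contMDiffAt.comp z hσ
  have hz : (baseProj M ∘ σ) z ∈ (extChartAt 𝓘(ℝ, E) q₀).source := by
    rw [hq₀]; exact mem_extChartAt_source _
  have hx := (extChartAt 𝓘(ℝ, E) q₀).map_source hz
  have hX := contDiffAt_extChartAt_comp hκ hz
  have hL : ∀ t : Z, ContDiffAt ℝ ∞ (fun w => loc P.P q₀ (extChartAt 𝓘(ℝ, E) q₀ ((baseProj M ∘ σ) w))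
      (fderiv ℝ (fun w => extChartAt 𝓘(ℝ, E) q₀ ((baseProj M ∘ σ) w)) w t)) z := fun t =>
    ((P.smooth q₀ _ hx).comp z hX).clm_apply
      ((hX.fderiv_right (m := ∞) (by simp)).clm_apply contDiffAt_const)
  have hA' := (smoothFormAt_pull (contMDiffAt_extChartAt_symm hx)
    (smoothFormAt_connection hA _)).fderiv_right (m := ∞) (by simp)
  have hA'' := ContDiffAt.comp z hA' hX
  have hJ := ((hM.contMDiff_momentum (EG := EG) hact).contMDiffAt.comp z hσ).contDiffAt
  refine (hJ.clm_apply (((hA''.clm_apply (hL u)).clm_apply (hL v)).sub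
    ((hA''.clm_apply (hL v)).clm_apply (hL u)))).congr_of_eventuallyEq ?_
  filter_upwards [eventually_mdifferentiableAt hσ, eventually_mdifferentiableAt hκ,
    hκ.continuousAt.preimage_mem_nhds ((isOpen_extChartAt_source q₀).mem_nhds hz)]
    with w hw hκw hwq
  refine (congrArg (momentum EM EG G M (σ w)) (two_comp _ _ _ _)).trans
    (congrArg (momentum EM EG G M (σ w)) ?_)
  rw [hM.connectionForm_eq hact hA hD hW]
  refine (extd_pullback hM.contMDiff_baseProj.contMDiffAt (smoothFormAt_connection hA _) _ _).trans
    (Eq.trans ?_ (extd_oneForm_proj hA hκw hwq u v))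
  have h1 := mfderiv_comp (I' := 𝓘(ℝ, EM)) (I'' := 𝓘(ℝ, E)) w (g := baseProj M) (f := σ)
    (hM.contMDiff_baseProj.mdifferentiableAt (by simp)) hw
  have h2 : ∀ t : Z, (show E from mfderiv 𝓘(ℝ, EM) 𝓘(ℝ, E) (baseProj M) (σ w)
      (projC EG G M D W (σ w) (mfderiv 𝓘(ℝ, Z) 𝓘(ℝ, EM) σ w t))) =
      P.P (baseProj M (σ w)) (mfderiv 𝓘(ℝ, Z) 𝓘(ℝ, E) (baseProj M ∘ σ) w t) := fun t =>
    (hM.mfderiv_projC hact hA hD hW (σ w) _).trans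
      (congrArg (P.P (baseProj M (σ w))) (congrArg (fun l : Z →L[ℝ] E => l t) h1).symm)
  exact two_eq_of_eq (extd (oneForm A)) rfl (h2 u) (h2 v)

end ProjField.IsDualImage
end PairingSmooth

/-! ### Reduced 2-forms in the Chaplygin case -/

section Chaplygin

variable {E Q EG G : Type*} [NormedAddCommGroup E] [NormedSpace ℝ E] [FiniteDimensional ℝ E]
  [TopologicalSpace Q] [ChartedSpace E Q] [IsManifold 𝓘(ℝ, E) ∞ Q]
  [NormedAddCommGroup EG] [NormedSpace ℝ EG] [FiniteDimensional ℝ EG]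
  [TopologicalSpace G] [ChartedSpace EG G] [Group G] [LieGroup 𝓘(ℝ, EG) ∞ G]
  [MulAction G Q] [ContMDiffSMul 𝓘(ℝ, EG) 𝓘(ℝ, E) ∞ G Q] [IsCancelSMul G Q]
  {EM E₀ : Type*} [NormedAddCommGroup EM] [NormedSpace ℝ EM] [FiniteDimensional ℝ EM]
  [NormedAddCommGroup E₀] [NormedSpace ℝ E₀]
  {R P : ProjField E Q} {M N₀ : Set (CotangentBundle E Q)} [ChartedSpace EM M]
  [IsManifold 𝓘(ℝ, EM) ∞ M] [ChartedSpace E₀ N₀] [IsManifold 𝓘(ℝ, E₀) ∞ N₀]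
  [MulAction G M] (hM : R.IsDualImage EM M) (hN : P.IsDualImage E₀ N₀)
  (h : ∀ q v, P.P q (R.P q v) = R.P q v) (h' : ∀ q v, R.P q (P.P q v) = P.P q v)
  (hact : ∀ (g : G) (m : M), (g • m).1 = cotangentLift g m.1)
  {A : ∀ q : Q, TangentSpace 𝓘(ℝ, E) q →L[ℝ] EG}
  (hA : ∀ q v, infGen E EG G q (A q v) = v - P.P q v)
  {D W : ∀ q : Q, Submodule ℝ (TangentSpace 𝓘(ℝ, E) q)}
  (hD : ∀ q v, v ∈ D q ↔ P.P q v = v) (hW : ∀ q v, v ∈ W q ↔ P.P q v = 0)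
  (hDG : ∀ (g : G) (q : Q) (v : TangentSpace 𝓘(ℝ, E) q), v ∈ D q → tangentAction E g q v ∈ D (g • q))
  {Er : Type*} [NormedAddCommGroup Er] [NormedSpace ℝ Er] [FiniteDimensional ℝ Er]
  [ChartedSpace Er (MulAction.orbitRel.Quotient G M)]
  [IsManifold 𝓘(ℝ, Er) ∞ (MulAction.orbitRel.Quotient G M)]
  (hρ : Manifold.IsSubmersion 𝓘(ℝ, EM) 𝓘(ℝ, Er) ∞ (orbitMap G M))
  {Ω' : DiffForm 𝓘(ℝ, Er) (MulAction.orbitRel.Quotient G M) 2 ℝ}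
  (hΩ' : ∀ (m : M) (X Y : TangentSpace 𝓘(ℝ, EM) m),
    Ω' (orbitMap G M m) ![mfderiv 𝓘(ℝ, EM) 𝓘(ℝ, Er) (orbitMap G M) m X,
      mfderiv 𝓘(ℝ, EM) 𝓘(ℝ, Er) (orbitMap G M) m Y] =
    restrictedForm N₀ (hN.transfer m) ![mfderiv 𝓘(ℝ, EM) 𝓘(ℝ, E₀) hN.transfer m X,
      mfderiv 𝓘(ℝ, EM) 𝓘(ℝ, E₀) hN.transfer m Y])

namespace ProjField.IsDualImage

-- A vector and its `𝒞`-component differ by an infinitesimal generator, which the orbit projection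
-- kills.
include hM hact hρ in
theorem mfderiv_orbitMap_projC (m : M) (X : TangentSpace 𝓘(ℝ, EM) m) :
    mfderiv 𝓘(ℝ, EM) 𝓘(ℝ, Er) (orbitMap G M) m (projC EG G M D W m X) =
      mfderiv 𝓘(ℝ, EM) 𝓘(ℝ, Er) (orbitMap G M) m X := by
  have := hM.contMDiffSMul (EG := EG) hact
  have h1 : projC EG G M D W m X =
    X - infGen EM EG G m (lin (connectionForm (EN := EM) EG G M D W) m X) := rfl
  rw [h1, map_sub]
  exact (congrArg (fun w => _ - w)
    (mfderiv_orbitMap_infGen (EG := EG) hρ.contMDiff m _)).trans (sub_zero _)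

include hM h h' hact hA hD hW hΩ'

/-- The horizontal distribution is complementary to the orbits. -/
theorem eq_zero_of_mfderiv_orbitMap {m : M} {X : TangentSpace 𝓘(ℝ, EM) m}
    (hX : X ∈ liftedDistribution M D m)
    (h0 : mfderiv 𝓘(ℝ, EM) 𝓘(ℝ, Er) (orbitMap G M) m X = 0) : X = 0 := by
  -- On `𝒞` the total form is the pullback of `Ω'` from the orbit space. A vector of `𝒞` killed by
  -- the projection pairs to zero with `𝒞`, so nondegeneracy applies.
  refine nondegenerateOn_totalForm hM hN h h' hact hA hD hW m X hX fun Y hY => ?_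
  refine (hM.totalForm_transfer hN hact hA hD hW hX hY).symm.trans ((hΩ' m X Y).symm.trans ?_)
  rw [h0, ← bil_apply, map_zero]
  rfl

include hDG hρ

/-- Both sides lie in `𝒞` and have the same image in the orbit space, and the orbit projection is
injective on `𝒞`. -/
theorem projC_smul {g : G} {m : M} {X : TangentSpace 𝓘(ℝ, EM) (g • m)}
    {X' : TangentSpace 𝓘(ℝ, EM) m}
    (hX : (show Er from mfderiv 𝓘(ℝ, EM) 𝓘(ℝ, Er) (orbitMap G M) (g • m) X) =
      mfderiv 𝓘(ℝ, EM) 𝓘(ℝ, Er) (orbitMap G M) m X') :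
    projC EG G M D W (g • m) X = tangentAction EM g m (projC EG G M D W m X') := by
  have := hM.contMDiffSMul (EG := EG) hact
  refine sub_eq_zero.1 (eq_zero_of_mfderiv_orbitMap hM hN h h' hact hA hD hW hΩ'
    (sub_mem (hM.projC_mem hact hA hD hW _ X)
      (hM.tangentAction_mem_liftedDistribution (EG := EG) hact hDG g
        (hM.projC_mem hact hA hD hW _ X'))) ?_)
  rw [map_sub, sub_eq_zero]
  refine (hM.mfderiv_orbitMap_projC hact hρ (g • m) X).trans (hX.trans ?_)
  refine Eq.trans ?_ (mfderiv_orbitMap_tangentAction (EG := EG) hρ.contMDiff g m _).symm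
  exact (hM.mfderiv_orbitMap_projC hact hρ m X').symm

/-- By `pairingJK_apply` the pairing is a difference of two invariant forms evaluated on
`𝒞`-components. By `projC_smul` these components are determined, up to the group action, by
projections to `M/G`, so the pairing descends. -/
theorem exists_reduced_pairingJK : ∃ θ : DiffForm 𝓘(ℝ, Er) (MulAction.orbitRel.Quotient G M) 2 ℝ,
    IsSmoothForm θ ∧
    pullback (I := 𝓘(ℝ, EM)) (orbitMap G M) θ = pairingJK EG G M D W := by
  have := hM.contMDiffSMul (EG := EG) hact
  obtain ⟨θ, hθ⟩ := exists_pullback_eq (f := orbitMap G M) (orbitMap_surjective)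
    (surjective_mfderiv_of_isSubmersion hρ) (θ := pairingJK EG G M D W) (by
      intro x m hxm X Y X' Y' hX hY
      obtain ⟨g, rfl⟩ := orbitMap_eq_iff.1 hxm
      have e1 := hM.pairingJK_apply hN hact hA hD hW (g • m) X Y
      have e2 := hM.pairingJK_apply hN hact hA hD hW m X' Y'
      refine e1.trans (Eq.trans ?_ e2.symm)
      rw [← hΩ', ← hΩ', projC_smul hM hN h h' hact hA hD hW hDG hρ hΩ' hX,
        projC_smul hM hN h h' hact hA hD hW hDG hρ hΩ' hY,
        hM.restrictedForm_smul (EG := EG) hact]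
      refine congrArg (· - _) ?_
      exact two_eq_of_eq Ω' (orbitMap_smul g m)
        (mfderiv_orbitMap_tangentAction (EG := EG) hρ.contMDiff g m _)
        (mfderiv_orbitMap_tangentAction (EG := EG) hρ.contMDiff g m _))
  refine ⟨θ, isSmoothForm_of_pullback hρ orbitMap_surjective fun σ z hσ u v => ?_, hθ⟩
  rw [hθ]
  exact hM.contDiffAt_pairingJK hact hA hD hW hσ u v

omit hDG

variable {θ : DiffForm 𝓘(ℝ, Er) (MulAction.orbitRel.Quotient G M) 2 ℝ}
  (hθ : pullback (I := 𝓘(ℝ, EM)) (orbitMap G M) θ = pairingJK EG G M D W)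

-- On `𝒞` the pullback of `Ω'` is `Ω_M + ⟨J, 𝒦⟩` and that of `θ` is `⟨J, 𝒦⟩`. This makes `(⊤, Ω' -
-- θ)` the isomorphic image of `(𝒞, Ω_M)`.
omit hρ h h' in
include hθ in
theorem sub_reduced_pairingJK_apply {m : M} {X Y : TangentSpace 𝓘(ℝ, EM) m}
    (hX : X ∈ liftedDistribution M D m) (hY : Y ∈ liftedDistribution M D m) :
    (Ω' - θ) (orbitMap G M m) ![mfderiv 𝓘(ℝ, EM) 𝓘(ℝ, Er) (orbitMap G M) m X,
      mfderiv 𝓘(ℝ, EM) 𝓘(ℝ, Er) (orbitMap G M) m Y] = restrictedForm M m ![X, Y] := by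
  have e1 := congrArg (fun η : DiffForm 𝓘(ℝ, EM) M 2 ℝ => η m ![X, Y]) hθ
  have e2 := (pullback_two (I := 𝓘(ℝ, EM)) (orbitMap G M) θ m X Y).symm.trans e1
  have e3 := (hΩ' m X Y).trans (hM.totalForm_transfer hN hact hA hD hW hX hY)
  refine (congrArg₂ (· - ·) e3 e2).trans ?_
  exact add_sub_cancel_right _ _

omit h h' hΩ' hN in
theorem exists_mem_mfderiv_orbitMap_eq {m : M}
    (X : TangentSpace 𝓘(ℝ, Er) (orbitMap G M m)) : ∃ X' ∈ liftedDistribution (EN := EM) M D m,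
      mfderiv 𝓘(ℝ, EM) 𝓘(ℝ, Er) (orbitMap G M) m X' = X := by
  obtain ⟨X', rfl⟩ := surjective_mfderiv_of_isSubmersion hρ m X
  exact ⟨_, hM.projC_mem hact hA hD hW m X', hM.mfderiv_orbitMap_projC hact hρ m X'⟩

variable (hnd : NondegenerateOn (liftedDistribution (EN := EM) M D) (restrictedForm M))

include hθ hnd

omit h h' in
theorem nondegenerateOn_reduced :
    NondegenerateOn (fun _ => ⊤) (Ω' - θ : DiffForm 𝓘(ℝ, Er) _ 2 ℝ) := by
  intro y X _ h0
  obtain ⟨m, rfl⟩ := orbitMap_surjective y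
  obtain ⟨X', hX', rfl⟩ := hM.exists_mem_mfderiv_orbitMap_eq hact hA hD hW hρ X
  rw [hnd m X' hX' fun Y hY => (sub_reduced_pairingJK_apply hM hN hact hA hD hW hΩ' hθ hX'
    hY).symm.trans (h0 _ trivial), map_zero]

omit h h' in
theorem isReducedBracket_reduced : IsReducedBracket 𝓘(ℝ, Er)
    (bracket (liftedDistribution (EN := EM) M D) (restrictedForm M))
    (bracket (fun _ => ⊤) (Ω' - θ : DiffForm 𝓘(ℝ, Er) _ 2 ℝ)) := by
  intro f k hf hk
  funext m
  have e : ∀ {f : MulAction.orbitRel.Quotient G M → ℝ}, ContMDiff 𝓘(ℝ, Er) 𝓘(ℝ, ℝ) ∞ f →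
      dfun 𝓘(ℝ, EM) (f ∘ orbitMap G M) m = dfun 𝓘(ℝ, Er) f (orbitMap G M m) ∘L
        mfderiv 𝓘(ℝ, EM) 𝓘(ℝ, Er) (orbitMap G M) m := fun hf =>
    mfderiv_comp m (hf.mdifferentiableAt (by simp)) (hρ.contMDiff.mdifferentiableAt (by simp))
  -- `map_sharp` asks only for surjectivity from `𝒞` and equality of forms on `𝒞`, so it applies
  -- although the tangent map of the orbit projection has a kernel.
  have h1 := map_sharp (D' := fun _ => ⊤) (mfderiv 𝓘(ℝ, EM) 𝓘(ℝ, Er) (orbitMap G M) m) (hnd m)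
    (nondegenerateOn_reduced hM hN hact hA hD hW hρ hΩ' hθ hnd (orbitMap G M m))
    (fun X _ => trivial)
    (fun Y _ => hM.exists_mem_mfderiv_orbitMap_eq hact hA hD hW hρ Y)
    (fun X hX Y hY => sub_reduced_pairingJK_apply hM hN hact hA hD hW hΩ' hθ hX hY)
    (dfun 𝓘(ℝ, Er) f (orbitMap G M m))
  change dfun 𝓘(ℝ, Er) k (orbitMap G M m) (sharp _ _ _ (dfun 𝓘(ℝ, Er) f (orbitMap G M m))) =
    dfun 𝓘(ℝ, EM) (k ∘ orbitMap G M) m (sharp _ _ m (dfun 𝓘(ℝ, EM) (f ∘ orbitMap G M) m))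
  rw [e hf, e hk, ← h1]
  rfl

end ProjField.IsDualImage
end Chaplygin

theorem IsSmoothForm.sub {E H P F : Type*} [NormedAddCommGroup E] [NormedSpace ℝ E]
    [TopologicalSpace H] [NormedAddCommGroup F] [NormedSpace ℝ F] {I : ModelWithCorners ℝ E H}
    [TopologicalSpace P] [ChartedSpace H P] {n : ℕ} {θ η : DiffForm I P n F}
    (hθ : IsSmoothForm θ) (hη : IsSmoothForm η) : IsSmoothForm (θ - η) :=
  fun x => (hθ x).sub (hη x)

theorem VerticalComplement.eq_vertical {E Q EG G : Type*} [NormedAddCommGroup E]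
    [NormedSpace ℝ E] [TopologicalSpace Q] [ChartedSpace E Q] [IsManifold 𝓘(ℝ, E) ∞ Q]
    [NormedAddCommGroup EG] [NormedSpace ℝ EG] [TopologicalSpace G] [ChartedSpace EG G] [Group G]
    [MulAction G Q] {S : SymmetricSystem E Q EG G} (W : VerticalComplement S)
    (h : S.IsChaplygin) (q : Q) : W.W q = vertical E EG G q := by
  refine (W.le_vertical q).antisymm fun v hv => ?_
  have hv' : v ∈ S.D q ⊔ W.W q := by rw [(W.isCompl q).sup_eq_top]; trivial
  obtain ⟨d, hd, w, hw, rfl⟩ := Submodule.mem_sup.1 hv'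
  have h0 : d ∈ S.D q ⊓ vertical E EG G q :=
    ⟨hd, (Submodule.add_mem_iff_left _ (W.le_vertical q hw)).1 hv⟩
  rw [h q, Submodule.mem_bot] at h0
  rw [h0, zero_add]
  exact hw

end Nonholonomic

/-! ### Assembly of the main theorem -/

theorem mainTheorem8
    -- the configuration manifold `Q`
    {E Q : Type*} [NormedAddCommGroup E] [NormedSpace ℝ E] [FiniteDimensional ℝ E]
    [TopologicalSpace Q] [ChartedSpace E Q] [IsManifold 𝓘(ℝ, E) ∞ Q]
    [T2Space Q] [SecondCountableTopology Q]
    -- the Lie group `G`, acting smoothly, properly and freely on `Q`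
    {EG G : Type*} [NormedAddCommGroup EG] [NormedSpace ℝ EG] [FiniteDimensional ℝ EG]
    [TopologicalSpace G] [ChartedSpace EG G] [Group G] [LieGroup 𝓘(ℝ, EG) ∞ G]
    [MulAction G Q] [ContMDiffSMul 𝓘(ℝ, EG) 𝓘(ℝ, E) ∞ G Q] [ProperSMul G Q] [IsCancelSMul G Q]
    -- the nonholonomic system with symmetries and the vertical complement `W`
    (S : SymmetricSystem E Q EG G) (W : VerticalComplement S)
    -- the manifold structures of the embedded submanifolds `M` and `W°` of `T^*Q`
    {EM : Type*} [NormedAddCommGroup EM] [NormedSpace ℝ EM] [FiniteDimensional ℝ EM]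
    [ChartedSpace EM S.constraintManifold] [IsManifold 𝓘(ℝ, EM) ∞ S.constraintManifold]
    (hM : Manifold.IsSmoothEmbedding 𝓘(ℝ, EM) (cotangentModel E) ∞
      (Subtype.val : S.constraintManifold → CotangentBundle E Q))
    {E₀ : Type*} [NormedAddCommGroup E₀] [NormedSpace ℝ E₀] [FiniteDimensional ℝ E₀]
    [ChartedSpace E₀ W.annihilator] [IsManifold 𝓘(ℝ, E₀) ∞ W.annihilator]
    (hW : Manifold.IsSmoothEmbedding 𝓘(ℝ, E₀) (cotangentModel E) ∞
      (Subtype.val : W.annihilator → CotangentBundle E Q))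
    -- the manifold structures of the orbit spaces `M/G`, `W°/G` and `Q/G`
    {EMr : Type*} [NormedAddCommGroup EMr] [NormedSpace ℝ EMr] [FiniteDimensional ℝ EMr]
    [ChartedSpace EMr (MulAction.orbitRel.Quotient G S.constraintManifold)]
    [IsManifold 𝓘(ℝ, EMr) ∞ (MulAction.orbitRel.Quotient G S.constraintManifold)]
    (hMr : Manifold.IsSubmersion 𝓘(ℝ, EM) 𝓘(ℝ, EMr) ∞ (orbitMap G S.constraintManifold))
    {E₀r : Type*} [NormedAddCommGroup E₀r] [NormedSpace ℝ E₀r] [FiniteDimensional ℝ E₀r]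
    [ChartedSpace E₀r (MulAction.orbitRel.Quotient G W.annihilator)]
    [IsManifold 𝓘(ℝ, E₀r) ∞ (MulAction.orbitRel.Quotient G W.annihilator)]
    (hWr : Manifold.IsSubmersion 𝓘(ℝ, E₀) 𝓘(ℝ, E₀r) ∞ (orbitMap G W.annihilator))
    {EB : Type*} [NormedAddCommGroup EB] [NormedSpace ℝ EB] [FiniteDimensional ℝ EB]
    [ChartedSpace EB (MulAction.orbitRel.Quotient G Q)]
    [IsManifold 𝓘(ℝ, EB) ∞ (MulAction.orbitRel.Quotient G Q)]
    (hQr : Manifold.IsSubmersion 𝓘(ℝ, E) 𝓘(ℝ, EB) ∞ (orbitMap G Q)) :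
    -- the 2-forms that determine `π_nh`, `π_JK`, `π₀` are nondegenerate on `𝒞`, `𝒞`, `𝒞₀`, and
    -- `π_JK`, `π₀` are almost Poisson structures
    NondegenerateOn (S.distC EM) (S.formM EM) ∧
    NondegenerateOn (S.distC EM) (W.totalForm EM) ∧
    NondegenerateOn (W.distC₀ E₀) (W.form₀ E₀) ∧
    IsAlmostPoissonBracket 𝓘(ℝ, EM) (bracket (S.distC EM) (W.totalForm EM)) ∧
    IsAlmostPoissonBracket 𝓘(ℝ, E₀) (bracket (W.distC₀ E₀) (W.form₀ E₀)) ∧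
    ∃ Ψ : S.constraintManifold ≃ₘ^∞⟮𝓘(ℝ, EM), 𝓘(ℝ, E₀)⟯ W.annihilator,
      -- `Ψ(κ^♯(v)) = κ₀^♯(v)` for `v ∈ D`
      (∀ (q : Q), ∀ v ∈ S.D q, ∀ m : S.constraintManifold, m.1 = S.legendre q v →
        ∃ β : TangentSpace 𝓘(ℝ, E) q →L[ℝ] ℝ,
          (Ψ m).1 = ⟨q, β⟩ ∧ ∀ w, β w = W.modifiedMetric q v w) ∧
      -- `Ψ` is `G`-equivariant
      (∀ (g : G) (m : S.constraintManifold), Ψ (g • m) = g • Ψ m) ∧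
      -- `Ψ` maps `π_JK` to `π₀`
      (∀ (m : S.constraintManifold) (α : TangentSpace 𝓘(ℝ, E₀) (Ψ m) →L[ℝ] ℝ),
        mfderiv 𝓘(ℝ, EM) 𝓘(ℝ, E₀) Ψ m
          (sharp (S.distC EM) (W.totalForm EM) m (α ∘L mfderiv 𝓘(ℝ, EM) 𝓘(ℝ, E₀) Ψ m)) =
        sharp (W.distC₀ E₀) (W.form₀ E₀) (Ψ m) α) ∧
      -- under the vertical-symmetry condition `Ψ` descends to a Poisson diffeomorphism
      (W.VerticalSymmetry →
        ∃ (Λ : (MulAction.orbitRel.Quotient G S.constraintManifold → ℝ) →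
              (MulAction.orbitRel.Quotient G S.constraintManifold → ℝ) →
              MulAction.orbitRel.Quotient G S.constraintManifold → ℝ)
          (Λ₀ : (MulAction.orbitRel.Quotient G W.annihilator → ℝ) →
              (MulAction.orbitRel.Quotient G W.annihilator → ℝ) →
              MulAction.orbitRel.Quotient G W.annihilator → ℝ)
          (Ψred : MulAction.orbitRel.Quotient G S.constraintManifold
            ≃ₘ^∞⟮𝓘(ℝ, EMr), 𝓘(ℝ, E₀r)⟯ MulAction.orbitRel.Quotient G W.annihilator),
          IsReducedBracket 𝓘(ℝ, EMr) (bracket (S.distC EM) (W.totalForm EM)) Λ ∧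
          IsReducedBracket 𝓘(ℝ, E₀r) (bracket (W.distC₀ E₀) (W.form₀ E₀)) Λ₀ ∧
          IsPoissonBracket 𝓘(ℝ, EMr) Λ ∧
          IsPoissonBracket 𝓘(ℝ, E₀r) Λ₀ ∧
          (∀ m : S.constraintManifold,
            Ψred (orbitMap G S.constraintManifold m) = orbitMap G W.annihilator (Ψ m)) ∧
          (∀ f g : MulAction.orbitRel.Quotient G W.annihilator → ℝ,
            ContMDiff 𝓘(ℝ, E₀r) 𝓘(ℝ, ℝ) ∞ f → ContMDiff 𝓘(ℝ, E₀r) 𝓘(ℝ, ℝ) ∞ g →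
            Λ (f ∘ Ψred) (g ∘ Ψred) = Λ₀ f g ∘ Ψred)) ∧
      -- the Chaplygin case: the identification `M/G ≅ T^*(Q/G)` and the 2-forms on `M/G`
      (S.IsChaplygin →
        ∃ (Φ : MulAction.orbitRel.Quotient G S.constraintManifold
            ≃ₘ^∞⟮𝓘(ℝ, EMr), cotangentModel EB⟯
              CotangentBundle EB (MulAction.orbitRel.Quotient G Q))
          (Ωnh JKred : DiffForm 𝓘(ℝ, EMr)
            (MulAction.orbitRel.Quotient G S.constraintManifold) 2 ℝ),
          -- `Φ` is `Ψ` followed by `W°/G = V°/G ≅ T^*(Q/G)`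
          (∀ m : S.constraintManifold,
            ∃ β : TangentSpace 𝓘(ℝ, EB) (orbitMap G Q (Ψ m).1.proj) →L[ℝ] ℝ,
              Φ (orbitMap G S.constraintManifold m) = ⟨orbitMap G Q (Ψ m).1.proj, β⟩ ∧
              β ∘L mfderiv 𝓘(ℝ, E) 𝓘(ℝ, EB) (orbitMap G Q) (Ψ m).1.proj = (Ψ m).1.snd) ∧
          -- `⟨J, 𝒦⟩_red` is the 2-form on `M/G` with `ρ^*⟨J, 𝒦⟩_red = ⟨J, 𝒦⟩`
          IsSmoothForm JKred ∧
          pullback (orbitMap G S.constraintManifold) JKred = W.formJK EM ∧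
          -- `Ω_red^nh` is the nondegenerate 2-form defining the reduction of `π_nh`
          IsSmoothForm Ωnh ∧
          NondegenerateOn (fun _ => ⊤) Ωnh ∧
          IsReducedBracket 𝓘(ℝ, EMr) (bracket (S.distC EM) (S.formM EM))
            (bracket (fun _ => ⊤) Ωnh) ∧
          -- `Ω_red^nh = Ω_{Q/G} - ⟨J, 𝒦⟩_red`
          Ωnh = pullback Φ (canonicalForm EB (MulAction.orbitRel.Quotient G Q)) - JKred) := by
  have hactM : ∀ (g : G) (m : S.constraintManifold), (g • m).1 = cotangentLift g m.1 :=
    fun _ _ => rfl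
  have hactW : ∀ (g : G) (m : W.annihilator), (g • m).1 = cotangentLift g m.1 := fun _ _ => rfl
  have hM' := S.isDualImage hM
  have hW' := W.isDualImage hW
  -- `A` is the `𝔤`-valued 1-form on `Q` whose pullback to `M` is `𝒜`.
  obtain ⟨A, hA⟩ := exists_vertical_connection (EG := EG) (G := G) W.proj
    fun q v => W.le_vertical q (W.sub_proj_mem q v)
  have hB := hM'.isAlmostPoissonBracket_totalForm hW' W.proj_projD W.projD_proj hactM hA
    W.mem_D_iff W.mem_W_iff
  have hB₀ := hW'.isAlmostPoissonBracket W.mem_D_iff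
  have hΨG : ∀ (g : G) (m : S.constraintManifold),
      hM'.diffeo hW' W.proj_projD W.projD_proj (g • m) =
        g • hM'.diffeo hW' W.proj_projD W.projD_proj m := fun g m =>
    Subtype.ext (W.proj_isInvariant.dual_cotangentLift (mdifferentiable_action (EG := EG)) g m.1)
  have hΨB : ∀ f g : W.annihilator → ℝ, ContMDiff 𝓘(ℝ, E₀) 𝓘(ℝ, ℝ) ∞ f →
      ContMDiff 𝓘(ℝ, E₀) 𝓘(ℝ, ℝ) ∞ g →
      bracket (S.distC EM) (W.totalForm EM) (f ∘ hM'.diffeo hW' W.proj_projD W.projD_proj)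
          (g ∘ hM'.diffeo hW' W.proj_projD W.projD_proj) =
        bracket (W.distC₀ E₀) (W.form₀ E₀) f g ∘ hM'.diffeo hW' W.proj_projD W.projD_proj :=
    fun f g hf hg => hM'.bracket_totalForm hW' W.proj_projD W.projD_proj hactM hA W.mem_D_iff
      W.mem_W_iff hf hg
  refine ⟨hM'.nondegenerateOn S.mem_D_iff,
    hM'.nondegenerateOn_totalForm hW' W.proj_projD W.projD_proj hactM hA W.mem_D_iff W.mem_W_iff,
    hW'.nondegenerateOn W.mem_D_iff, hB, hB₀,
    hM'.diffeo hW' W.proj_projD W.projD_proj, ?_, hΨG, ?_, ?_, ?_⟩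
  · intro q v hv m hm
    refine ⟨S.metric.inner q v ∘L W.proj.P q, ?_, W.inner_proj_eq_modifiedMetric q hv⟩
    change W.proj.dual m.1 = _
    rw [hm]
    rfl
  · exact hM'.map_sharp_totalForm hW' W.proj_projD W.projD_proj hactM hA W.mem_D_iff W.mem_W_iff
  · rintro ⟨𝔤W, -, h𝔤⟩
    obtain ⟨Ψred, hΨred⟩ := exists_reduced_diffeomorph hMr hWr _ hΨG
    have hinv : ∀ f : MulAction.orbitRel.Quotient G W.annihilator → ℝ, ∀ (c : G)
        (x : W.annihilator), (f ∘ orbitMap G W.annihilator) (c • x) =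
          (f ∘ orbitMap G W.annihilator) x := fun f c x => congrArg f (orbitMap_smul c x)
    have hc : ∀ {f : MulAction.orbitRel.Quotient G W.annihilator → ℝ},
        ContMDiff 𝓘(ℝ, E₀r) 𝓘(ℝ, ℝ) ∞ f →
        ContMDiff 𝓘(ℝ, E₀) 𝓘(ℝ, ℝ) ∞ (f ∘ orbitMap G W.annihilator) :=
      fun hf => hf.comp hWr.contMDiff
    have hred : IsReducedBracket 𝓘(ℝ, E₀r) (bracket (W.distC₀ E₀) (W.form₀ E₀))
        (reducedBracket (G := G) (bracket (W.distC₀ E₀) (W.form₀ E₀))) :=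
      isReducedBracket_reducedBracket fun f g hf hg c x =>
        hW'.bracket_smul (EG := EG) hactW W.mem_D_iff (fun g q v hv => S.tangentAction_mem_D hv)
          ((hc hf).mdifferentiable (by simp)) ((hc hg).mdifferentiable (by simp))
          (hinv f) (hinv g) c x
    have hpoi := hred.isPoissonBracket hWr hB₀ fun f g h hf hg hh =>
      hW'.jacobi_of_invariant hactW W.mem_D_iff W.mem_W_iff h𝔤 (hc hf) (hc hg) (hc hh)
        (hinv f) (hinv g) (hinv h)
    -- `Λ` is taken to be the transport of `Λ₀` along `Ψred`, so it is Poisson at once; that it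
    -- reduces the bracket of `π_JK` follows from `hΨB`.
    refine ⟨_, _, Ψred, ?_, hred, hpoi.transport Ψred, hpoi, hΨred, fun f g hf hg => ?_⟩
    · intro f g hf hg
      have e : ∀ f : MulAction.orbitRel.Quotient G S.constraintManifold → ℝ,
          f ∘ orbitMap G S.constraintManifold = ((f ∘ Ψred.symm) ∘ orbitMap G W.annihilator) ∘
            hM'.diffeo hW' W.proj_projD W.projD_proj := fun f => funext fun x => by
        change _ = f (Ψred.symm (orbitMap G W.annihilator _))
        rw [← hΨred, Ψred.symm_apply_apply]
        rfl
      have hs : ∀ {f : MulAction.orbitRel.Quotient G S.constraintManifold → ℝ},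
          ContMDiff 𝓘(ℝ, EMr) 𝓘(ℝ, ℝ) ∞ f → ContMDiff 𝓘(ℝ, E₀r) 𝓘(ℝ, ℝ) ∞ (f ∘ Ψred.symm) :=
        fun hf => hf.comp Ψred.symm.contMDiff
      rw [e f, e g, hΨB _ _ (hc (hs hf)) (hc (hs hg)), ← hred _ _ (hs hf) (hs hg)]
      exact funext fun x => congrArg _ (hΨred x)
    · have e : ∀ f : MulAction.orbitRel.Quotient G W.annihilator → ℝ,
          (f ∘ Ψred) ∘ Ψred.symm = f := fun f =>
        funext fun x => congrArg f (Ψred.apply_symm_apply x)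
      simp only [e]
  · intro hCh
    obtain ⟨Ψred, hΨred⟩ := exists_reduced_diffeomorph hMr hWr _ hΨG
    obtain ⟨Φ₀, hΦ₀⟩ := exists_cotangent_reduction hQr hW' hactW
      (fun α => by rw [← W.eq_vertical hCh]; rfl) hWr
    have hΦ : ∀ m : S.constraintManifold,
        (Ψred.trans Φ₀) (orbitMap G S.constraintManifold m) =
          Φ₀ (orbitMap G W.annihilator (hM'.diffeo hW' W.proj_projD W.projD_proj m)) :=
      fun m => congrArg Φ₀ (hΨred m)
    have hφ : ContMDiff 𝓘(ℝ, E₀) (cotangentModel EB) ∞ (Φ₀ ∘ orbitMap G W.annihilator) :=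
      Φ₀.contMDiff.comp hWr.contMDiff
    have hT := hM'.contMDiff_transfer hW'
    have hΩ' : ∀ (m : S.constraintManifold) (X Y : TangentSpace 𝓘(ℝ, EM) m),
        pullback (I := 𝓘(ℝ, EMr)) (Ψred.trans Φ₀)
          (canonicalForm EB (MulAction.orbitRel.Quotient G Q)) (orbitMap G S.constraintManifold m)
          ![mfderiv 𝓘(ℝ, EM) 𝓘(ℝ, EMr) (orbitMap G S.constraintManifold) m X,
            mfderiv 𝓘(ℝ, EM) 𝓘(ℝ, EMr) (orbitMap G S.constraintManifold) m Y] =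
        restrictedForm W.annihilator (hW'.transfer m)
          ![mfderiv 𝓘(ℝ, EM) 𝓘(ℝ, E₀) hW'.transfer m X,
            mfderiv 𝓘(ℝ, EM) 𝓘(ℝ, E₀) hW'.transfer m Y] := by
      intro m X Y
      -- Two factorizations of one map `M → T^*(Q/G)`, through `M/G` and through `W°`; comparing
      -- tangent maps reduces the claim to the canonical form on `W°`.
      have e : (Ψred.trans Φ₀) ∘ orbitMap G S.constraintManifold =
          (Φ₀ ∘ orbitMap G W.annihilator) ∘ hW'.transfer := funext hΦ
      have h1 := mfderiv_comp (I' := 𝓘(ℝ, EMr)) (I'' := cotangentModel EB) m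
        (g := Ψred.trans Φ₀) (f := orbitMap G S.constraintManifold)
        ((Ψred.trans Φ₀).contMDiff.mdifferentiableAt (by simp))
        (hMr.contMDiff.mdifferentiableAt (by simp))
      have h2 := mfderiv_comp (I' := 𝓘(ℝ, E₀)) (I'' := cotangentModel EB) m
        (g := Φ₀ ∘ orbitMap G W.annihilator) (f := hW'.transfer)
        (hφ.mdifferentiableAt (by simp)) (hT.mdifferentiableAt (by simp))
      rw [e] at h1
      refine (pullback_two _ _ _ _ _).trans (Eq.trans ?_
        (hW'.canonicalForm_of_pullsBackTo hQr.contMDiff hφ hΦ₀ (hW'.transfer m) _ _))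
      have h3 : ∀ t : EM, _ := fun t =>
        congrArg (fun l : EM →L[ℝ] EB × (EB →L[ℝ] ℝ) => l t) (h1.symm.trans h2)
      exact two_eq_of_eq (canonicalForm EB (MulAction.orbitRel.Quotient G Q)) (hΦ m) (h3 X) (h3 Y)
    obtain ⟨θ, hθs, hθ⟩ := hM'.exists_reduced_pairingJK hW' W.proj_projD W.projD_proj hactM hA
      W.mem_D_iff W.mem_W_iff (fun g q v hv => S.tangentAction_mem_D hv) hMr hΩ'
    have hnd := hM'.nondegenerateOn S.mem_D_iff
    -- `Ωnh` is defined as `Φ^*Ω_{Q/G} - θ` through the final `rfl`; the content is that this form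
    -- is nondegenerate and induces the reduction of `π_nh`.
    refine ⟨Ψred.trans Φ₀, _, θ, fun m => ?_, hθs, hθ,
      (isSmoothForm_pullback_canonicalForm (Ψred.trans Φ₀).contMDiff).sub hθs,
      hM'.nondegenerateOn_reduced hW' hactM hA W.mem_D_iff W.mem_W_iff hMr hΩ' hθ hnd,
      hM'.isReducedBracket_reduced hW' hactM hA W.mem_D_iff W.mem_W_iff hMr hΩ' hθ hnd, rfl⟩
    rw [hΦ m]
    obtain ⟨h1, h2⟩ := hΦ₀ (hM'.diffeo hW' W.proj_projD W.projD_proj m)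
    obtain ⟨⟨p, β⟩, hb⟩ : ∃ b, b = Φ₀ (orbitMap G W.annihilator
      (hM'.diffeo hW' W.proj_projD W.projD_proj m)) := ⟨_, rfl⟩
    rw [← hb] at h1 h2 ⊢
    obtain rfl : p = _ := h1
    exact ⟨β, rfl, ContinuousLinearMap.ext h2⟩
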